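/- Let $\Omega=[0,1]$, $p\in[1,2)$, $p'=\frac{2}{2-p}$, $\lambda>0$, $g\in L^2(\Omega)$, and let $K:\Omega^2\to[0,\infty)$ be measurable, symmetric and bounded. Let $(q_n)_{n\ge1}$ be a bounded sequence of positive numbers. Let $u^\star$ be the unique minimizer over $u\in L^2(\Omega)$ of $$\frac1{2\lambda}\|u-g\|_{L^2(\Omega)}^2+\frac1{2p}\int_{\Omega^2}K(x,y)|u(y)-u(x)|^p\,dx\,dy .$$ For $n\ge1$ let $X=(X_1,\dots,X_n)$ be i.i.d. uniform on $\Omega$, with order statistics $X_{(1)}\le\dots\le X_{(n)}$ and $X_{(0)}:=0$; put $\Omega^X_{ni}=\,]X_{(i-1)},X_{(i)}]$ and $$g_{ni}=\frac1{|\Omega^X_{ni}|}\int_{\Omega^X_{ni}}g,\qquad \hat K^X_{nij}=\min\Big(\frac{1}{|\Omega^X_{ni}\times\Omega^X_{nj}|}\int_{\Omega^X_{ni}\times\Omega^X_{nj}}K,\ \frac1{q_n}\Big).$$ Conditionally on $X$, let $(\Upsilon_{nij})_{i\ne j}$ (indexed by ordered pairs) be independent, $q_n\Upsilon_{nij}$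 being Bernoulli with parameter $q_n\hat K^X_{nij}$. Let $u_n^\star$ be the (almost surely unique) minimizer over $u\in\mathbb R^n$ of $$\frac1{2\lambda n}\sum_{i=1}^n|u_i-g_{ni}|^2+\frac1{2pn^2}\sum_{i\neq j}\Upsilon_{nij}|u_j-u_i|^p .$$ With the uniform cells $\Omega^{(n)}_i=[\frac{i-1}n,\frac in[$, let $(P_nv)_i=n\int_{\Omega_i^{(n)}}v$, and let $I_n$ send a vector $w$ (resp. a matrix $W$) to the step function equal to $w_i$ on $\Omega^{(n)}_i$ (resp. $W_{ij}$ on $\Omega^{(n)}_i\times\Omega^{(n)}_j$). For $\beta>0$ put $$\varepsilon_n(\beta)=\Big(\beta\frac{\log n}{n}+\frac{1}{q_n^{p'-1}n^{p'/2}}\Big)^{1/p'} .$$ (i) There are positive constants $C,C_1$ independent of $n$ such that for all $n\ge1$ and $\beta>0$, with probability at least $1-2n^{-C_1q_n^{2p'-1}\beta}$, $$\|I_nu_n^\star-u^\star\|_{L^2(\Omega)}^2\le C\Big(\varepsilon_n(\beta)+\|g-I_ng_n\|_{L^2(\Omega)}^2+\|g-I_ng_n\|_{L^2(\Omega)}+\|K-I_n\hat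 K^X_n\|_{L^{p'}(\Omega^2)}+\|u^\star-I_nP_nu^\star\|_{L^{2/(3-p)}(\Omega)}\Big).$$ (ii) For $d\in\{1,2\}$ let $\mathrm{Lip}(s,L^q(\Omega^d))$ be the space of $F\in L^q(\Omega^d)$ with $\sup_{h>0}h^{-s}\sup_{|z|<h}\|F(\cdot+z)-F\|_{L^q(\{x\,:\,x,\,x+z\in\Omega^d\})}<\infty$. Assume moreover that $g\in L^\infty(\Omega)\cap\mathrm{Lip}(s,L^q(\Omega))$ with $s\in\,]0,1]$ and $q\in[\frac{2}{3-p},2]$; that $K(x,y)=J(|x-y|)$ on $\Omega^2$ with $J:\Omega\to[0,\infty)$ bounded and measurable; that $K\in\mathrm{Lip}(s',L^{q'}(\Omega^2))$ with $s'\in\,]0,1]$ and $q'\in[p',\infty]$; and that $q_n\|K\|_{L^\infty(\Omega^2)}\le1$ for all $n$. Then there is $C_1>0$ independent of $n$, and for every $t_0\in\,]0,e[$ there is $C>0$ independent of $n$ (depending on $t_0$), such that for all $n\ge1$, $\beta>0$ and $t\in[t_0,e[$, with probability at least $1-\big(2n^{-C_1q_n^{2p'-1}\beta}+n^{-t}\big)$,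 $$\|I_nu_n^\star-u^\star\|_{L^2(\Omega)}^2\le C\Big(\varepsilon_n(\beta)+\Big(t\frac{\log n}n\Big)^{\min(sq/2,\,s')}\Big).$$ -/

import Mathlib

open MeasureTheory ProbabilityTheory Set
open scoped ENNReal

namespace NonlocalVariational

noncomputable section

/-! Functions on `Ω = [0,1]` and on `Ω²` are represented by functions on `ℝ` and `ℝ × ℝ`;
only their values on `Ω`, resp. `Ω²`, matter. -/

/-- Lebesgue measure on `Ω = [0,1]`. -/
abbrev leb : Measure ℝ := volume.restrict (Icc 0 1)

/-- Lebesgue measure on `Ω² = [0,1]²`. -/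
abbrev leb2 : Measure (ℝ × ℝ) := volume.restrict (Icc 0 1 ×ˢ Icc 0 1)

/-- The real-valued `L^r(μ)` norm. -/
def norm' {α : Type*} [MeasurableSpace α] (μ : Measure α) (r : ℝ≥0∞) (f : α → ℝ) : ℝ :=
  (eLpNorm f r μ).toReal

/-! ### The continuum problem -/

/-- The nonlocal regularizer `(1/2p) ∫∫ K(x,y) |u(y) - u(x)|^p dx dy ∈ [0,∞]`. -/
def reg (p : ℝ) (K : ℝ × ℝ → ℝ) (u : ℝ → ℝ) : ℝ≥0∞ :=
  ENNReal.ofReal (1 / (2 * p)) * ∫⁻ z, ENNReal.ofReal (K z * |u z.2 - u z.1| ^ p) ∂leb2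

/-- The energy `(1/2λ) ‖u - g‖²_{L²(Ω)} + R(u,K) ∈ [0,∞]`. -/
def energy (lam p : ℝ) (g : ℝ → ℝ) (K : ℝ × ℝ → ℝ) (u : ℝ → ℝ) : ℝ≥0∞ :=
  ENNReal.ofReal (1 / (2 * lam)) * eLpNorm (fun x => u x - g x) 2 leb ^ 2 + reg p K u

/-- `u` minimizes the energy over `L²(Ω)`. -/
def IsContinuumMinimizer (lam p : ℝ) (g : ℝ → ℝ) (K : ℝ × ℝ → ℝ) (u : ℝ → ℝ) : Prop :=
  MemLp u 2 leb ∧ ∀ v : ℝ → ℝ, MemLp v 2 leb → energy lam p g K u ≤ energy lam p g K v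

/-! ### The discrete problem -/

/-- The discrete energy
`(1/2λn) ∑ᵢ (uᵢ - γᵢ)² + (1/2pn²) ∑ᵢⱼ Wᵢⱼ |uⱼ - uᵢ|^p`. -/
def discreteEnergy {n : ℕ} (lam p : ℝ) (γ : Fin n → ℝ) (W : Fin n → Fin n → ℝ)
    (u : Fin n → ℝ) : ℝ :=
  1 / (2 * lam * n) * ∑ i, (u i - γ i) ^ 2
    + 1 / (2 * p * (n : ℝ) ^ 2) * ∑ i, ∑ j, W i j * |u j - u i| ^ p

/-- `u` minimizes the discrete energy over `ℝⁿ`. -/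
def IsDiscreteMinimizer {n : ℕ} (lam p : ℝ) (γ : Fin n → ℝ) (W : Fin n → Fin n → ℝ)
    (u : Fin n → ℝ) : Prop :=
  ∀ v : Fin n → ℝ, discreteEnergy lam p γ W u ≤ discreteEnergy lam p γ W v

/-! ### Projector and injector on the uniform partition -/

/-- The cell `[(i-1)/n, i/n[` (here `i` runs over `0, …, n-1`). -/
def cell (n : ℕ) (i : Fin n) : Set ℝ := Ico ((i : ℝ) / n) (((i : ℝ) + 1) / n)

/-- The projector `P_n`: averages over the cells of the uniform partition. -/
def proj (n : ℕ) (v : ℝ → ℝ) (i : Fin n) : ℝ := ⨍ x in cell n i, v x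

/-- The piecewise constant injector `I_n` of vectors. -/
def inj (n : ℕ) (w : Fin n → ℝ) (x : ℝ) : ℝ :=
  ∑ i, (cell n i).indicator (fun _ => w i) x

/-- The piecewise constant injector `I_n` of matrices. -/
def inj2 (n : ℕ) (W : Fin n → Fin n → ℝ) (z : ℝ × ℝ) : ℝ :=
  ∑ i, ∑ j, (cell n i ×ˢ cell n j).indicator (fun _ => W i j) z

/-! ### Quantities attached to a vector of nodes -/

/-- The `i`-th smallest of the nodes. -/
def orderStat {n : ℕ} (x : Fin n → ℝ) (i : Fin n) : ℝ := x (Tuple.sort x i)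

/-- The order statistic preceding the `i`-th one, equal to `0` for the first. -/
def prevOrderStat {n : ℕ} (x : Fin n → ℝ) (i : Fin n) : ℝ :=
  if (i : ℕ) = 0 then 0 else orderStat x ⟨(i : ℕ) - 1, lt_of_le_of_lt (Nat.sub_le _ _) i.isLt⟩

/-- The node cell `]x_(i-1), x_(i)]`. -/
def nodeCell {n : ℕ} (x : Fin n → ℝ) (i : Fin n) : Set ℝ :=
  Ioc (prevOrderStat x i) (orderStat x i)

/-- The discrete data: averages of `g` over the node cells. -/
def nodeData {n : ℕ} (g : ℝ → ℝ) (x : Fin n → ℝ) (i : Fin n) : ℝ :=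
  ⨍ y in nodeCell x i, g y

/-- The truncated averages of `K` over products of node cells. -/
def nodeKernel {n : ℕ} (q : ℝ) (K : ℝ × ℝ → ℝ) (x : Fin n → ℝ) (i j : Fin n) : ℝ :=
  min (⨍ z in nodeCell x i ×ˢ nodeCell x j, K z) (1 / q)

/-! ### The random graph -/

/-- Ordered pairs of distinct vertices. -/
abbrev OffDiag (n : ℕ) : Type := {e : Fin n × Fin n // e.1 ≠ e.2}

/-- The law of a random variable `Y` such that `q Y` is Bernoulli with parameter `q w`. -/
def scaledBernoulli (q w : ℝ) : Measure ℝ :=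
  ENNReal.ofReal (q * w) • Measure.dirac (1 / q) + ENNReal.ofReal (1 - q * w) • Measure.dirac 0

/-- The law of the edge variables for fixed nodes `x`: independent over ordered pairs `i ≠ j`,
with `q Λᵢⱼ` Bernoulli of parameter `q K̂ᵢⱼ(x)`. -/
def edgeLaw {n : ℕ} (q : ℝ) (K : ℝ × ℝ → ℝ) (x : Fin n → ℝ) : Measure (OffDiag n → ℝ) :=
  Measure.pi fun e => scaledBernoulli q (nodeKernel q K x e.1.1 e.1.2)

/-- The fully random model: the nodes `X` are i.i.d. uniform on `[0,1]`, and the conditional law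
of the edge variables `Υ` given `X = x` is `edgeLaw q K x`. -/
structure IsRandomGraph {Ω : Type*} [MeasurableSpace Ω] (P : Measure Ω) (n : ℕ) (q : ℝ)
    (K : ℝ × ℝ → ℝ) (X : Fin n → Ω → ℝ) (Υ : Fin n → Fin n → Ω → ℝ) : Prop where
  measurable_nodes : ∀ k, Measurable (X k)
  measurable_edges : ∀ i j, i ≠ j → Measurable (Υ i j)
  indep_nodes : iIndepFun X P
  uniform_nodes : ∀ k, P.map (X k) = leb
  edges_given_nodes : ∀ S : Set ((Fin n → ℝ) × (OffDiag n → ℝ)), MeasurableSet S →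
    P {ω | ((fun k => X k ω), fun e : OffDiag n => Υ e.1.1 e.1.2 ω) ∈ S} =
      ∫⁻ ω, edgeLaw q K (fun k => X k ω) {υ | ((fun k => X k ω), υ) ∈ S} ∂P

/-- The event `A` holds with probability at least `r`. -/
def WithProbAtLeast {Ω : Type*} [MeasurableSpace Ω] (P : Measure Ω) (r : ℝ) (A : Set Ω) : Prop :=
  ∃ B ⊆ A, MeasurableSet B ∧ ENNReal.ofReal r ≤ P B

/-! ### Lipschitz spaces -/

/-- The first-order modulus of smoothness `ω(F,h)_r` of `F` on the domain `D`. -/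
def modulus {E : Type*} [NormedAddCommGroup E] [MeasureSpace E] (D : Set E) (r : ℝ≥0∞)
    (F : E → ℝ) (h : ℝ) : ℝ≥0∞ :=
  ⨆ (z : E) (_ : ‖z‖ < h),
    eLpNorm (fun x => F (x + z) - F x) r (volume.restrict {x | x ∈ D ∧ x + z ∈ D})

/-- The seminorm `sup_{h > 0} h^{-s} ω(F,h)_r`. -/
def lipSeminorm {E : Type*} [NormedAddCommGroup E] [MeasureSpace E] (D : Set E) (s : ℝ) (r : ℝ≥0∞)
    (F : E → ℝ) : ℝ≥0∞ :=
  ⨆ (h : ℝ) (_ : 0 < h), ENNReal.ofReal (h ^ (-s)) * modulus D r F h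

/-- Membership in `Lip(s, L^r(D))`. On `ℝ × ℝ` the maximum norm is used, which gives the same
space as the Euclidean norm. -/
def MemLip {E : Type*} [NormedAddCommGroup E] [MeasureSpace E] (D : Set E) (s : ℝ) (r : ℝ≥0∞)
    (F : E → ℝ) : Prop :=
  MemLp F r (volume.restrict D) ∧ lipSeminorm D s r F < ∞

/-! ### The stochastic part of the error bound -/

/-- The exponent `p' = 2/(2-p)`. -/
def pExp (p : ℝ) : ℝ := 2 / (2 - p)

/-- `(β log n / n + 1 / (q^{p'-1} n^{p'/2}))^{1/p'}`. -/
def noiseRate (p q β : ℝ) (n : ℕ) : ℝ :=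
  (β * (Real.log n / n) + 1 / (q ^ (pExp p - 1) * (n : ℝ) ^ (pExp p / 2))) ^ (1 / pExp p)

/-- `2 n^{-C₁ q^{2p'-1} β}`. -/
def failProb (p q β C₁ : ℝ) (n : ℕ) : ℝ :=
  2 * (n : ℝ) ^ (-(C₁ * q ^ (2 * pExp p - 1) * β))

end

end NonlocalVariational

open NonlocalVariational

/-! ### Exponential integrability of squares of sub-Gaussian variables -/

/-! The random minimizer is compared with `u⋆` through a third one, `u0`, which minimizes the
discrete energy whose random weights `Υ` are replaced by their conditional means `nodeKernel`. The
distance from the random minimizer to `u0` is pure edge noise. The distance from `u0` to `u⋆` is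
discretization error, which is deterministic once the nodes are fixed. All energies are strongly
convex because of the quadratic data term, so an almost optimal competitor is close to the
minimizer.

Noise. The comparison point `v` has to depend on the nodes alone, so that, given the nodes, the
noise consists of linear forms in independent centred edges with fixed coefficients. Since `|t|^p`
may fail to be differentiable, it is replaced by `(t² + δ²)^(p/2)`, which is convex, costs at most
`δ^p`, and has a derivative of linear growth uniformly in `δ ≤ 1`. The point `v` is an approximate
critical point of the smoothed energy with weights `nodeKernel`. Strong convexity bounds the
distance of either minimizer to `v` by the gradient at `v` (`mean_sq_sub_minimizer_le`), and the two
gradients differ by the linear forms in `Υ - nodeKernel`. Their squared coefficients sum to `O(1)`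
(`sum_sq_edgeCoeff_le`). Each form is sub-Gaussian by Hoeffding's lemma, and the sum of their
squares is sub-exponential by convexity of `exp`, whatever their dependence
(`measure_sum_sq_gt_le`). So the mean square noise exceeds a multiple of `β log n / n`, up to an
arbitrarily small smoothing error, with probability at most `2 n^(-c q_n² β)`. As `q_n` is bounded,
`q_n²` dominates a multiple of `q_n^(2p'-1)`; and `β log n / n` is at most the noise rate unless it
exceeds one, a case covered by an a priori bound.

General bound. Step functions turn the discrete energy into a continuum energy with step data and
step kernel. Testing the minimality of `u0` against `P_n u⋆` and using the strong convexity of the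
continuum energy gives `integral_sq_inj_sub_le`. Hölder's inequality finishes: `p'` is conjugate to
`2/p`, which handles the kernel error, and `2/(3-p)` is conjugate to `2/(p-1)`, which handles the
projection error.

Rate. With bounded data all minimizers are bounded, so `|t|^p` acts as a Lipschitz function, and the
kernel error enters squared in `L²` after Young's inequality (`integral_sq_inj_sub_le_of_bounded`).
Two further facts are needed. First, for a convolution kernel the minimizer inherits the translation
regularity of `g`: averaging `u⋆` with its two opposite translates gives competitors whose
regularizers do not grow in total, up to boundary strips of width `h`
(`setIntegral_sq_translate_sub_le`). Second, averages over the random node cells, placed on the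
uniform cells, are close to the function itself (`measure_pi_displacement_le`). Order statistics are
displaced by about `√(t log n / n)`, so a function with mean square increments `|w|^(2σ)` moves by
`(t log n / n)^σ`. Node cells may be arbitrarily thin, so an average over one of them is controlled
by a dyadic maximal function at its corners. These corners are nodes or `0`, and the sum over pairs
of nodes concentrates around a multiple of the integral of the squared maximal function, which the
`L²` maximal inequality bounds. -/

lemma lintegral_exp_sq_gaussian_le {b : ℝ} (hb : 0 < b) :
    ∫⁻ t, ENNReal.ofReal (Real.exp (b * t ^ 2 / 2))
      ∂(gaussianReal 0 (Real.toNNReal (1 / (2 * b)))) ≤ 2 := by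
  have hv : (Real.toNNReal (1 / (2 * b))) ≠ 0 := by
    simp only [ne_eq, Real.toNNReal_eq_zero, not_le]; positivity
  have hv' : ((Real.toNNReal (1 / (2 * b)) : NNReal) : ℝ) = 1 / (2 * b) :=
    Real.coe_toNNReal _ (by positivity)
  rw [gaussianReal_of_var_ne_zero _ hv,
    lintegral_withDensity_eq_lintegral_mul _ (measurable_gaussianPDF _ _) (by fun_prop)]
  have hpt : ∀ t : ℝ, (gaussianPDF 0 (Real.toNNReal (1 / (2 * b))) *
      fun t : ℝ => ENNReal.ofReal (Real.exp (b * t ^ 2 / 2))) t =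
      ENNReal.ofReal ((√(Real.pi / b))⁻¹ * Real.exp (-(b / 2) * t ^ 2)) := by
    intro t
    simp only [Pi.mul_apply, gaussianPDF, gaussianPDFReal]
    rw [← ENNReal.ofReal_mul (by positivity), hv', mul_assoc, ← Real.exp_add]
    congr 2
    · congr 2
      field_simp
    · congr 1
      field_simp
      ring
  rw [lintegral_congr hpt]
  rw [← ofReal_integral_eq_lintegral_ofReal ((integrable_exp_neg_mul_sq (by positivity)).const_mul _)
    (Filter.Eventually.of_forall fun t => by positivity), integral_const_mul, integral_gaussian]
  rw [show (2 : ℝ≥0∞) = ENNReal.ofReal 2 by simp]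
  apply ENNReal.ofReal_le_ofReal
  rw [show Real.pi / (b / 2) = 2 * (Real.pi / b) by field_simp, Real.sqrt_mul (by norm_num)]
  have : 0 < √(Real.pi / b) := Real.sqrt_pos.2 (by positivity)
  rw [mul_comm, mul_assoc, mul_inv_cancel₀ this.ne', mul_one]
  exact Real.sqrt_le_iff.2 ⟨by norm_num, by norm_num⟩

/-- The square is linearized by a Gaussian: `exp (y² / (4b))` is the moment generating function at
`y` of a centred Gaussian of variance `1/(2b)`. Exchanging the two integrals reduces the claim to
the sub-Gaussian bound for `Y` and one Gaussian integral, whose value is `√2`. -/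
lemma lintegral_exp_sq_le {Ω : Type*} [MeasurableSpace Ω] {μ : Measure Ω} [IsProbabilityMeasure μ]
    {Y : Ω → ℝ} {c : NNReal} (hY : HasSubgaussianMGF Y c μ) (hYm : Measurable Y) {b : ℝ}
    (hb : 0 < b) (hcb : c ≤ b) :
    ∫⁻ ω, ENNReal.ofReal (Real.exp (Y ω ^ 2 / (4 * b))) ∂μ ≤ 2 := by
  have h1 : ∀ y : ℝ, ENNReal.ofReal (Real.exp (y ^ 2 / (4 * b))) =
      ∫⁻ t, ENNReal.ofReal (Real.exp (y * t))
        ∂(gaussianReal 0 (Real.toNNReal (1 / (2 * b)))) := by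
    intro y
    have h := mgf_gaussianReal (p := gaussianReal 0 (Real.toNNReal (1 / (2 * b)))) (X := id)
      (μ := 0) (v := Real.toNNReal (1 / (2 * b))) (by simp) y
    rw [← ofReal_integral_eq_lintegral_ofReal (by
      have := integrable_exp_mul_gaussianReal (μ := 0) (v := Real.toNNReal (1 / (2 * b))) y
      simpa using this) (Filter.Eventually.of_forall fun t => by positivity)]
    congr 1
    rw [mgf] at h
    simp only [id] at h
    rw [h, Real.coe_toNNReal _ (by positivity)]
    congr 1
    field_simp
    ring
  simp_rw [h1]
  rw [lintegral_lintegral_swap (by fun_prop)]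
  refine le_trans (lintegral_mono fun t => ?_) (lintegral_exp_sq_gaussian_le hb)
  have h2 := hY.mgf_le t
  have h3 := hY.integrable_exp_mul t
  rw [mgf] at h2
  have h4 : ∀ ω, Real.exp (Y ω * t) = Real.exp (t * Y ω) := fun ω => by rw [mul_comm]
  simp_rw [h4]
  rw [← ofReal_integral_eq_lintegral_ofReal h3 (Filter.Eventually.of_forall fun t => by positivity)]
  apply ENNReal.ofReal_le_ofReal (h2.trans _)
  gcongr

/-- A sum of squares of sub-Gaussian variables, dependent or not, is sub-exponential. -/
lemma measure_sum_sq_gt_le {Ω ι : Type*} [MeasurableSpace Ω] {μ : Measure Ω}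
    [IsProbabilityMeasure μ] [Fintype ι] {Y : ι → Ω → ℝ} {c : ι → NNReal}
    (hY : ∀ k, HasSubgaussianMGF (Y k) (c k) μ) (hYm : ∀ k, Measurable (Y k)) {b : ι → ℝ}
    (hb : ∀ k, 0 < b k) (hcb : ∀ k, c k ≤ b k) {B : ℝ} (hB : 0 < B) (hbB : ∑ k, b k ≤ B) (τ : ℝ) :
    μ {ω | τ < ∑ k, Y k ω ^ 2} ≤ ENNReal.ofReal (2 * Real.exp (-(τ / (4 * B)))) := by
  rcases isEmpty_or_nonempty ι with hι | hι
  · simp only [Finset.univ_eq_empty, Finset.sum_empty]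
    by_cases hτ : τ < 0
    · refine (prob_le_one).trans ?_
      rw [← ENNReal.ofReal_one]
      apply ENNReal.ofReal_le_ofReal
      have : 1 ≤ Real.exp (-(τ / (4 * B))) := by
        apply Real.one_le_exp
        have : τ / (4 * B) ≤ 0 := div_nonpos_of_nonpos_of_nonneg hτ.le (by positivity)
        linarith
      linarith
    · simp [hτ]
  set S := ∑ k, b k with hS
  have hSpos : 0 < S := Finset.sum_pos (fun k _ => hb k) Finset.univ_nonempty
  have key : ∫⁻ ω, ENNReal.ofReal (Real.exp ((∑ k, Y k ω ^ 2) / (4 * S))) ∂μ ≤ 2 := by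
    -- Jensen's inequality for `exp` with weights `b k / S`. Only the single exponential moments
    -- matter, so no independence between the `Y k` is used.
    have hconv : ∀ ω, Real.exp ((∑ k, Y k ω ^ 2) / (4 * S)) ≤
        ∑ k, b k / S * Real.exp (Y k ω ^ 2 / (4 * b k)) := by
      intro ω
      have := convexOn_exp.map_sum_le (t := Finset.univ) (w := fun k => b k / S)
        (p := fun k => Y k ω ^ 2 / (4 * b k)) (fun k _ => by have := hb k; positivity)
        (by rw [← Finset.sum_div, div_self hSpos.ne']) (fun _ _ => mem_univ _)
      simp only [smul_eq_mul] at this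
      refine le_of_eq_of_le ?_ this
      congr 1
      rw [Finset.sum_div]
      refine Finset.sum_congr rfl fun k _ => ?_
      have := (hb k).ne'
      field_simp
    calc _ ≤ ∫⁻ ω, ∑ k, ENNReal.ofReal (b k / S) * ENNReal.ofReal (Real.exp (Y k ω ^ 2 / (4 * b k))) ∂μ := by
          refine lintegral_mono fun ω => ?_
          refine (ENNReal.ofReal_le_ofReal (hconv ω)).trans ?_
          rw [ENNReal.ofReal_sum_of_nonneg (fun k _ => by have := hb k; positivity)]
          refine Finset.sum_le_sum fun k _ => ?_
          rw [ENNReal.ofReal_mul (by have := hb k; positivity)]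
      _ = ∑ k, ENNReal.ofReal (b k / S) * ∫⁻ ω, ENNReal.ofReal (Real.exp (Y k ω ^ 2 / (4 * b k))) ∂μ := by
          rw [lintegral_finsetSum _ (fun k _ => by have := hYm k; fun_prop)]
          refine Finset.sum_congr rfl fun k _ => ?_
          rw [lintegral_const_mul _ (by have := hYm k; fun_prop)]
      _ ≤ ∑ k, ENNReal.ofReal (b k / S) * 2 := by
          gcongr with k
          exact lintegral_exp_sq_le (hY k) (hYm k) (hb k) (hcb k)
      _ = 2 := by
          rw [← Finset.sum_mul, ← ENNReal.ofReal_sum_of_nonneg (fun k _ => by have := hb k; positivity),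
            ← Finset.sum_div, div_self hSpos.ne']
          simp
  by_cases hτ : τ < 0
  · refine (prob_le_one).trans ?_
    rw [← ENNReal.ofReal_one]
    apply ENNReal.ofReal_le_ofReal
    have : 1 ≤ Real.exp (-(τ / (4 * B))) := by
      apply Real.one_le_exp
      have : τ / (4 * B) ≤ 0 := div_nonpos_of_nonpos_of_nonneg hτ.le (by positivity)
      linarith
    linarith
  have hM := meas_ge_le_lintegral_div (μ := μ)
    (f := fun ω => ENNReal.ofReal (Real.exp ((∑ k, Y k ω ^ 2) / (4 * S))))
    (by have := hYm; fun_prop) (ε := ENNReal.ofReal (Real.exp (τ / (4 * S))))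
    (by simp [Real.exp_pos]) (by simp)
  calc μ {ω | τ < ∑ k, Y k ω ^ 2}
      ≤ μ {ω | ENNReal.ofReal (Real.exp (τ / (4 * S))) ≤
          ENNReal.ofReal (Real.exp ((∑ k, Y k ω ^ 2) / (4 * S)))} := by
        apply measure_mono
        intro ω hω
        apply ENNReal.ofReal_le_ofReal
        apply Real.exp_le_exp.2
        have : τ < ∑ k, Y k ω ^ 2 := hω
        gcongr
    _ ≤ _ := hM
    _ ≤ 2 / ENNReal.ofReal (Real.exp (τ / (4 * S))) := by gcongr
    _ = ENNReal.ofReal (2 * Real.exp (-(τ / (4 * S)))) := by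
        rw [Real.exp_neg, ENNReal.ofReal_mul (by norm_num), ENNReal.ofReal_inv_of_pos (Real.exp_pos _)]
        simp [div_eq_mul_inv]
    _ ≤ _ := by
        apply ENNReal.ofReal_le_ofReal
        push Not at hτ
        gcongr

/-! ### Scaled Bernoulli variables -/

lemma isProbabilityMeasure_scaledBernoulli {q w : ℝ} (hq : 0 < q) (hw : 0 ≤ w) (hw' : w ≤ 1 / q) :
    IsProbabilityMeasure (scaledBernoulli q w) := by
  have h1 : q * w ≤ 1 := by
    rw [le_div_iff₀ hq] at hw'; linarith
  refine ⟨?_⟩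
  simp only [scaledBernoulli, Measure.add_apply, Measure.smul_apply, measure_univ, smul_eq_mul, mul_one]
  rw [← ENNReal.ofReal_add (by positivity) (by linarith)]
  simp

lemma ae_scaledBernoulli (q w : ℝ) : ∀ᵐ x ∂scaledBernoulli q w, x = 0 ∨ x = 1 / q := by
  have hm : MeasurableSet {x : ℝ | x = 0 ∨ x = 1 / q} :=
    (measurableSet_singleton 0).union (measurableSet_singleton (1 / q))
  rw [scaledBernoulli, ae_add_measure_iff]
  constructor
  · refine Measure.ae_smul_measure ?_ _
    rw [ae_dirac_iff hm]; exact Or.inr rfl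
  · refine Measure.ae_smul_measure ?_ _
    rw [ae_dirac_iff hm]; exact Or.inl rfl

lemma integral_scaledBernoulli {q w : ℝ} (hq : 0 < q) (hw : 0 ≤ w) :
    ∫ x, x ∂scaledBernoulli q w = w := by
  rw [scaledBernoulli, integral_add_measure, integral_smul_measure, integral_smul_measure,
    integral_dirac, integral_dirac, ENNReal.toReal_ofReal (by positivity)]
  · simp; field_simp
  · exact (integrable_dirac (by simp)).smul_measure (by simp)
  · exact (integrable_dirac (by simp)).smul_measure (by simp)

/-- A variable with values in `[0, 1/q]` has variance proxy `1/(4q²)` by Hoeffding's lemma, so the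
`k`-th form has proxy `∑ e, c k e ^ 2 / (4q²)`. The tail then depends only on the total `V`, not on
the number of forms. -/
lemma measure_pi_scaledBernoulli_sum_sq_gt_le {ι κ : Type*} [Fintype ι] [Fintype κ] {q : ℝ}
    (hq : 0 < q) {w : ι → ℝ} (hw : ∀ e, 0 ≤ w e) (hw' : ∀ e, w e ≤ 1 / q) (c : κ → ι → ℝ) {V : ℝ}
    (hV : ∑ k, ∑ e, c k e ^ 2 ≤ V) (τ : ℝ) :
    (Measure.pi fun e => scaledBernoulli q (w e))
        {υ | τ < ∑ k, (∑ e, c k e * (υ e - w e)) ^ 2} ≤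
      ENNReal.ofReal (2 * Real.exp (-(τ * q ^ 2 / (V + 1)))) := by
  have hprob : ∀ e, IsProbabilityMeasure (scaledBernoulli q (w e)) :=
    fun e => isProbabilityMeasure_scaledBernoulli hq (hw e) (hw' e)
  have hV0 : 0 ≤ V := le_trans (Finset.sum_nonneg fun k _ => Finset.sum_nonneg fun e _ => sq_nonneg _) hV
  have hsub : ∀ e, HasSubgaussianMGF (fun x : ℝ => x - w e)
      ((‖1 / q - 0‖₊ / 2) ^ 2) (scaledBernoulli q (w e)) := by
    intro e
    have := hasSubgaussianMGF_of_mem_Icc (μ := scaledBernoulli q (w e)) (X := id) (a := 0)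
      (b := 1 / q) aemeasurable_id (by
        filter_upwards [ae_scaledBernoulli q (w e)] with x hx
        have : 0 < 1 / q := by positivity
        rcases hx with rfl | rfl
        · exact ⟨le_rfl, this.le⟩
        · exact ⟨this.le, le_rfl⟩)
    simpa [integral_scaledBernoulli hq (hw e)] using this
  have hcoord : ∀ e, HasSubgaussianMGF (fun υ : ι → ℝ => υ e - w e)
      ((‖1 / q - 0‖₊ / 2) ^ 2) (Measure.pi fun e => scaledBernoulli q (w e)) := by
    intro e
    have hmp := measurePreserving_eval (fun e => scaledBernoulli q (w e)) e
    have h := hsub e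
    rw [← hmp.map_eq] at h
    exact h.of_map hmp.measurable.aemeasurable
  have hind : iIndepFun (fun e (υ : ι → ℝ) => υ e - w e)
      (Measure.pi fun e => scaledBernoulli q (w e)) :=
    iIndepFun_pi (X := fun e x => x - w e) fun e => by fun_prop
  have hY : ∀ k, HasSubgaussianMGF (fun υ : ι → ℝ => ∑ e, c k e * (υ e - w e))
      (∑ e, Real.toNNReal (c k e ^ 2) * (‖1 / q - 0‖₊ / 2) ^ 2)
      (Measure.pi fun e => scaledBernoulli q (w e)) := by
    intro k
    refine HasSubgaussianMGF.sum_of_iIndepFun (X := fun e (υ : ι → ℝ) => c k e * (υ e - w e)) ?_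
      (fun e _ => by
        rw [Real.toNNReal_of_nonneg (sq_nonneg _)]
        exact (hcoord e).const_mul (c k e))
    exact hind.comp (g := fun e x => c k e * x) fun e => by fun_prop
  have hcval : ∀ k, ((∑ e, Real.toNNReal (c k e ^ 2) * (‖1 / q - 0‖₊ / 2) ^ 2 : NNReal) : ℝ)
      = (∑ e, c k e ^ 2) / (4 * q ^ 2) := by
    intro k
    push_cast
    rw [Finset.sum_div]
    refine Finset.sum_congr rfl fun e _ => ?_
    rw [sub_zero, Real.norm_of_nonneg (by positivity), Real.coe_toNNReal _ (sq_nonneg _)]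
    field_simp
    norm_num
  rcases isEmpty_or_nonempty κ with hκ | hκ
  · have := measure_sum_sq_gt_le hY (fun k => by fun_prop) (b := fun _ => 1) (fun _ => one_pos)
      (fun k => (IsEmpty.false k).elim) (B := (V + 1) / (4 * q ^ 2)) (by positivity)
      (by simp; positivity) τ
    convert this using 5
    field_simp
  have hcard : (0 : ℝ) < Fintype.card κ := by exact_mod_cast Fintype.card_pos
  -- The summand `1 / card κ` makes every `b k` strictly positive, even where all coefficients
  -- vanish. Over all `k` it adds one, which is the `+ 1` in the denominator of the exponent.
  have := measure_sum_sq_gt_le hY (fun k => by fun_prop)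
    (b := fun k => (∑ e, c k e ^ 2 + 1 / Fintype.card κ) / (4 * q ^ 2))
    (fun k => by positivity)
    (fun k => by
      rw [hcval]
      gcongr
      have : (0 : ℝ) < 1 / Fintype.card κ := by positivity
      linarith) (B := (V + 1) / (4 * q ^ 2)) (by positivity)
    (by
      rw [← Finset.sum_div, Finset.sum_add_distrib]
      gcongr
      simp [hcard.ne']) τ
  convert this using 5
  field_simp

/-! ### A smooth approximation of `|t|^p` -/

/-- The smooth approximation `(t² + δ²)^{p/2}` of `|t|^p`. -/
noncomputable def smoothPow (p δ t : ℝ) : ℝ := (t ^ 2 + δ ^ 2) ^ (p / 2)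

/-- The derivative of `smoothPow`. -/
noncomputable def smoothPowDeriv (p δ t : ℝ) : ℝ := p * t * (t ^ 2 + δ ^ 2) ^ (p / 2 - 1)

section smoothPow
variable {p δ : ℝ}

lemma abs_rpow_eq_sq_rpow (p t : ℝ) : |t| ^ p = (t ^ 2) ^ (p / 2) := by
  rw [← sq_abs, ← Real.rpow_natCast, ← Real.rpow_mul (abs_nonneg _)]
  congr 1; push_cast; ring

lemma abs_rpow_le_smoothPow (hp : 0 ≤ p) (δ t : ℝ) : |t| ^ p ≤ smoothPow p δ t := by
  rw [abs_rpow_eq_sq_rpow, smoothPow]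
  gcongr
  nlinarith [sq_nonneg δ]

lemma smoothPow_le (hp : 0 ≤ p) (hp2 : p ≤ 2) (hδ : 0 ≤ δ) (t : ℝ) :
    smoothPow p δ t ≤ |t| ^ p + δ ^ p := by
  have h := Real.rpow_add_le_add_rpow (sq_nonneg t) (sq_nonneg δ) (p := p / 2) (by linarith) (by linarith)
  rw [smoothPow, abs_rpow_eq_sq_rpow]
  nth_rewrite 2 [← abs_of_nonneg hδ]
  rwa [abs_rpow_eq_sq_rpow]

lemma smoothPow_mono (hp : 0 ≤ p) (δ : ℝ) {s t : ℝ} (h : |s| ≤ |t|) :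
    smoothPow p δ s ≤ smoothPow p δ t := by
  rw [smoothPow, smoothPow]
  have := sq_le_sq.2 h
  gcongr

lemma hasDerivAt_smoothPow (hδ : 0 < δ) (t : ℝ) :
    HasDerivAt (smoothPow p δ) (smoothPowDeriv p δ t) t := by
  have h1 : HasDerivAt (fun t : ℝ => t ^ 2 + δ ^ 2) (2 * t) t := by
    simpa using (hasDerivAt_pow 2 t).add_const (δ ^ 2)
  have h2 := h1.rpow_const (p := p / 2) (Or.inl (by positivity))
  refine h2.congr_deriv ?_
  rw [smoothPowDeriv]; ring

lemma continuous_smoothPow (hδ : 0 < δ) : Continuous (smoothPow p δ) :=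
  continuous_iff_continuousAt.2 fun t => (hasDerivAt_smoothPow hδ t).continuousAt

lemma continuous_smoothPowDeriv (hδ : 0 < δ) : Continuous (smoothPowDeriv p δ) := by
  unfold smoothPowDeriv
  refine Continuous.mul (by fun_prop) (Continuous.rpow_const (by fun_prop) fun t => Or.inl ?_)
  positivity

/-- `smoothPow p δ a` is the `p`-th power of the Euclidean norm `A` of `(a, δ)`. Bernoulli's
inequality gives the tangent bound in `A`, and Cauchy–Schwarz, `a b + δ² ≤ A B`, transfers it to
`a`. -/
lemma smoothPow_tangent_le (hp : 1 ≤ p) (hδ : 0 < δ) (a b : ℝ) :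
    smoothPow p δ a + smoothPowDeriv p δ a * (b - a) ≤ smoothPow p δ b := by
  set A := √(a ^ 2 + δ ^ 2) with hA
  set B := √(b ^ 2 + δ ^ 2) with hB
  have hA0 : 0 < A := Real.sqrt_pos.2 (by positivity)
  have hB0 : 0 < B := Real.sqrt_pos.2 (by positivity)
  have hA2 : A ^ 2 = a ^ 2 + δ ^ 2 := Real.sq_sqrt (by positivity)
  have hB2 : B ^ 2 = b ^ 2 + δ ^ 2 := Real.sq_sqrt (by positivity)
  have pw : ∀ x : ℝ, 0 < x → ∀ r : ℝ, (x ^ 2) ^ r = x ^ (2 * r) := fun x hx r => by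
    rw [← Real.rpow_natCast, ← Real.rpow_mul hx.le]; norm_num
  rw [smoothPow, smoothPow, smoothPowDeriv, ← hA2, ← hB2, pw A hA0, pw B hB0, pw A hA0]
  have e1 : 2 * (p / 2) = p := by ring
  rw [e1]
  have hCS : a * b + δ ^ 2 ≤ A * B := by
    refine le_of_sq_le_sq ?_ (by positivity) |>.trans le_rfl
    rw [mul_pow, hA2, hB2]; nlinarith [sq_nonneg (a * δ - b * δ)]
  have hbern := one_add_mul_self_le_rpow_one_add (s := B / A - 1) (by
    have : 0 < B / A := by positivity
    linarith) hp
  rw [add_sub_cancel, Real.div_rpow hB0.le hA0.le, le_div_iff₀ (by positivity)] at hbern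
  have e2 : A ^ p = A ^ (2 * (p / 2 - 1)) * A ^ 2 := by
    rw [← Real.rpow_natCast, ← Real.rpow_add hA0]; congr 1; push_cast; ring
  have hnn : 0 ≤ A ^ (2 * (p / 2 - 1)) := by positivity
  have e3 : (1 + p * (B / A - 1)) * A ^ p = A ^ p + p * A ^ (2 * (p / 2 - 1)) * (A * B - A ^ 2) := by
    rw [e2]; field_simp
  rw [e3] at hbern
  have : p * a * A ^ (2 * (p / 2 - 1)) * (b - a) ≤ p * A ^ (2 * (p / 2 - 1)) * (A * B - A ^ 2) := by
    have h5 : a * (b - a) ≤ A * B - A ^ 2 := by rw [hA2]; nlinarith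
    have h6 : 0 ≤ p * A ^ (2 * (p / 2 - 1)) := by positivity
    nlinarith [mul_le_mul_of_nonneg_left h5 h6]
  linarith

/-- The bound is uniform in `δ`, which allows `δ` to be sent to zero without spoiling the deviation
estimate. -/
lemma sq_smoothPowDeriv_le (hp : 1 ≤ p) (hp2 : p ≤ 2) (hδ : 0 < δ) (hδ1 : δ ≤ 1) (t : ℝ) :
    smoothPowDeriv p δ t ^ 2 ≤ p ^ 2 * (2 + t ^ 2) := by
  set a := t ^ 2 + δ ^ 2 with ha
  have ha0 : 0 < a := by positivity
  have h1 : smoothPowDeriv p δ t ^ 2 = p ^ 2 * (t ^ 2 * a ^ (p - 2)) := by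
    rw [smoothPowDeriv, mul_pow, mul_pow, ← Real.rpow_natCast (a ^ _), ← Real.rpow_mul ha0.le,
      mul_assoc]
    congr 3; push_cast; ring
  rw [h1]
  refine mul_le_mul_of_nonneg_left ?_ (sq_nonneg p)
  calc t ^ 2 * a ^ (p - 2) ≤ a * a ^ (p - 2) := by gcongr; rw [ha]; nlinarith
    _ = a ^ (p - 1) := by
        rw [show p - 1 = 1 + (p - 2) by ring, Real.rpow_add ha0, Real.rpow_one]
    _ ≤ 1 + a := by
        rcases le_total a 1 with h | h
        · have := Real.rpow_le_one ha0.le h (z := p - 1) (by linarith)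
          linarith
        · have := Real.rpow_le_rpow_of_exponent_le h (show p - 1 ≤ 1 by linarith)
          rw [Real.rpow_one] at this
          linarith
    _ ≤ 2 + t ^ 2 := by rw [ha]; nlinarith

end smoothPow

/-! ### Discrete energies with a general profile -/

/-- The discrete energy with `|t|^p` replaced by a general profile `h`. -/
noncomputable def profileEnergy {n : ℕ} (lam p : ℝ) (h : ℝ → ℝ) (γ : Fin n → ℝ)
    (W : Fin n → Fin n → ℝ) (u : Fin n → ℝ) : ℝ :=
  1 / (2 * lam * n) * ∑ i, (u i - γ i) ^ 2
    + 1 / (2 * p * (n : ℝ) ^ 2) * ∑ i, ∑ j, W i j * h (u j - u i)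

/-- The gradient of `profileEnergy` for the normalized inner product, `h'` being the derivative
of the profile. -/
noncomputable def profileGrad {n : ℕ} (lam p : ℝ) (h' : ℝ → ℝ) (γ : Fin n → ℝ)
    (W : Fin n → Fin n → ℝ) (u : Fin n → ℝ) (k : Fin n) : ℝ :=
  (u k - γ k) / lam
    + 1 / (2 * p * n) * ∑ j, (W j k * h' (u k - u j) - W k j * h' (u j - u k))

lemma discreteEnergy_eq_profileEnergy {n : ℕ} (lam p : ℝ) (γ : Fin n → ℝ)
    (W : Fin n → Fin n → ℝ) (u : Fin n → ℝ) :
    discreteEnergy lam p γ W u = profileEnergy lam p (fun t => |t| ^ p) γ W u := rfl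

section profile
variable {n : ℕ} {lam p : ℝ} {h h' : ℝ → ℝ} {γ : Fin n → ℝ} {W : Fin n → Fin n → ℝ}

lemma abs_clamp_sub_clamp_le (G a b : ℝ) :
    |max (-G) (min a G) - max (-G) (min b G)| ≤ |a - b| := by
  refine (abs_max_sub_max_le_max _ _ _ _).trans ?_
  rw [sub_self, abs_zero]
  refine max_le (abs_nonneg _) ((abs_min_sub_min_le_max _ _ _ _).trans ?_)
  simp

lemma abs_clamp_le {G : ℝ} (hG : 0 ≤ G) (a : ℝ) : |max (-G) (min a G)| ≤ G := by
  rw [abs_le]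
  exact ⟨le_max_left _ _, max_le (by linarith) (min_le_right _ _)⟩

lemma clamp_eq_self {G a : ℝ} (ha : |a| ≤ G) : max (-G) (min a G) = a := by
  rw [abs_le] at ha
  rw [min_eq_left ha.2, max_eq_right ha.1]

lemma continuous_profileEnergy (hc : Continuous h) :
    Continuous (profileEnergy lam p h γ W) := by
  unfold profileEnergy
  fun_prop

/-- Truncating the values to `[-G, G]` raises neither term of the energy, so it suffices to minimize
over a compact cube. -/
lemma exists_profileEnergy_minimizer (hlam : 0 < lam) (hp : 0 < p)
    (hc : Continuous h) (hmono : ∀ s t : ℝ, |s| ≤ |t| → h s ≤ h t) (hW : ∀ i j, 0 ≤ W i j)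
    {G : ℝ} (hG : 0 ≤ G) (hγ : ∀ i, |γ i| ≤ G) :
    ∃ u : Fin n → ℝ, (∀ i, |u i| ≤ G) ∧
      ∀ v, profileEnergy lam p h γ W u ≤ profileEnergy lam p h γ W v := by
  have hcomp : IsCompact (Set.pi univ fun _ : Fin n => Icc (-G) G) :=
    isCompact_univ_pi fun _ => isCompact_Icc
  obtain ⟨u, hu, hmin⟩ := hcomp.exists_isMinOn (f := profileEnergy lam p h γ W)
    ⟨fun _ => 0, fun i _ => ⟨by linarith, hG⟩⟩ (continuous_profileEnergy hc).continuousOn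
  refine ⟨u, fun i => abs_le.2 (hu i (mem_univ _)), fun v => ?_⟩
  refine (hmin (show (fun i => max (-G) (min (v i) G)) ∈ _ from fun i _ =>
    abs_le.1 (abs_clamp_le hG _))).trans ?_
  unfold profileEnergy
  refine add_le_add (mul_le_mul_of_nonneg_left (Finset.sum_le_sum fun i _ => ?_) (by positivity))
    (mul_le_mul_of_nonneg_left (Finset.sum_le_sum fun i _ => Finset.sum_le_sum fun j _ =>
      mul_le_mul_of_nonneg_left (hmono _ _ (abs_clamp_sub_clamp_le _ _ _)) (hW i j)) (by positivity))
  rw [sq_le_sq]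
  nth_rewrite 1 [← clamp_eq_self (hγ i)]
  exact abs_clamp_sub_clamp_le _ _ _

/-- A discrete integration by parts: relabelling one of the two double sums collects the terms of
the gradient by edges. -/
lemma sum_profileGrad_mul (hp : p ≠ 0) (hn : (n : ℝ) ≠ 0) (u D : Fin n → ℝ) :
    1 / (n : ℝ) * ∑ k, profileGrad lam p h' γ W u k * D k =
      1 / (lam * n) * ∑ i, (u i - γ i) * D i
        + 1 / (2 * p * (n : ℝ) ^ 2) * ∑ i, ∑ j, W i j * (h' (u j - u i) * (D j - D i)) := by
  have e1 : ∑ k, profileGrad lam p h' γ W u k * D k = 1 / lam * ∑ i, (u i - γ i) * D i +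
      1 / (2 * p * n) * (∑ k, ∑ j, W j k * h' (u k - u j) * D k
        - ∑ k, ∑ j, W k j * h' (u j - u k) * D k) := by
    rw [← Finset.sum_sub_distrib, Finset.mul_sum, Finset.mul_sum, ← Finset.sum_add_distrib]
    refine Finset.sum_congr rfl fun k _ => ?_
    rw [profileGrad, ← Finset.sum_sub_distrib, add_mul, mul_assoc _ (∑ j, _) (D k), Finset.sum_mul]
    congr 1
    · ring
    · congr 1
      refine Finset.sum_congr rfl fun j _ => by ring
  rw [e1, Finset.sum_comm (f := fun k j => W j k * h' (u k - u j) * D k)]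
  rw [← Finset.sum_sub_distrib]
  simp_rw [← Finset.sum_sub_distrib]
  have e2 : ∀ i j, W i j * h' (u j - u i) * D j - W i j * h' (u j - u i) * D i =
      W i j * (h' (u j - u i) * (D j - D i)) := fun i j => by ring
  simp_rw [e2]
  rw [mul_add]
  congr 1
  · rw [← mul_assoc]; congr 1; field_simp
  · rw [← mul_assoc]; congr 1; field_simp

/-- Strong convexity: the quadratic data term is expanded exactly and leaves the square of `v - u`,
while the regularizer is only bounded below by its tangent. -/
lemma profileEnergy_ge_of_tangent (hlam : 0 < lam) (hp : 0 < p) (hn : 0 < n)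
    (htan : ∀ a b, h a + h' a * (b - a) ≤ h b) (hW : ∀ i j, 0 ≤ W i j) (u v : Fin n → ℝ) :
    profileEnergy lam p h γ W u
        + 1 / (n : ℝ) * ∑ k, profileGrad lam p h' γ W u k * (v k - u k)
        + 1 / (2 * lam * n) * ∑ k, (v k - u k) ^ 2 ≤ profileEnergy lam p h γ W v := by
  have hn' : (0 : ℝ) < n := by exact_mod_cast hn
  rw [sum_profileGrad_mul hp.ne' hn'.ne']
  unfold profileEnergy
  have h1 : 1 / (2 * lam * n) * ∑ i, (v i - γ i) ^ 2 = 1 / (2 * lam * n) * ∑ i, (u i - γ i) ^ 2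
      + 1 / (lam * n) * ∑ i, (u i - γ i) * (v i - u i)
      + 1 / (2 * lam * n) * ∑ k, (v k - u k) ^ 2 := by
    rw [Finset.mul_sum, Finset.mul_sum, Finset.mul_sum, Finset.mul_sum, ← Finset.sum_add_distrib,
      ← Finset.sum_add_distrib]
    refine Finset.sum_congr rfl fun i _ => ?_
    field_simp
    ring
  have h2 : ∑ i, ∑ j, W i j * h (u j - u i)
      + ∑ i, ∑ j, W i j * (h' (u j - u i) * ((v j - u j) - (v i - u i)))
      ≤ ∑ i, ∑ j, W i j * h (v j - v i) := by
    rw [← Finset.sum_add_distrib]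
    refine Finset.sum_le_sum fun i _ => ?_
    rw [← Finset.sum_add_distrib]
    refine Finset.sum_le_sum fun j _ => ?_
    rw [← mul_add]
    refine mul_le_mul_of_nonneg_left ?_ (hW i j)
    have := htan (u j - u i) (v j - v i)
    rwa [show v j - v i - (u j - u i) = v j - u j - (v i - u i) by ring] at this
  rw [h1]
  have h3 := mul_le_mul_of_nonneg_left h2 (show 0 ≤ 1 / (2 * p * (n : ℝ) ^ 2) by positivity)
  rw [mul_add] at h3
  linarith

lemma profileGrad_eq_zero_of_min (hp : 0 < p) (hn : 0 < n)
    (hd : ∀ t, HasDerivAt h (h' t) t) {u : Fin n → ℝ}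
    (hu : ∀ v, profileEnergy lam p h γ W u ≤ profileEnergy lam p h γ W v) (k : Fin n) :
    profileGrad lam p h' γ W u k = 0 := by
  have hn' : (0 : ℝ) < n := by exact_mod_cast hn
  set D : Fin n → ℝ := Pi.single k 1 with hD
  have hder : HasDerivAt (fun t : ℝ => profileEnergy lam p h γ W (fun i => u i + t * D i))
      (1 / (n : ℝ) * ∑ k, profileGrad lam p h' γ W u k * D k) 0 := by
    rw [sum_profileGrad_mul hp.ne' hn'.ne']
    unfold profileEnergy
    have hl : ∀ i, HasDerivAt (fun t : ℝ => u i + t * D i) (D i) 0 := fun i => by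
      simpa using ((hasDerivAt_id (0 : ℝ)).mul_const (D i)).const_add (u i)
    refine HasDerivAt.add ?_ ?_
    · have : HasDerivAt (fun t : ℝ => ∑ i, (u i + t * D i - γ i) ^ 2)
          (∑ i, 2 * (u i - γ i) * D i) 0 := by
        refine HasDerivAt.fun_sum fun i _ => ?_
        have := ((hl i).sub_const (γ i)).fun_pow 2
        simpa using this
      refine (this.const_mul (1 / (2 * lam * n))).congr_deriv ?_
      simp_rw [mul_assoc]
      rw [← Finset.mul_sum]
      by_cases hl0 : lam = 0
      · simp [hl0]
      field_simp
    · refine HasDerivAt.const_mul _ (HasDerivAt.fun_sum fun i _ => HasDerivAt.fun_sum fun j _ =>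
        HasDerivAt.const_mul _ ?_)
      have h1 := (hl j).sub (hl i)
      have h2 : HasDerivAt h (h' (u j - u i)) ((fun t : ℝ => u j + t * D j - (u i + t * D i)) 0) := by
        simpa using hd (u j - u i)
      exact h2.comp 0 h1
  have hmin : IsLocalMin (fun t : ℝ => profileEnergy lam p h γ W (fun i => u i + t * D i)) 0 :=
    Filter.Eventually.of_forall fun t => by simpa using hu _
  have h0 := hmin.hasDerivAt_eq_zero hder
  have h1 : ∑ k, profileGrad lam p h' γ W u k * D k = profileGrad lam p h' γ W u k := by
    rw [Finset.sum_eq_single k]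
    · simp [hD]
    · intro j _ hj; simp [hD, hj]
    · simp
  rw [h1] at h0
  have : 1 / (n : ℝ) ≠ 0 := by positivity
  exact (mul_eq_zero.1 h0).resolve_left this

lemma continuous_profileGrad (hc : Continuous h') (k : Fin n) :
    Continuous fun u => profileGrad lam p h' γ W u k := by
  unfold profileGrad
  fun_prop

end profile

/-! ### Stability of discrete minimizers under perturbation of the weights -/

section stability
variable {n : ℕ} {lam p δ : ℝ} {γ : Fin n → ℝ} {W : Fin n → Fin n → ℝ}

/-- The matrix `W` with its diagonal replaced by zero. -/
def offDiagPart (W : Fin n → Fin n → ℝ) (i j : Fin n) : ℝ := if i = j then 0 else W i j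

/-- The diagonal weights carry no information: `Υ i i` is unconstrained, possibly negative. They are
removed before smoothing, because `smoothPow p δ 0` is not zero. -/
lemma profileEnergy_offDiagPart {h : ℝ → ℝ} (h0 : h 0 = 0) (u : Fin n → ℝ) :
    profileEnergy lam p h γ (offDiagPart W) u = profileEnergy lam p h γ W u := by
  unfold profileEnergy
  congr 2
  refine Finset.sum_congr rfl fun i _ => Finset.sum_congr rfl fun j _ => ?_
  by_cases hij : i = j
  · simp [hij, h0]
  · simp [offDiagPart, hij]

lemma profileGrad_offDiagPart {h' : ℝ → ℝ} (u : Fin n → ℝ) (k : Fin n) :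
    profileGrad lam p h' γ (offDiagPart W) u k = profileGrad lam p h' γ W u k := by
  unfold profileGrad
  congr 2
  refine Finset.sum_congr rfl fun j _ => ?_
  by_cases hij : j = k
  · simp [hij]
  · simp [offDiagPart, hij, Ne.symm hij]

lemma neg_mul_mean_le (hlam : 0 < lam) (hn : 0 < n) (a D : Fin n → ℝ) :
    -(1 / (n : ℝ) * ∑ k, a k * D k) ≤
      lam * (1 / (n : ℝ) * ∑ k, a k ^ 2) + 1 / (4 * lam * n) * ∑ k, D k ^ 2 := by
  have hn' : (0 : ℝ) < n := by exact_mod_cast hn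
  have : ∑ k, -(a k * D k) ≤ ∑ k, (lam * a k ^ 2 + 1 / (4 * lam) * D k ^ 2) := by
    refine Finset.sum_le_sum fun k _ => ?_
    have : lam * a k ^ 2 + 1 / (4 * lam) * D k ^ 2 + a k * D k =
        1 / (4 * lam) * (2 * lam * a k + D k) ^ 2 := by field_simp; ring
    have h2 : 0 ≤ 1 / (4 * lam) * (2 * lam * a k + D k) ^ 2 := by positivity
    linarith
  rw [Finset.sum_neg_distrib, Finset.sum_add_distrib, ← Finset.mul_sum, ← Finset.mul_sum] at this
  have h2 := mul_le_mul_of_nonneg_left this (show 0 ≤ 1 / (n : ℝ) by positivity)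
  have e : 1 / (4 * lam * n) * ∑ k, D k ^ 2 = 1 / (n : ℝ) * (1 / (4 * lam) * ∑ k, D k ^ 2) := by
    field_simp
  rw [e]
  linarith

/-- The true and the smoothed energy of a point differ by at most `M δ^p / (2p)`. Hence `u` is
almost minimal for the smoothed energy, and strong convexity at `v` together with Young's inequality
bounds `u - v` by the gradient at `v`. -/
lemma mean_sq_sub_minimizer_le (hp : 1 ≤ p) (hp2 : p ≤ 2) (hlam : 0 < lam) (hn : 0 < n)
    (hδ : 0 < δ) {M : ℝ} (hM : 0 ≤ M)
    (hW : ∀ i j, i ≠ j → 0 ≤ W i j) (hWM : ∀ i j, i ≠ j → W i j ≤ M) {u : Fin n → ℝ}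
    (hu : IsDiscreteMinimizer lam p γ W u) (v : Fin n → ℝ) :
    1 / (n : ℝ) * ∑ k, (u k - v k) ^ 2 ≤ 2 * lam * M * δ ^ p / p
      + 4 * lam ^ 2 * (1 / (n : ℝ) * ∑ k, profileGrad lam p (smoothPowDeriv p δ) γ W v k ^ 2) := by
  have hn' : (0 : ℝ) < n := by exact_mod_cast hn
  have hp0 : 0 < p := by linarith
  have hW' : ∀ i j, 0 ≤ offDiagPart W i j := fun i j => by
    unfold offDiagPart; split_ifs with h
    · exact le_rfl
    · exact hW i j h
  have hWM' : ∀ i j, offDiagPart W i j ≤ M := fun i j => by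
    unfold offDiagPart; split_ifs with h
    · exact hM
    · exact hWM i j h
  have h1 := profileEnergy_ge_of_tangent (γ := γ) hlam hp0 hn (smoothPow_tangent_le hp hδ) hW' v u
  simp_rw [profileGrad_offDiagPart] at h1
  have hz : (fun t : ℝ => |t| ^ p) 0 = 0 := by simp [hp0.ne']
  have h2 : profileEnergy lam p (fun t => |t| ^ p) γ (offDiagPart W) v
      ≤ profileEnergy lam p (smoothPow p δ) γ (offDiagPart W) v := by
    unfold profileEnergy
    gcongr with i _ j _
    · exact hW' i j
    · exact abs_rpow_le_smoothPow hp0.le _ _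
  have h3 : profileEnergy lam p (smoothPow p δ) γ (offDiagPart W) u ≤
      profileEnergy lam p (fun t => |t| ^ p) γ (offDiagPart W) u + M * δ ^ p / (2 * p) := by
    unfold profileEnergy
    rw [add_assoc]
    refine add_le_add_right ?_ _
    have h4 : ∑ i, ∑ j, offDiagPart W i j * smoothPow p δ (u j - u i) ≤
        ∑ i, ∑ j, offDiagPart W i j * |u j - u i| ^ p + n ^ 2 * (M * δ ^ p) := by
      have : (n : ℝ) ^ 2 * (M * δ ^ p) = ∑ i : Fin n, ∑ j : Fin n, M * δ ^ p := by
        simp; ring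
      rw [this, ← Finset.sum_add_distrib]
      refine Finset.sum_le_sum fun i _ => ?_
      rw [← Finset.sum_add_distrib]
      refine Finset.sum_le_sum fun j _ => ?_
      have h5 := mul_le_mul_of_nonneg_left (smoothPow_le hp0.le hp2 hδ.le (u j - u i)) (hW' i j)
      have h6 : offDiagPart W i j * δ ^ p ≤ M * δ ^ p :=
        mul_le_mul_of_nonneg_right (hWM' i j) (by positivity)
      rw [mul_add] at h5
      linarith
    have h7 := mul_le_mul_of_nonneg_left h4 (show 0 ≤ 1 / (2 * p * (n : ℝ) ^ 2) by positivity)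
    rw [mul_add] at h7
    refine h7.trans (le_of_eq ?_)
    congr 1
    field_simp
  have h5 := hu v
  rw [discreteEnergy_eq_profileEnergy, discreteEnergy_eq_profileEnergy,
    ← profileEnergy_offDiagPart (W := W) hz, ← profileEnergy_offDiagPart (W := W) hz] at h5
  have h6 := neg_mul_mean_le hlam hn (fun k => profileGrad lam p (smoothPowDeriv p δ) γ W v k)
    (fun k => u k - v k)
  have h7 : 1 / (4 * lam * n) * ∑ k, (u k - v k) ^ 2 ≤ M * δ ^ p / (2 * p)
      + lam * (1 / (n : ℝ) * ∑ k, profileGrad lam p (smoothPowDeriv p δ) γ W v k ^ 2) := by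
    -- Half of the strongly convex term is spent on absorbing the cross term from Young's
    -- inequality.
    have e : 1 / (2 * lam * n) * ∑ k, (u k - v k) ^ 2 = 1 / (4 * lam * n) * ∑ k, (u k - v k) ^ 2
      + 1 / (4 * lam * n) * ∑ k, (u k - v k) ^ 2 := by ring
    linarith
  have h8 := mul_le_mul_of_nonneg_left h7 (show 0 ≤ 4 * lam by positivity)
  have e1 : 4 * lam * (1 / (4 * lam * n) * ∑ k, (u k - v k) ^ 2) =
      1 / (n : ℝ) * ∑ k, (u k - v k) ^ 2 := by field_simp
  rw [e1] at h8
  refine h8.trans (le_of_eq ?_)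
  rw [mul_add]
  congr 1
  · field_simp; ring
  · ring

/-- The competitor is `0`: it minimizes the regularizer, so an approximate critical point cannot be
much larger than the data. -/
lemma mean_sq_le_of_profileGrad (hp : 1 ≤ p) (hlam : 0 < lam) (hn : 0 < n)
    (hδ : 0 < δ) (hW : ∀ i j, 0 ≤ W i j) (v : Fin n → ℝ) :
    1 / (n : ℝ) * ∑ k, v k ^ 2 ≤ 2 * (1 / (n : ℝ) * ∑ k, γ k ^ 2)
      + 4 * lam ^ 2 * (1 / (n : ℝ) * ∑ k, profileGrad lam p (smoothPowDeriv p δ) γ W v k ^ 2) := by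
  have hn' : (0 : ℝ) < n := by exact_mod_cast hn
  have hp0 : 0 < p := by linarith
  have h1 := profileEnergy_ge_of_tangent (γ := γ) hlam hp0 hn (smoothPow_tangent_le hp hδ) hW v 0
  have h2 : profileEnergy lam p (smoothPow p δ) γ W 0 ≤ profileEnergy lam p (smoothPow p δ) γ W v
      + 1 / (2 * lam * n) * ∑ k, γ k ^ 2 := by
    unfold profileEnergy
    have h4 : ∑ i, ∑ j, W i j * smoothPow p δ ((0 : Fin n → ℝ) j - (0 : Fin n → ℝ) i) ≤
        ∑ i, ∑ j, W i j * smoothPow p δ (v j - v i) := by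
      refine Finset.sum_le_sum fun i _ => Finset.sum_le_sum fun j _ =>
        mul_le_mul_of_nonneg_left (smoothPow_mono hp0.le _ ?_) (hW i j)
      simp
    have h7 := mul_le_mul_of_nonneg_left h4 (show 0 ≤ 1 / (2 * p * (n : ℝ) ^ 2) by positivity)
    have h8 : 0 ≤ 1 / (2 * lam * n) * ∑ i, (v i - γ i) ^ 2 := by positivity
    have h9 : ∑ i, ((0 : Fin n → ℝ) i - γ i) ^ 2 = ∑ i, γ i ^ 2 := by simp
    rw [h9]
    linarith
  have h6 := neg_mul_mean_le hlam hn (fun k => profileGrad lam p (smoothPowDeriv p δ) γ W v k)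
    (fun k => (0 : Fin n → ℝ) k - v k)
  have e0 : ∑ k, ((0 : Fin n → ℝ) k - v k) ^ 2 = ∑ k, v k ^ 2 := by simp
  rw [e0] at h1 h6
  have h7 : 1 / (4 * lam * n) * ∑ k, v k ^ 2 ≤ 1 / (2 * lam * n) * ∑ k, γ k ^ 2
      + lam * (1 / (n : ℝ) * ∑ k, profileGrad lam p (smoothPowDeriv p δ) γ W v k ^ 2) := by
    have e : 1 / (2 * lam * n) * ∑ k, v k ^ 2 = 1 / (4 * lam * n) * ∑ k, v k ^ 2
      + 1 / (4 * lam * n) * ∑ k, v k ^ 2 := by ring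
    linarith
  have h8 := mul_le_mul_of_nonneg_left h7 (show 0 ≤ 4 * lam by positivity)
  have e1 : 4 * lam * (1 / (4 * lam * n) * ∑ k, v k ^ 2) = 1 / (n : ℝ) * ∑ k, v k ^ 2 := by field_simp
  rw [e1] at h8
  refine h8.trans (le_of_eq ?_)
  rw [mul_add]
  congr 1
  · field_simp; norm_num
  · ring

/-- The coefficient of the edge variable `e` in the `k`-th component of the gradient. -/
noncomputable def edgeCoeff (p : ℝ) (h' : ℝ → ℝ) (v : Fin n → ℝ) (k : Fin n) (e : OffDiag n) : ℝ :=
  1 / (2 * p * n) * (h' (v e.1.2 - v e.1.1) *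
    ((if e.1.2 = k then 1 else 0) - (if e.1.1 = k then 1 else 0)))

lemma sum_offDiag (f : Fin n → Fin n → ℝ) (hf : ∀ i, f i i = 0) :
    ∑ e : OffDiag n, f e.1.1 e.1.2 = ∑ i, ∑ j, f i j := by
  rw [← Fintype.sum_prod_type' f,
    ← Finset.sum_subtype (Finset.univ.filter fun e : Fin n × Fin n => e.1 ≠ e.2) (by simp)
      (fun e : Fin n × Fin n => f e.1 e.2)]
  refine Finset.sum_subset (Finset.filter_subset _ _) fun e _ he => ?_
  simp only [Finset.mem_filter, Finset.mem_univ, true_and, not_not] at he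
  rw [he, hf]

lemma profileGrad_sub_eq (h' : ℝ → ℝ) (W' : Fin n → Fin n → ℝ) (v : Fin n → ℝ) (k : Fin n) :
    profileGrad lam p h' γ W v k - profileGrad lam p h' γ W' v k =
      ∑ e : OffDiag n, edgeCoeff p h' v k e * (W e.1.1 e.1.2 - W' e.1.1 e.1.2) := by
  unfold edgeCoeff
  rw [sum_offDiag (fun i j => 1 / (2 * p * n) * (h' (v j - v i) *
    ((if j = k then 1 else 0) - (if i = k then 1 else 0))) * (W i j - W' i j)) (fun i => by simp)]
  unfold profileGrad
  have e : ∀ i j, 1 / (2 * p * n) * (h' (v j - v i) *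
    ((if j = k then 1 else 0) - (if i = k then 1 else 0))) * (W i j - W' i j) =
    1 / (2 * p * n) * ((if j = k then h' (v j - v i) * (W i j - W' i j) else 0)
      - (if i = k then h' (v j - v i) * (W i j - W' i j) else 0)) := by
    intro i j; split_ifs <;> ring
  simp_rw [e, ← Finset.mul_sum, Finset.sum_sub_distrib]
  rw [Finset.sum_comm (f := fun i j => if i = k then h' (v j - v i) * (W i j - W' i j) else 0)]
  simp only [Finset.sum_ite_eq', Finset.mem_univ, if_true]
  rw [add_sub_add_left_eq_sub, ← mul_sub]
  congr 1
  rw [← Finset.sum_sub_distrib, ← Finset.sum_sub_distrib, ← Finset.sum_sub_distrib, ← Finset.sum_sub_distrib]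
  refine Finset.sum_congr rfl fun i _ => by ring

/-- An edge enters only the two components of the gradient at its end points. The factor `1/n` in
each coefficient is squared and compensates the at most `n²` edges. -/
lemma sum_sq_edgeCoeff_le (hp : 1 ≤ p) (hp2 : p ≤ 2) (hn : 0 < n) (hδ : 0 < δ) (hδ1 : δ ≤ 1)
    (v : Fin n → ℝ) :
    ∑ k, ∑ e, edgeCoeff p (smoothPowDeriv p δ) v k e ^ 2 ≤
      1 + 2 * (1 / (n : ℝ) * ∑ k, v k ^ 2) := by
  have hn' : (0 : ℝ) < n := by exact_mod_cast hn
  have hp0 : 0 < p := by linarith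
  rw [Finset.sum_comm]
  calc ∑ e : OffDiag n, ∑ k, edgeCoeff p (smoothPowDeriv p δ) v k e ^ 2
      ≤ ∑ e : OffDiag n, 1 / (2 * (n : ℝ) ^ 2) * (2 + (v e.1.2 - v e.1.1) ^ 2) := by
        refine Finset.sum_le_sum fun e _ => ?_
        have h1 : ∀ k, edgeCoeff p (smoothPowDeriv p δ) v k e ^ 2 ≤
            (1 / (2 * p * n)) ^ 2 * smoothPowDeriv p δ (v e.1.2 - v e.1.1) ^ 2 *
              ((if e.1.2 = k then 1 else 0) + (if e.1.1 = k then 1 else 0)) := by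
          intro k
          unfold edgeCoeff
          rw [mul_pow, mul_pow, ← mul_assoc]
          refine mul_le_mul_of_nonneg_left ?_ (by positivity)
          split_ifs <;> norm_num
        refine (Finset.sum_le_sum fun k _ => h1 k).trans ?_
        rw [← Finset.mul_sum, Finset.sum_add_distrib]
        simp only [Finset.sum_ite_eq, Finset.mem_univ, if_true]
        have h2 := sq_smoothPowDeriv_le hp hp2 hδ hδ1 (v e.1.2 - v e.1.1)
        calc _ ≤ (1 / (2 * p * n)) ^ 2 * (p ^ 2 * (2 + (v e.1.2 - v e.1.1) ^ 2)) * (1 + 1) := by gcongr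
          _ = _ := by field_simp; ring
    _ ≤ ∑ e : OffDiag n, (1 / (n : ℝ) ^ 2 * 1 + 1 / (n : ℝ) ^ 2 * (v e.1.2 ^ 2 + v e.1.1 ^ 2)) := by
        refine Finset.sum_le_sum fun e _ => ?_
        rw [← mul_add]
        have h3 : (2 + (v e.1.2 - v e.1.1) ^ 2) ≤ 2 * (1 + (v e.1.2 ^ 2 + v e.1.1 ^ 2)) := by
          nlinarith [sq_nonneg (v e.1.2 + v e.1.1)]
        calc _ ≤ 1 / (2 * (n : ℝ) ^ 2) * (2 * (1 + (v e.1.2 ^ 2 + v e.1.1 ^ 2))) := by gcongr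
          _ = _ := by field_simp
    _ ≤ ∑ e : Fin n × Fin n, (1 / (n : ℝ) ^ 2 * 1 + 1 / (n : ℝ) ^ 2 * (v e.2 ^ 2 + v e.1 ^ 2)) := by
        rw [← Finset.sum_subtype (Finset.univ.filter fun e : Fin n × Fin n => e.1 ≠ e.2) (by simp)
          (fun e : Fin n × Fin n => (1 / (n : ℝ) ^ 2 * 1 + 1 / (n : ℝ) ^ 2 * (v e.2 ^ 2 + v e.1 ^ 2)))]
        exact Finset.sum_le_sum_of_subset_of_nonneg (Finset.filter_subset _ _)
          fun _ _ _ => by positivity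
    _ = 1 + 2 * (1 / (n : ℝ) * ∑ k, v k ^ 2) := by
        rw [Fintype.sum_prod_type]
        simp only [Finset.sum_add_distrib, ← Finset.mul_sum]
        simp only [Finset.sum_const, Finset.card_univ, Fintype.card_fin, nsmul_eq_mul,
          ← Finset.mul_sum]
        field_simp
        ring

end stability

/-! ### Averages over sets -/

section average
variable {E : Type*} [MeasurableSpace E] {μ : Measure E}

lemma setAverage_congr_of_subset {F F' : E → ℝ} {s D : Set E} (h : F =ᵐ[μ.restrict D] F')
    (hs : s ⊆ D) : ⨍ z in s, F z ∂μ = ⨍ z in s, F' z ∂μ :=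
  average_congr (ae_restrict_of_ae_restrict_of_subset hs h)

lemma abs_setAverage_le {F : E → ℝ} {s D : Set E} {M : ℝ} (hM : 0 ≤ M)
    (h : ∀ᵐ z ∂μ.restrict D, |F z| ≤ M) (hs : s ⊆ D) (hfin : μ s ≠ ∞) :
    |⨍ z in s, F z ∂μ| ≤ M := by
  have h1 := norm_setIntegral_le_of_norm_le_const_ae (f := F) (C := M) hfin.lt_top
    (ae_restrict_of_ae_restrict_of_subset hs h)
  rw [setAverage_eq, smul_eq_mul, abs_mul, abs_inv, abs_of_nonneg measureReal_nonneg]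
  rcases eq_or_lt_of_le (measureReal_nonneg (μ := μ) (s := s)) with h0 | h0
  · rw [← h0]; simpa using hM
  · rw [inv_mul_le_iff₀ h0, mul_comm]
    exact h1

lemma setAverage_nonneg {F : E → ℝ} {s D : Set E} (h : ∀ᵐ z ∂μ.restrict D, 0 ≤ F z) (hs : s ⊆ D) :
    0 ≤ ⨍ z in s, F z ∂μ := by
  rw [setAverage_eq, smul_eq_mul]
  exact mul_nonneg (by positivity)
    (integral_nonneg_of_ae (ae_restrict_of_ae_restrict_of_subset hs h))

/-- Supplies the measurability of node averages as functions of the nodes, the cells being sections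
of one measurable set. -/
lemma measurable_setAverage_section {α : Type*} [MeasurableSpace α] [SFinite μ] {A : Set (α × E)}
    (hA : MeasurableSet A) {F : E → ℝ} (hF : Measurable F) :
    Measurable fun x => ⨍ z in {z | (x, z) ∈ A}, F z ∂μ := by
  simp_rw [setAverage_eq, smul_eq_mul]
  refine Measurable.mul ?_ ?_
  · exact (measurable_measure_prodMk_left hA).ennreal_toReal.inv
  · have h1 : ∀ x, ∫ z in {z | (x, z) ∈ A}, F z ∂μ = ∫ z, A.indicator (fun y => F y.2) (x, z) ∂μ := by
      intro x
      rw [← integral_indicator (s := {z | (x, z) ∈ A}) (measurable_prodMk_left hA)]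
      rfl
    simp_rw [h1]
    exact (StronglyMeasurable.integral_prod_right'
      ((hF.comp measurable_snd).indicator hA).stronglyMeasurable).measurable

end average

/-! ### Order statistics -/

section nodes
variable {n : ℕ}

/-- Order statistics are measurable because, on each of these finitely many sets, they are plain
coordinates. -/
lemma measurableSet_sort_eq (σ : Equiv.Perm (Fin n)) :
    MeasurableSet {x : Fin n → ℝ | σ = Tuple.sort x} := by
  simp_rw [Tuple.eq_sort_iff]
  have : {x : Fin n → ℝ | Monotone (x ∘ σ) ∧ ∀ i j, i < j → x (σ i) = x (σ j) → σ i < σ j} =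
      (⋂ i, ⋂ j, ⋂ (_ : i ≤ j), {x | x (σ i) ≤ x (σ j)}) ∩
      (⋂ i, ⋂ j, ⋂ (_ : i < j), ({x | x (σ i) = x (σ j)}ᶜ ∪ {_x | σ i < σ j})) := by
    ext x
    simp only [mem_ofPred_eq, Monotone, Function.comp, mem_inter_iff, mem_iInter, mem_union,
      mem_compl_iff, imp_iff_not_or]
  rw [this]
  refine MeasurableSet.inter ?_ ?_
  · refine MeasurableSet.iInter fun i => MeasurableSet.iInter fun j => MeasurableSet.iInter fun _ => ?_
    exact measurableSet_le (by fun_prop) (by fun_prop)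
  · refine MeasurableSet.iInter fun i => MeasurableSet.iInter fun j => MeasurableSet.iInter fun _ => ?_
    exact (measurableSet_eq_fun (by fun_prop) (by fun_prop)).compl.union (MeasurableSet.const _)

lemma measurable_orderStat (i : Fin n) : Measurable fun x : Fin n → ℝ => orderStat x i := by
  have : (fun x : Fin n → ℝ => orderStat x i) = fun x => ∑ σ : Equiv.Perm (Fin n),
      {x : Fin n → ℝ | σ = Tuple.sort x}.indicator (fun x => x (σ i)) x := by
    ext x
    rw [Finset.sum_eq_single (Tuple.sort x)]
    · simp [orderStat]
    · intro σ _ hσ; simp [hσ]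
    · simp
  rw [this]
  exact Finset.measurable_sum _ fun σ _ => Measurable.indicator (by fun_prop) (measurableSet_sort_eq σ)

lemma measurable_prevOrderStat (i : Fin n) :
    Measurable fun x : Fin n → ℝ => prevOrderStat x i := by
  unfold prevOrderStat
  split_ifs with h
  · exact measurable_const
  · exact measurable_orderStat _

lemma orderStat_mem {x : Fin n → ℝ} {s : Set ℝ} (hx : ∀ k, x k ∈ s) (i : Fin n) :
    orderStat x i ∈ s := hx _

lemma prevOrderStat_nonneg {x : Fin n → ℝ} (hx : ∀ k, x k ∈ Icc (0 : ℝ) 1) (i : Fin n) :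
    0 ≤ prevOrderStat x i := by
  unfold prevOrderStat
  split_ifs with h
  · exact le_rfl
  · exact (orderStat_mem hx _).1

lemma nodeCell_subset {x : Fin n → ℝ} (hx : ∀ k, x k ∈ Icc (0 : ℝ) 1) (i : Fin n) :
    nodeCell x i ⊆ Icc 0 1 := fun _ hy =>
  ⟨(prevOrderStat_nonneg hx i).trans hy.1.le, hy.2.trans (orderStat_mem hx i).2⟩

lemma measurableSet_nodeCell (x : Fin n → ℝ) (i : Fin n) : MeasurableSet (nodeCell x i) :=
  measurableSet_Ioc

lemma nodeCell_prod_subset {x : Fin n → ℝ} (hx : ∀ k, x k ∈ Icc (0 : ℝ) 1) (i j : Fin n) :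
    nodeCell x i ×ˢ nodeCell x j ⊆ Icc 0 1 ×ˢ Icc 0 1 :=
  prod_mono (nodeCell_subset hx i) (nodeCell_subset hx j)

lemma measurableSet_nodeCell_graph (i : Fin n) :
    MeasurableSet {y : (Fin n → ℝ) × ℝ | y.2 ∈ nodeCell y.1 i} :=
  (measurableSet_lt ((measurable_prevOrderStat i).comp measurable_fst) measurable_snd).inter
    (measurableSet_le measurable_snd ((measurable_orderStat i).comp measurable_fst))

lemma measurable_nodeData {g : ℝ → ℝ} (hg : Measurable g) (i : Fin n) :
    Measurable fun x : Fin n → ℝ => nodeData g x i :=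
  measurable_setAverage_section (measurableSet_nodeCell_graph i) hg

lemma measurable_nodeKernel (q : ℝ) {K : ℝ × ℝ → ℝ} (hK : Measurable K) (i j : Fin n) :
    Measurable fun x : Fin n → ℝ => nodeKernel q K x i j := by
  unfold nodeKernel
  refine Measurable.min ?_ measurable_const
  have hA : MeasurableSet {y : (Fin n → ℝ) × (ℝ × ℝ) | y.2 ∈ nodeCell y.1 i ×ˢ nodeCell y.1 j} := by
    refine MeasurableSet.inter
      (s₁ := {y : (Fin n → ℝ) × (ℝ × ℝ) | y.2.1 ∈ nodeCell y.1 i})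
      (s₂ := {y : (Fin n → ℝ) × (ℝ × ℝ) | y.2.2 ∈ nodeCell y.1 j}) ?_ ?_
    · exact (show Measurable fun y : (Fin n → ℝ) × (ℝ × ℝ) => (y.1, y.2.1) by fun_prop)
        (measurableSet_nodeCell_graph i)
    · exact (show Measurable fun y : (Fin n → ℝ) × (ℝ × ℝ) => (y.1, y.2.2) by fun_prop)
        (measurableSet_nodeCell_graph j)
  exact measurable_setAverage_section hA hK

lemma volume_unitSquare : volume (Icc (0 : ℝ) 1 ×ˢ Icc (0 : ℝ) 1) = 1 := by
  rw [Measure.volume_eq_prod, Measure.prod_prod]; simp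

lemma nodeCell_prod_volume_ne_top {x : Fin n → ℝ} (hx : ∀ k, x k ∈ Icc (0 : ℝ) 1) (i j : Fin n) :
    volume (nodeCell x i ×ˢ nodeCell x j) ≠ ∞ :=
  ((measure_mono (nodeCell_prod_subset hx i j)).trans_lt
    (by rw [volume_unitSquare]; exact ENNReal.one_lt_top)).ne

lemma nodeData_congr {g g' : ℝ → ℝ} (h : g =ᵐ[leb] g') {x : Fin n → ℝ}
    (hx : ∀ k, x k ∈ Icc (0 : ℝ) 1) (i : Fin n) : nodeData g x i = nodeData g' x i :=
  setAverage_congr_of_subset h (nodeCell_subset hx i)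

lemma nodeKernel_congr {K K' : ℝ × ℝ → ℝ} (h : K =ᵐ[leb2] K') (q : ℝ) {x : Fin n → ℝ}
    (hx : ∀ k, x k ∈ Icc (0 : ℝ) 1) (i j : Fin n) : nodeKernel q K x i j = nodeKernel q K' x i j := by
  unfold nodeKernel
  rw [setAverage_congr_of_subset h (nodeCell_prod_subset hx i j)]

lemma abs_nodeData_le {g : ℝ → ℝ} {G : ℝ} (hG : 0 ≤ G) (h : ∀ᵐ y ∂leb, |g y| ≤ G)
    {x : Fin n → ℝ} (hx : ∀ k, x k ∈ Icc (0 : ℝ) 1) (i : Fin n) : |nodeData g x i| ≤ G :=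
  abs_setAverage_le hG h (nodeCell_subset hx i) (by simp [nodeCell])

lemma nodeKernel_nonneg {K : ℝ × ℝ → ℝ} (h : ∀ᵐ z ∂leb2, 0 ≤ K z) {q : ℝ} (hq : 0 < q)
    {x : Fin n → ℝ} (hx : ∀ k, x k ∈ Icc (0 : ℝ) 1) (i j : Fin n) : 0 ≤ nodeKernel q K x i j :=
  le_min (setAverage_nonneg h (nodeCell_prod_subset hx i j)) (by positivity)

lemma nodeKernel_le {K : ℝ × ℝ → ℝ} {M : ℝ} (hM : 0 ≤ M) (h : ∀ᵐ z ∂leb2, |K z| ≤ M) (q : ℝ)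
    {x : Fin n → ℝ} (hx : ∀ k, x k ∈ Icc (0 : ℝ) 1) (i j : Fin n) : nodeKernel q K x i j ≤ M :=
  (min_le_left _ _).trans ((le_abs_self _).trans
    (abs_setAverage_le hM h (nodeCell_prod_subset hx i j) (nodeCell_prod_volume_ne_top hx i j)))

lemma nodeKernel_le_inv (q : ℝ) (K : ℝ × ℝ → ℝ) (x : Fin n → ℝ) (i j : Fin n) :
    nodeKernel q K x i j ≤ 1 / q := min_le_right _ _

end nodes

/-! ### The noise in the edge variables -/

section noise
variable {n : ℕ} {lam p : ℝ}

lemma exists_small_profileGrad (hp : 1 ≤ p) (hlam : 0 < lam) (hn : 0 < n) {δ η : ℝ} (hδ : 0 < δ)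
    (hη : 0 < η) (γ : Fin n → ℝ) {W : Fin n → Fin n → ℝ} (hW : ∀ i j, 0 ≤ W i j) :
    ∃ k : ℕ, ∀ i, |profileGrad lam p (smoothPowDeriv p δ) γ W
      (TopologicalSpace.denseSeq (Fin n → ℝ) k) i| ≤ η := by
  have hp0 : 0 < p := by linarith
  obtain ⟨u, -, hu⟩ := exists_profileEnergy_minimizer (γ := γ) (G := ∑ i, |γ i|) hlam hp0
    (continuous_smoothPow (p := p) hδ) (fun s t h => smoothPow_mono hp0.le δ h) hW
    (Finset.sum_nonneg fun i _ => abs_nonneg _)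
    (fun i => Finset.single_le_sum (f := fun i => |γ i|) (fun i _ => abs_nonneg _) (Finset.mem_univ i))
  have h0 := profileGrad_eq_zero_of_min hp0 hn (hasDerivAt_smoothPow hδ) hu
  have hopen : IsOpen {v : Fin n → ℝ | ∀ i, |profileGrad lam p (smoothPowDeriv p δ) γ W v i| < η} := by
    have : {v : Fin n → ℝ | ∀ i, |profileGrad lam p (smoothPowDeriv p δ) γ W v i| < η} =
        ⋂ i, {v | |profileGrad lam p (smoothPowDeriv p δ) γ W v i| < η} := by ext; simp
    rw [this]
    exact isOpen_iInter_of_finite fun i => isOpen_lt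
      (continuous_profileGrad (continuous_smoothPowDeriv hδ) i).abs continuous_const
  obtain ⟨k, hk⟩ := (TopologicalSpace.denseRange_denseSeq (Fin n → ℝ)).exists_mem_open hopen
    ⟨u, fun i => by rw [h0 i]; simpa using hη⟩
  exact ⟨k, fun i => (hk i).le⟩

/-- An exact critical point would need a measurable selection. Allowing an error `η`, one takes the
first term of a dense sequence with small gradient; this exists by continuity of the gradient at a
true minimizer. -/
lemma exists_measurable_approx_critical (hp : 1 ≤ p) (hlam : 0 < lam) (hn : 0 < n) {δ η : ℝ}
    (hδ : 0 < δ) (hη : 0 < η) {α : Type*} [MeasurableSpace α] {γ : α → Fin n → ℝ}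
    {W : α → Fin n → Fin n → ℝ} (hγ : ∀ i, Measurable fun x => γ x i)
    (hWm : ∀ i j, Measurable fun x => W x i j) (hW : ∀ x i j, 0 ≤ W x i j) :
    ∃ v : α → Fin n → ℝ, Measurable v ∧
      ∀ x i, |profileGrad lam p (smoothPowDeriv p δ) (γ x) (W x) (v x) i| ≤ η := by
  classical
  have hex := fun x => exists_small_profileGrad hp hlam hn hδ hη (γ x) (hW x)
  refine ⟨fun x => TopologicalSpace.denseSeq (Fin n → ℝ) (Nat.find (hex x)), ?_,
    fun x => Nat.find_spec (hex x)⟩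
  refine (measurable_from_nat (f := TopologicalSpace.denseSeq (Fin n → ℝ))).comp
    (measurable_find hex fun k => ?_)
  have : {x | ∀ i, |profileGrad lam p (smoothPowDeriv p δ) (γ x) (W x)
      (TopologicalSpace.denseSeq (Fin n → ℝ) k) i| ≤ η} = ⋂ i, {x | |profileGrad lam p
      (smoothPowDeriv p δ) (γ x) (W x) (TopologicalSpace.denseSeq (Fin n → ℝ) k) i| ≤ η} := by
    ext; simp
  rw [this]
  refine MeasurableSet.iInter fun i => measurableSet_le ?_ measurable_const
  unfold profileGrad
  fun_prop

/-- Both minimizers are compared with `v`. For the weights `W` the gradient at `v` is at most `η`;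
for `Υ` it is this plus the noise, written as linear forms in `Υ - W`. -/
lemma mean_sq_sub_minimizers_le (hp : 1 ≤ p) (hp2 : p ≤ 2) (hlam : 0 < lam) (hn : 0 < n)
    {δ η M q : ℝ} (hδ : 0 < δ) (hM : 0 ≤ M) (hq : 0 < q) (hη0 : 0 ≤ η) {γ : Fin n → ℝ}
    {W Υ : Fin n → Fin n → ℝ}
    (hW : ∀ i j, 0 ≤ W i j) (hWM : ∀ i j, W i j ≤ M) (hΥ : ∀ i j, i ≠ j → 0 ≤ Υ i j)
    (hΥq : ∀ i j, i ≠ j → Υ i j ≤ 1 / q) {v u u0 : Fin n → ℝ}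
    (hv : ∀ i, |profileGrad lam p (smoothPowDeriv p δ) γ W v i| ≤ η)
    (hu : IsDiscreteMinimizer lam p γ Υ u) (hu0 : IsDiscreteMinimizer lam p γ W u0) :
    1 / (n : ℝ) * ∑ k, (u k - u0 k) ^ 2 ≤ 4 * lam * (1 / q + M) * δ ^ p / p + 24 * lam ^ 2 * η ^ 2
      + 16 * lam ^ 2 * (1 / (n : ℝ) * ∑ k, (∑ e : OffDiag n, edgeCoeff p (smoothPowDeriv p δ) v k e *
        (Υ e.1.1 e.1.2 - W e.1.1 e.1.2)) ^ 2) := by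
  have hn' : (0 : ℝ) < n := by exact_mod_cast hn
  have hA := mean_sq_sub_minimizer_le hp hp2 hlam hn hδ (by positivity) hΥ hΥq hu v
  have hB := mean_sq_sub_minimizer_le hp hp2 hlam hn hδ hM (fun i j _ => hW i j)
    (fun i j _ => hWM i j) hu0 v
  simp_rw [← profileGrad_sub_eq (lam := lam) (γ := γ)]
  set a := fun k => profileGrad lam p (smoothPowDeriv p δ) γ W v k with ha
  set b := fun k => profileGrad lam p (smoothPowDeriv p δ) γ Υ v k with hb
  change _ ≤ _ + 16 * lam ^ 2 * (1 / (n : ℝ) * ∑ k, (b k - a k) ^ 2)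
  change _ ≤ _ + 4 * lam ^ 2 * (1 / (n : ℝ) * ∑ k, b k ^ 2) at hA
  change _ ≤ _ + 4 * lam ^ 2 * (1 / (n : ℝ) * ∑ k, a k ^ 2) at hB
  have mean_le : ∀ (f g : Fin n → ℝ), (∀ k, f k ≤ g k) →
      1 / (n : ℝ) * ∑ k, f k ≤ 1 / (n : ℝ) * ∑ k, g k := fun f g h => by
    gcongr with k; exact h k
  have h1 : 1 / (n : ℝ) * ∑ k, a k ^ 2 ≤ η ^ 2 := by
    refine (mean_le _ (fun _ => η ^ 2) fun k => ?_).trans (le_of_eq ?_)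
    · rw [sq_le_sq, abs_of_nonneg hη0]; exact hv k
    · simp; field_simp
  have h2 : 1 / (n : ℝ) * ∑ k, b k ^ 2 ≤ 2 * (1 / (n : ℝ) * ∑ k, a k ^ 2)
      + 2 * (1 / (n : ℝ) * ∑ k, (b k - a k) ^ 2) := by
    refine (mean_le _ (fun k => 2 * a k ^ 2 + 2 * (b k - a k) ^ 2) fun k => ?_).trans (le_of_eq ?_)
    · nlinarith [sq_nonneg (b k - 2 * a k)]
    · rw [Finset.sum_add_distrib, ← Finset.mul_sum, ← Finset.mul_sum]; ring
  have h3 : 1 / (n : ℝ) * ∑ k, (u k - u0 k) ^ 2 ≤ 2 * (1 / (n : ℝ) * ∑ k, (u k - v k) ^ 2)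
      + 2 * (1 / (n : ℝ) * ∑ k, (u0 k - v k) ^ 2) := by
    refine (mean_le _ (fun k => 2 * (u k - v k) ^ 2 + 2 * (u0 k - v k) ^ 2) fun k => ?_).trans
      (le_of_eq ?_)
    · nlinarith [sq_nonneg (u k - v k + (u0 k - v k))]
    · rw [Finset.sum_add_distrib, ← Finset.mul_sum, ← Finset.mul_sum]; ring
  have e : 4 * lam * (1 / q + M) * δ ^ p / p = 2 * (2 * lam * (1 / q) * δ ^ p / p)
      + 2 * (2 * lam * M * δ ^ p / p) := by ring
  rw [e]
  have h4 := mul_le_mul_of_nonneg_left h1 (show 0 ≤ lam ^ 2 by positivity)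
  have h5 := mul_le_mul_of_nonneg_left h2 (show 0 ≤ lam ^ 2 by positivity)
  nlinarith

/-- `v`, `δ` and `η` are fixed before the edges are drawn, so the deviation bound for independent
edges applies conditionally on the nodes. The slack `ε` is arbitrary and pays for smoothing and for
inexact criticality. -/
lemma measure_noise_le (hp : 1 ≤ p) (hp2 : p ≤ 2) (hlam : 0 < lam) (hn : 0 < n)
    {M q Γ τ ε : ℝ} (hM : 0 ≤ M) (hq : 0 < q) (hε : 0 < ε)
    {g : ℝ → ℝ} (hg : Measurable g) {K : ℝ × ℝ → ℝ} (hK : Measurable K) (hK0 : ∀ z, 0 ≤ K z)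
    (hKM : ∀ z, K z ≤ M)
    {Ω : Type*} [MeasurableSpace Ω] {P : Measure Ω} [IsProbabilityMeasure P]
    {X : Fin n → Ω → ℝ} {Υ : Fin n → Fin n → Ω → ℝ} (hG : IsRandomGraph P n q K X Υ)
    {un : Ω → Fin n → ℝ} (hun : ∀ᵐ ω ∂P, IsDiscreteMinimizer lam p (nodeData g (fun k => X k ω))
          (fun i j => Υ i j ω) (un ω)) :
    P {ω | 1 / (n : ℝ) * ∑ k, nodeData g (fun k => X k ω) k ^ 2 ≤ Γ ∧
        ∃ u0, IsDiscreteMinimizer lam p (nodeData g (fun k => X k ω))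
          (nodeKernel q K (fun k => X k ω)) u0 ∧
          ε + 16 * lam ^ 2 * τ < 1 / (n : ℝ) * ∑ k, (un ω k - u0 k) ^ 2} ≤
      ENNReal.ofReal (2 * Real.exp (-(n * τ * q ^ 2 / (2 + 4 * Γ + 8 * lam ^ 2)))) := by
  have hn' : (0 : ℝ) < n := by exact_mod_cast hn
  have hp0 : 0 < p := by linarith
  obtain ⟨δ, hδ, hδ1, hδε⟩ : ∃ δ : ℝ, 0 < δ ∧ δ ≤ 1 ∧ 4 * lam * (1 / q + M) * δ ^ p / p ≤ ε / 2 := by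
    have hc : 0 < 4 * lam * (1 / q + M) := by positivity
    refine ⟨min 1 (ε / (2 * (4 * lam * (1 / q + M)))), by positivity, min_le_left _ _, ?_⟩
    set δ := min 1 (ε / (2 * (4 * lam * (1 / q + M)))) with hd
    have hd0 : 0 < δ := by positivity
    have h1 : δ ^ p ≤ δ := by
      simpa using Real.rpow_le_rpow_of_exponent_ge hd0 (min_le_left _ _) hp
    rw [div_le_iff₀ hp0]
    calc 4 * lam * (1 / q + M) * δ ^ p ≤ 4 * lam * (1 / q + M) * (ε / (2 * (4 * lam * (1 / q + M)))) := by
          gcongr; exact h1.trans (min_le_right _ _)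
      _ = ε / 2 * 1 := by field_simp
      _ ≤ ε / 2 * p := by gcongr
  obtain ⟨η, hη, hη1, hηε⟩ : ∃ η : ℝ, 0 < η ∧ η ≤ 1 ∧ 24 * lam ^ 2 * η ^ 2 ≤ ε / 2 := by
    refine ⟨min 1 (ε / (48 * lam ^ 2)), by positivity, min_le_left _ _, ?_⟩
    set η := min 1 (ε / (48 * lam ^ 2)) with hd
    have hd0 : 0 < η := by positivity
    have h1 : η ^ 2 ≤ η := by nlinarith [min_le_left 1 (ε / (48 * lam ^ 2))]
    calc 24 * lam ^ 2 * η ^ 2 ≤ 24 * lam ^ 2 * (ε / (48 * lam ^ 2)) := by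
          gcongr; exact h1.trans (min_le_right _ _)
      _ = ε / 2 := by field_simp; norm_num
  have hW : ∀ (x : Fin n → ℝ) i j, 0 ≤ nodeKernel q K x i j := fun x i j =>
    le_min (setAverage_nonneg (D := univ) (Filter.Eventually.of_forall hK0) (subset_univ _)) (by positivity)
  obtain ⟨v, hvm, hv⟩ := exists_measurable_approx_critical (γ := fun x : Fin n → ℝ => nodeData g x)
    (W := fun x : Fin n → ℝ => nodeKernel q K x) hp hlam hn hδ hη (measurable_nodeData hg)
    (measurable_nodeKernel q hK) hW
  -- `sum_sq_edgeCoeff_le` gives `1` plus twice the mean square of `v`, and the latter is at most `2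
  -- Γ + 4 lam²` by `mean_sq_le_of_profileGrad` with `η ≤ 1`.
  set V : ℝ := 1 + 4 * Γ + 8 * lam ^ 2 with hV
  set Z : (Fin n → ℝ) × (OffDiag n → ℝ) → ℝ := fun y => ∑ k, (∑ e : OffDiag n,
    edgeCoeff p (smoothPowDeriv p δ) (v y.1) k e * (y.2 e - nodeKernel q K y.1 e.1.1 e.1.2)) ^ 2
    with hZ
  have hZm : Measurable Z := by
    have h1 := measurable_nodeKernel (n := n) q hK
    have h2 := (continuous_smoothPowDeriv (p := p) hδ).measurable
    have h3 : ∀ i, Measurable fun y : (Fin n → ℝ) × (OffDiag n → ℝ) => v y.1 i := fun i =>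
      (measurable_pi_apply i).comp (hvm.comp measurable_fst)
    refine Finset.measurable_sum _ fun k _ => Measurable.pow_const
      (Finset.measurable_sum _ fun e _ => Measurable.mul ?_ (Measurable.sub (by fun_prop)
        ((h1 _ _).comp measurable_fst))) 2
    unfold edgeCoeff
    exact ((h2.comp ((h3 _).sub (h3 _))).mul_const _).const_mul _
  -- The second set collects edge values outside `{0, 1/q}`. It is null for every edge law, and off
  -- it the weights lie between `0` and `1/q`, as the deterministic comparison requires.
  set T : Set ((Fin n → ℝ) × (OffDiag n → ℝ)) :=
    {y | 1 / (n : ℝ) * ∑ k, nodeData g y.1 k ^ 2 ≤ Γ ∧ n * τ < Z y} ∪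
      {y | ∃ e, ¬ (y.2 e = 0 ∨ y.2 e = 1 / q)} with hT
  have hTm : MeasurableSet T := by
    refine MeasurableSet.union (MeasurableSet.inter
      (s₁ := {y : (Fin n → ℝ) × (OffDiag n → ℝ) | 1 / (n : ℝ) * ∑ k, nodeData g y.1 k ^ 2 ≤ Γ})
      (s₂ := {y | n * τ < Z y}) ?_ (measurableSet_lt measurable_const hZm)) ?_
    · refine measurableSet_le (Measurable.const_mul (Finset.measurable_sum _ fun k _ =>
        (((measurable_nodeData hg k).comp measurable_fst).pow_const 2)) _) measurable_const
    · have : {y : (Fin n → ℝ) × (OffDiag n → ℝ) | ∃ e, ¬ (y.2 e = 0 ∨ y.2 e = 1 / q)} =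
          ⋃ e, ({y | y.2 e = 0} ∪ {y | y.2 e = 1 / q})ᶜ := by
        ext y; simp
      rw [this]
      exact MeasurableSet.iUnion fun e => ((measurableSet_eq_fun (by fun_prop) (by fun_prop)).union
        (measurableSet_eq_fun (by fun_prop) (by fun_prop))).compl
  have hsec : ∀ x : Fin n → ℝ, edgeLaw q K x {υ | (x, υ) ∈ T} ≤
      ENNReal.ofReal (2 * Real.exp (-(n * τ * q ^ 2 / (2 + 4 * Γ + 8 * lam ^ 2)))) := by
    intro x
    have hprob : ∀ e : OffDiag n, IsProbabilityMeasure (scaledBernoulli q (nodeKernel q K x e.1.1 e.1.2)) :=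
      fun e => isProbabilityMeasure_scaledBernoulli hq (hW x _ _) (nodeKernel_le_inv _ _ _ _ _)
    have hnull : edgeLaw q K x {υ | ∃ e, ¬ (υ e = 0 ∨ υ e = 1 / q)} = 0 := by
      have : ∀ᵐ υ ∂edgeLaw q K x, ∀ e, (υ e = 0 ∨ υ e = 1 / q) := by
        rw [ae_all_iff]
        intro e
        exact (measurePreserving_eval (fun e : OffDiag n =>
          scaledBernoulli q (nodeKernel q K x e.1.1 e.1.2)) e).quasiMeasurePreserving.ae
          (ae_scaledBernoulli q _)
      simpa [ae_iff] using this
    by_cases hx : 1 / (n : ℝ) * ∑ k, nodeData g x k ^ 2 ≤ Γ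
    · have hSv := mean_sq_le_of_profileGrad hp hlam hn hδ (hW x) (v x) (γ := nodeData g x)
      have hgr : 1 / (n : ℝ) * ∑ k, profileGrad lam p (smoothPowDeriv p δ) (nodeData g x)
          (nodeKernel q K x) (v x) k ^ 2 ≤ 1 := by
        have : ∑ k, profileGrad lam p (smoothPowDeriv p δ) (nodeData g x)
          (nodeKernel q K x) (v x) k ^ 2 ≤ ∑ k : Fin n, (1 : ℝ) := by
          refine Finset.sum_le_sum fun k _ => ?_
          rw [sq_le_one_iff_abs_le_one]
          exact (hv x k).trans hη1
        simp at this
        rw [one_div, inv_mul_le_iff₀ hn']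
        simpa using this
      have hsum := sum_sq_edgeCoeff_le hp hp2 hn hδ hδ1 (v x)
      have hVb : ∑ k, ∑ e, edgeCoeff p (smoothPowDeriv p δ) (v x) k e ^ 2 ≤ V := by
        have := mul_le_mul_of_nonneg_left hgr (show 0 ≤ 4 * lam ^ 2 by positivity)
        rw [hV]
        linarith
      have h1 := measure_pi_scaledBernoulli_sum_sq_gt_le hq
        (w := fun e : OffDiag n => nodeKernel q K x e.1.1 e.1.2) (fun e => hW x _ _)
        (fun e => nodeKernel_le_inv _ _ _ _ _) (fun k e => edgeCoeff p (smoothPowDeriv p δ) (v x) k e)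
        hVb (n * τ)
      rw [show V + 1 = 2 + 4 * Γ + 8 * lam ^ 2 by rw [hV]; ring] at h1
      refine le_trans ((measure_mono (t := {υ | n * τ < Z (x, υ)} ∪
        {υ | ∃ e, ¬ (υ e = 0 ∨ υ e = 1 / q)}) ?_).trans (measure_union_le _ _)) ?_
      · rintro υ (h | h)
        · exact Or.inl h.2
        · exact Or.inr h
      · rw [hnull, add_zero]
        exact h1
    · refine le_trans ((measure_mono ?_).trans hnull.le) zero_le
      rintro υ (h | h)
      · exact absurd h.1 hx
      · exact h
  have hPT : P {ω | ((fun k => X k ω), fun e : OffDiag n => Υ e.1.1 e.1.2 ω) ∈ T} ≤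
      ENNReal.ofReal (2 * Real.exp (-(n * τ * q ^ 2 / (2 + 4 * Γ + 8 * lam ^ 2)))) := by
    rw [hG.edges_given_nodes T hTm]
    refine (lintegral_mono fun ω => hsec _).trans ?_
    simp
  -- Only monotonicity of the outer measure is used: neither `un` nor the choice of `u0` has to be
  -- measurable, since the bad event lies almost surely inside the preimage of the measurable set
  -- `T`.
  refine le_trans (measure_mono_ae ?_) hPT
  filter_upwards [hun] with ω hω hbad
  obtain ⟨hΓ, u0, hu0, hlt⟩ := hbad
  change ((fun k => X k ω), fun e : OffDiag n => Υ e.1.1 e.1.2 ω) ∈ T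
  by_contra hnT
  rw [hT, mem_union, not_or] at hnT
  obtain ⟨hn1, hn2⟩ := hnT
  have hΥ : ∀ i j, i ≠ j → Υ i j ω = 0 ∨ Υ i j ω = 1 / q := by
    intro i j hij
    by_contra hc
    exact hn2 ⟨⟨(i, j), hij⟩, hc⟩
  have hZle : Z ((fun k => X k ω), fun e : OffDiag n => Υ e.1.1 e.1.2 ω) ≤ n * τ := by
    by_contra hc
    exact hn1 ⟨hΓ, not_le.1 hc⟩
  have hq' : 0 ≤ 1 / q := by positivity
  have hfin := mean_sq_sub_minimizers_le hp hp2 hlam hn hδ hM hq hη.le (hW _)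
    (fun i j => (min_le_left _ _).trans ((le_abs_self _).trans
      (abs_setAverage_le (D := univ) hM (Filter.Eventually.of_forall fun z => by
        rw [abs_of_nonneg (hK0 z)]; exact hKM z) (subset_univ _) (by
          rw [Measure.volume_eq_prod, Measure.prod_prod]
          exact ENNReal.mul_ne_top (by simp [nodeCell]) (by simp [nodeCell])))))
    (fun i j hij => by rcases hΥ i j hij with h | h <;> simp only [h] <;> first | exact le_rfl | exact hq')
    (fun i j hij => by rcases hΥ i j hij with h | h <;> simp only [h] <;> first | exact hq' | exact le_rfl)
    (hv (fun k => X k ω)) hω hu0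
  have hZ2 : 1 / (n : ℝ) * Z ((fun k => X k ω), fun e : OffDiag n => Υ e.1.1 e.1.2 ω) ≤ τ := by
    rw [one_div, inv_mul_le_iff₀ hn']; exact hZle
  have h16 := mul_le_mul_of_nonneg_left hZ2 (show 0 ≤ 16 * lam ^ 2 by positivity)
  have : 1 / (n : ℝ) * ∑ k, (un ω k - u0 k) ^ 2 ≤ ε + 16 * lam ^ 2 * τ := by
    refine hfin.trans ?_
    refine (add_le_add (add_le_add hδε hηε) h16).trans (le_of_eq (by ring))
  linarith

end noise

/-! ### Elementary bounds for the noise rate. -/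

section rates
variable {p : ℝ}

lemma two_le_pExp (hp : p ∈ Ico (1 : ℝ) 2) : 2 ≤ pExp p := by
  have : 0 < 2 - p := by linarith [hp.2]
  rw [pExp, le_div_iff₀ this]; linarith [hp.1]

lemma noiseRate_pos {q β : ℝ} (hq : 0 < q) (hβ : 0 < β) {n : ℕ}
    (hn : 0 < n) : 0 < noiseRate p q β n := by
  have hn' : (1 : ℝ) ≤ n := by exact_mod_cast hn
  have := Real.log_nonneg hn'
  unfold noiseRate
  positivity

/-- The exponent `1/p'` is at most one, so it enlarges numbers below one and keeps numbers above one
at least one. -/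
lemma le_noiseRate (hp : p ∈ Ico (1 : ℝ) 2) {q β : ℝ} (hq : 0 < q) (hβ : 0 < β) {n : ℕ}
    (hn : 0 < n) : min 1 (β * (Real.log n / n)) ≤ noiseRate p q β n := by
  have hn' : (1 : ℝ) ≤ n := by exact_mod_cast hn
  have hlog := Real.log_nonneg hn'
  have hp' := two_le_pExp hp
  have hx : 0 ≤ β * (Real.log n / n) := by positivity
  set x := β * (Real.log n / n) with hxd
  have h1 : x ^ (1 / pExp p) ≤ noiseRate p q β n := by
    unfold noiseRate
    have : 0 ≤ 1 / (q ^ (pExp p - 1) * (n : ℝ) ^ (pExp p / 2)) := by positivity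
    gcongr
    linarith
  refine le_trans ?_ h1
  have he : 1 / pExp p ≤ 1 := by rw [div_le_one (by linarith)]; linarith
  have he0 : 0 ≤ 1 / pExp p := by positivity
  rcases le_total x 1 with h | h
  · rw [min_eq_right h]
    rcases eq_or_lt_of_le hx with h0 | h0
    · rw [← h0]; positivity
    · simpa using Real.rpow_le_rpow_of_exponent_ge h0 h he
  · rw [min_eq_left h]
    exact Real.one_le_rpow h he0

end rates

/-! ### The noise bound for the random graph. -/

section graph
variable {n : ℕ} {q : ℝ} {K K' : ℝ × ℝ → ℝ} {Ω : Type*} [MeasurableSpace Ω] {P : Measure Ω}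
  {X : Fin n → Ω → ℝ} {Υ : Fin n → Fin n → Ω → ℝ}

lemma NonlocalVariational.IsRandomGraph.ae_nodes_mem (hG : IsRandomGraph P n q K X Υ) :
    ∀ᵐ ω ∂P, ∀ k, X k ω ∈ Icc (0 : ℝ) 1 := by
  rw [ae_all_iff]
  intro k
  have h : ∀ᵐ x ∂(P.map (X k)), x ∈ Icc (0 : ℝ) 1 := by
    rw [hG.uniform_nodes k]
    exact ae_restrict_mem measurableSet_Icc
  exact ae_of_ae_map (hG.measurable_nodes k).aemeasurable h

/-- The nodes lie in `[0,1]` almost surely, so the edge law sees the kernel only through averages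
over subsets of the unit square. -/
lemma NonlocalVariational.IsRandomGraph.congr (hG : IsRandomGraph P n q K X Υ)
    (h : K =ᵐ[leb2] K') : IsRandomGraph P n q K' X Υ where
  measurable_nodes := hG.measurable_nodes
  measurable_edges := hG.measurable_edges
  indep_nodes := hG.indep_nodes
  uniform_nodes := hG.uniform_nodes
  edges_given_nodes := fun S hS => by
    rw [hG.edges_given_nodes S hS]
    refine lintegral_congr_ae ?_
    filter_upwards [hG.ae_nodes_mem] with ω hω
    unfold edgeLaw
    simp_rw [nodeKernel_congr h q hω]

/-- A measurable representative of a bounded nonnegative kernel, bounded everywhere. -/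
lemma exists_measurable_bounded_rep {K : ℝ × ℝ → ℝ} (hK : AEMeasurable K leb2) {M : ℝ} (hM : 0 ≤ M)
    (h0 : ∀ᵐ z ∂leb2, 0 ≤ K z) (h1 : ∀ᵐ z ∂leb2, K z ≤ M) :
    ∃ K' : ℝ × ℝ → ℝ, Measurable K' ∧ K =ᵐ[leb2] K' ∧ (∀ z, 0 ≤ K' z) ∧ ∀ z, K' z ≤ M := by
  refine ⟨fun z => max 0 (min (hK.mk K z) M), ?_, ?_, fun z => le_max_left _ _,
    fun z => max_le hM (min_le_right _ _)⟩
  · exact measurable_const.max (hK.measurable_mk.min measurable_const)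
  · filter_upwards [hK.ae_eq_mk, h0, h1] with z hz h0 h1
    rw [← hz, min_eq_left h1, max_eq_right h0]

theorem measure_noise_gt_le {p : ℝ} (hp : p ∈ Ico (1 : ℝ) 2) {lam : ℝ} (hlam : 0 < lam)
    {g : ℝ → ℝ} (hg : AEMeasurable g leb)
    {K : ℝ × ℝ → ℝ} (hK : AEMeasurable K leb2) {M : ℝ} (hM : 0 ≤ M)
    (h0 : ∀ᵐ z ∂leb2, 0 ≤ K z) (h1 : ∀ᵐ z ∂leb2, K z ≤ M)
    {q : ℕ → ℝ} (hq_pos : ∀ n, 0 < n → 0 < q n) (hq_bdd : ∃ Q : ℝ, ∀ n, 0 < n → q n ≤ Q)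
    {Γ : ℝ} (hΓ : 0 ≤ Γ) :
    ∃ C > 0, ∃ C₁ > 0, ∀ n : ℕ, 0 < n →
      ∀ (Ω : Type*) [MeasurableSpace Ω] (P : Measure Ω) [IsProbabilityMeasure P]
        (X : Fin n → Ω → ℝ) (Υ : Fin n → Fin n → Ω → ℝ), IsRandomGraph P n (q n) K X Υ →
      ∀ un : Ω → Fin n → ℝ,
        (∀ᵐ ω ∂P, IsDiscreteMinimizer lam p (nodeData g (fun k => X k ω))
          (fun i j => Υ i j ω) (un ω)) →
      ∀ β : ℝ, 0 < β →
        P {ω | 1 / (n : ℝ) * ∑ k, nodeData g (fun k => X k ω) k ^ 2 ≤ Γ ∧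
          β * (Real.log n / n) ≤ 1 ∧
          ∃ u0, IsDiscreteMinimizer lam p (nodeData g (fun k => X k ω))
            (nodeKernel (q n) K (fun k => X k ω)) u0 ∧
            C * noiseRate p (q n) β n < 1 / (n : ℝ) * ∑ k, (un ω k - u0 k) ^ 2} ≤
        ENNReal.ofReal (failProb p (q n) β C₁ n) := by
  obtain ⟨Q, hQ⟩ := hq_bdd
  obtain ⟨K', hK'm, hKK', hK'0, hK'M⟩ := exists_measurable_bounded_rep hK hM h0 h1
  set Q' := max Q 1 with hQ'
  have hQ'1 : 1 ≤ Q' := le_max_right _ _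
  have hp' := two_le_pExp hp
  set c : ℝ := 2 + 4 * Γ + 8 * lam ^ 2 with hc
  have hc0 : 0 < c := by positivity
  -- The slack `ε` is taken equal to the noise rate and `τ = β log n / n` is at most the noise rate;
  -- together they give the first constant. In the second, the power of `Q'` turns `q²` into
  -- `q^(2p'-1)`.
  refine ⟨1 + 16 * lam ^ 2, by positivity, 1 / (c * Q' ^ (2 * pExp p - 3)), by positivity, ?_⟩
  intro n hn Ω _ P _ X Υ hG un hun β hβ
  have hqn := hq_pos n hn
  have hn' : (1 : ℝ) ≤ n := by exact_mod_cast hn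
  have hlog := Real.log_nonneg hn'
  by_cases hx1 : β * (Real.log n / n) ≤ 1
  swap
  · simp [hx1]
  have hτ := le_noiseRate hp hqn hβ hn
  rw [min_eq_right hx1] at hτ
  have hun' : ∀ᵐ ω ∂P, IsDiscreteMinimizer lam p (nodeData (hg.mk g) (fun k => X k ω))
      (fun i j => Υ i j ω) (un ω) := by
    filter_upwards [hun, hG.ae_nodes_mem] with ω hω hX
    rwa [← funext (nodeData_congr hg.ae_eq_mk hX)]
  have hmain := measure_noise_le hp.1 hp.2.le hlam hn hM hqn (noiseRate_pos (p := p) hqn hβ hn)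
    (Γ := Γ) (τ := β * (Real.log n / n)) hg.measurable_mk hK'm hK'0 hK'M (hG.congr hKK') hun'
  refine le_trans (le_trans (measure_mono_ae ?_) hmain) ?_
  · filter_upwards [hG.ae_nodes_mem] with ω hX hbad
    obtain ⟨hb1, -, u0, hu0, hlt⟩ := hbad
    rw [funext (nodeData_congr hg.ae_eq_mk hX)] at hb1 hu0
    rw [show nodeKernel (q n) K (fun k => X k ω) = nodeKernel (q n) K' (fun k => X k ω) from
      funext fun i => funext fun j => nodeKernel_congr hKK' _ hX i j] at hu0
    refine ⟨hb1, u0, hu0, lt_of_le_of_lt ?_ hlt⟩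
    have := mul_le_mul_of_nonneg_left hτ (show 0 ≤ 16 * lam ^ 2 by positivity)
    linarith
  · apply ENNReal.ofReal_le_ofReal
    unfold failProb
    rw [Real.rpow_def_of_pos (by linarith)]
    gcongr 2 * Real.exp ?_
    rw [mul_neg, neg_le_neg_iff]
    have e1 : (n : ℝ) * (β * (Real.log n / n)) = β * Real.log n := by field_simp
    rw [e1]
    -- As `p' ≥ 2`, the surplus exponent `2p' - 3` is positive, and the bound on `q` absorbs it.
    have h2 : q n ^ (2 * pExp p - 1) ≤ q n ^ 2 * Q' ^ (2 * pExp p - 3) := by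
      have : q n ^ (2 * pExp p - 1) = q n ^ 2 * q n ^ (2 * pExp p - 3) := by
        rw [← Real.rpow_natCast, ← Real.rpow_add hqn]; congr 1; push_cast; ring
      rw [this]
      gcongr
      · linarith
      · exact (hQ n hn).trans (le_max_left _ _)
    have hQpos : 0 < Q' ^ (2 * pExp p - 3) := by positivity
    rw [le_div_iff₀ hc0]
    calc Real.log n * (1 / (c * Q' ^ (2 * pExp p - 3)) * q n ^ (2 * pExp p - 1) * β) * c
        ≤ Real.log n * (1 / (c * Q' ^ (2 * pExp p - 3)) * (q n ^ 2 * Q' ^ (2 * pExp p - 3)) * β) * c := by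
          gcongr
      _ = β * Real.log n * q n ^ 2 := by field_simp

/-- The exceptional set need not be measurable; the complement of its measurable hull is the
required measurable event. -/
lemma withProbAtLeast_of_compl_le {Ω : Type*} [MeasurableSpace Ω] {P : Measure Ω}
    [IsProbabilityMeasure P] {A : Set Ω} {e : ℝ} (h : P Aᶜ ≤ ENNReal.ofReal e) (he : 0 ≤ e) :
    WithProbAtLeast P (1 - e) A := by
  refine ⟨(toMeasurable P Aᶜ)ᶜ, ?_, (measurableSet_toMeasurable _ _).compl, ?_⟩
  · rw [compl_subset_comm]; exact subset_toMeasurable _ _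
  · rw [prob_compl_eq_one_sub (measurableSet_toMeasurable _ _), measure_toMeasurable,
      ENNReal.ofReal_sub _ he, ENNReal.ofReal_one]
    exact tsub_le_tsub_left h _

end graph

/-! ### Step functions on the uniform partition -/

section cells
variable {n : ℕ}

lemma measurableSet_cell (n : ℕ) (i : Fin n) : MeasurableSet (cell n i) := measurableSet_Ico

lemma volume_cell (i : Fin n) : volume (cell n i) = ENNReal.ofReal (1 / n) := by
  rw [cell, Real.volume_Ico]; congr 1; ring

lemma measureReal_cell (i : Fin n) : volume.real (cell n i) = 1 / n := by
  rw [measureReal_def, volume_cell, ENNReal.toReal_ofReal (by positivity)]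

lemma cell_subset (i : Fin n) : cell n i ⊆ Ico 0 1 := by
  have hn : (0 : ℝ) < n := by exact_mod_cast i.pos
  have hi : (i : ℝ) + 1 ≤ n := by exact_mod_cast i.isLt
  refine Ico_subset_Ico (by positivity) ?_
  rw [div_le_one hn]; exact hi

lemma cell_subset_Icc (i : Fin n) : cell n i ⊆ Icc 0 1 := (cell_subset i).trans Ico_subset_Icc_self

lemma mem_cell_iff {i : Fin n} {x : ℝ} : x ∈ cell n i ↔ (i : ℝ) ≤ n * x ∧ n * x < i + 1 := by
  have hn : (0 : ℝ) < n := by exact_mod_cast i.pos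
  rw [cell, mem_Ico, div_le_iff₀ hn, lt_div_iff₀ hn, mul_comm x]

lemma eq_of_mem_cell {i j : Fin n} {x : ℝ} (hi : x ∈ cell n i) (hj : x ∈ cell n j) : i = j := by
  rw [mem_cell_iff] at hi hj
  have h1 : (i : ℝ) < j + 1 := lt_of_le_of_lt hi.1 hj.2
  have h2 : (j : ℝ) < i + 1 := lt_of_le_of_lt hj.1 hi.2
  have h1' : (i : ℕ) < j + 1 := by exact_mod_cast h1
  have h2' : (j : ℕ) < i + 1 := by exact_mod_cast h2
  exact Fin.ext (by omega)

lemma exists_mem_cell (hn : 0 < n) {x : ℝ} (hx : x ∈ Ico (0 : ℝ) 1) : ∃ i : Fin n, x ∈ cell n i := by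
  have hn' : (0 : ℝ) < n := by exact_mod_cast hn
  have h0 : 0 ≤ n * x := mul_nonneg hn'.le hx.1
  refine ⟨⟨⌊n * x⌋₊, ?_⟩, ?_⟩
  · rw [Nat.floor_lt h0]; nlinarith [hx.2]
  · rw [mem_cell_iff]
    exact ⟨Nat.floor_le h0, Nat.lt_floor_add_one _⟩

lemma pairwise_disjoint_cell (n : ℕ) : Pairwise (Function.onFun Disjoint (cell n)) := fun _ _ hij =>
  Set.disjoint_left.2 fun _ hi hj => hij (eq_of_mem_cell hi hj)

lemma iUnion_cell (hn : 0 < n) : ⋃ i, cell n i = Ico 0 1 := by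
  ext x
  rw [mem_iUnion]
  exact ⟨fun ⟨i, hi⟩ => cell_subset i hi, fun hx => exists_mem_cell hn hx⟩

lemma leb_eq_sum (hn : 0 < n) : leb = Measure.sum fun i : Fin n => volume.restrict (cell n i) := by
  rw [← Measure.restrict_iUnion (pairwise_disjoint_cell n) (measurableSet_cell n), iUnion_cell hn,
    Measure.restrict_congr_set Ico_ae_eq_Icc]

lemma leb2_eq_prod : leb2 = leb.prod leb := by
  rw [leb2, leb, Measure.prod_restrict, Measure.volume_eq_prod]

instance : IsProbabilityMeasure leb := ⟨by simp⟩

instance : IsProbabilityMeasure leb2 := by rw [leb2_eq_prod]; infer_instance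

lemma leb2_eq_sum (hn : 0 < n) : leb2 =
    Measure.sum fun e : Fin n × Fin n => volume.restrict (cell n e.1 ×ˢ cell n e.2) := by
  rw [leb2_eq_prod, leb_eq_sum hn, Measure.prod_sum]
  simp_rw [Measure.prod_restrict, Measure.volume_eq_prod]

lemma volume_cell_prod (i j : Fin n) :
    volume (cell n i ×ˢ cell n j) = ENNReal.ofReal (1 / (n : ℝ) ^ 2) := by
  rw [Measure.volume_eq_prod, Measure.prod_prod, volume_cell, volume_cell,
    ← ENNReal.ofReal_mul (by positivity)]
  congr 1; field_simp

lemma measureReal_cell_prod (i j : Fin n) :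
    volume.real (cell n i ×ˢ cell n j) = 1 / (n : ℝ) ^ 2 := by
  rw [measureReal_def, volume_cell_prod, ENNReal.toReal_ofReal (by positivity)]

lemma inj_apply_of_mem (w : Fin n → ℝ) {i : Fin n} {x : ℝ} (hx : x ∈ cell n i) : inj n w x = w i := by
  rw [inj, Finset.sum_eq_single i]
  · simp [hx]
  · intro j _ hj
    rw [indicator_of_notMem]
    exact fun h => hj (eq_of_mem_cell h hx)
  · simp

lemma inj2_apply_of_mem (W : Fin n → Fin n → ℝ) {i j : Fin n} {z : ℝ × ℝ}
    (hz : z ∈ cell n i ×ˢ cell n j) : inj2 n W z = W i j := by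
  rw [inj2, Finset.sum_eq_single i, Finset.sum_eq_single j]
  · simp only [indicator_of_mem hz]
  · intro k _ hk
    rw [indicator_of_notMem]
    exact fun h => hk (eq_of_mem_cell h.2 hz.2)
  · simp
  · intro k _ hk
    refine Finset.sum_eq_zero fun l _ => ?_
    rw [indicator_of_notMem]
    exact fun h => hk (eq_of_mem_cell h.1 hz.1)
  · simp

lemma measurable_inj (w : Fin n → ℝ) : Measurable (inj n w) :=
  Finset.measurable_sum _ fun i _ => measurable_const.indicator (measurableSet_cell n i)

lemma measurable_inj2 (W : Fin n → Fin n → ℝ) : Measurable (inj2 n W) :=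
  Finset.measurable_sum _ fun i _ => Finset.measurable_sum _ fun j _ =>
    measurable_const.indicator ((measurableSet_cell n i).prod (measurableSet_cell n j))

lemma ae_leb_of_cells (hn : 0 < n) {φ : ℝ → Prop} (h : ∀ i : Fin n, ∀ x ∈ cell n i, φ x) :
    ∀ᵐ x ∂leb, φ x := by
  rw [leb, ← Measure.restrict_congr_set Ico_ae_eq_Icc]
  filter_upwards [ae_restrict_mem measurableSet_Ico] with x hx
  obtain ⟨i, hi⟩ := exists_mem_cell hn hx
  exact h i x hi

lemma ae_leb2_of_cells (hn : 0 < n) {φ : ℝ × ℝ → Prop}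
    (h : ∀ i j : Fin n, ∀ z ∈ cell n i ×ˢ cell n j, φ z) : ∀ᵐ z ∂leb2, φ z := by
  have h1 := ae_leb_of_cells hn (φ := fun x => ∃ i : Fin n, x ∈ cell n i) fun i x hx => ⟨i, hx⟩
  have e1 : ∀ᵐ z ∂leb2, ∃ i : Fin n, z.1 ∈ cell n i := by
    rw [leb2_eq_prod]; exact Measure.quasiMeasurePreserving_fst.ae h1
  have e2 : ∀ᵐ z ∂leb2, ∃ i : Fin n, z.2 ∈ cell n i := by
    rw [leb2_eq_prod]; exact Measure.quasiMeasurePreserving_snd.ae h1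
  filter_upwards [e1, e2] with z ⟨i, hi⟩ ⟨j, hj⟩
  exact h i j z ⟨hi, hj⟩

lemma ae_abs_inj_le (hn : 0 < n) {w : Fin n → ℝ} {B : ℝ} (hB : ∀ i, |w i| ≤ B) :
    ∀ᵐ x ∂leb, |inj n w x| ≤ B :=
  ae_leb_of_cells hn fun i x hx => by rw [inj_apply_of_mem w hx]; exact hB i

lemma memLp_inj (n : ℕ) (w : Fin n → ℝ) (r : ℝ≥0∞) : MemLp (inj n w) r leb := by
  have hb : ∀ x, ‖inj n w x‖ ≤ ∑ i, |w i| := fun x => by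
    refine (Finset.abs_sum_le_sum_abs _ _).trans (Finset.sum_le_sum fun i _ => ?_)
    by_cases hx : x ∈ cell n i <;> simp [hx]
  exact MemLp.of_bound (measurable_inj w).aestronglyMeasurable _ (Filter.Eventually.of_forall hb)

lemma integral_leb_eq_sum (hn : 0 < n) {f : ℝ → ℝ} (hf : Integrable f leb) :
    ∫ x, f x ∂leb = ∑ i : Fin n, ∫ x in cell n i, f x := by
  rw [leb_eq_sum hn] at hf ⊢
  rw [integral_sum_measure hf, tsum_fintype]

lemma integral_leb_of_cells (hn : 0 < n) {f : ℝ → ℝ} {c : Fin n → ℝ}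
    (h : ∀ i, ∀ x ∈ cell n i, f x = c i) : ∫ x, f x ∂leb = 1 / n * ∑ i, c i := by
  have h1 : f =ᵐ[leb] inj n c := ae_leb_of_cells hn fun i x hx => by
    rw [h i x hx, inj_apply_of_mem c hx]
  rw [integral_congr_ae h1, integral_leb_eq_sum hn ((memLp_inj n c 1).integrable le_rfl), Finset.mul_sum]
  refine Finset.sum_congr rfl fun i _ => ?_
  rw [setIntegral_congr_fun (measurableSet_cell n i) (fun x hx => inj_apply_of_mem c hx),
    setIntegral_const, measureReal_cell, smul_eq_mul]

lemma integrable_inj2 (n : ℕ) (W : Fin n → Fin n → ℝ) : Integrable (inj2 n W) leb2 := by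
  have hb : ∀ z, ‖inj2 n W z‖ ≤ ∑ i, ∑ j, |W i j| := fun z => by
    refine (Finset.abs_sum_le_sum_abs _ _).trans (Finset.sum_le_sum fun i _ => ?_)
    refine (Finset.abs_sum_le_sum_abs _ _).trans (Finset.sum_le_sum fun j _ => ?_)
    by_cases hz : z ∈ cell n i ×ˢ cell n j
    · rw [indicator_of_mem hz]
    · rw [indicator_of_notMem hz, abs_zero]; exact abs_nonneg _
  exact Integrable.of_bound (measurable_inj2 W).aestronglyMeasurable _ (Filter.Eventually.of_forall hb)

lemma integral_leb2_of_cells (hn : 0 < n) {f : ℝ × ℝ → ℝ} {c : Fin n → Fin n → ℝ}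
    (h : ∀ i j, ∀ z ∈ cell n i ×ˢ cell n j, f z = c i j) :
    ∫ z, f z ∂leb2 = 1 / (n : ℝ) ^ 2 * ∑ i, ∑ j, c i j := by
  have h1 : f =ᵐ[leb2] inj2 n c := ae_leb2_of_cells hn fun i j z hz => by
    rw [h i j z hz, inj2_apply_of_mem c hz]
  have hI := integrable_inj2 n c
  rw [integral_congr_ae h1]
  rw [leb2_eq_sum hn] at hI ⊢
  rw [integral_sum_measure hI, tsum_fintype, Fintype.sum_prod_type, Finset.mul_sum]
  refine Finset.sum_congr rfl fun i _ => ?_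
  rw [Finset.mul_sum]
  refine Finset.sum_congr rfl fun j _ => ?_
  rw [setIntegral_congr_fun ((measurableSet_cell n i).prod (measurableSet_cell n j))
    (fun z hz => inj2_apply_of_mem c hz), setIntegral_const, measureReal_cell_prod, smul_eq_mul]

/-- Jensen's inequality on one cell, obtained by expanding the nonnegative integral of `(f - a)²`
with `a` the cell average. -/
lemma sq_setAverage_mul_le {f : ℝ → ℝ} (hf : MemLp f 2 leb) (i : Fin n) :
    1 / (n : ℝ) * proj n f i ^ 2 ≤ ∫ x in cell n i, f x ^ 2 := by
  have hn' : (0 : ℝ) < n := by exact_mod_cast i.pos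
  have hle : volume.restrict (cell n i) ≤ leb := Measure.restrict_mono_set _ (cell_subset_Icc i)
  have hf2 : MemLp f 2 (volume.restrict (cell n i)) := hf.mono_measure hle
  have hfin : volume (cell n i) ≠ ∞ := by rw [volume_cell]; exact ENNReal.ofReal_ne_top
  have : IsFiniteMeasure (volume.restrict (cell n i)) := ⟨by
    rw [Measure.restrict_apply_univ]; exact hfin.lt_top⟩
  have hi1 : Integrable f (volume.restrict (cell n i)) := hf2.integrable one_le_two
  set a := proj n f i with ha
  have hint : ∫ x in cell n i, f x = 1 / n * a := by
    rw [ha, proj, setAverage_eq, measureReal_cell, smul_eq_mul]; field_simp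
  have h0 : 0 ≤ ∫ x in cell n i, (f x - a) ^ 2 := integral_nonneg fun x => sq_nonneg _
  have e : ∀ x, (f x - a) ^ 2 = f x ^ 2 - 2 * a * f x + a ^ 2 := fun x => by ring
  simp_rw [e] at h0
  have hs : Integrable (fun x => f x ^ 2 - 2 * a * f x) (volume.restrict (cell n i)) :=
    hf2.integrable_sq.sub (hi1.const_mul _)
  rw [integral_add hs (integrable_const _), integral_sub hf2.integrable_sq (hi1.const_mul _), integral_const_mul, hint, setIntegral_const,
    measureReal_cell, smul_eq_mul] at h0
  linarith

lemma mean_sq_proj_le (hn : 0 < n) {f : ℝ → ℝ} (hf : MemLp f 2 leb) :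
    1 / (n : ℝ) * ∑ i, proj n f i ^ 2 ≤ ∫ x, f x ^ 2 ∂leb := by
  rw [integral_leb_eq_sum hn hf.integrable_sq, Finset.mul_sum]
  exact Finset.sum_le_sum fun i _ => sq_setAverage_mul_le hf i

lemma proj_sub_inj {f : ℝ → ℝ} (hf : MemLp f 2 leb) (γ : Fin n → ℝ) (i : Fin n) :
    proj n (fun x => f x - inj n γ x) i = proj n f i - γ i := by
  have hle : volume.restrict (cell n i) ≤ leb := Measure.restrict_mono_set _ (cell_subset_Icc i)
  have hn' : (0 : ℝ) < n := by exact_mod_cast i.pos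
  unfold proj
  rw [setAverage_eq, setAverage_eq, integral_sub
    ((hf.integrable one_le_two).mono_measure hle)
    (((memLp_inj n γ 2).integrable one_le_two).mono_measure hle),
    setIntegral_congr_fun (measurableSet_cell n i) (fun x hx => inj_apply_of_mem γ hx),
    setIntegral_const, measureReal_cell]
  simp only [smul_eq_mul]
  field_simp

end cells

/-! ### The continuum energy as a real number -/

/-- The continuum energy as a real number. -/
noncomputable def realEnergy (lam p : ℝ) (g : ℝ → ℝ) (K : ℝ × ℝ → ℝ) (f : ℝ → ℝ) : ℝ :=
  1 / (2 * lam) * ∫ x, (f x - g x) ^ 2 ∂leb + 1 / (2 * p) * ∫ z, K z * |f z.2 - f z.1| ^ p ∂leb2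

section energy
variable {lam p M : ℝ} {f g u v : ℝ → ℝ} {K : ℝ × ℝ → ℝ}

lemma measurePreserving_fst_leb2 : MeasurePreserving Prod.fst leb2 leb := by
  rw [leb2_eq_prod]; exact measurePreserving_fst

lemma measurePreserving_snd_leb2 : MeasurePreserving Prod.snd leb2 leb := by
  rw [leb2_eq_prod]; exact measurePreserving_snd

lemma memLp_pairDiff {r : ℝ≥0∞} (hf : MemLp f r leb) :
    MemLp (fun z : ℝ × ℝ => f z.2 - f z.1) r leb2 :=
  (hf.comp_measurePreserving measurePreserving_snd_leb2).sub
    (hf.comp_measurePreserving measurePreserving_fst_leb2)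

lemma integrable_pairDiff_rpow (hp : 1 ≤ p) (hp2 : p ≤ 2) (hf : MemLp f 2 leb) :
    Integrable (fun z : ℝ × ℝ => |f z.2 - f z.1| ^ p) leb2 := by
  have h1 : MemLp (fun z : ℝ × ℝ => f z.2 - f z.1) (ENNReal.ofReal p) leb2 :=
    (memLp_pairDiff hf).mono_exponent (by
      rw [show (2 : ℝ≥0∞) = ENNReal.ofReal 2 by simp]; exact ENNReal.ofReal_le_ofReal hp2)
  have := h1.integrable_norm_rpow (by simp; linarith) (by simp)
  simpa [ENNReal.toReal_ofReal (show 0 ≤ p by linarith)] using this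

lemma integrable_mul_pairDiff_rpow (hp : 1 ≤ p) (hp2 : p ≤ 2) (hK : AEMeasurable K leb2)
    (hKM : ∀ᵐ z ∂leb2, |K z| ≤ M) (hf : MemLp f 2 leb) :
    Integrable (fun z : ℝ × ℝ => K z * |f z.2 - f z.1| ^ p) leb2 :=
  (integrable_pairDiff_rpow hp hp2 hf).bdd_mul hK.aestronglyMeasurable hKM

lemma eLpNorm_two_sq (hf : MemLp f 2 leb) :
    eLpNorm f 2 leb ^ 2 = ENNReal.ofReal (∫ x, f x ^ 2 ∂leb) := by
  rw [hf.eLpNorm_eq_integral_rpow_norm (by norm_num) (by norm_num),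
    ← ENNReal.ofReal_pow (by positivity)]
  congr 1
  simp only [ENNReal.toReal_ofNat, Real.norm_eq_abs]
  rw [← Real.rpow_natCast, ← Real.rpow_mul (by positivity)]
  norm_num

lemma norm'_two_sq (hf : MemLp f 2 leb) : norm' leb 2 f ^ 2 = ∫ x, f x ^ 2 ∂leb := by
  rw [norm', ← ENNReal.toReal_pow, eLpNorm_two_sq hf, ENNReal.toReal_ofReal]
  exact integral_nonneg fun x => sq_nonneg _

lemma energy_eq_ofReal (hlam : 0 < lam) (hp : 1 ≤ p) (hp2 : p ≤ 2) (hg : MemLp g 2 leb)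
    (hK : AEMeasurable K leb2) (hK0 : ∀ᵐ z ∂leb2, 0 ≤ K z) (hKM : ∀ᵐ z ∂leb2, |K z| ≤ M)
    (hf : MemLp f 2 leb) : energy lam p g K f = ENNReal.ofReal (realEnergy lam p g K f) := by
  have hp0 : 0 < p := by linarith
  have h0 : 0 ≤ᵐ[leb2] fun z : ℝ × ℝ => K z * |f z.2 - f z.1| ^ p := by
    filter_upwards [hK0] with z hz
    positivity
  have h1 : 0 ≤ ∫ z, K z * |f z.2 - f z.1| ^ p ∂leb2 := integral_nonneg_of_ae h0
  have h2 : 0 ≤ ∫ x, (f x - g x) ^ 2 ∂leb := integral_nonneg fun x => sq_nonneg _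
  unfold energy reg realEnergy
  rw [eLpNorm_two_sq (f := fun x => f x - g x) (hf.sub hg),
    ← ofReal_integral_eq_lintegral_ofReal (integrable_mul_pairDiff_rpow hp hp2 hK hKM hf) h0,
    ← ENNReal.ofReal_mul (by positivity), ← ENNReal.ofReal_mul (by positivity),
    ← ENNReal.ofReal_add (by positivity) (by positivity)]

lemma realEnergy_nonneg (hlam : 0 < lam) (hp : 1 ≤ p) (hK0 : ∀ᵐ z ∂leb2, 0 ≤ K z) (f : ℝ → ℝ) :
    0 ≤ realEnergy lam p g K f := by
  have hp0 : 0 < p := by linarith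
  have h1 : 0 ≤ ∫ z, K z * |f z.2 - f z.1| ^ p ∂leb2 := integral_nonneg_of_ae (by
    filter_upwards [hK0] with z hz
    positivity)
  have h2 : 0 ≤ ∫ x, (f x - g x) ^ 2 ∂leb := integral_nonneg fun x => sq_nonneg _
  unfold realEnergy
  positivity

lemma realEnergy_le_of_minimizer (hlam : 0 < lam) (hp : 1 ≤ p) (hp2 : p ≤ 2) (hg : MemLp g 2 leb)
    (hK : AEMeasurable K leb2) (hK0 : ∀ᵐ z ∂leb2, 0 ≤ K z) (hKM : ∀ᵐ z ∂leb2, |K z| ≤ M)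
    (hu : IsContinuumMinimizer lam p g K u) (hv : MemLp v 2 leb) :
    realEnergy lam p g K u ≤ realEnergy lam p g K v := by
  have := hu.2 v hv
  rw [energy_eq_ofReal hlam hp hp2 hg hK hK0 hKM hu.1,
    energy_eq_ofReal hlam hp hp2 hg hK hK0 hKM hv] at this
  exact (ENNReal.ofReal_le_ofReal_iff (realEnergy_nonneg hlam hp hK0 v)).1 this

lemma abs_convexComb_rpow_le (hp : 1 ≤ p) {t : ℝ} (ht : 0 ≤ t) (ht1 : t ≤ 1) (a b : ℝ) :
    |(1 - t) * a + t * b| ^ p ≤ (1 - t) * |a| ^ p + t * |b| ^ p := by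
  have h1 : |(1 - t) * a + t * b| ≤ (1 - t) * |a| + t * |b| := by
    refine (abs_add_le _ _).trans (le_of_eq ?_)
    rw [abs_mul, abs_mul, abs_of_nonneg ht, abs_of_nonneg (by linarith : 0 ≤ 1 - t)]
  refine (Real.rpow_le_rpow (abs_nonneg _) h1 (by linarith)).trans ?_
  have := (convexOn_rpow hp).2 (abs_nonneg a) (abs_nonneg b) (by linarith : 0 ≤ 1 - t) ht (by ring)
  simpa using this

/-- The midpoint of `u` and `v` is a competitor: the regularizer is convex along the segment, and
the parallelogram identity for the data term leaves the square of `v - u`. -/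
lemma integral_sq_sub_le_of_minimizer (hlam : 0 < lam) (hp : 1 ≤ p) (hp2 : p ≤ 2)
    (hg : MemLp g 2 leb) (hK : AEMeasurable K leb2) (hK0 : ∀ᵐ z ∂leb2, 0 ≤ K z)
    (hKM : ∀ᵐ z ∂leb2, |K z| ≤ M) (hu : IsContinuumMinimizer lam p g K u) (hv : MemLp v 2 leb) :
    1 / (4 * lam) * ∫ x, (v x - u x) ^ 2 ∂leb ≤
      realEnergy lam p g K v - realEnergy lam p g K u := by
  have hp0 : 0 < p := by linarith
  set m : ℝ → ℝ := fun x => (1 - 1 / 2) * u x + 1 / 2 * v x with hm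
  have hmL : MemLp m 2 leb := (hu.1.const_mul _).add (hv.const_mul _)
  have hmin := realEnergy_le_of_minimizer hlam hp hp2 hg hK hK0 hKM hu hmL
  have e1 : ∫ x, (m x - g x) ^ 2 ∂leb = 1 / 2 * ∫ x, (u x - g x) ^ 2 ∂leb
      + 1 / 2 * ∫ x, (v x - g x) ^ 2 ∂leb - 1 / 4 * ∫ x, (v x - u x) ^ 2 ∂leb := by
    have i1 := (hu.1.sub hg).integrable_sq
    have i2 := (hv.sub hg).integrable_sq
    have i3 := (hv.sub hu.1).integrable_sq
    simp only [Pi.sub_apply] at i1 i2 i3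
    rw [← integral_const_mul, ← integral_const_mul, ← integral_const_mul,
      ← integral_add (i1.const_mul _) (i2.const_mul _), ← integral_sub
        (by exact (i1.const_mul _).add (i2.const_mul _)) (i3.const_mul _)]
    refine integral_congr_ae (Filter.Eventually.of_forall fun x => ?_)
    simp only [hm]
    ring
  have e2 : ∫ z, K z * |m z.2 - m z.1| ^ p ∂leb2 ≤ 1 / 2 * ∫ z, K z * |u z.2 - u z.1| ^ p ∂leb2
      + 1 / 2 * ∫ z, K z * |v z.2 - v z.1| ^ p ∂leb2 := by
    have i1 := integrable_mul_pairDiff_rpow hp hp2 hK hKM hu.1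
    have i2 := integrable_mul_pairDiff_rpow hp hp2 hK hKM hv
    rw [← integral_const_mul, ← integral_const_mul,
      ← integral_add (i1.const_mul _) (i2.const_mul _)]
    refine integral_mono_ae (integrable_mul_pairDiff_rpow hp hp2 hK hKM hmL)
      ((i1.const_mul _).add (i2.const_mul _)) ?_
    filter_upwards [hK0] with z hz
    have h := abs_convexComb_rpow_le hp (t := 1 / 2) (by norm_num) (by norm_num)
      (u z.2 - u z.1) (v z.2 - v z.1)
    have e : m z.2 - m z.1 = (1 - 1 / 2) * (u z.2 - u z.1) + 1 / 2 * (v z.2 - v z.1) := by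
      simp only [hm]; ring
    rw [e]
    refine (mul_le_mul_of_nonneg_left h hz).trans (le_of_eq ?_)
    ring
  have h3 := mul_le_mul_of_nonneg_left e2 (show 0 ≤ 1 / (2 * p) by positivity)
  unfold realEnergy at hmin ⊢
  rw [e1] at hmin
  have e4 : 1 / (2 * lam) * (1 / 4 * ∫ x, (v x - u x) ^ 2 ∂leb) =
    1 / 2 * (1 / (4 * lam) * ∫ x, (v x - u x) ^ 2 ∂leb) := by field_simp
  rw [mul_sub, e4] at hmin
  linarith

/-- The discrete energy is the continuum energy of a step function with step data and step kernel,
so all energies can be compared as integrals. -/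
lemma discreteEnergy_eq_integral {n : ℕ} (hn : 0 < n) (γ w : Fin n → ℝ) (W : Fin n → Fin n → ℝ) :
    discreteEnergy lam p γ W w = 1 / (2 * lam) * ∫ x, (inj n w x - inj n γ x) ^ 2 ∂leb
      + 1 / (2 * p) * ∫ z, inj2 n W z * |inj n w z.2 - inj n w z.1| ^ p ∂leb2 := by
  have hn' : (0 : ℝ) < n := by exact_mod_cast hn
  rw [integral_leb_of_cells hn (c := fun i => (w i - γ i) ^ 2) fun i x hx => by
      rw [inj_apply_of_mem w hx, inj_apply_of_mem γ hx],
    integral_leb2_of_cells hn (c := fun i j => W i j * |w j - w i| ^ p) fun i j z hz => by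
      rw [inj2_apply_of_mem W hz, inj_apply_of_mem w hz.1, inj_apply_of_mem w hz.2],
    discreteEnergy, ← mul_assoc, ← mul_assoc]
  congr 2
  · field_simp
  · field_simp

/-- The comparison of the continuum minimizer with a discrete one. -/
theorem integral_sq_inj_sub_le {n : ℕ} (hn : 0 < n) (hlam : 0 < lam) (hp : 1 ≤ p) (hp2 : p ≤ 2)
    (hg : MemLp g 2 leb) (hK : AEMeasurable K leb2) (hK0 : ∀ᵐ z ∂leb2, 0 ≤ K z)
    (hKM : ∀ᵐ z ∂leb2, |K z| ≤ M) (hu : IsContinuumMinimizer lam p g K u)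
    {γ : Fin n → ℝ} {W : Fin n → Fin n → ℝ} (hWM : ∀ i j, |W i j| ≤ M) {w : Fin n → ℝ}
    (hw : IsDiscreteMinimizer lam p γ W w) :
    ∫ x, (inj n w x - u x) ^ 2 ∂leb ≤ 16 * ∫ x, (g x - inj n γ x) ^ 2 ∂leb
      + 4 * lam * (∫ z, |K z - inj2 n W z| * |(|inj n w z.2 - inj n w z.1| ^ p
          - |inj n (proj n u) z.2 - inj n (proj n u) z.1| ^ p)| ∂leb2
        + M * ∫ z, |(|inj n (proj n u) z.2 - inj n (proj n u) z.1| ^ p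
          - |u z.2 - u z.1| ^ p)| ∂leb2) := by
  have hp0 : 0 < p := by linarith
  have hv := memLp_inj n w 2
  have hwb := memLp_inj n (proj n u) 2
  have hγ := memLp_inj n γ 2
  set v := inj n w with hvdef
  set b := inj n (proj n u) with hbdef
  have hgap := integral_sq_sub_le_of_minimizer hlam hp hp2 hg hK hK0 hKM hu hv
  have hdisc := hw (proj n u)
  rw [discreteEnergy_eq_integral hn, discreteEnergy_eq_integral hn] at hdisc
  -- Projecting `u` and the step data together is a contraction in `L²`, so replacing `u` by its
  -- projection does not raise the step data term.
  have hproj : ∫ x, (b x - inj n γ x) ^ 2 ∂leb ≤ ∫ x, (u x - inj n γ x) ^ 2 ∂leb := by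
    have h1 := mean_sq_proj_le hn (f := fun x => u x - inj n γ x) (hu.1.sub hγ)
    simp_rw [proj_sub_inj hu.1 γ] at h1
    rwa [integral_leb_of_cells hn (c := fun i => (proj n u i - γ i) ^ 2) fun i x hx => by
      rw [hbdef, inj_apply_of_mem _ hx, inj_apply_of_mem γ hx]]
  -- The difference of differences is linear in the data: it equals twice the product of `v - u`
  -- with the step data minus `g`. Young's inequality leaves a quarter of the square of `v - u`,
  -- small enough to be absorbed later.
  have hquad : (∫ x, (v x - g x) ^ 2 ∂leb - ∫ x, (u x - g x) ^ 2 ∂leb)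
      - (∫ x, (v x - inj n γ x) ^ 2 ∂leb - ∫ x, (u x - inj n γ x) ^ 2 ∂leb) ≤
      1 / 4 * ∫ x, (v x - u x) ^ 2 ∂leb + 4 * ∫ x, (g x - inj n γ x) ^ 2 ∂leb := by
    have i1 := (hv.sub hg).integrable_sq
    have i2 := (hu.1.sub hg).integrable_sq
    have i3 := (hv.sub hγ).integrable_sq
    have i4 := (hu.1.sub hγ).integrable_sq
    have i5 := (hv.sub hu.1).integrable_sq
    have i6 := (hg.sub hγ).integrable_sq
    simp only [Pi.sub_apply] at i1 i2 i3 i4 i5 i6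
    rw [← integral_sub i1 i2, ← integral_sub i3 i4, ← integral_sub (by exact i1.sub i2) (by exact i3.sub i4),
      ← integral_const_mul, ← integral_const_mul, ← integral_add (i5.const_mul _) (i6.const_mul _)]
    refine integral_mono ((i1.sub i2).sub (i3.sub i4)) ((i5.const_mul _).add (i6.const_mul _)) fun x => ?_
    simp only
    nlinarith [sq_nonneg (v x - u x + 4 * (g x - inj n γ x))]
  have hWae : ∀ᵐ z ∂leb2, |inj2 n W z| ≤ M := ae_leb2_of_cells hn fun i j z hz => by
    rw [inj2_apply_of_mem W hz]; exact hWM i j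
  have hWm : AEMeasurable (inj2 n W) leb2 := (measurable_inj2 W).aemeasurable
  have hreg : (∫ z, K z * |v z.2 - v z.1| ^ p ∂leb2 - ∫ z, K z * |u z.2 - u z.1| ^ p ∂leb2)
      - (∫ z, inj2 n W z * |v z.2 - v z.1| ^ p ∂leb2 - ∫ z, inj2 n W z * |b z.2 - b z.1| ^ p ∂leb2) ≤
      ∫ z, |K z - inj2 n W z| * |(|v z.2 - v z.1| ^ p - |b z.2 - b z.1| ^ p)| ∂leb2
        + M * ∫ z, |(|b z.2 - b z.1| ^ p - |u z.2 - u z.1| ^ p)| ∂leb2 := by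
    have i1 := integrable_mul_pairDiff_rpow hp hp2 hK hKM hv
    have i2 := integrable_mul_pairDiff_rpow hp hp2 hK hKM hu.1
    have i3 := integrable_mul_pairDiff_rpow hp hp2 hWm hWae hv
    have i4 := integrable_mul_pairDiff_rpow hp hp2 hWm hWae hwb
    have j1 := integrable_pairDiff_rpow hp hp2 hv
    have j2 := integrable_pairDiff_rpow hp hp2 hwb
    have j3 := integrable_pairDiff_rpow hp hp2 hu.1
    have i5 : Integrable (fun z : ℝ × ℝ => |K z - inj2 n W z| *
        |(|v z.2 - v z.1| ^ p - |b z.2 - b z.1| ^ p)|) leb2 := by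
      refine (j1.sub j2).abs.bdd_mul (c := M + M) (hK.sub hWm).abs.aestronglyMeasurable ?_
      filter_upwards [hKM, hWae] with z h1 h2
      simp only [Real.norm_eq_abs]
      rw [abs_abs]
      exact (abs_sub _ _).trans (add_le_add h1 h2)
    have i6 : Integrable (fun z : ℝ × ℝ => |(|b z.2 - b z.1| ^ p - |u z.2 - u z.1| ^ p)|) leb2 :=
      (j2.sub j3).abs
    rw [← integral_sub i1 i2, ← integral_sub i3 i4, ← integral_sub (by exact i1.sub i2) (by exact i3.sub i4),
      ← integral_const_mul, ← integral_add i5 (i6.const_mul _)]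
    refine integral_mono_ae ((i1.sub i2).sub (i3.sub i4)) (i5.add (i6.const_mul _)) ?_
    filter_upwards [hKM] with z hz
    set A := |v z.2 - v z.1| ^ p
    set B := |b z.2 - b z.1| ^ p
    set D := |u z.2 - u z.1| ^ p
    -- The kernel error multiplies `A - B`, the difference between the two step functions, instead
    -- of `A` and `B` separately. In the bounded case this makes it quadratic after Young's
    -- inequality.
    have e : K z * A - K z * D - (inj2 n W z * A - inj2 n W z * B) =
      (K z - inj2 n W z) * (A - B) + K z * (B - D) := by ring
    rw [e]
    refine add_le_add ((le_abs_self _).trans (abs_mul _ _).le) ((le_abs_self _).trans ?_)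
    rw [abs_mul]
    exact mul_le_mul_of_nonneg_right hz (abs_nonneg _)
  set I1 := ∫ z, |K z - inj2 n W z| * |(|v z.2 - v z.1| ^ p - |b z.2 - b z.1| ^ p)| ∂leb2 with hI1
  set I2 := ∫ z, |(|b z.2 - b z.1| ^ p - |u z.2 - u z.1| ^ p)| ∂leb2 with hI2
  have hM : 0 ≤ M := by
    obtain ⟨z, hz⟩ := hKM.exists
    exact (abs_nonneg _).trans hz
  have hI : 0 ≤ I1 + M * I2 := add_nonneg
    (integral_nonneg fun z => mul_nonneg (abs_nonneg _) (abs_nonneg _))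
    (mul_nonneg hM (integral_nonneg fun z => abs_nonneg _))
  have h1 := mul_le_mul_of_nonneg_left hquad (show 0 ≤ 1 / (2 * lam) by positivity)
  have h2 := mul_le_mul_of_nonneg_left hreg (show 0 ≤ 1 / (2 * p) by positivity)
  have h3 := mul_le_mul_of_nonneg_left hproj (show 0 ≤ 1 / (2 * lam) by positivity)
  have h4 : 1 / (2 * p) * (I1 + M * I2) ≤ 1 / 2 * (I1 + M * I2) := by
    refine mul_le_mul_of_nonneg_right ?_ hI
    exact one_div_le_one_div_of_le (by norm_num) (by linarith)
  unfold realEnergy at hgap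
  have h5 : 1 / (4 * lam) * ∫ x, (v x - u x) ^ 2 ∂leb ≤
      1 / (2 * lam) * (1 / 4 * ∫ x, (v x - u x) ^ 2 ∂leb + 4 * ∫ x, (g x - inj n γ x) ^ 2 ∂leb)
        + 1 / 2 * (I1 + M * I2) := by linarith
  have h6 := mul_le_mul_of_nonneg_left h5 (show 0 ≤ 8 * lam by positivity)
  have e1 : 8 * lam * (1 / (4 * lam) * ∫ x, (v x - u x) ^ 2 ∂leb) =
    2 * ∫ x, (v x - u x) ^ 2 ∂leb := by field_simp; ring
  have e2 : 8 * lam * (1 / (2 * lam) * (1 / 4 * ∫ x, (v x - u x) ^ 2 ∂leb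
      + 4 * ∫ x, (g x - inj n γ x) ^ 2 ∂leb) + 1 / 2 * (I1 + M * I2)) =
      ∫ x, (v x - u x) ^ 2 ∂leb + 16 * ∫ x, (g x - inj n γ x) ^ 2 ∂leb + 4 * lam * (I1 + M * I2) := by
    field_simp; ring
  rw [e1, e2] at h6
  linarith

end energy

/-! ### Hölder estimates and the deterministic error bound -/

/-- Bernoulli's inequality is the convexity of the power at the point of larger modulus. Keeping
both powers on the right makes the bound symmetric. -/
lemma abs_rpow_sub_abs_rpow_le {p : ℝ} (hp : 1 ≤ p) (a b : ℝ) :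
    |(|a| ^ p - |b| ^ p)| ≤ p * (|a - b| * (|a| ^ (p - 1) + |b| ^ (p - 1))) := by
  have key : ∀ a b : ℝ, |b| ≤ |a| → |a| ^ p - |b| ^ p ≤ p * (|a - b| * |a| ^ (p - 1)) := by
    intro a b hab
    rcases eq_or_lt_of_le (abs_nonneg a) with h | h
    · have hb : |b| = 0 := le_antisymm (by rw [h]; exact hab) (abs_nonneg _)
      rw [← h, hb]
      have : 0 ≤ (0 : ℝ) ^ (p - 1) := Real.rpow_nonneg le_rfl _
      have := mul_nonneg (by linarith : 0 ≤ p) (mul_nonneg (abs_nonneg (a - b)) this)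
      linarith
    · have h1 := one_add_mul_self_le_rpow_one_add (s := |b| / |a| - 1)
        (by have : 0 ≤ |b| / |a| := by positivity
            linarith) hp
      rw [show 1 + (|b| / |a| - 1) = |b| / |a| by ring, Real.div_rpow (abs_nonneg _) (abs_nonneg _),
        le_div_iff₀ (by positivity)] at h1
      have h2 : |a| ^ p = |a| * |a| ^ (p - 1) := by
        rw [← Real.rpow_one_add' (abs_nonneg _) (by linarith)]; congr 1; ring
      have h3 : (1 + p * (|b| / |a| - 1)) * |a| ^ p
          = |a| ^ p - p * ((|a| - |b|) * |a| ^ (p - 1)) := by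
        rw [h2]; field_simp; ring
      have h4 : (|a| - |b|) * |a| ^ (p - 1) ≤ |a - b| * |a| ^ (p - 1) :=
        mul_le_mul_of_nonneg_right (abs_sub_abs_le_abs_sub a b) (by positivity)
      have := mul_le_mul_of_nonneg_left h4 (by linarith : 0 ≤ p)
      linarith
  have ha : 0 ≤ p * (|a - b| * |a| ^ (p - 1)) := by positivity
  have hb : 0 ≤ p * (|a - b| * |b| ^ (p - 1)) := by positivity
  rcases le_total |b| |a| with h | h
  · have hm := Real.rpow_le_rpow (abs_nonneg _) h (by linarith : 0 ≤ p)
    rw [abs_of_nonneg (by linarith)]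
    have := key a b h
    linarith
  · have hm := Real.rpow_le_rpow (abs_nonneg _) h (by linarith : 0 ≤ p)
    rw [abs_of_nonpos (by linarith)]
    have := key b a h
    rw [abs_sub_comm] at this
    linarith

section holder
variable {α : Type*} [MeasurableSpace α] {μ : Measure α}

lemma norm'_eq_integral {r : ℝ} (hr : 0 < r) {f : α → ℝ} (hf : MemLp f (ENNReal.ofReal r) μ) :
    norm' μ (ENNReal.ofReal r) f = (∫ x, |f x| ^ r ∂μ) ^ (1 / r) := by
  rw [norm', hf.eLpNorm_eq_integral_rpow_norm (by simpa using hr) (by simp),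
    ENNReal.toReal_ofReal hr.le, ENNReal.toReal_ofReal, one_div]
  · rfl
  · exact Real.rpow_nonneg (integral_nonneg fun x => by positivity) _

lemma norm'_nonneg (r : ℝ≥0∞) (f : α → ℝ) : 0 ≤ norm' μ r f := ENNReal.toReal_nonneg

/-- Hölder's inequality with the second factor a power of a square integrable function. -/
lemma integral_abs_mul_abs_rpow_le {a r : ℝ} (ha : 0 ≤ a) (ha2 : a < 2) (hr : r = 2 / (2 - a))
    {e f : α → ℝ} (he : MemLp e (ENNReal.ofReal r) μ) (hf : MemLp f 2 μ) :
    ∫ x, |e x| * |f x| ^ a ∂μ ≤ norm' μ (ENNReal.ofReal r) e * (∫ x, f x ^ 2 ∂μ) ^ (a / 2) := by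
  have hr0 : 0 < r := by rw [hr]; exact div_pos (by norm_num) (by linarith)
  rw [norm'_eq_integral hr0 he]
  rcases eq_or_lt_of_le ha with h | h
  · subst h
    have : r = 1 := by rw [hr]; norm_num
    simp [this]
  · have hpq : r.HolderConjugate (2 / a) := by
      rw [Real.holderConjugate_iff]
      refine ⟨?_, ?_⟩
      · rw [hr, lt_div_iff₀ (by linarith)]; linarith
      · rw [hr]
        have : (2 - a) ≠ 0 := by linarith
        field_simp; ring
    have hf' : MemLp (fun x => |f x| ^ a) (ENNReal.ofReal (2 / a)) μ := by
      have := hf.norm_rpow_div (ENNReal.ofReal a)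
      simp only [ENNReal.toReal_ofReal ha, Real.norm_eq_abs] at this
      convert this using 1
      rw [ENNReal.ofReal_div_of_pos h]; simp
    have := integral_mul_le_Lp_mul_Lq_of_nonneg hpq (μ := μ) (f := fun x => |e x|)
      (g := fun x => |f x| ^ a) (ae_of_all _ fun x => abs_nonneg _)
      (ae_of_all _ fun x => by positivity) he.abs hf'
    refine this.trans (le_of_eq ?_)
    congr 2
    · refine integral_congr_ae (ae_of_all _ fun x => ?_)
      simp only
      rw [← Real.rpow_mul (abs_nonneg _), show a * (2 / a) = ((2 : ℕ) : ℝ) by field_simp; norm_num,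
        Real.rpow_natCast, sq_abs]
    · field_simp

lemma integrable_abs_mul_abs_rpow {a r : ℝ} (ha : 0 ≤ a) (ha2 : a < 2) (hr : r = 2 / (2 - a))
    {e f : α → ℝ} (he : MemLp e (ENNReal.ofReal r) μ) (hf : MemLp f 2 μ) :
    Integrable (fun x => |e x| * |f x| ^ a) μ := by
  rcases eq_or_lt_of_le ha with h | h
  · subst h
    have : r = 1 := by rw [hr]; norm_num
    subst this
    simp only [Real.rpow_zero, mul_one]
    rw [ENNReal.ofReal_one] at he
    exact (memLp_one_iff_integrable.1 he).abs
  · have hf' : MemLp (fun x => |f x| ^ a) (ENNReal.ofReal (2 / a)) μ := by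
      have := hf.norm_rpow_div (ENNReal.ofReal a)
      simp only [ENNReal.toReal_ofReal ha, Real.norm_eq_abs] at this
      convert this using 1
      rw [ENNReal.ofReal_div_of_pos h]; simp
    have hpq : r.HolderConjugate (2 / a) := by
      rw [Real.holderConjugate_iff]
      refine ⟨?_, ?_⟩
      · rw [hr, lt_div_iff₀ (by linarith)]; linarith
      · rw [hr]
        have : (2 - a) ≠ 0 := by linarith
        field_simp; ring
    have : (ENNReal.ofReal r).HolderConjugate (ENNReal.ofReal (2 / a)) := hpq.ennrealOfReal
    exact MemLp.integrable_mul he.abs hf'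

end holder

section deterministic
variable {lam p M : ℝ} {f g u v : ℝ → ℝ} {K : ℝ × ℝ → ℝ}

lemma integral_sq_pairDiff_le (hf : MemLp f 2 leb) :
    ∫ z, (f z.2 - f z.1) ^ 2 ∂leb2 ≤ 4 * ∫ x, f x ^ 2 ∂leb := by
  have i1 : Integrable (fun z : ℝ × ℝ => f z.1 ^ 2) leb2 :=
    (hf.comp_measurePreserving measurePreserving_fst_leb2).integrable_sq
  have i2 : Integrable (fun z : ℝ × ℝ => f z.2 ^ 2) leb2 :=
    (hf.comp_measurePreserving measurePreserving_snd_leb2).integrable_sq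
  have i3 := (memLp_pairDiff hf).integrable_sq
  have e1 : ∫ z, f z.1 ^ 2 ∂leb2 = ∫ x, f x ^ 2 ∂leb := by
    rw [leb2_eq_prod]; exact integral_fun_fst (μ := leb) (ν := leb) (fun x => f x ^ 2) |>.trans (by simp)
  have e2 : ∫ z, f z.2 ^ 2 ∂leb2 = ∫ x, f x ^ 2 ∂leb := by
    rw [leb2_eq_prod]; exact integral_fun_snd (μ := leb) (ν := leb) (fun x => f x ^ 2) |>.trans (by simp)
  calc ∫ z, (f z.2 - f z.1) ^ 2 ∂leb2 ≤ ∫ z, (2 * f z.1 ^ 2 + 2 * f z.2 ^ 2) ∂leb2 := by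
        refine integral_mono i3 ((i1.const_mul 2).add (i2.const_mul 2)) fun z => ?_
        simp only
        nlinarith [sq_nonneg (f z.2 + f z.1)]
    _ = 4 * ∫ x, f x ^ 2 ∂leb := by
        rw [integral_add (i1.const_mul 2) (i2.const_mul 2), integral_const_mul, integral_const_mul,
          e1, e2]; ring

lemma norm'_pairDiff_le {r : ℝ≥0∞} (hr : 1 ≤ r) (hf : MemLp f r leb) :
    norm' leb2 r (fun z : ℝ × ℝ => f z.2 - f z.1) ≤ 2 * norm' leb r f := by
  have h1 := hf.comp_measurePreserving measurePreserving_fst_leb2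
  have h2 := hf.comp_measurePreserving measurePreserving_snd_leb2
  have h := eLpNorm_sub_le h2.1 h1.1 hr
  rw [eLpNorm_comp_measurePreserving hf.1 measurePreserving_fst_leb2,
    eLpNorm_comp_measurePreserving hf.1 measurePreserving_snd_leb2] at h
  have h3 := ENNReal.toReal_mono (ENNReal.add_ne_top.2 ⟨hf.2.ne, hf.2.ne⟩) h
  rw [ENNReal.toReal_add hf.2.ne hf.2.ne] at h3
  have h4 : norm' leb2 r (fun z : ℝ × ℝ => f z.2 - f z.1)
      = (eLpNorm ((f ∘ Prod.snd) - (f ∘ Prod.fst)) r leb2).toReal := rfl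
  rw [h4]
  unfold norm'
  linarith

lemma rpow_half_le_one_add {x a : ℝ} (hx : 0 ≤ x) (ha : 0 ≤ a) (ha2 : a ≤ 2) :
    x ^ (a / 2) ≤ 1 + x := by
  calc x ^ (a / 2) ≤ (1 + x) ^ (a / 2) := by gcongr; linarith
    _ ≤ (1 + x) ^ (1 : ℝ) := by
        apply Real.rpow_le_rpow_of_exponent_le <;> linarith
    _ = 1 + x := Real.rpow_one _

/-- The differences of square integrable functions, raised to the power `p`, lie in `L^(2/p)`, the
dual of `L^(p')`; this is why the kernel error is measured in `L^(p')`. -/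
lemma integral_abs_mul_pairDiff_rpow_sub_le (hp : p ∈ Ico (1 : ℝ) 2) {F : ℝ × ℝ → ℝ}
    (hF : MemLp F (ENNReal.ofReal (pExp p)) leb2) (hu : MemLp u 2 leb) (hv : MemLp v 2 leb) :
    ∫ z, |F z| * |(|u z.2 - u z.1| ^ p - |v z.2 - v z.1| ^ p)| ∂leb2 ≤
      norm' leb2 (ENNReal.ofReal (pExp p)) F *
        (2 + 4 * ∫ x, u x ^ 2 ∂leb + 4 * ∫ x, v x ^ 2 ∂leb) := by
  have hp0 : 0 ≤ p := by linarith [hp.1]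
  have key : ∀ w : ℝ → ℝ, MemLp w 2 leb → ∫ z, |F z| * |w z.2 - w z.1| ^ p ∂leb2 ≤
      norm' leb2 (ENNReal.ofReal (pExp p)) F * (1 + 4 * ∫ x, w x ^ 2 ∂leb) := by
    intro w hw
    refine (integral_abs_mul_abs_rpow_le hp0 hp.2 rfl hF (memLp_pairDiff hw)).trans ?_
    refine mul_le_mul_of_nonneg_left ?_ (norm'_nonneg _ _)
    have := integral_sq_pairDiff_le hw
    have h0 : 0 ≤ ∫ z, (w z.2 - w z.1) ^ 2 ∂leb2 := integral_nonneg fun z => sq_nonneg _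
    exact (rpow_half_le_one_add h0 hp0 hp.2.le).trans (by linarith)
  have iu := integrable_abs_mul_abs_rpow hp0 hp.2 rfl hF (memLp_pairDiff hu)
  have iv := integrable_abs_mul_abs_rpow hp0 hp.2 rfl hF (memLp_pairDiff hv)
  calc ∫ z, |F z| * |(|u z.2 - u z.1| ^ p - |v z.2 - v z.1| ^ p)| ∂leb2
      ≤ ∫ z, (|F z| * |u z.2 - u z.1| ^ p + |F z| * |v z.2 - v z.1| ^ p) ∂leb2 := by
        refine integral_mono_of_nonneg
          (ae_of_all _ fun z => mul_nonneg (abs_nonneg _) (abs_nonneg _)) (iu.add iv)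
          (ae_of_all _ fun z => ?_)
        simp only
        rw [← mul_add]
        refine mul_le_mul_of_nonneg_left ?_ (abs_nonneg _)
        have h1 : 0 ≤ |u z.2 - u z.1| ^ p := by positivity
        have h2 : 0 ≤ |v z.2 - v z.1| ^ p := by positivity
        rw [abs_le]
        constructor <;> linarith
    _ = _ := integral_add iu iv
    _ ≤ _ := by
        have h1 := key u hu
        have h2 := key v hv
        linarith

/-- The difference of powers contains one factor `u - v` and a power `p - 1` of a square integrable
function. The latter is dual to `L^r` with `r = 2/(3-p)`, which is `2/(2-a)` for `a = p - 1`. -/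
lemma integral_pairDiff_rpow_sub_le (hp : p ∈ Ico (1 : ℝ) 2) (hu : MemLp u 2 leb)
    (hv : MemLp v 2 leb) :
    ∫ z, |(|u z.2 - u z.1| ^ p - |v z.2 - v z.1| ^ p)| ∂leb2 ≤
      4 * norm' leb (ENNReal.ofReal (2 / (3 - p))) (fun x => u x - v x) *
        (2 + 4 * ∫ x, u x ^ 2 ∂leb + 4 * ∫ x, v x ^ 2 ∂leb) := by
  have hp1 : 0 ≤ p - 1 := by linarith [hp.1]
  have hp2 := hp.2
  have hr : 2 / (3 - p) = 2 / (2 - (p - 1)) := by congr 1; ring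
  have hr1 : 1 ≤ 2 / (3 - p) := by rw [le_div_iff₀ (by linarith)]; linarith [hp.1]
  have hr2 : 2 / (3 - p) ≤ 2 := by rw [div_le_iff₀ (by linarith)]; linarith
  set r := 2 / (3 - p) with hrdef
  have hr1' : 1 ≤ ENNReal.ofReal r := by simpa using hr1
  have hr2' : ENNReal.ofReal r ≤ 2 := by
    rw [show (2 : ℝ≥0∞) = ENNReal.ofReal 2 by simp]; exact ENNReal.ofReal_le_ofReal hr2
  have he0 : MemLp (fun x => u x - v x) (ENNReal.ofReal r) leb := (hu.sub hv).mono_exponent hr2'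
  have he := memLp_pairDiff he0
  have hN := norm'_pairDiff_le hr1' he0
  have hN0 := norm'_nonneg (μ := leb) (ENNReal.ofReal r) (fun x => u x - v x)
  have key : ∀ w : ℝ → ℝ, MemLp w 2 leb →
      ∫ z, |(u z.2 - v z.2) - (u z.1 - v z.1)| * |w z.2 - w z.1| ^ (p - 1) ∂leb2 ≤
      2 * norm' leb (ENNReal.ofReal r) (fun x => u x - v x) * (1 + 4 * ∫ x, w x ^ 2 ∂leb) := by
    intro w hw
    refine (integral_abs_mul_abs_rpow_le hp1 (by linarith) hr he (memLp_pairDiff hw)).trans ?_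
    have := integral_sq_pairDiff_le hw
    have h0 : 0 ≤ ∫ z, (w z.2 - w z.1) ^ 2 ∂leb2 := integral_nonneg fun z => sq_nonneg _
    exact mul_le_mul hN ((rpow_half_le_one_add h0 hp1 (by linarith)).trans (by linarith))
      (by positivity) (by positivity)
  have iu := integrable_abs_mul_abs_rpow hp1 (by linarith) hr he (memLp_pairDiff hu)
  have iv := integrable_abs_mul_abs_rpow hp1 (by linarith) hr he (memLp_pairDiff hv)
  calc ∫ z, |(|u z.2 - u z.1| ^ p - |v z.2 - v z.1| ^ p)| ∂leb2
      ≤ ∫ z, p * (|(u z.2 - v z.2) - (u z.1 - v z.1)| * |u z.2 - u z.1| ^ (p - 1)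
          + |(u z.2 - v z.2) - (u z.1 - v z.1)| * |v z.2 - v z.1| ^ (p - 1)) ∂leb2 := by
        refine integral_mono_of_nonneg (ae_of_all _ fun z => abs_nonneg _)
          ((iu.add iv).const_mul p) (ae_of_all _ fun z => ?_)
        simp only
        have := abs_rpow_sub_abs_rpow_le hp.1 (u z.2 - u z.1) (v z.2 - v z.1)
        rw [show u z.2 - u z.1 - (v z.2 - v z.1) = (u z.2 - v z.2) - (u z.1 - v z.1) by ring,
          mul_add] at this
        exact this
    _ = p * (_ + _) := by rw [integral_const_mul, integral_add iu iv]
    _ ≤ 2 * (2 * norm' leb (ENNReal.ofReal r) (fun x => u x - v x) * (1 + 4 * ∫ x, u x ^ 2 ∂leb)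
          + 2 * norm' leb (ENNReal.ofReal r) (fun x => u x - v x) * (1 + 4 * ∫ x, v x ^ 2 ∂leb)) := by
        have h1 := key u hu
        have h2 := key v hv
        have i0 : 0 ≤ ∫ z, |(u z.2 - v z.2) - (u z.1 - v z.1)| * |u z.2 - u z.1| ^ (p - 1) ∂leb2 :=
          integral_nonneg fun z => by positivity
        have i1 : 0 ≤ ∫ z, |(u z.2 - v z.2) - (u z.1 - v z.1)| * |v z.2 - v z.1| ^ (p - 1) ∂leb2 :=
          integral_nonneg fun z => by positivity
        exact mul_le_mul hp2.le (add_le_add h1 h2) (add_nonneg i0 i1) (by norm_num)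
    _ = _ := by ring

lemma integral_sq_inj {n : ℕ} (hn : 0 < n) (w : Fin n → ℝ) :
    ∫ x, inj n w x ^ 2 ∂leb = 1 / n * ∑ i, w i ^ 2 :=
  integral_leb_of_cells hn fun i x hx => by rw [inj_apply_of_mem w hx]

lemma integral_sq_inj_sub_inj {n : ℕ} (hn : 0 < n) (w w' : Fin n → ℝ) :
    ∫ x, (inj n w x - inj n w' x) ^ 2 ∂leb = 1 / n * ∑ i, (w i - w' i) ^ 2 :=
  integral_leb_of_cells hn fun i x hx => by rw [inj_apply_of_mem w hx, inj_apply_of_mem w' hx]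

/-- Comparison with the zero vector, whose regularizer vanishes. -/
lemma mean_sq_le_of_isDiscreteMinimizer {n : ℕ} (hn : 0 < n) (hlam : 0 < lam) (hp : 0 < p)
    {γ : Fin n → ℝ} {W : Fin n → Fin n → ℝ} (hW : ∀ i j, i ≠ j → 0 ≤ W i j) {w : Fin n → ℝ}
    (hw : IsDiscreteMinimizer lam p γ W w) :
    1 / (n : ℝ) * ∑ i, w i ^ 2 ≤ 4 * (1 / (n : ℝ) * ∑ i, γ i ^ 2) := by
  have hn' : (0 : ℝ) < n := by exact_mod_cast hn
  have h := hw 0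
  unfold discreteEnergy at h
  have h1 : 0 ≤ ∑ i, ∑ j, W i j * |w j - w i| ^ p :=
    Finset.sum_nonneg fun i _ => Finset.sum_nonneg fun j _ => by
      by_cases hij : i = j
      · subst hij; simp [Real.zero_rpow hp.ne']
      · exact mul_nonneg (hW i j hij) (by positivity)
  have h2 : 0 ≤ 1 / (2 * p * (n : ℝ) ^ 2) * ∑ i, ∑ j, W i j * |w j - w i| ^ p := by positivity
  simp only [Pi.zero_apply, sub_self, abs_zero, Real.zero_rpow hp.ne', mul_zero,
    Finset.sum_const_zero, add_zero, zero_sub, neg_sq] at h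
  have h3 : ∑ i, (w i - γ i) ^ 2 ≤ ∑ i, γ i ^ 2 := by
    have : 1 / (2 * lam * n) * ∑ i, (w i - γ i) ^ 2 ≤ 1 / (2 * lam * n) * ∑ i, γ i ^ 2 := by linarith
    exact le_of_mul_le_mul_left this (by positivity)
  have h4 : ∑ i, w i ^ 2 ≤ 2 * ∑ i, (w i - γ i) ^ 2 + 2 * ∑ i, γ i ^ 2 := by
    rw [Finset.mul_sum, Finset.mul_sum, ← Finset.sum_add_distrib]
    refine Finset.sum_le_sum fun i _ => ?_
    nlinarith [sq_nonneg (w i - 2 * γ i)]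
  have : 1 / (n : ℝ) * ∑ i, w i ^ 2 ≤ 1 / (n : ℝ) * (4 * ∑ i, γ i ^ 2) :=
    mul_le_mul_of_nonneg_left (by linarith) (by positivity)
  linarith

lemma exists_isDiscreteMinimizer {n : ℕ} (hlam : 0 < lam) (hp : 0 < p) (γ : Fin n → ℝ)
    {W : Fin n → Fin n → ℝ} (hW : ∀ i j, 0 ≤ W i j) {G : ℝ} (hG : 0 ≤ G) (hγ : ∀ i, |γ i| ≤ G) :
    ∃ w, (∀ i, |w i| ≤ G) ∧ IsDiscreteMinimizer lam p γ W w :=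
  exists_profileEnergy_minimizer hlam hp
    (continuous_abs.rpow_const fun _ => Or.inr hp.le)
    (fun _ _ h => Real.rpow_le_rpow (abs_nonneg _) h hp.le) hW hG hγ

lemma mean_sq_le_integral {n : ℕ} (hn : 0 < n) (hg : MemLp g 2 leb) (γ : Fin n → ℝ) :
    1 / (n : ℝ) * ∑ i, γ i ^ 2 ≤ 2 * ∫ x, g x ^ 2 ∂leb + 2 * ∫ x, (g x - inj n γ x) ^ 2 ∂leb := by
  rw [← integral_sq_inj hn]
  have i1 := hg.integrable_sq
  have i2 : Integrable (fun x => (g x - inj n γ x) ^ 2) leb := (hg.sub (memLp_inj n γ 2)).integrable_sq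
  have i3 := (memLp_inj n γ 2).integrable_sq
  rw [← integral_const_mul, ← integral_const_mul, ← integral_add (i1.const_mul 2) (i2.const_mul 2)]
  refine integral_mono i3 ((i1.const_mul 2).add (i2.const_mul 2)) fun x => ?_
  simp only
  nlinarith [sq_nonneg (g x + (g x - inj n γ x))]

lemma integral_sq_sub_le_add {f g h : ℝ → ℝ} (hf : MemLp f 2 leb) (hg : MemLp g 2 leb)
    (hh : MemLp h 2 leb) :
    ∫ x, (f x - h x) ^ 2 ∂leb ≤ 2 * ∫ x, (f x - g x) ^ 2 ∂leb + 2 * ∫ x, (g x - h x) ^ 2 ∂leb := by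
  have i1 : Integrable (fun x => (f x - g x) ^ 2) leb := (hf.sub hg).integrable_sq
  have i2 : Integrable (fun x => (g x - h x) ^ 2) leb := (hg.sub hh).integrable_sq
  have i3 : Integrable (fun x => (f x - h x) ^ 2) leb := (hf.sub hh).integrable_sq
  rw [← integral_const_mul, ← integral_const_mul, ← integral_add (i1.const_mul 2) (i2.const_mul 2)]
  refine integral_mono i3 ((i1.const_mul 2).add (i2.const_mul 2)) fun x => ?_
  simp only
  nlinarith [sq_nonneg ((f x - g x) - (g x - h x))]

end deterministic

/-! ### The general error bound -/

section general
variable {lam p M : ℝ} {g u : ℝ → ℝ} {K : ℝ × ℝ → ℝ}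

/-- Needed for the a priori bound on the random minimizer, which requires nonnegative weights off
the diagonal. -/
lemma NonlocalVariational.IsRandomGraph.ae_edges_nonneg {n : ℕ} {q : ℝ} {Ω : Type*}
    [MeasurableSpace Ω] {P : Measure Ω} {X : Fin n → Ω → ℝ} {Υ : Fin n → Fin n → Ω → ℝ}
    (hG : IsRandomGraph P n q K X Υ) (hq : 0 < q) (hK0 : ∀ᵐ z ∂leb2, 0 ≤ K z) :
    ∀ᵐ ω ∂P, ∀ i j, i ≠ j → 0 ≤ Υ i j ω := by
  have key : ∀ e : OffDiag n, ∀ᵐ ω ∂P, 0 ≤ Υ e.1.1 e.1.2 ω := by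
    intro e
    have hS : MeasurableSet {y : (Fin n → ℝ) × (OffDiag n → ℝ) | y.2 e < 0} :=
      measurableSet_lt ((measurable_pi_apply e).comp measurable_snd) measurable_const
    have h := hG.edges_given_nodes _ hS
    have h0 : ∫⁻ ω, edgeLaw q K (fun k => X k ω)
        {υ | ((fun k => X k ω), υ) ∈ {y : (Fin n → ℝ) × (OffDiag n → ℝ) | y.2 e < 0}} ∂P = 0 := by
      rw [← lintegral_zero (μ := P)]
      refine lintegral_congr_ae ?_
      filter_upwards [hG.ae_nodes_mem] with ω hX
      have hprob : ∀ e : OffDiag n, IsProbabilityMeasure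
          (scaledBernoulli q (nodeKernel q K (fun k => X k ω) e.1.1 e.1.2)) := fun e =>
        isProbabilityMeasure_scaledBernoulli hq (nodeKernel_nonneg hK0 hq hX _ _)
          (nodeKernel_le_inv _ _ _ _ _)
      have hev : MeasurePreserving (Function.eval e) (edgeLaw q K fun k => X k ω) _ :=
        measurePreserving_eval _ e
      have := hev.quasiMeasurePreserving.ae (ae_scaledBernoulli q _)
      refine measure_mono_null ?_ this
      intro υ hυ
      have hυ' : υ e < 0 := hυ
      have hq' : 0 < 1 / q := by positivity
      intro hc
      rcases hc with hc | hc <;> rw [Function.eval] at hc <;> linarith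
    rw [h0] at h
    rw [ae_iff]
    convert h using 3
    ext ω
    simp
  filter_upwards [ae_all_iff.2 key] with ω hω i j hij
  exact hω ⟨(i, j), hij⟩

/-- The trivial bound for the distance of a discrete to the continuum minimizer. -/
lemma integral_sq_inj_sub_le_trivial {n : ℕ} (hn : 0 < n) (hlam : 0 < lam) (hp : 0 < p)
    (hg : MemLp g 2 leb) (hu : MemLp u 2 leb) {γ : Fin n → ℝ} {W : Fin n → Fin n → ℝ}
    (hW : ∀ i j, i ≠ j → 0 ≤ W i j) {w : Fin n → ℝ} (hw : IsDiscreteMinimizer lam p γ W w) :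
    ∫ x, (inj n w x - u x) ^ 2 ∂leb ≤ 16 * ∫ x, g x ^ 2 ∂leb
      + 16 * ∫ x, (g x - inj n γ x) ^ 2 ∂leb + 2 * ∫ x, u x ^ 2 ∂leb := by
  have h1 := mean_sq_le_of_isDiscreteMinimizer hn hlam hp hW hw
  have h2 := mean_sq_le_integral hn hg γ
  have h3 := integral_sq_sub_le_add (memLp_inj n w 2) (MemLp.zero (μ := leb) (p := 2)) hu
  simp only [Pi.zero_apply, sub_zero, zero_sub, neg_sq] at h3
  rw [integral_sq_inj hn] at h3
  linarith

lemma integral_sq_inj_proj_le {n : ℕ} (hn : 0 < n) (hu : MemLp u 2 leb) :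
    ∫ x, inj n (proj n u) x ^ 2 ∂leb ≤ ∫ x, u x ^ 2 ∂leb := by
  rw [integral_sq_inj hn]; exact mean_sq_proj_le hn hu

/-- The error of the minimizer for the averaged kernel. -/
lemma integral_sq_inj_sub_le_norms {n : ℕ} (hn : 0 < n) (hlam : 0 < lam) (hp : p ∈ Ico (1 : ℝ) 2)
    (hg : MemLp g 2 leb) (hK : AEMeasurable K leb2) (hK0 : ∀ᵐ z ∂leb2, 0 ≤ K z)
    (hM : 0 ≤ M) (hKM : ∀ᵐ z ∂leb2, |K z| ≤ M) (hu : IsContinuumMinimizer lam p g K u)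
    {γ : Fin n → ℝ} {W : Fin n → Fin n → ℝ} (hW0 : ∀ i j, 0 ≤ W i j) (hWM : ∀ i j, W i j ≤ M)
    (hY : ∫ x, (g x - inj n γ x) ^ 2 ∂leb ≤ 1)
    {w : Fin n → ℝ} (hw : IsDiscreteMinimizer lam p γ W w) :
    ∫ x, (inj n w x - u x) ^ 2 ∂leb ≤ 16 * ∫ x, (g x - inj n γ x) ^ 2 ∂leb
      + 4 * lam * (34 + 32 * ∫ x, g x ^ 2 ∂leb + 8 * ∫ x, u x ^ 2 ∂leb) *
        (norm' leb2 (ENNReal.ofReal (pExp p)) (fun z => K z - inj2 n W z)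
          + 4 * M * norm' leb (ENNReal.ofReal (2 / (3 - p))) (fun x => u x - inj n (proj n u) x)) := by
  have hp0 : 0 < p := by linarith [hp.1]
  have h := integral_sq_inj_sub_le hn hlam hp.1 hp.2.le hg hK hK0 hKM hu
    (fun i j => by rw [abs_of_nonneg (hW0 i j)]; exact hWM i j) hw
  have hwb := memLp_inj n (proj n u) 2
  have hF : MemLp (fun z => K z - inj2 n W z) (ENNReal.ofReal (pExp p)) leb2 := by
    refine MemLp.of_bound (C := M + M) (hK.aestronglyMeasurable.sub
      (measurable_inj2 W).aestronglyMeasurable) ?_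
    have h2 : ∀ᵐ z ∂leb2, |inj2 n W z| ≤ M := ae_leb2_of_cells hn fun i j z hz => by
      rw [inj2_apply_of_mem W hz, abs_of_nonneg (hW0 i j)]; exact hWM i j
    filter_upwards [hKM, h2] with z h1 h2
    exact (abs_sub _ _).trans (add_le_add h1 h2)
  have hA := integral_abs_mul_pairDiff_rpow_sub_le hp hF (memLp_inj n w 2) hwb
  have hB := integral_pairDiff_rpow_sub_le hp hwb hu.1
  have e : norm' leb (ENNReal.ofReal (2 / (3 - p))) (fun x => inj n (proj n u) x - u x)
      = norm' leb (ENNReal.ofReal (2 / (3 - p))) (fun x => u x - inj n (proj n u) x) := by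
    unfold norm'
    rw [← eLpNorm_neg]
    congr 2
    ext x
    simp
  rw [e] at hB
  set NK := norm' leb2 (ENNReal.ofReal (pExp p)) (fun z => K z - inj2 n W z)
  set NU := norm' leb (ENNReal.ofReal (2 / (3 - p))) (fun x => u x - inj n (proj n u) x)
  have hNK : 0 ≤ NK := norm'_nonneg _ _
  have hNU : 0 ≤ NU := norm'_nonneg _ _
  have h1 := mean_sq_le_of_isDiscreteMinimizer hn hlam hp0 (fun i j _ => hW0 i j) hw
  have h2 := mean_sq_le_integral hn hg γ
  have h3 := integral_sq_inj_proj_le hn hu.1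
  rw [integral_sq_inj hn] at hA
  have hg0 : 0 ≤ ∫ x, g x ^ 2 ∂leb := integral_nonneg fun x => sq_nonneg _
  have hu0 : 0 ≤ ∫ x, u x ^ 2 ∂leb := integral_nonneg fun x => sq_nonneg _
  set D := 34 + 32 * ∫ x, g x ^ 2 ∂leb + 8 * ∫ x, u x ^ 2 ∂leb with hD
  have hA' := hA.trans (mul_le_mul_of_nonneg_left (show _ ≤ D by rw [hD]; linarith) hNK)
  have hB' := hB.trans (mul_le_mul_of_nonneg_left (show _ ≤ D by rw [hD]; linarith)
    (by positivity : 0 ≤ 4 * NU))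
  have hB'' := mul_le_mul_of_nonneg_left hB' hM
  refine h.trans (add_le_add le_rfl ?_)
  rw [mul_assoc (4 * lam)]
  refine mul_le_mul_of_nonneg_left ?_ (by positivity)
  refine (add_le_add hA' hB'').trans (le_of_eq ?_)
  ring

end general

/-- Passing from the minimizer of the random energy to that for the averaged kernel. -/
theorem measure_error_gt_le {p : ℝ} (hp : p ∈ Ico (1 : ℝ) 2) {lam : ℝ} (hlam : 0 < lam)
    {g : ℝ → ℝ} (hg : MemLp g 2 leb)
    {K : ℝ × ℝ → ℝ} (hK : AEMeasurable K leb2) {M : ℝ} (hM : 0 ≤ M)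
    (h0 : ∀ᵐ z ∂leb2, 0 ≤ K z) (h1 : ∀ᵐ z ∂leb2, K z ≤ M)
    {q : ℕ → ℝ} (hq_pos : ∀ n, 0 < n → 0 < q n) (hq_bdd : ∃ Q : ℝ, ∀ n, 0 < n → q n ≤ Q)
    {u : ℝ → ℝ} (hu : MemLp u 2 leb) :
    ∃ C > 0, ∃ C₁ > 0, ∀ n : ℕ, 0 < n →
      ∀ (Ω : Type*) [MeasurableSpace Ω] (P : Measure Ω) [IsProbabilityMeasure P]
        (X : Fin n → Ω → ℝ) (Υ : Fin n → Fin n → Ω → ℝ), IsRandomGraph P n (q n) K X Υ →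
      ∀ un : Ω → Fin n → ℝ,
        (∀ᵐ ω ∂P, IsDiscreteMinimizer lam p (nodeData g (fun k => X k ω))
          (fun i j => Υ i j ω) (un ω)) →
      ∀ β : ℝ, 0 < β →
        P {ω | ¬ ∀ u0, IsDiscreteMinimizer lam p (nodeData g (fun k => X k ω))
            (nodeKernel (q n) K (fun k => X k ω)) u0 →
            ∫ x, (inj n (un ω) x - u x) ^ 2 ∂leb ≤
              C * (noiseRate p (q n) β n
                + ∫ x, (g x - inj n (nodeData g (fun k => X k ω)) x) ^ 2 ∂leb)
              + 2 * ∫ x, (inj n u0 x - u x) ^ 2 ∂leb} ≤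
        ENNReal.ofReal (failProb p (q n) β C₁ n) := by
  have hg0 : 0 ≤ ∫ x, g x ^ 2 ∂leb := integral_nonneg fun x => sq_nonneg _
  have hu0 : 0 ≤ ∫ x, u x ^ 2 ∂leb := integral_nonneg fun x => sq_nonneg _
  have hp0 : 0 < p := by linarith [hp.1]
  obtain ⟨C, hC, C₁, hC₁, hmain⟩ := measure_noise_gt_le hp hlam hg.1.aemeasurable hK hM h0 h1
    hq_pos hq_bdd (Γ := 2 * ∫ x, g x ^ 2 ∂leb + 2) (by positivity)
  -- `T` bounds the squared error whenever the data error `Y` is at most one. With `T` inside the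
  -- constant, the estimate is automatic as soon as `Y` or the noise rate exceeds one.
  set T := 16 * ∫ x, g x ^ 2 ∂leb + 16 + 2 * ∫ x, u x ^ 2 ∂leb with hT
  refine ⟨2 * C + T, by positivity, C₁, hC₁, ?_⟩
  intro n hn Ω _ P _ X Υ hG un hun β hβ
  refine le_trans (measure_mono_ae ?_) (hmain n hn Ω P X Υ hG un hun β hβ)
  filter_upwards [hun, hG.ae_edges_nonneg (hq_pos n hn) h0] with ω hω hΥ hbad
  have hbad' := hbad
  change ¬ _ at hbad'
  push Not at hbad'
  obtain ⟨u0, hu0min, hlt⟩ := hbad'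
  have hnoise := noiseRate_pos (p := p) (hq_pos n hn) hβ hn
  have htriv := integral_sq_inj_sub_le_trivial hn hlam hp0 hg hu hΥ hω
  have hI : 0 ≤ ∫ x, (inj n u0 x - u x) ^ 2 ∂leb := integral_nonneg fun x => sq_nonneg _
  set Y := ∫ x, (g x - inj n (nodeData g (fun k => X k ω)) x) ^ 2 ∂leb with hYdef
  have hY0 : 0 ≤ Y := integral_nonneg fun x => sq_nonneg _
  have hY1 : Y ≤ 1 := by
    by_contra hY
    push Not at hY
    have : T ≤ T * Y := le_mul_of_one_le_right (by positivity) hY.le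
    have e2 : 16 * ∫ x, g x ^ 2 ∂leb + 16 * Y + 2 * ∫ x, u x ^ 2 ∂leb ≤ T * Y := by
      rw [hT]; nlinarith
    have e3 : T * Y ≤ (2 * C + T) * (noiseRate p (q n) β n + Y) := by
      have : 0 ≤ 2 * C * (noiseRate p (q n) β n + Y) + T * noiseRate p (q n) β n := by positivity
      linarith
    linarith
  have htT : ∫ x, (inj n (un ω) x - u x) ^ 2 ∂leb ≤ T := by rw [hT]; linarith
  -- If this failed, the noise rate would be at least one and the a priori bound would already give
  -- the estimate.
  have hx1 : β * (Real.log n / n) ≤ 1 := by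
    by_contra hx
    push Not at hx
    have hτ := le_noiseRate hp (hq_pos n hn) hβ hn
    rw [min_eq_left hx.le] at hτ
    have : T ≤ T * noiseRate p (q n) β n := le_mul_of_one_le_right (by positivity) hτ
    have : 0 ≤ 2 * C * (noiseRate p (q n) β n + Y) + T * Y := by positivity
    linarith
  refine ⟨?_, hx1, u0, hu0min, ?_⟩
  · have := mean_sq_le_integral hn hg (nodeData g (fun k => X k ω))
    linarith
  · by_contra hle
    push Not at hle
    have h3 := integral_sq_sub_le_add (memLp_inj n (un ω) 2) (memLp_inj n u0 2) hu
    rw [integral_sq_inj_sub_inj hn] at h3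
    have : 0 ≤ (2 * C + T) * Y + T * noiseRate p (q n) β n := by positivity
    linarith

/-- The general error bound. -/
theorem withProbAtLeast_error_le {p : ℝ} (hp : p ∈ Ico (1 : ℝ) 2) {lam : ℝ} (hlam : 0 < lam)
    {g : ℝ → ℝ} (hg : MemLp g 2 leb)
    {K : ℝ × ℝ → ℝ} (hK : AEMeasurable K leb2) {M : ℝ} (hM : 0 ≤ M)
    (h0 : ∀ᵐ z ∂leb2, 0 ≤ K z) (h1 : ∀ᵐ z ∂leb2, K z ≤ M)
    {q : ℕ → ℝ} (hq_pos : ∀ n, 0 < n → 0 < q n) (hq_bdd : ∃ Q : ℝ, ∀ n, 0 < n → q n ≤ Q)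
    {u : ℝ → ℝ} (hu : IsContinuumMinimizer lam p g K u) :
    ∃ C > 0, ∃ C₁ > 0, ∀ n : ℕ, 0 < n →
      ∀ (Ω : Type*) [MeasurableSpace Ω] (P : Measure Ω) [IsProbabilityMeasure P]
        (X : Fin n → Ω → ℝ) (Υ : Fin n → Fin n → Ω → ℝ), IsRandomGraph P n (q n) K X Υ →
      ∀ un : Ω → Fin n → ℝ,
        (∀ᵐ ω ∂P, IsDiscreteMinimizer lam p (nodeData g (fun k => X k ω))
          (fun i j => Υ i j ω) (un ω)) →
      ∀ β : ℝ, 0 < β →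
        WithProbAtLeast P (1 - failProb p (q n) β C₁ n)
          {ω | norm' leb 2 (fun x => inj n (un ω) x - u x) ^ 2 ≤
            C * (noiseRate p (q n) β n
              + norm' leb 2 (fun x => g x - inj n (nodeData g (fun k => X k ω)) x) ^ 2
              + norm' leb 2 (fun x => g x - inj n (nodeData g (fun k => X k ω)) x)
              + norm' leb2 (ENNReal.ofReal (pExp p))
                  (fun z => K z - inj2 n (nodeKernel (q n) K (fun k => X k ω)) z)
              + norm' leb (ENNReal.ofReal (2 / (3 - p)))
                  (fun x => u x - inj n (proj n u) x))} := by
  have hg0 : 0 ≤ ∫ x, g x ^ 2 ∂leb := integral_nonneg fun x => sq_nonneg _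
  have hu0 : 0 ≤ ∫ x, u x ^ 2 ∂leb := integral_nonneg fun x => sq_nonneg _
  have hp0 : 0 < p := by linarith [hp.1]
  have hKM : ∀ᵐ z ∂leb2, |K z| ≤ M := by
    filter_upwards [h0, h1] with z h0 h1
    rwa [abs_of_nonneg h0]
  obtain ⟨C, hC, C₁, hC₁, hmain⟩ := measure_error_gt_le hp hlam hg hK hM h0 h1 hq_pos hq_bdd hu.1
  set T := 16 * ∫ x, g x ^ 2 ∂leb + 16 + 2 * ∫ x, u x ^ 2 ∂leb with hT
  set D := 34 + 32 * ∫ x, g x ^ 2 ∂leb + 8 * ∫ x, u x ^ 2 ∂leb with hD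
  have hD0 : 0 < D := by positivity
  -- The factor `2` comes from splitting the error through `u0`. The part `T` serves the case where
  -- the data error exceeds one, the rest is the constant of `integral_sq_inj_sub_le_norms`.
  set E := 2 * (T + 16 + 4 * lam * D * (1 + 4 * M)) with hE
  refine ⟨C + E, by positivity, C₁, hC₁, ?_⟩
  intro n hn Ω _ P _ X Υ hG un hun β hβ
  refine withProbAtLeast_of_compl_le (le_trans (measure_mono_ae ?_)
    (hmain n hn Ω P X Υ hG un hun β hβ)) (by unfold failProb; positivity)
  filter_upwards [hG.ae_nodes_mem] with ω hX hbad hgood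
  refine hbad ?_
  change norm' leb 2 (fun x => inj n (un ω) x - u x) ^ 2 ≤ _
  have hW0 := nodeKernel_nonneg h0 (hq_pos n hn) hX
  have hWM := nodeKernel_le hM hKM (q n) hX
  set γ := nodeData g (fun k => X k ω) with hγ
  set W := nodeKernel (q n) K (fun k => X k ω) with hW
  obtain ⟨u0, -, hmin⟩ := exists_isDiscreteMinimizer hlam hp0 γ hW0
    (G := ∑ i, |γ i|) (Finset.sum_nonneg fun i _ => abs_nonneg _)
    (fun i => Finset.single_le_sum (f := fun i => |γ i|) (fun i _ => abs_nonneg _) (Finset.mem_univ i))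
  have h2 := hgood u0 hmin
  rw [norm'_two_sq (f := fun x => inj n (un ω) x - u x) ((memLp_inj n _ 2).sub hu.1),
    norm'_two_sq (f := fun x => g x - inj n γ x) (hg.sub (memLp_inj n _ 2))]
  have hnoise := noiseRate_pos (p := p) (hq_pos n hn) hβ hn
  have hY0 : 0 ≤ ∫ x, (g x - inj n γ x) ^ 2 ∂leb := integral_nonneg fun x => sq_nonneg _
  have hY' := norm'_nonneg (μ := leb) 2 (fun x => g x - inj n γ x)
  have hNK := norm'_nonneg (μ := leb2) (ENNReal.ofReal (pExp p)) (fun z => K z - inj2 n W z)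
  have hNU := norm'_nonneg (μ := leb) (ENNReal.ofReal (2 / (3 - p)))
    (fun x => u x - inj n (proj n u) x)
  have key : 2 * ∫ x, (inj n u0 x - u x) ^ 2 ∂leb ≤ E * (∫ x, (g x - inj n γ x) ^ 2 ∂leb
      + norm' leb2 (ENNReal.ofReal (pExp p)) (fun z => K z - inj2 n W z)
      + norm' leb (ENNReal.ofReal (2 / (3 - p))) (fun x => u x - inj n (proj n u) x)) := by
    by_cases hY1 : ∫ x, (g x - inj n γ x) ^ 2 ∂leb ≤ 1
    · have h3 := integral_sq_inj_sub_le_norms hn hlam hp hg hK h0 hM hKM hu hW0 hWM hY1 hmin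
      rw [← hD] at h3
      set Y := ∫ x, (g x - inj n γ x) ^ 2 ∂leb
      set NK := norm' leb2 (ENNReal.ofReal (pExp p)) (fun z => K z - inj2 n W z)
      set NU := norm' leb (ENNReal.ofReal (2 / (3 - p))) (fun x => u x - inj n (proj n u) x)
      have e1 : 0 ≤ T * (Y + NK + NU) := by positivity
      have e2 : 0 ≤ 4 * lam * D * (1 + 4 * M) * Y := by positivity
      have e3 : 0 ≤ 4 * lam * D * (4 * M) * NK := by positivity
      have e4 : 0 ≤ 4 * lam * D * NU := by positivity
      rw [hE]
      linarith
    · push Not at hY1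
      have h3 := integral_sq_inj_sub_le_trivial hn hlam hp0 hg hu.1 (fun i j _ => hW0 i j) hmin
      set Y := ∫ x, (g x - inj n γ x) ^ 2 ∂leb
      set NK := norm' leb2 (ENNReal.ofReal (pExp p)) (fun z => K z - inj2 n W z)
      set NU := norm' leb (ENNReal.ofReal (2 / (3 - p))) (fun x => u x - inj n (proj n u) x)
      have e0 : 16 * ∫ x, g x ^ 2 ∂leb + 16 * Y + 2 * ∫ x, u x ^ 2 ∂leb ≤ T * Y := by
        rw [hT]; nlinarith
      have e1 : 0 ≤ (2 * (16 + 4 * lam * D * (1 + 4 * M))) * (Y + NK + NU) := by positivity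
      have e2 : 0 ≤ 2 * T * (NK + NU) := by positivity
      rw [hE]
      linarith
  have e1 : 0 ≤ C * (norm' leb 2 (fun x => g x - inj n γ x)
      + norm' leb2 (ENNReal.ofReal (pExp p)) (fun z => K z - inj2 n W z)
      + norm' leb (ENNReal.ofReal (2 / (3 - p))) (fun x => u x - inj n (proj n u) x)) := by positivity
  have e2 : 0 ≤ E * (noiseRate p (q n) β n + norm' leb 2 (fun x => g x - inj n γ x)) := by positivity
  linarith

/-! ### Boundedness and translates of the continuum minimizer -/

section regularity
variable {lam p M G : ℝ} {g u v : ℝ → ℝ} {K : ℝ × ℝ → ℝ}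

lemma ae_leb2_pair {φ ψ : ℝ → Prop} (h1 : ∀ᵐ x ∂leb, φ x) (h2 : ∀ᵐ y ∂leb, ψ y) :
    ∀ᵐ z ∂leb2, φ z.1 ∧ ψ z.2 :=
  (measurePreserving_fst_leb2.quasiMeasurePreserving.ae h1).and
    (measurePreserving_snd_leb2.quasiMeasurePreserving.ae h2)

lemma energy_congr (h : u =ᵐ[leb] v) : energy lam p g K u = energy lam p g K v := by
  unfold energy reg
  congr 2
  · congr 1
    refine eLpNorm_congr_ae ?_
    filter_upwards [h] with x hx
    rw [hx]
  · refine lintegral_congr_ae ?_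
    filter_upwards [ae_leb2_pair h h] with z hz
    rw [hz.1, hz.2]

lemma NonlocalVariational.IsContinuumMinimizer.congr (hu : IsContinuumMinimizer lam p g K u)
    (h : u =ᵐ[leb] v) : IsContinuumMinimizer lam p g K v :=
  ⟨(memLp_congr_ae h).1 hu.1, fun w hw => energy_congr (lam := lam) (p := p) (g := g) (K := K) h ▸ hu.2 w hw⟩

/-- Truncation at the bound of `g` raises neither term of the energy, so the truncated function is
again minimal; strong convexity then forces it to equal `u`. -/
lemma ae_abs_le_of_minimizer (hlam : 0 < lam) (hp : 1 ≤ p) (hp2 : p ≤ 2)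
    (hg : MemLp g 2 leb) (hK : AEMeasurable K leb2) (hK0 : ∀ᵐ z ∂leb2, 0 ≤ K z)
    (hKM : ∀ᵐ z ∂leb2, |K z| ≤ M) (hu : IsContinuumMinimizer lam p g K u)
    (hG : 0 ≤ G) (hgG : ∀ᵐ x ∂leb, |g x| ≤ G) : ∀ᵐ x ∂leb, |u x| ≤ G := by
  set v : ℝ → ℝ := fun x => max (-G) (min (u x) G) with hv
  have hvm : AEStronglyMeasurable v leb :=
    (aemeasurable_const.max (hu.1.1.aemeasurable.min aemeasurable_const)).aestronglyMeasurable
  have hvL : MemLp v 2 leb := MemLp.of_bound hvm G (ae_of_all _ fun x => abs_clamp_le hG _)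
  have h := integral_sq_sub_le_of_minimizer hlam hp hp2 hg hK hK0 hKM hu hvL
  have hle : realEnergy lam p g K v ≤ realEnergy lam p g K u := by
    unfold realEnergy
    refine add_le_add (mul_le_mul_of_nonneg_left ?_ (by positivity))
      (mul_le_mul_of_nonneg_left ?_ (by have : 0 < p := by linarith
                                        positivity))
    · refine integral_mono_ae (hvL.sub hg).integrable_sq (hu.1.sub hg).integrable_sq ?_
      filter_upwards [hgG] with x hx
      have := abs_clamp_sub_clamp_le G (u x) (g x)
      rw [clamp_eq_self hx] at this
      exact sq_le_sq.2 this
    · refine integral_mono_ae (integrable_mul_pairDiff_rpow hp hp2 hK hKM hvL)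
        (integrable_mul_pairDiff_rpow hp hp2 hK hKM hu.1) ?_
      filter_upwards [hK0] with z hz
      exact mul_le_mul_of_nonneg_left (Real.rpow_le_rpow (abs_nonneg _)
        (abs_clamp_sub_clamp_le G _ _) (by linarith)) hz
  have h0 : 0 ≤ ∫ x, (v x - u x) ^ 2 ∂leb := integral_nonneg fun x => sq_nonneg _
  have h1 : ∫ x, (v x - u x) ^ 2 ∂leb = 0 := by
    have : 1 / (4 * lam) * ∫ x, (v x - u x) ^ 2 ∂leb ≤ 1 / (4 * lam) * 0 := by linarith
    exact le_antisymm (le_of_mul_le_mul_left this (by positivity)) h0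
  have h2 := (integral_eq_zero_iff_of_nonneg (fun x => sq_nonneg _)
    (hvL.sub hu.1).integrable_sq).1 h1
  filter_upwards [h2] with x hx
  have : v x = u x := by
    have : (v x - u x) ^ 2 = 0 := hx
    have := pow_eq_zero_iff (two_ne_zero) |>.1 this
    linarith
  rw [← this]
  exact abs_clamp_le hG _

lemma exists_measurable_bounded_rep_leb (hu : AEMeasurable u leb) (hG : 0 ≤ G)
    (h : ∀ᵐ x ∂leb, |u x| ≤ G) :
    ∃ u' : ℝ → ℝ, Measurable u' ∧ u =ᵐ[leb] u' ∧ ∀ x, |u' x| ≤ G := by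
  refine ⟨fun x => max (-G) (min (hu.mk u x) G),
    measurable_const.max (hu.measurable_mk.min measurable_const), ?_, fun x => abs_clamp_le hG _⟩
  filter_upwards [h, hu.ae_eq_mk] with x hx hm
  rw [← hm, clamp_eq_self hx]

lemma abs_rpow_sub_le_of_bounded (hp : p ∈ Ico (1 : ℝ) 2) {G : ℝ} (hG : 0 ≤ G) {a b : ℝ}
    (ha : |a| ≤ 2 * G) (hb : |b| ≤ 2 * G) :
    |(|a| ^ p - |b| ^ p)| ≤ p * (2 * (1 + 2 * G)) * |a - b| := by
  have hp1 := hp.1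
  have hp2 := hp.2
  have key : ∀ c : ℝ, |c| ≤ 2 * G → |c| ^ (p - 1) ≤ 1 + 2 * G := by
    intro c hc
    calc |c| ^ (p - 1) ≤ (1 + 2 * G) ^ (p - 1) := by
          apply Real.rpow_le_rpow (abs_nonneg _) <;> linarith
      _ ≤ (1 + 2 * G) ^ (1 : ℝ) := by apply Real.rpow_le_rpow_of_exponent_le <;> linarith
      _ = _ := Real.rpow_one _
  refine (abs_rpow_sub_abs_rpow_le hp1 a b).trans ?_
  have := mul_le_mul_of_nonneg_left (add_le_add (key a ha) (key b hb)) (abs_nonneg (a - b))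
  calc p * (|a - b| * (|a| ^ (p - 1) + |b| ^ (p - 1)))
      ≤ p * (|a - b| * (1 + 2 * G + (1 + 2 * G))) :=
        mul_le_mul_of_nonneg_left this (by linarith)
    _ = _ := by ring

/-- The energy change of the regularizer under a perturbation supported on `A`,
away from `A ×ˢ A`. -/
lemma setIntegral_diff_prod_le (hp : p ∈ Ico (1 : ℝ) 2) (hG : 0 ≤ G) (hM : 0 ≤ M)
    (hK : AEMeasurable K leb2) (hKM : ∀ᵐ z ∂leb2, |K z| ≤ M)
    (hu : Measurable u) (hv : Measurable v) (huG : ∀ x, |u x| ≤ G) (hvG : ∀ x, |v x| ≤ G)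
    {A : Set ℝ} (hA : MeasurableSet A) (hAD : A ⊆ Icc 0 1) (huv : ∀ x, x ∉ A → v x = u x) :
    ∫ z in (Icc 0 1 ×ˢ Icc 0 1) \ (A ×ˢ A), K z * (|v z.2 - v z.1| ^ p - |u z.2 - u z.1| ^ p) ≤
      M * p * (4 * (1 + 2 * G)) * (volume.real (Icc 0 1 \ A) * ∫ x in A, |v x - u x|) := by
  have hp1 := hp.1
  set D : Set ℝ := Icc 0 1 with hD
  set e : ℝ → ℝ := fun x => |v x - u x| with he
  have hem : Measurable e := (hv.sub hu).abs
  have heb : ∀ x, |e x| ≤ 2 * G := fun x => by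
    rw [he]; simp only [abs_abs]
    have h1 := abs_le.1 (huG x)
    have h2 := abs_le.1 (hvG x)
    rw [abs_le]; constructor <;> linarith
  set c := M * p * (2 * (1 + 2 * G)) with hc
  have hc0 : 0 ≤ c := by positivity
  -- Off `A ×ˢ A` at least one coordinate lies outside `A`, where `v = u`. So only products of `|v -
  -- u|` in one variable with `χ` in the other survive, and the integral factorizes.
  set χ : ℝ → ℝ := (D \ A).indicator 1 with hχ
  have hχm : Measurable χ := measurable_one.indicator (measurableSet_Icc.diff hA)
  have hχb : ∀ x, |χ x| ≤ 1 := fun x => by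
    rw [hχ]; by_cases h : x ∈ D \ A <;> simp [h]
  have hχ0 : ∀ x, 0 ≤ χ x := fun x => by
    rw [hχ]; by_cases h : x ∈ D \ A <;> simp [h]
  have hint : Integrable (fun z : ℝ × ℝ => c * (e z.1 * χ z.2 + e z.2 * χ z.1)) leb2 := by
    refine Integrable.const_mul (Integrable.of_bound (C := 4 * G) ?_ (ae_of_all _ fun z => ?_)) c
    · exact (((hem.comp measurable_fst).mul (hχm.comp measurable_snd)).add
        ((hem.comp measurable_snd).mul (hχm.comp measurable_fst))).aestronglyMeasurable
    · have a1 : |e z.1 * χ z.2| ≤ 2 * G := by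
        rw [abs_mul]; calc _ ≤ 2 * G * 1 := mul_le_mul (heb _) (hχb _) (abs_nonneg _) (by positivity)
          _ = _ := by ring
      have a2 : |e z.2 * χ z.1| ≤ 2 * G := by
        rw [abs_mul]; calc _ ≤ 2 * G * 1 := mul_le_mul (heb _) (hχb _) (abs_nonneg _) (by positivity)
          _ = _ := by ring
      exact (abs_add_le _ _).trans (by linarith)
  have hsub : (D ×ˢ D) \ (A ×ˢ A) ⊆ D ×ˢ D := sdiff_subset
  have hint0 : Integrable (fun z : ℝ × ℝ => K z * (|v z.2 - v z.1| ^ p - |u z.2 - u z.1| ^ p)) leb2 := by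
    have hb : ∀ w : ℝ → ℝ, Measurable w → (∀ x, |w x| ≤ G) → MemLp w 2 leb := fun w hw hb =>
      MemLp.of_bound hw.aestronglyMeasurable G (ae_of_all _ hb)
    have := (integrable_mul_pairDiff_rpow hp.1 hp.2.le hK hKM (hb v hv hvG)).sub
      (integrable_mul_pairDiff_rpow hp.1 hp.2.le hK hKM (hb u hu huG))
    refine this.congr (ae_of_all _ fun z => ?_)
    simp only [Pi.sub_apply]; ring
  have hstep : ∫ z in (D ×ˢ D) \ (A ×ˢ A), K z * (|v z.2 - v z.1| ^ p - |u z.2 - u z.1| ^ p) ≤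
      ∫ z in (D ×ˢ D) \ (A ×ˢ A), c * (e z.1 * χ z.2 + e z.2 * χ z.1) := by
    refine integral_mono_ae (hint0.mono_measure (Measure.restrict_mono hsub le_rfl))
      (hint.mono_measure (Measure.restrict_mono hsub le_rfl)) ?_
    have hmem := ae_restrict_mem (μ := volume)
      ((measurableSet_Icc.prod measurableSet_Icc).diff (hA.prod hA) :
        MeasurableSet ((D ×ˢ D) \ (A ×ˢ A)))
    filter_upwards [ae_mono (Measure.restrict_mono hsub le_rfl) hKM, hmem] with z hKz hz
    have hd : ∀ w : ℝ → ℝ, (∀ x, |w x| ≤ G) → |w z.2 - w z.1| ≤ 2 * G := fun w hw => by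
      have h1 := abs_le.1 (hw z.1)
      have h2 := abs_le.1 (hw z.2)
      rw [abs_le]; constructor <;> linarith
    have h1 := abs_rpow_sub_le_of_bounded hp hG (hd v hvG) (hd u huG)
    have h2 : |v z.2 - v z.1 - (u z.2 - u z.1)| ≤ e z.1 * χ z.2 + e z.2 * χ z.1 := by
      have ezero : ∀ x, x ∉ A → e x = 0 := fun x hx => by rw [he]; simp [huv x hx]
      have e1 : |v z.2 - v z.1 - (u z.2 - u z.1)| ≤ e z.1 + e z.2 := by
        rw [show v z.2 - v z.1 - (u z.2 - u z.1) = (v z.2 - u z.2) - (v z.1 - u z.1) by ring]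
        exact (abs_sub _ _).trans (by rw [add_comm])
      by_cases hx : z.1 ∈ A
      · have hy : z.2 ∉ A := fun hy => hz.2 ⟨hx, hy⟩
        have : χ z.2 = 1 := by rw [hχ]; exact indicator_of_mem (show z.2 ∈ D \ A from ⟨hz.1.2, hy⟩) _
        rw [this, ezero _ hy]; rw [ezero _ hy] at e1; linarith
      · have : χ z.1 = 1 := by rw [hχ]; exact indicator_of_mem (show z.1 ∈ D \ A from ⟨hz.1.1, hx⟩) _
        rw [this, ezero _ hx]; rw [ezero _ hx] at e1; linarith
    calc K z * (|v z.2 - v z.1| ^ p - |u z.2 - u z.1| ^ p)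
        ≤ |K z| * |(|v z.2 - v z.1| ^ p - |u z.2 - u z.1| ^ p)| := by
          rw [← abs_mul]; exact le_abs_self _
      _ ≤ M * (p * (2 * (1 + 2 * G)) * (e z.1 * χ z.2 + e z.2 * χ z.1)) := by
          refine mul_le_mul hKz (h1.trans (mul_le_mul_of_nonneg_left h2 (by positivity)))
            (abs_nonneg _) hM
      _ = _ := by rw [hc]; ring
  refine hstep.trans ?_
  have hnn : ∀ z : ℝ × ℝ, 0 ≤ c * (e z.1 * χ z.2 + e z.2 * χ z.1) := fun z =>
    mul_nonneg hc0 (add_nonneg (mul_nonneg (abs_nonneg _) (hχ0 _)) (mul_nonneg (abs_nonneg _) (hχ0 _)))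
  refine (setIntegral_mono_set hint (ae_of_all _ hnn) (ae_of_all _ hsub)).trans (le_of_eq ?_)
  have i1 : Integrable (fun z : ℝ × ℝ => e z.1 * χ z.2) (leb.prod leb) :=
    Integrable.mul_prod (Integrable.of_bound hem.aestronglyMeasurable _ (ae_of_all _ heb))
      (Integrable.of_bound hχm.aestronglyMeasurable _ (ae_of_all _ hχb))
  have i2 : Integrable (fun z : ℝ × ℝ => e z.2 * χ z.1) (leb.prod leb) := i1.swap
  have e1 : ∫ z, e z.1 * χ z.2 ∂(leb.prod leb) = (∫ x, e x ∂leb) * ∫ y, χ y ∂leb :=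
    integral_prod_mul e χ
  have e2 : ∫ z, e z.2 * χ z.1 ∂(leb.prod leb) = (∫ x, e x ∂leb) * ∫ y, χ y ∂leb := by
    rw [← e1, ← integral_prod_swap]; rfl
  have e3 : ∫ y, χ y ∂leb = volume.real (D \ A) := by
    rw [hχ, integral_indicator_one (measurableSet_Icc.diff hA), measureReal_restrict_apply
      (measurableSet_Icc.diff hA), inter_eq_left.2 sdiff_subset]
  have e4 : ∫ x, e x ∂leb = ∫ x in A, e x := by
    refine (setIntegral_eq_of_subset_of_forall_sdiff_eq_zero measurableSet_Icc hAD ?_)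
    intro x hx
    rw [he]; simp [huv x hx.2]
  change ∫ z, c * (e z.1 * χ z.2 + e z.2 * χ z.1) ∂leb2 = _
  rw [leb2_eq_prod, integral_const_mul, integral_add i1 i2, e1, e2, e3, e4, hc]
  ring

end regularity

section translates
variable {lam p M G : ℝ} {g u v : ℝ → ℝ} {K : ℝ × ℝ → ℝ}

lemma setIntegral_comp_add_right {E : Type*} [NormedAddCommGroup E] [MeasureSpace E] [BorelSpace E]
    [SecondCountableTopology E]
    [(volume : Measure E).IsAddRightInvariant] (f : E → ℝ) (s : Set E) (h : E) :
    ∫ x in (fun x => x + h) ⁻¹' s, f (x + h) = ∫ x in s, f x :=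
  (measurePreserving_add_right volume h).setIntegral_preimage_emb
    (measurableEmbedding_addRight h) f s

/-- Half the difference of a function with its translate, cut off outside `A`, added to it. -/
noncomputable def halfShift (A : Set ℝ) (h : ℝ) (u : ℝ → ℝ) (x : ℝ) : ℝ :=
  u x + A.indicator (fun x => (u (x + h) - u x) / 2) x

lemma halfShift_of_mem {A : Set ℝ} {h x : ℝ} (hx : x ∈ A) :
    halfShift A h u x = (u x + u (x + h)) / 2 := by
  simp [halfShift, hx]; ring

lemma halfShift_of_notMem {A : Set ℝ} {h x : ℝ} (hx : x ∉ A) : halfShift A h u x = u x := by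
  simp [halfShift, hx]

lemma measurable_halfShift {A : Set ℝ} (hA : MeasurableSet A) (h : ℝ) (hu : Measurable u) :
    Measurable (halfShift A h u) :=
  hu.add ((((hu.comp (measurable_id.add_const h)).sub hu).div_const 2).indicator hA)

lemma abs_halfShift_le (A : Set ℝ) (h : ℝ) (huG : ∀ x, |u x| ≤ G) (x : ℝ) :
    |halfShift A h u x| ≤ G := by
  by_cases hx : x ∈ A
  · rw [halfShift_of_mem hx]
    have h1 := abs_le.1 (huG x)
    have h2 := abs_le.1 (huG (x + h))
    rw [abs_le]; constructor <;> linarith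
  · rw [halfShift_of_notMem hx]; exact huG x

lemma setIntegral_abs_halfShift {A : Set ℝ} (hA : MeasurableSet A) (h : ℝ) :
    ∫ x in A, |halfShift A h u x - u x| = 1 / 2 * ∫ x in A, |u (x + h) - u x| := by
  rw [← integral_const_mul]
  refine setIntegral_congr_fun hA fun x hx => ?_
  rw [halfShift_of_mem hx, show (u x + u (x + h)) / 2 - u x = 1 / 2 * (u (x + h) - u x) by ring,
    abs_mul, abs_of_pos (by norm_num : (0 : ℝ) < 1 / 2)]

/-- Translates of the continuum minimizer for a convolution kernel. -/
theorem setIntegral_sq_translate_sub_le (hlam : 0 < lam) (hp : p ∈ Ico (1 : ℝ) 2) (hG : 0 ≤ G)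
    (hM : 0 ≤ M) (hg : MemLp g 2 leb) (hK : AEMeasurable K leb2) (hK0 : ∀ᵐ z ∂leb2, 0 ≤ K z)
    (hKM : ∀ᵐ z ∂leb2, |K z| ≤ M) (hu : IsContinuumMinimizer lam p g K u)
    (hum : Measurable u) (huG : ∀ x, |u x| ≤ G) {J : ℝ → ℝ}
    (hKJ : ∀ x ∈ Icc (0 : ℝ) 1, ∀ y ∈ Icc (0 : ℝ) 1, K (x, y) = J |x - y|)
    {h : ℝ} (h0 : 0 < h) :
    ∫ x in Icc 0 (1 - h), (u (x + h) - u x) ^ 2 ≤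
      8 * (∫ x in Icc 0 (1 - h), (g (x + h) - g x) ^ 2)
        + 8 * (8 * lam * M * (1 + 2 * G)) ^ 2 * h ^ 2 := by
  rcases lt_or_ge 1 h with h1 | h1
  · rw [Icc_eq_empty (by linarith)]; simp only [Measure.restrict_empty, integral_zero_measure]; positivity
  have hp0 : 0 < p := by linarith [hp.1]
  set D : Set ℝ := Icc 0 1 with hD
  set A : Set ℝ := Icc 0 (1 - h) with hA
  set B : Set ℝ := Icc h 1 with hB
  have hAm : MeasurableSet A := measurableSet_Icc
  have hBm : MeasurableSet B := measurableSet_Icc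
  have hAD : A ⊆ D := Icc_subset_Icc le_rfl (by linarith)
  have hBD : B ⊆ D := Icc_subset_Icc h0.le le_rfl
  have hpre : (fun x : ℝ => x + h) ⁻¹' B = A := by
    ext x; simp only [hA, hB, mem_preimage, mem_Icc]; constructor <;> rintro ⟨_, _⟩ <;> constructor <;> linarith
  have hpre2 : (fun z : ℝ × ℝ => z + (h, h)) ⁻¹' (B ×ˢ B) = A ×ˢ A := by
    rw [← hpre]; rfl
  have hvol1 : volume.real (D \ A) = h := by
    rw [measureReal_sdiff hAD hAm measure_Icc_lt_top.ne, hD, hA, Real.volume_real_Icc_of_le (by norm_num),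
      Real.volume_real_Icc_of_le (by linarith)]; ring
  have hvol2 : volume.real (D \ B) = h := by
    rw [measureReal_sdiff hBD hBm measure_Icc_lt_top.ne, hD, hB, Real.volume_real_Icc_of_le (by norm_num),
      Real.volume_real_Icc_of_le (by linarith)]; ring
  -- `v1` moves `u` halfway to its forward translate and `v2` halfway to its backward translate. A
  -- single competitor would leave an uncontrolled linear term; in the sum of the two, this term
  -- becomes an increment of `u - g`.
  set v1 := halfShift A h u with hv1
  set v2 := halfShift B (-h) u with hv2
  have hv1m : Measurable v1 := measurable_halfShift hAm h hum
  have hv2m : Measurable v2 := measurable_halfShift hBm (-h) hum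
  have hv1G : ∀ x, |v1 x| ≤ G := abs_halfShift_le A h huG
  have hv2G : ∀ x, |v2 x| ≤ G := abs_halfShift_le B (-h) huG
  have hL : ∀ w : ℝ → ℝ, Measurable w → (∀ x, |w x| ≤ G) → MemLp w 2 leb := fun w hw hb =>
    MemLp.of_bound hw.aestronglyMeasurable G (ae_of_all _ hb)
  have hm1 := realEnergy_le_of_minimizer hlam hp.1 hp.2.le hg hK hK0 hKM hu (hL v1 hv1m hv1G)
  have hm2 := realEnergy_le_of_minimizer hlam hp.1 hp.2.le hg hK hK0 hKM hu (hL v2 hv2m hv2G)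
  unfold realEnergy at hm1 hm2
  set Δ := fun x => u (x + h) - u x with hΔ
  set Δg := fun x => g (x + h) - g x with hΔg
  -- the regularizer
  have iu := integrable_mul_pairDiff_rpow hp.1 hp.2.le hK hKM (hL u hum huG)
  have i1 := integrable_mul_pairDiff_rpow hp.1 hp.2.le hK hKM (hL v1 hv1m hv1G)
  have i2 := integrable_mul_pairDiff_rpow hp.1 hp.2.le hK hKM (hL v2 hv2m hv2G)
  set Φ1 := fun z : ℝ × ℝ => K z * (|v1 z.2 - v1 z.1| ^ p - |u z.2 - u z.1| ^ p) with hΦ1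
  set Φ2 := fun z : ℝ × ℝ => K z * (|v2 z.2 - v2 z.1| ^ p - |u z.2 - u z.1| ^ p) with hΦ2
  have j1 : Integrable Φ1 leb2 := (i1.sub iu).congr (ae_of_all _ fun z => by
    simp only [Pi.sub_apply, hΦ1]; ring)
  have j2 : Integrable Φ2 leb2 := (i2.sub iu).congr (ae_of_all _ fun z => by
    simp only [Pi.sub_apply, hΦ2]; ring)
  have r1 : ∫ z, Φ1 z ∂leb2 = ∫ z, K z * |v1 z.2 - v1 z.1| ^ p ∂leb2
      - ∫ z, K z * |u z.2 - u z.1| ^ p ∂leb2 := by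
    rw [← integral_sub i1 iu]; refine integral_congr_ae (ae_of_all _ fun z => ?_)
    simp only [hΦ1]; ring
  have r2 : ∫ z, Φ2 z ∂leb2 = ∫ z, K z * |v2 z.2 - v2 z.1| ^ p ∂leb2
      - ∫ z, K z * |u z.2 - u z.1| ^ p ∂leb2 := by
    rw [← integral_sub i2 iu]; refine integral_congr_ae (ae_of_all _ fun z => ?_)
    simp only [hΦ2]; ring
  have sAA : A ×ˢ A ⊆ D ×ˢ D := prod_mono hAD hAD
  have sBB : B ×ˢ B ⊆ D ×ˢ D := prod_mono hBD hBD
  have hsplit : ∀ (Φ : ℝ × ℝ → ℝ) (S : Set (ℝ × ℝ)), Integrable Φ leb2 → MeasurableSet S →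
      S ⊆ D ×ˢ D → ∫ z, Φ z ∂leb2 = (∫ z in S, Φ z) + ∫ z in (D ×ˢ D) \ S, Φ z := by
    intro Φ S hΦ hS hSD
    rw [setIntegral_sdiff hS hΦ hSD]; ring
  have hd1 := setIntegral_diff_prod_le hp hG hM hK hKM hum hv1m huG hv1G hAm hAD
    (fun x hx => halfShift_of_notMem hx)
  have hd2 := setIntegral_diff_prod_le hp hG hM hK hKM hum hv2m huG hv2G hBm hBD
    (fun x hx => halfShift_of_notMem hx)
  have hL2 : ∫ x in B, |u (x + -h) - u x| = ∫ x in A, |Δ x| := by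
    rw [← setIntegral_comp_add_right _ B h, hpre]
    refine integral_congr_ae (ae_of_all _ fun x => ?_)
    simp only [add_neg_cancel_right, hΔ]
    rw [abs_sub_comm]
  rw [hvol1, hv1, setIntegral_abs_halfShift hAm, ← hv1] at hd1
  rw [hvol2, hv2, setIntegral_abs_halfShift hBm, ← hv2, hL2] at hd2
  -- After the shift by `(h, h)`, under which the kernel is invariant, both competitors have the
  -- same differences at `z`: the average of the differences of `u` and of its translate. Convexity
  -- of `|t|^p` makes the sum nonpositive.
  have hin : (∫ z in A ×ˢ A, Φ1 z) + (∫ z in B ×ˢ B, Φ2 z) ≤ 0 := by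
    have k1 : IntegrableOn Φ1 (A ×ˢ A) := j1.mono_measure (Measure.restrict_mono sAA le_rfl)
    have k2 : IntegrableOn Φ2 (B ×ˢ B) := j2.mono_measure (Measure.restrict_mono sBB le_rfl)
    have k3 : IntegrableOn (fun z => Φ2 (z + (h, h))) (A ×ˢ A) := by
      rw [← hpre2]
      exact ((measurePreserving_add_right volume ((h, h) : ℝ × ℝ)).integrableOn_comp_preimage
        (measurableEmbedding_addRight _)).2 k2
    rw [← setIntegral_comp_add_right Φ2 (B ×ˢ B) (h, h), hpre2, ← integral_add k1 k3]
    refine integral_nonpos_of_ae ?_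
    have hmem := ae_restrict_mem (μ := volume) (hAm.prod hAm : MeasurableSet (A ×ˢ A))
    filter_upwards [hmem, ae_mono (Measure.restrict_mono sAA le_rfl) hK0] with z hz hKz
    have hz1 : z.1 + h ∈ B := by rw [← hpre] at hz; exact hz.1
    have hz2 : z.2 + h ∈ B := by rw [← hpre] at hz; exact hz.2
    have hKe : K (z + (h, h)) = K z := by
      have e1 := hKJ _ (hBD hz1) _ (hBD hz2)
      have e2 := hKJ _ (hAD hz.1) _ (hAD hz.2)
      rw [add_sub_add_right_eq_sub] at e1
      exact e1.trans e2.symm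
    simp only [hΦ1, hΦ2, hKe, Prod.fst_add, Prod.snd_add, hv1, hv2]
    rw [halfShift_of_mem hz.1, halfShift_of_mem hz.2, halfShift_of_mem hz1, halfShift_of_mem hz2]
    simp only [add_neg_cancel_right]
    have hc := abs_convexComb_rpow_le hp.1 (t := 1 / 2) (by norm_num) (by norm_num)
      (u z.2 - u z.1) (u (z.2 + h) - u (z.1 + h))
    rw [show (1 - 1 / 2) * (u z.2 - u z.1) + 1 / 2 * (u (z.2 + h) - u (z.1 + h)) =
      (u z.2 + u (z.2 + h)) / 2 - (u z.1 + u (z.1 + h)) / 2 by ring] at hc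
    rw [show (u (z.2 + h) + u z.2) / 2 - (u (z.1 + h) + u z.1) / 2 =
      (u z.2 + u (z.2 + h)) / 2 - (u z.1 + u (z.1 + h)) / 2 by ring, ← mul_add]
    exact mul_nonpos_of_nonneg_of_nonpos hKz (by linarith)
  have hreg : ∫ z, Φ1 z ∂leb2 + ∫ z, Φ2 z ∂leb2 ≤
      M * p * (4 * (1 + 2 * G)) * (h * ∫ x in A, |Δ x|) := by
    rw [hsplit Φ1 _ j1 (hAm.prod hAm) sAA, hsplit Φ2 _ j2 (hBm.prod hBm) sBB]
    linarith
  -- the data term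
  have hgu : MemLp (fun x => u x - g x) 2 leb := (hL u hum huG).sub hg
  have hΔb : ∀ x, |Δ x| ≤ 2 * G := fun x => by
    have h1 := abs_le.1 (huG x)
    have h2 := abs_le.1 (huG (x + h))
    rw [hΔ, abs_le]; constructor <;> simp only <;> linarith
  have hΔm : Measurable Δ := (hum.comp (measurable_id.add_const h)).sub hum
  have hguA : MemLp (fun x => u x - g x) 2 (volume.restrict A) :=
    hgu.mono_measure (Measure.restrict_mono hAD le_rfl)
  have hguB : MemLp (fun x => u x - g x) 2 (volume.restrict B) :=
    hgu.mono_measure (Measure.restrict_mono hBD le_rfl)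
  have hmp : MeasurePreserving (fun x : ℝ => x + h) (volume.restrict A) (volume.restrict B) := by
    rw [← hpre]; exact (measurePreserving_add_right volume h).restrict_preimage hBm
  have hguS : MemLp (fun x => u (x + h) - g (x + h)) 2 (volume.restrict A) :=
    hguB.comp_measurePreserving hmp
  have hfin : IsFiniteMeasure (volume.restrict A) := ⟨by rw [Measure.restrict_apply_univ]; exact measure_Icc_lt_top⟩
  have hΔL : MemLp Δ 2 (volume.restrict A) :=
    MemLp.of_bound hΔm.aestronglyMeasurable (2 * G) (ae_of_all _ hΔb)
  have hΔgL : MemLp Δg 2 (volume.restrict A) := by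
    have hE : Δg = fun x => Δ x + ((u x - g x) - (u (x + h) - g (x + h))) := by
      ext x; simp only [hΔg, hΔ]; ring
    rw [hE]
    exact hΔL.add (hguA.sub hguS)
  have iA := (hguA.integrable_sq).add ((hΔL.integrable_mul hguA).add (hΔL.integrable_sq.div_const 4))
  have dat1 : ∫ x, (v1 x - g x) ^ 2 ∂leb - ∫ x, (u x - g x) ^ 2 ∂leb =
      ∫ x in A, (Δ x * (u x - g x) + Δ x ^ 2 / 4) := by
    have a1 : Integrable (fun x => (v1 x - g x) ^ 2) leb := ((hL v1 hv1m hv1G).sub hg).integrable_sq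
    have a2 : Integrable (fun x => (u x - g x) ^ 2) leb := hgu.integrable_sq
    rw [← integral_sub a1 a2]
    rw [setIntegral_eq_of_subset_of_forall_sdiff_eq_zero measurableSet_Icc hAD]
    · refine setIntegral_congr_fun hAm fun x hx => ?_
      simp only [hv1]
      rw [halfShift_of_mem hx, hΔ]; ring
    · intro x hx
      simp only [hv1]
      rw [halfShift_of_notMem hx.2]; ring
  have dat2 : ∫ x, (v2 x - g x) ^ 2 ∂leb - ∫ x, (u x - g x) ^ 2 ∂leb =
      ∫ x in A, (-(Δ x * (u (x + h) - g (x + h))) + Δ x ^ 2 / 4) := by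
    have a1 : Integrable (fun x => (v2 x - g x) ^ 2) leb := ((hL v2 hv2m hv2G).sub hg).integrable_sq
    have a2 : Integrable (fun x => (u x - g x) ^ 2) leb := hgu.integrable_sq
    rw [← integral_sub a1 a2]
    rw [setIntegral_eq_of_subset_of_forall_sdiff_eq_zero measurableSet_Icc hBD]
    · rw [← setIntegral_comp_add_right _ B h, hpre]
      refine setIntegral_congr_fun hAm fun x hx => ?_
      have hx' : x + h ∈ B := by rw [← hpre] at hx; exact hx
      simp only [hv2]
      rw [halfShift_of_mem hx', hΔ, add_neg_cancel_right]; ring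
    · intro x hx
      simp only [hv2]
      rw [halfShift_of_notMem hx.2]; ring
  have b1 : Integrable (fun x => Δ x * (u x - g x) + Δ x ^ 2 / 4) (volume.restrict A) :=
    (hΔL.integrable_mul hguA).add (hΔL.integrable_sq.div_const 4)
  have b2 : Integrable (fun x => -(Δ x * (u (x + h) - g (x + h))) + Δ x ^ 2 / 4) (volume.restrict A) :=
    (hΔL.integrable_mul hguS).neg.add (hΔL.integrable_sq.div_const 4)
  have c1 : Integrable (fun x => Δ x ^ 2) (volume.restrict A) := hΔL.integrable_sq
  have c2 : Integrable (fun x => Δg x ^ 2) (volume.restrict A) := hΔgL.integrable_sq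
  have c3 : Integrable (fun x => |Δ x|) (volume.restrict A) := (hΔL.integrable (by norm_num)).abs
  have hsum : 0 ≤ 1 / (2 * lam) * (∫ x in A, (Δ x * Δg x - Δ x ^ 2 / 2))
      + 1 / (2 * p) * (M * p * (4 * (1 + 2 * G)) * (h * ∫ x in A, |Δ x|)) := by
    have e : ∫ x in A, (Δ x * Δg x - Δ x ^ 2 / 2) =
        (∫ x in A, (Δ x * (u x - g x) + Δ x ^ 2 / 4))
        + ∫ x in A, (-(Δ x * (u (x + h) - g (x + h))) + Δ x ^ 2 / 4) := by
      rw [← integral_add b1 b2]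
      refine integral_congr_ae (ae_of_all _ fun x => ?_)
      simp only [hΔ, hΔg]; ring
    rw [e, ← dat1, ← dat2]
    have hreg' := mul_le_mul_of_nonneg_left hreg (show 0 ≤ 1 / (2 * p) by positivity)
    rw [r1, r2] at hreg'
    linarith
  set c := 8 * lam * M * (1 + 2 * G) with hc
  have hsum2 : 0 ≤ (∫ x in A, (Δ x * Δg x - Δ x ^ 2 / 2)) + c / 2 * h * ∫ x in A, |Δ x| := by
    have e1 : 1 / (2 * lam) * (∫ x in A, (Δ x * Δg x - Δ x ^ 2 / 2))
      + 1 / (2 * p) * (M * p * (4 * (1 + 2 * G)) * (h * ∫ x in A, |Δ x|)) =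
      1 / (2 * lam) * ((∫ x in A, (Δ x * Δg x - Δ x ^ 2 / 2)) + c / 2 * h * ∫ x in A, |Δ x|) := by
      rw [hc]; field_simp; ring
    rw [e1] at hsum
    exact (mul_nonneg_iff_of_pos_left (by positivity)).1 hsum
  -- Young's inequality twice, each time spending an eighth of `Δ²`; a quarter of `Δ²` remains with
  -- negative sign.
  have hfinal : (∫ x in A, (Δ x * Δg x - Δ x ^ 2 / 2)) + c / 2 * h * ∫ x in A, |Δ x| ≤
      ∫ x in A, (2 * Δg x ^ 2 - Δ x ^ 2 / 4 + 2 * c ^ 2 * h ^ 2) := by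
    rw [← integral_const_mul, ← integral_add (by exact (hΔL.integrable_mul hΔgL).sub (c1.div_const 2))
      (by exact c3.const_mul _)]
    refine integral_mono (((hΔL.integrable_mul hΔgL).sub (c1.div_const 2)).add (c3.const_mul _))
      (((c2.const_mul 2).sub (c1.div_const 4)).add (integrable_const _)) fun x => ?_
    simp only
    have q1 : Δ x ^ 2 = |Δ x| ^ 2 := (sq_abs _).symm
    nlinarith [sq_nonneg (Δ x - 4 * Δg x), sq_nonneg (|Δ x| - 2 * (c * h)), sq_nonneg (c * h)]
  rw [integral_add (by exact (c2.const_mul 2).sub (c1.div_const 4)) (by exact integrable_const _),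
    integral_sub (c2.const_mul 2) (c1.div_const 4), integral_const_mul, integral_div,
    integral_const, measureReal_restrict_apply_univ] at hfinal
  have hvA : volume.real A ≤ 1 := by
    rw [hA, Real.volume_real_Icc_of_le (by linarith)]; linarith
  have : volume.real A • (2 * c ^ 2 * h ^ 2) ≤ 2 * c ^ 2 * h ^ 2 := by
    rw [smul_eq_mul]; exact mul_le_of_le_one_left (by positivity) hvA
  change ∫ x in A, Δ x ^ 2 ≤ 8 * (∫ x in A, Δg x ^ 2) + 8 * c ^ 2 * h ^ 2
  linarith

end translates

/-! ### Mean square increments -/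

set_option linter.unusedSectionVars false

section increments
variable {E : Type*} [NormedAddCommGroup E] [MeasureSpace E] [BorelSpace E]
  [SecondCountableTopology E]

/-- The square of the `L²` norm of `F(· + w) - F` over the points of `D` where it makes sense. -/
noncomputable def incrSq (D : Set E) (F : E → ℝ) (w : E) : ℝ≥0∞ :=
  ∫⁻ z in {z | z ∈ D ∧ z + w ∈ D}, ENNReal.ofReal ((F (z + w) - F z) ^ 2)

/-- The increments of `F` on `D` are of order `σ` in mean square. -/
def HolderSq (D : Set E) (σ L : ℝ) (F : E → ℝ) : Prop :=
  ∀ w, incrSq D F w ≤ ENNReal.ofReal (L * ‖w‖ ^ (2 * σ))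

variable {D : Set E} {F F' : E → ℝ} {σ L : ℝ}

lemma ofReal_sq_eq_enorm (x : ℝ) : ENNReal.ofReal (x ^ 2) = ‖x‖ₑ ^ (2 : ℝ) := by
  rw [Real.enorm_eq_ofReal_abs, ENNReal.ofReal_rpow_of_nonneg (abs_nonneg _) (by norm_num)]
  simp

lemma incrSq_eq_eLpNorm (D : Set E) (F : E → ℝ) (w : E) :
    incrSq D F w =
      eLpNorm (fun z => F (z + w) - F z) 2 (volume.restrict {z | z ∈ D ∧ z + w ∈ D}) ^ (2 : ℝ) := by
  rw [eLpNorm_eq_lintegral_rpow_enorm_toReal (by norm_num) (by norm_num), ← ENNReal.rpow_mul]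
  simp [incrSq, ofReal_sq_eq_enorm]

lemma measurableSet_overlap (hD : MeasurableSet D) (w : E) :
    MeasurableSet {z | z ∈ D ∧ z + w ∈ D} := by
  have : {z | z ∈ D ∧ z + w ∈ D} = D ∩ (fun z => z + w) ⁻¹' D := rfl
  rw [this]
  exact hD.inter ((measurable_add_const w) hD)

variable [(volume : Measure E).IsAddHaarMeasure] [SFinite (volume : Measure E)]

lemma incrSq_neg (D : Set E) (F : E → ℝ) (w : E) : incrSq D F (-w) = incrSq D F w := by
  unfold incrSq
  rw [← (measurePreserving_add_right volume w).setLIntegral_comp_preimage_emb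
    (measurableEmbedding_addRight w)]
  congr 1
  · congr 1
    ext z
    simp [and_comm]
  · ext z
    simp only [add_neg_cancel_right]
    rw [← neg_sub, neg_sq]

/-- The modulus takes only shifts of norm strictly below `h`, so it is evaluated at `h = 2‖w‖`. -/
lemma eLpNorm_increment_le {r : ℝ≥0∞} {s : ℝ} (w : E) (hw : w ≠ 0) :
    eLpNorm (fun z => F (z + w) - F z) r (volume.restrict {z | z ∈ D ∧ z + w ∈ D}) ≤
      ENNReal.ofReal ((2 * ‖w‖) ^ s) * lipSeminorm D s r F := by
  have hw0 : 0 < ‖w‖ := norm_pos_iff.2 hw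
  have h1 : eLpNorm (fun z => F (z + w) - F z) r (volume.restrict {z | z ∈ D ∧ z + w ∈ D}) ≤
      modulus D r F (2 * ‖w‖) :=
    le_iSup₂ (f := fun (z : E) (_ : ‖z‖ < 2 * ‖w‖) =>
      eLpNorm (fun x => F (x + z) - F x) r (volume.restrict {x | x ∈ D ∧ x + z ∈ D})) w (by linarith)
  have h2 : ENNReal.ofReal ((2 * ‖w‖) ^ (-s)) * modulus D r F (2 * ‖w‖) ≤ lipSeminorm D s r F :=
    le_iSup₂ (f := fun (h : ℝ) (_ : 0 < h) => ENNReal.ofReal (h ^ (-s)) * modulus D r F h)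
      (2 * ‖w‖) (by positivity)
  calc _ ≤ modulus D r F (2 * ‖w‖) := h1
    _ = ENNReal.ofReal ((2 * ‖w‖) ^ s) * (ENNReal.ofReal ((2 * ‖w‖) ^ (-s)) * modulus D r F (2 * ‖w‖)) := by
        rw [← mul_assoc, ← ENNReal.ofReal_mul (by positivity), ← Real.rpow_add (by positivity)]
        simp
    _ ≤ _ := by gcongr

lemma incrSq_zero (D : Set E) (F : E → ℝ) : incrSq D F 0 = 0 := by
  simp [incrSq]

lemma two_mul_rpow_le {a s : ℝ} (ha : 0 ≤ a) (hs1 : s ≤ 1) :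
    (2 * a) ^ s ≤ 2 * a ^ s := by
  rw [Real.mul_rpow (by norm_num) ha]
  refine mul_le_mul_of_nonneg_right ?_ (by positivity)
  calc (2 : ℝ) ^ s ≤ 2 ^ (1 : ℝ) := Real.rpow_le_rpow_of_exponent_le (by norm_num) hs1
    _ = 2 := Real.rpow_one _

/-- On a domain of volume at most one, norms increase with the exponent, so smoothness in `L^r` with
`r ≥ 2` gives the same order in `L²`. -/
lemma exists_holderSq_of_memLip (hDv : volume D ≤ 1) {r : ℝ≥0∞} (hr : 2 ≤ r) {s : ℝ}
    (hs1 : s ≤ 1) (hFm : Measurable F) (hF : lipSeminorm D s r F < ∞) :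
    ∃ L, 0 ≤ L ∧ HolderSq D s L F := by
  set S := (lipSeminorm D s r F).toReal with hS
  have hSe : lipSeminorm D s r F = ENNReal.ofReal S := (ENNReal.ofReal_toReal hF.ne).symm
  refine ⟨(2 * S) ^ 2, by positivity, fun w => ?_⟩
  rcases eq_or_ne w 0 with rfl | hw
  · rw [incrSq_zero]; exact zero_le
  have hm : Measurable (fun z => F (z + w) - F z) := (hFm.comp (measurable_add_const w)).sub hFm
  have hμ : (volume.restrict {z | z ∈ D ∧ z + w ∈ D}) univ ≤ 1 := by
    rw [Measure.restrict_apply_univ]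
    exact (measure_mono fun z hz => hz.1).trans hDv
  have h1 := eLpNorm_le_eLpNorm_mul_rpow_measure_univ hr
    (μ := volume.restrict {z | z ∈ D ∧ z + w ∈ D}) hm.aestronglyMeasurable
  have h2 : (volume.restrict {z | z ∈ D ∧ z + w ∈ D}) univ ^ (1 / (2 : ℝ≥0∞).toReal - 1 / r.toReal) ≤ 1 := by
    refine ENNReal.rpow_le_one hμ ?_
    rw [sub_nonneg]
    rcases eq_or_ne r ∞ with rfl | hr'
    · simp
    · exact one_div_le_one_div_of_le (by norm_num) (ENNReal.toReal_mono hr' hr)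
  have h3 := (h1.trans (mul_le_of_le_one_right' h2)).trans (eLpNorm_increment_le (s := s) w hw)
  rw [incrSq_eq_eLpNorm]
  rw [hSe, ← ENNReal.ofReal_mul (by positivity)] at h3
  refine (ENNReal.rpow_le_rpow h3 (by norm_num)).trans ?_
  rw [ENNReal.ofReal_rpow_of_nonneg (by positivity) (by norm_num)]
  refine ENNReal.ofReal_le_ofReal ?_
  have h4 := two_mul_rpow_le (norm_nonneg w) hs1
  have h5 : (2 * ‖w‖) ^ s * S ≤ 2 * S * ‖w‖ ^ s := by
    have := mul_le_mul_of_nonneg_right h4 (ENNReal.toReal_nonneg : 0 ≤ S)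
    linarith
  calc ((2 * ‖w‖) ^ s * S) ^ (2 : ℝ) ≤ (2 * S * ‖w‖ ^ s) ^ (2 : ℝ) :=
        Real.rpow_le_rpow (by positivity) h5 (by norm_num)
    _ = (2 * S) ^ 2 * ‖w‖ ^ (2 * s) := by
        rw [Real.rpow_two, mul_pow, mul_comm 2 s, Real.rpow_mul (norm_nonneg _), Real.rpow_two]

/-- For `r ≤ 2` a bounded increment satisfies `|Δ|² ≤ (2G)^(2-r) |Δ|^r`. The loss of integrability
turns the order `s` into `s r / 2`. -/
lemma exists_holderSq_of_memLip_of_bounded {G : ℝ} (hG : 0 ≤ G) (hFG : ∀ x, |F x| ≤ G) {r : ℝ}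
    (hr : 1 ≤ r) (hr2 : r ≤ 2) {s : ℝ} (hs1 : s ≤ 1)
    (hF : lipSeminorm D s (ENNReal.ofReal r) F < ∞) :
    ∃ L, 0 ≤ L ∧ HolderSq D (s * r / 2) L F := by
  set S := (lipSeminorm D s (ENNReal.ofReal r) F).toReal with hS
  have hSe : lipSeminorm D s (ENNReal.ofReal r) F = ENNReal.ofReal S := (ENNReal.ofReal_toReal hF.ne).symm
  have hr0 : 0 < r := by linarith
  refine ⟨(2 * G) ^ (2 - r) * (2 * S) ^ r, by positivity, fun w => ?_⟩
  rcases eq_or_ne w 0 with rfl | hw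
  · rw [incrSq_zero]; exact zero_le
  have h3 := eLpNorm_increment_le (F := F) (D := D) (r := ENNReal.ofReal r) (s := s) w hw
  rw [hSe, ← ENNReal.ofReal_mul (by positivity)] at h3
  have h3' := ENNReal.rpow_le_rpow h3 hr0.le
  rw [eLpNorm_eq_lintegral_rpow_enorm_toReal (by simpa using hr0) (by simp), ← ENNReal.rpow_mul,
    ENNReal.toReal_ofReal hr0.le, one_div_mul_cancel hr0.ne', ENNReal.rpow_one,
    ENNReal.ofReal_rpow_of_nonneg (by positivity) hr0.le] at h3'
  calc incrSq D F w ≤ ∫⁻ z in {z | z ∈ D ∧ z + w ∈ D},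
        ENNReal.ofReal ((2 * G) ^ (2 - r)) * ‖F (z + w) - F z‖ₑ ^ r := by
        refine lintegral_mono fun z => ?_
        rw [Real.enorm_eq_ofReal_abs, ENNReal.ofReal_rpow_of_nonneg (abs_nonneg _) hr0.le,
          ← ENNReal.ofReal_mul (by positivity)]
        refine ENNReal.ofReal_le_ofReal ?_
        have hb : |F (z + w) - F z| ≤ 2 * G := by
          have h1 := abs_le.1 (hFG z)
          have h2 := abs_le.1 (hFG (z + w))
          rw [abs_le]; constructor <;> linarith
        rcases eq_or_lt_of_le (abs_nonneg (F (z + w) - F z)) with h | h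
        · rw [← sq_abs, ← h]
          simp only [ne_eq, OfNat.ofNat_ne_zero, not_false_eq_true, zero_pow]
          positivity
        calc (F (z + w) - F z) ^ 2 = |F (z + w) - F z| ^ (2 - r) * |F (z + w) - F z| ^ r := by
              rw [← Real.rpow_add h]; simp
          _ ≤ _ := by
              gcongr
    _ = ENNReal.ofReal ((2 * G) ^ (2 - r)) * ∫⁻ z in {z | z ∈ D ∧ z + w ∈ D}, ‖F (z + w) - F z‖ₑ ^ r :=
        lintegral_const_mul' _ _ ENNReal.ofReal_ne_top
    _ ≤ ENNReal.ofReal ((2 * G) ^ (2 - r)) * ENNReal.ofReal (((2 * ‖w‖) ^ s * S) ^ r) := by gcongr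
    _ ≤ _ := by
        rw [← ENNReal.ofReal_mul (by positivity)]
        refine ENNReal.ofReal_le_ofReal ?_
        have h4 := two_mul_rpow_le (norm_nonneg w) hs1
        have h5 : (2 * ‖w‖) ^ s * S ≤ 2 * S * ‖w‖ ^ s := by
          have := mul_le_mul_of_nonneg_right h4 (ENNReal.toReal_nonneg : 0 ≤ S)
          linarith
        have hS0 : 0 ≤ S := ENNReal.toReal_nonneg
        rw [mul_assoc]
        refine mul_le_mul_of_nonneg_left ?_ (by positivity)
        calc ((2 * ‖w‖) ^ s * S) ^ r ≤ (2 * S * ‖w‖ ^ s) ^ r :=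
              Real.rpow_le_rpow (by positivity) h5 hr0.le
          _ = (2 * S) ^ r * ‖w‖ ^ (2 * (s * r / 2)) := by
              rw [Real.mul_rpow (by positivity) (by positivity), ← Real.rpow_mul (norm_nonneg _)]
              congr 2; ring

/-- Averaging the increments over small shifts. -/
lemma lintegral_lintegral_ball_le (hD : MeasurableSet D) (hFm : Measurable F) (hσ : 0 ≤ σ)
    (hL : 0 ≤ L) (hF : HolderSq D σ L F) {ρ : ℝ} :
    ∫⁻ z in D, ∫⁻ z' in D ∩ Metric.ball z ρ, ENNReal.ofReal ((F z' - F z) ^ 2) ≤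
      volume (Metric.ball (0 : E) ρ) * ENNReal.ofReal (L * ρ ^ (2 * σ)) := by
  set T : Set (E × E) := {y | y.1 ∈ D ∧ y.1 + y.2 ∈ D} with hT
  have hTm : MeasurableSet T :=
    (measurable_fst hD).inter ((measurable_fst.add measurable_snd) hD)
  set Φ : E × E → ℝ≥0∞ := T.indicator fun y => ENNReal.ofReal ((F (y.1 + y.2) - F y.1) ^ 2) with hΦ
  have hΦm : Measurable Φ := by
    refine Measurable.indicator ?_ hTm
    exact (((hFm.comp (measurable_fst.add measurable_snd)).sub (hFm.comp measurable_fst)).pow_const 2).ennreal_ofReal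
  have e1 : ∀ z ∈ D, ∫⁻ z' in D ∩ Metric.ball z ρ, ENNReal.ofReal ((F z' - F z) ^ 2) =
      ∫⁻ w in Metric.ball (0 : E) ρ, Φ (z, w) := by
    intro z hz
    rw [← lintegral_indicator (hD.inter Metric.isOpen_ball.measurableSet),
      ← lintegral_indicator Metric.isOpen_ball.measurableSet, ← lintegral_add_left_eq_self _ z]
    congr 1
    ext w
    by_cases h1 : z + w ∈ D <;> by_cases h2 : ‖w‖ < ρ <;>
      simp [hΦ, hT, indicator, hz, h1, h2, Metric.mem_ball, dist_eq_norm]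
  rw [setLIntegral_congr_fun hD e1]
  rw [lintegral_lintegral_swap (f := fun z w => Φ (z, w)) (by exact hΦm.aemeasurable)]
  calc ∫⁻ w in Metric.ball (0 : E) ρ, ∫⁻ z in D, Φ (z, w)
      ≤ ∫⁻ w in Metric.ball (0 : E) ρ, ENNReal.ofReal (L * ρ ^ (2 * σ)) := by
        refine setLIntegral_mono measurable_const fun w hw => ?_
        have hw' : ‖w‖ < ρ := by simpa using hw
        have : ∫⁻ z in D, Φ (z, w) = incrSq D F w := by
          unfold incrSq
          rw [← lintegral_indicator hD, ← lintegral_indicator (measurableSet_overlap hD w)]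
          congr 1
          ext z
          by_cases h1 : z ∈ D <;> by_cases h2 : z + w ∈ D <;> simp [hΦ, hT, indicator, h1, h2]
        rw [this]
        refine (hF w).trans (ENNReal.ofReal_le_ofReal ?_)
        gcongr
    _ = _ := by rw [setLIntegral_const, mul_comm]

end increments

/-! ### Averages and the projection error of the continuum minimizer -/

lemma ofReal_sq_setAverage_sub_le {E : Type*} [MeasurableSpace E] {μ : Measure E} {F : E → ℝ}
    (hFm : Measurable F) {B : ℝ} (hFB : ∀ x, |F x| ≤ B) {s : Set E} (h0 : μ s ≠ 0) (hs : μ s ≠ ∞)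
    (c : ℝ) :
    ENNReal.ofReal ((⨍ x in s, F x ∂μ - c) ^ 2) ≤
      (μ s)⁻¹ * ∫⁻ x in s, ENNReal.ofReal ((F x - c) ^ 2) ∂μ := by
  have hfin : IsFiniteMeasure (μ.restrict s) := ⟨by simpa using hs.lt_top⟩
  have hb : ∀ x, |F x - c| ≤ B + |c| := fun x => (abs_sub _ _).trans (by linarith [hFB x])
  have i0 : Integrable F (μ.restrict s) :=
    Integrable.of_bound hFm.aestronglyMeasurable B (ae_of_all _ hFB)
  have i1 : Integrable (fun x => F x - c) (μ.restrict s) := i0.sub (integrable_const c)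
  have i2 : Integrable (fun x => (F x - c) ^ 2) (μ.restrict s) :=
    Integrable.of_bound ((hFm.sub_const c).pow_const 2).aestronglyMeasurable ((B + |c|) ^ 2)
      (ae_of_all _ fun x => by
        rw [Real.norm_eq_abs, abs_pow]
        exact pow_le_pow_left₀ (abs_nonneg _) (hb x) 2)
  have hμ : 0 < μ.real s := ENNReal.toReal_pos h0 hs
  have e : ⨍ x in s, F x ∂μ - c = ⨍ x in s, (F x - c) ∂μ := by
    rw [setAverage_eq, setAverage_eq, integral_sub i0 (integrable_const c), integral_const,
      measureReal_restrict_apply_univ, smul_sub, smul_smul, inv_mul_cancel₀ hμ.ne', one_smul]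
  have h := (even_two.convexOn_pow (𝕜 := ℝ)).map_set_average_le (continuous_pow 2).continuousOn
    isClosed_univ h0 hs (ae_of_all _ fun x => mem_univ (F x - c)) i1 i2
  rw [e]
  refine (ENNReal.ofReal_le_ofReal h).trans (le_of_eq ?_)
  rw [setAverage_eq, smul_eq_mul, ENNReal.ofReal_mul (by positivity),
    ofReal_integral_eq_lintegral_ofReal i2 (ae_of_all _ fun x => sq_nonneg _),
    ENNReal.ofReal_inv_of_pos hμ, Measure.real, ENNReal.ofReal_toReal hs]

section
variable {lam p M G σ L : ℝ} {g g' u : ℝ → ℝ} {K : ℝ × ℝ → ℝ}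

lemma NonlocalVariational.IsContinuumMinimizer.congr_data (hu : IsContinuumMinimizer lam p g K u)
    (h : g =ᵐ[leb] g') : IsContinuumMinimizer lam p g' K u := by
  have key : ∀ v, energy lam p g K v = energy lam p g' K v := fun v => by
    unfold energy
    congr 3
    refine eLpNorm_congr_ae ?_
    filter_upwards [h] with x hx
    rw [hx]
  exact ⟨hu.1, fun v hv => by rw [← key, ← key]; exact hu.2 v hv⟩

lemma overlap_Icc {h : ℝ} (hh : 0 ≤ h) :
    {z : ℝ | z ∈ Icc (0 : ℝ) 1 ∧ z + h ∈ Icc (0 : ℝ) 1} = Icc 0 (1 - h) := by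
  ext z
  simp only [mem_ofPred_eq, mem_Icc]
  constructor
  · rintro ⟨⟨_, _⟩, _, _⟩; constructor <;> linarith
  · rintro ⟨_, _⟩; refine ⟨⟨?_, ?_⟩, ?_, ?_⟩ <;> linarith

lemma incrSq_Icc_eq {f : ℝ → ℝ} (hf : Measurable f) (hfG : ∀ x, |f x| ≤ G) {h : ℝ} (hh : 0 ≤ h) :
    incrSq (Icc 0 1) f h = ENNReal.ofReal (∫ x in Icc 0 (1 - h), (f (x + h) - f x) ^ 2) := by
  unfold incrSq
  rw [overlap_Icc hh, ofReal_integral_eq_lintegral_ofReal]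
  · have hfin : IsFiniteMeasure (volume.restrict (Icc 0 (1 - h))) :=
      ⟨by rw [Measure.restrict_apply_univ]; exact measure_Icc_lt_top⟩
    refine Integrable.of_bound (C := (2 * G) ^ 2)
      (((hf.comp (measurable_id.add_const h)).sub hf).pow_const 2).aestronglyMeasurable
      (ae_of_all _ fun x => ?_)
    rw [Real.norm_eq_abs, abs_pow]
    refine pow_le_pow_left₀ (abs_nonneg _) ?_ 2
    have h1 := abs_le.1 (hfG x)
    have h2 := abs_le.1 (hfG (x + h))
    rw [abs_le]; constructor <;> linarith
  · exact ae_of_all _ fun x => sq_nonneg _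

/-- The continuum minimizer inherits the regularity of the data. -/
theorem holderSq_of_minimizer (hlam : 0 < lam) (hp : p ∈ Ico (1 : ℝ) 2) (hG : 0 ≤ G)
    (hM : 0 ≤ M) (hg : Measurable g) (hgG : ∀ x, |g x| ≤ G) (hK : AEMeasurable K leb2)
    (hK0 : ∀ᵐ z ∂leb2, 0 ≤ K z)
    (hKM : ∀ᵐ z ∂leb2, |K z| ≤ M) (hu : IsContinuumMinimizer lam p g K u)
    (hum : Measurable u) (huG : ∀ x, |u x| ≤ G) {J : ℝ → ℝ}
    (hKJ : ∀ x ∈ Icc (0 : ℝ) 1, ∀ y ∈ Icc (0 : ℝ) 1, K (x, y) = J |x - y|) (hσ1 : σ ≤ 1) (hL : 0 ≤ L) (hgH : HolderSq (Icc 0 1) σ L g) :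
    HolderSq (Icc 0 1) σ (8 * L + 8 * (8 * lam * M * (1 + 2 * G)) ^ 2) u := by
  have hgL : MemLp g 2 leb := MemLp.of_bound hg.aestronglyMeasurable G (ae_of_all _ hgG)
  have key : ∀ h : ℝ, 0 < h → incrSq (Icc 0 1) u h ≤
      ENNReal.ofReal ((8 * L + 8 * (8 * lam * M * (1 + 2 * G)) ^ 2) * h ^ (2 * σ)) := by
    intro h hh
    rcases lt_or_ge 1 h with h1 | h1
    · unfold incrSq
      rw [overlap_Icc hh.le, Icc_eq_empty (by linarith)]; simp
    rw [incrSq_Icc_eq hum huG hh.le]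
    refine ENNReal.ofReal_le_ofReal
      ((setIntegral_sq_translate_sub_le hlam hp hG hM hgL hK hK0 hKM hu hum huG hKJ hh).trans ?_)
    have h2 := hgH h
    rw [incrSq_Icc_eq hg hgG hh.le, Real.norm_eq_abs, abs_of_pos hh,
      ENNReal.ofReal_le_ofReal_iff (by positivity)] at h2
    -- The boundary strips contribute `h²`, which is of lower order since `h ≤ 1` and `σ ≤ 1`.
    have h3 : h ^ 2 ≤ h ^ (2 * σ) := by
      rw [← Real.rpow_two]
      exact Real.rpow_le_rpow_of_exponent_ge hh h1 (by linarith)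
    have := mul_le_mul_of_nonneg_left h3 (show 0 ≤ 8 * (8 * lam * M * (1 + 2 * G)) ^ 2 by positivity)
    linarith
  intro w
  rcases lt_trichotomy w 0 with hw | rfl | hw
  · have := key (-w) (by linarith)
    rwa [incrSq_neg, ← abs_of_neg hw] at this
  · rw [incrSq_zero]; exact zero_le
  · have := key w hw
    rwa [Real.norm_eq_abs, abs_of_pos hw]

/-- A cell lies in the ball of radius `1/n` about each of its points, so Jensen's inequality reduces
the projection error to increments averaged over that ball. The `2` is the ball's length `2/n`
divided by the cell's `1/n`. -/
lemma integral_sq_sub_inj_proj_le {n : ℕ} (hn : 0 < n) (hum : Measurable u)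
    (huG : ∀ x, |u x| ≤ G) (hσ : 0 ≤ σ) (hL : 0 ≤ L) (hu : HolderSq (Icc 0 1) σ L u) :
    ∫ x, (u x - inj n (proj n u) x) ^ 2 ∂leb ≤ 2 * L * (1 / (n : ℝ)) ^ (2 * σ) := by
  have hn' : (0 : ℝ) < n := by exact_mod_cast hn
  have huL : MemLp u 2 leb := MemLp.of_bound hum.aestronglyMeasurable G (ae_of_all _ huG)
  have hint : Integrable (fun x => (u x - inj n (proj n u) x) ^ 2) leb :=
    (huL.sub (memLp_inj n _ 2)).integrable_sq
  have hpt : ∀ᵐ x ∂leb, ENNReal.ofReal ((u x - inj n (proj n u) x) ^ 2) ≤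
      (n : ℝ≥0∞) * ∫⁻ y in Icc 0 1 ∩ Metric.ball x (1 / n), ENNReal.ofReal ((u y - u x) ^ 2) := by
    refine ae_leb_of_cells hn fun i x hx => ?_
    have hv : (volume (cell n i))⁻¹ = n := by
      rw [volume_cell, ← ENNReal.ofReal_inv_of_pos (by positivity)]; simp
    rw [inj_apply_of_mem _ hx, ← neg_sub, neg_sq]
    refine (ofReal_sq_setAverage_sub_le hum huG (s := cell n i)
      (by rw [volume_cell]; simpa using hn.ne') (by rw [volume_cell]; simp) (u x)).trans ?_
    rw [hv]
    gcongr
    refine fun y hy => ⟨cell_subset_Icc i hy, ?_⟩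
    rw [Metric.mem_ball, Real.dist_eq]
    have e : ((i : ℝ) + 1) / n = (i : ℝ) / n + 1 / n := by ring
    have h1 : (i : ℝ) / n ≤ x ∧ x < ((i : ℝ) + 1) / n := hx
    have h2 : (i : ℝ) / n ≤ y ∧ y < ((i : ℝ) + 1) / n := hy
    rw [e] at h1 h2
    rw [abs_lt]; constructor <;> linarith
  have h := lintegral_mono_ae hpt
  rw [← ofReal_integral_eq_lintegral_ofReal hint (ae_of_all _ fun x => sq_nonneg _),
    lintegral_const_mul' _ _ (by simp)] at h
  have h2 := h.trans (mul_le_mul_right (lintegral_lintegral_ball_le measurableSet_Icc hum hσ hL hu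
    (ρ := 1 / n)) _)
  rw [Real.volume_ball, ← ENNReal.ofReal_natCast, ← ENNReal.ofReal_mul (by positivity),
    ← ENNReal.ofReal_mul (by positivity), ENNReal.ofReal_le_ofReal_iff (by positivity)] at h2
  refine h2.trans (le_of_eq ?_)
  field_simp

end

/-! ### The dyadic maximal function on the line -/

/-- The kernel of the averaging operator over dyadic intervals of length `2⁻ᵏ`. -/
noncomputable def dyadicKernel (k : ℕ) (x y : ℝ) : ℝ≥0∞ :=
  if ⌊(2 : ℝ) ^ k * x⌋ = ⌊(2 : ℝ) ^ k * y⌋ then 2 ^ k else 0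

/-- The average over the dyadic interval of length `2⁻ᵏ` containing `x`. -/
noncomputable def dyadicAvg (k : ℕ) (f : ℝ → ℝ≥0∞) (x : ℝ) : ℝ≥0∞ :=
  ∫⁻ y, dyadicKernel k x y * f y

/-- The dyadic maximal function over intervals of length at most one. -/
noncomputable def dyadicMax (f : ℝ → ℝ≥0∞) (x : ℝ) : ℝ≥0∞ := ⨆ k, dyadicAvg k f x

section dyadic
variable {α : Type*} [MeasurableSpace α] {f g : ℝ → ℝ≥0∞} {b : ℝ≥0∞}

lemma dyadicKernel_comm (k : ℕ) (x y : ℝ) : dyadicKernel k x y = dyadicKernel k y x := by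
  simp only [dyadicKernel, eq_comm]

lemma measurable_dyadicKernel (k : ℕ) : Measurable fun z : ℝ × ℝ => dyadicKernel k z.1 z.2 := by
  refine Measurable.ite ?_ measurable_const measurable_const
  exact measurableSet_eq_fun (Int.measurable_floor.comp (measurable_fst.const_mul _))
    (Int.measurable_floor.comp (measurable_snd.const_mul _))

lemma measurable_dyadicKernel_left (k : ℕ) (x : ℝ) : Measurable fun y => dyadicKernel k x y :=
  (measurable_dyadicKernel k).comp measurable_prodMk_left

lemma lintegral_dyadicKernel (k : ℕ) (x : ℝ) : ∫⁻ y, dyadicKernel k x y = 1 := by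
  have hk : (0 : ℝ) < 2 ^ k := by positivity
  set m := ⌊(2 : ℝ) ^ k * x⌋
  have e : ∀ y, dyadicKernel k x y =
      (Ico ((m : ℝ) / 2 ^ k) ((m + 1) / 2 ^ k)).indicator (fun _ => (2 : ℝ≥0∞) ^ k) y := by
    intro y
    have : y ∈ Ico ((m : ℝ) / 2 ^ k) ((m + 1) / 2 ^ k) ↔ m = ⌊(2 : ℝ) ^ k * y⌋ := by
      rw [mem_Ico, div_le_iff₀ hk, lt_div_iff₀ hk, eq_comm, Int.floor_eq_iff, mul_comm]
    by_cases h : m = ⌊(2 : ℝ) ^ k * y⌋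
    · rw [indicator_of_mem (this.2 h), dyadicKernel, if_pos h]
    · rw [indicator_of_notMem (fun hy => h (this.1 hy)), dyadicKernel, if_neg h]
  simp_rw [e]
  rw [lintegral_indicator measurableSet_Ico, setLIntegral_const, Real.volume_Ico,
    show ((m : ℝ) + 1) / 2 ^ k - m / 2 ^ k = (2 ^ k)⁻¹ by field_simp; ring,
    ENNReal.ofReal_inv_of_pos hk, ENNReal.ofReal_pow (by norm_num), ENNReal.ofReal_ofNat]
  exact ENNReal.mul_inv_cancel (by positivity) (by finiteness)

lemma dyadicAvg_le (hf : ∀ x, f x ≤ b) (k : ℕ) (x : ℝ) : dyadicAvg k f x ≤ b := by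
  calc dyadicAvg k f x ≤ ∫⁻ y, dyadicKernel k x y * b := lintegral_mono fun y => by gcongr; exact hf y
    _ = b := by
      rw [lintegral_mul_const _ (measurable_dyadicKernel_left k x),
        lintegral_dyadicKernel, one_mul]

lemma dyadicMax_le (hf : ∀ x, f x ≤ b) (x : ℝ) : dyadicMax f x ≤ b :=
  iSup_le fun k => dyadicAvg_le hf k x

lemma measurable_dyadicAvg_param (k : ℕ) {f : α → ℝ → ℝ≥0∞}
    (hf : Measurable fun z : α × ℝ => f z.1 z.2) :
    Measurable fun z : α × ℝ => dyadicAvg k (f z.1) z.2 := by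
  refine Measurable.lintegral_prod_right' (f := fun z : (α × ℝ) × ℝ =>
    dyadicKernel k z.1.2 z.2 * f z.1.1 z.2) ?_
  exact ((measurable_dyadicKernel k).comp (measurable_fst.snd.prodMk measurable_snd)).mul
    (hf.comp (measurable_fst.fst.prodMk measurable_snd))

lemma measurable_dyadicMax_param {f : α → ℝ → ℝ≥0∞} (hf : Measurable fun z : α × ℝ => f z.1 z.2) :
    Measurable fun z : α × ℝ => dyadicMax (f z.1) z.2 :=
  Measurable.iSup fun k => measurable_dyadicAvg_param k hf

lemma measurable_dyadicAvg (k : ℕ) (hf : Measurable f) : Measurable (dyadicAvg k f) :=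
  (measurable_dyadicAvg_param (α := Unit) k (f := fun _ => f) (hf.comp measurable_snd)).comp
    (measurable_prodMk_left (x := ()))

/-- Averaging is self-adjoint because its kernel is symmetric. This replaces the conditional
expectation property of a martingale. -/
lemma lintegral_mul_dyadicAvg (k : ℕ) (hf : Measurable f) (hg : Measurable g) :
    ∫⁻ x, g x * dyadicAvg k f x = ∫⁻ x, dyadicAvg k g x * f x := by
  have hκ := measurable_dyadicKernel k
  have hm : Measurable fun z : ℝ × ℝ => g z.1 * (dyadicKernel k z.1 z.2 * f z.2) :=
    (hg.comp measurable_fst).mul (hκ.mul (hf.comp measurable_snd))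
  calc ∫⁻ x, g x * dyadicAvg k f x = ∫⁻ x, ∫⁻ y, g x * (dyadicKernel k x y * f y) := by
        refine lintegral_congr fun x => ?_
        rw [dyadicAvg, lintegral_const_mul]
        exact (hκ.comp measurable_prodMk_left).mul hf
    _ = ∫⁻ y, ∫⁻ x, g x * (dyadicKernel k x y * f y) :=
        lintegral_lintegral_swap (f := fun x y => g x * (dyadicKernel k x y * f y))
          (by exact hm.aemeasurable)
    _ = ∫⁻ y, dyadicAvg k g y * f y := by
        refine lintegral_congr fun y => ?_
        rw [dyadicAvg, ← lintegral_mul_const _ (by exact (measurable_dyadicKernel_left k y).mul hg)]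
        refine lintegral_congr fun x => ?_
        rw [dyadicKernel_comm]; ring

lemma floor_two_pow_eq_of_le {k l : ℕ} (h : l ≤ k) {x y : ℝ}
    (hxy : ⌊(2 : ℝ) ^ k * x⌋ = ⌊(2 : ℝ) ^ k * y⌋) : ⌊(2 : ℝ) ^ l * x⌋ = ⌊(2 : ℝ) ^ l * y⌋ := by
  obtain ⟨m, rfl⟩ := Nat.exists_eq_add_of_le h
  have e : ∀ x : ℝ, ⌊(2 : ℝ) ^ l * x⌋ = ⌊(2 : ℝ) ^ (l + m) * x⌋ / ((2 ^ m : ℕ) : ℤ) := by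
    intro x
    rw [← Int.floor_div_natCast]
    congr 1
    push_cast
    rw [pow_add]; field_simp
  rw [e x, e y, hxy]

/-- `f` is constant on the dyadic intervals of length `2⁻ᵏ`. -/
def DyadicConst (k : ℕ) (f : ℝ → ℝ≥0∞) : Prop :=
  ∀ x y : ℝ, ⌊(2 : ℝ) ^ k * x⌋ = ⌊(2 : ℝ) ^ k * y⌋ → f x = f y

lemma DyadicConst.mono {k l : ℕ} (h : DyadicConst l f) (hl : l ≤ k) : DyadicConst k f :=
  fun x y hxy => h x y (floor_two_pow_eq_of_le hl hxy)

lemma dyadicConst_dyadicAvg (k : ℕ) (f : ℝ → ℝ≥0∞) : DyadicConst k (dyadicAvg k f) := by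
  intro x y hxy
  unfold dyadicAvg dyadicKernel
  rw [hxy]

lemma DyadicConst.dyadicAvg_eq {k : ℕ} (h : DyadicConst k f) : dyadicAvg k f = f := by
  ext x
  calc dyadicAvg k f x = ∫⁻ y, dyadicKernel k x y * f x := by
        refine lintegral_congr fun y => ?_
        unfold dyadicKernel
        split_ifs with hxy
        · rw [h x y hxy]
        · simp
    _ = f x := by
      rw [lintegral_mul_const _ (measurable_dyadicKernel_left k x),
        lintegral_dyadicKernel, one_mul]

lemma two_mul_le_sq_add_sq_ennreal (a b : ℝ≥0∞) : 2 * (a * b) ≤ a ^ 2 + b ^ 2 := by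
  rcases le_total a b with h | h
  · obtain ⟨c, rfl⟩ := exists_add_of_le h
    calc 2 * (a * (a + c)) ≤ 2 * (a * (a + c)) + c ^ 2 := le_self_add
      _ = _ := by ring
  · obtain ⟨c, rfl⟩ := exists_add_of_le h
    calc 2 * ((b + c) * b) ≤ 2 * ((b + c) * b) + c ^ 2 := le_self_add
      _ = _ := by ring

/-- The pathwise inequality behind Doob's `L²` bound: one step of the running maximum `m` towards a
new value `a`. It is written without subtraction so that it holds in `ℝ≥0∞`. -/
lemma sq_max_add_le (m a : ℝ≥0∞) :
    max m a ^ 2 + 2 * (m * a) ≤ m ^ 2 + 2 * (max m a * a) := by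
  rcases le_total a m with h | h
  · rw [max_eq_left h]
  · rw [max_eq_right h]
    calc a ^ 2 + 2 * (m * a) ≤ a ^ 2 + (m ^ 2 + a ^ 2) := by
          gcongr; exact two_mul_le_sq_add_sq_ennreal m a
      _ = _ := by ring

/-- The `L²` bound for the dyadic maximal function. -/
theorem lintegral_sq_dyadicMax_le (hf : Measurable f) (hb : b ≠ ∞) (hfb : ∀ x, f x ≤ b)
    (hfi : ∫⁻ x, f x ≠ ∞) : ∫⁻ x, dyadicMax f x ^ 2 ≤ 4 * ∫⁻ x, f x ^ 2 := by
  set A : ℕ → ℝ → ℝ≥0∞ := fun k => dyadicAvg k f with hA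
  set S : ℕ → ℝ → ℝ≥0∞ := fun k x => partialSups (fun j => A j x) k with hS
  have hAm : ∀ k, Measurable (A k) := fun k => measurable_dyadicAvg k hf
  have hSsucc : ∀ k x, S (k + 1) x = max (S k x) (A (k + 1) x) := fun k x => by
    simp only [hS]; rw [partialSups_add_one]
  have hS0 : ∀ x, S 0 x = A 0 x := fun x => by simp [hS]
  have hSm : ∀ k, Measurable (S k) := by
    intro k
    induction k with
    | zero => exact (funext hS0 : S 0 = A 0) ▸ hAm 0
    | succ k ih =>
      rw [show S (k + 1) = fun x => max (S k x) (A (k + 1) x) from funext (hSsucc k)]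
      exact ih.max (hAm _)
  have hSc : ∀ k, DyadicConst k (S k) := by
    intro k
    induction k with
    | zero => rw [funext hS0]; exact dyadicConst_dyadicAvg 0 f
    | succ k ih =>
      intro x y hxy
      rw [hSsucc, hSsucc, (ih.mono (Nat.le_succ k)) x y hxy,
        show A (k + 1) x = A (k + 1) y from dyadicConst_dyadicAvg _ f x y hxy]
  have hSb : ∀ k x, S k x ≤ b := fun k x => partialSups_le _ _ _ fun j _ => dyadicAvg_le hfb j x
  -- The running maximum up to level `k` is constant on dyadic intervals of level `l ≥ k`, so
  -- averaging at level `l` can be moved onto it and leaves it unchanged.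
  have hSA : ∀ k l, k ≤ l → ∫⁻ x, S k x * A l x = ∫⁻ x, S k x * f x := by
    intro k l hkl
    rw [lintegral_mul_dyadicAvg l hf (hSm k), ((hSc k).mono hkl).dyadicAvg_eq]
  have hfin : ∀ k, ∫⁻ x, S k x * f x ≠ ∞ := by
    intro k
    refine ne_top_of_le_ne_top (ENNReal.mul_ne_top hb hfi) ?_
    rw [← lintegral_const_mul _ hf]
    exact lintegral_mono fun x => by gcongr; exact hSb k x
  have key : ∀ k, ∫⁻ x, S k x ^ 2 ≤ 2 * ∫⁻ x, S k x * f x := by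
    intro k
    induction k with
    | zero =>
      have : ∫⁻ x, S 0 x ^ 2 = ∫⁻ x, S 0 x * f x := by
        rw [← hSA 0 0 le_rfl]
        refine lintegral_congr fun x => ?_
        rw [hS0, sq]
      rw [this]
      exact le_mul_of_one_le_left' one_le_two
    | succ k ih =>
      have h1 : ∫⁻ x, (S (k + 1) x ^ 2 + 2 * (S k x * A (k + 1) x)) ≤
          ∫⁻ x, (S k x ^ 2 + 2 * (S (k + 1) x * A (k + 1) x)) :=
        lintegral_mono fun x => by
          simp only
          rw [hSsucc]; exact sq_max_add_le _ _
      rw [lintegral_add_left ((hSm _).pow_const 2), lintegral_add_left ((hSm _).pow_const 2),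
        lintegral_const_mul _ (by exact (hSm _).mul (hAm _)),
        lintegral_const_mul _ (by exact (hSm _).mul (hAm _)),
        hSA k (k + 1) (Nat.le_succ k), hSA (k + 1) (k + 1) le_rfl] at h1
      -- With the induction hypothesis, `2 ∫ S k * f` appears on both sides and cancels. It is
      -- finite because `f` is bounded and integrable.
      have h2 := h1.trans (add_le_add_left ih _)
      rw [add_comm] at h2
      exact (ENNReal.add_le_add_iff_left (ENNReal.mul_ne_top (by simp) (hfin k))).1 h2
  have key2 : ∀ k, ∫⁻ x, S k x ^ 2 ≤ 4 * ∫⁻ x, f x ^ 2 := by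
    intro k
    have hf2 : ∫⁻ x, S k x ^ 2 ≠ ∞ :=
      ne_top_of_le_ne_top (ENNReal.mul_ne_top (by simp) (hfin k)) (key k)
    have h3 : ∫⁻ x, 2 * (S k x * (2 * f x)) ≤ ∫⁻ x, (S k x ^ 2 + (2 * f x) ^ 2) :=
      lintegral_mono fun x => two_mul_le_sq_add_sq_ennreal _ _
    rw [lintegral_add_left ((hSm _).pow_const 2)] at h3
    have e1 : ∫⁻ x, 2 * (S k x * (2 * f x)) = 2 * (2 * ∫⁻ x, S k x * f x) := by
      rw [← lintegral_const_mul _ (by exact (hSm _).mul hf),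
        ← lintegral_const_mul _ (by exact ((hSm _).mul hf).const_mul _)]
      refine lintegral_congr fun x => ?_
      ring
    have e2 : ∫⁻ x, (2 * f x) ^ 2 = 4 * ∫⁻ x, f x ^ 2 := by
      rw [← lintegral_const_mul _ (hf.pow_const 2)]
      refine lintegral_congr fun x => ?_
      ring
    rw [e1, e2] at h3
    have h4 := (mul_le_mul_right (key k) 2).trans h3
    rw [two_mul] at h4
    exact (ENNReal.add_le_add_iff_left hf2).1 h4
  have e : ∀ x, dyadicMax f x ^ 2 = ⨆ k, S k x ^ 2 := by
    intro x
    rw [dyadicMax, ← iSup_partialSups_eq]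
    have hmono : Monotone (fun y : ℝ≥0∞ => y ^ 2) := fun a b h => pow_le_pow_left' h 2
    exact hmono.map_iSup_of_continuousAt (ENNReal.continuous_pow 2).continuousAt (by simp)
  simp_rw [e]
  rw [lintegral_iSup (fun k => (hSm k).pow_const 2)
    (fun k l hkl x => pow_le_pow_left' ((partialSups _).monotone hkl) 2)]
  exact iSup_le key2

/-- Averages over short intervals are controlled by the maximal function at the end points. -/
lemma setLIntegral_Ioc_le_dyadicMax (hf : Measurable f) {a c : ℝ} (hac : a < c) (h1 : c - a ≤ 1) :
    ∫⁻ y in Ioc a c, f y ≤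
      ENNReal.ofReal (c - a) * (2 * (dyadicMax f a + dyadicMax f c)) := by
  have hpos : 0 < c - a := by linarith
  -- The level is chosen so that `2⁻ᵏ` lies between the length of the interval and twice that
  -- length.
  obtain ⟨k, hk1, hk2⟩ := exists_nat_pow_near_of_lt_one (y := (1 / 2 : ℝ)) hpos h1 (by norm_num) (by norm_num)
  have hk : (0 : ℝ) < 2 ^ k := by positivity
  have hk2' : (2 : ℝ) ^ k * (c - a) ≤ 1 := by
    rw [one_div, inv_pow] at hk2
    calc (2 : ℝ) ^ k * (c - a) ≤ 2 ^ k * (2 ^ k)⁻¹ := by gcongr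
      _ = 1 := mul_inv_cancel₀ hk.ne'
  have hk1' : ((2 : ℝ) ^ k)⁻¹ ≤ 2 * (c - a) := by
    rw [one_div, inv_pow, pow_succ, mul_inv] at hk1
    linarith
  have hpt : ∀ y ∈ Ioc a c, (2 : ℝ≥0∞) ^ k * f y ≤ dyadicKernel k a y * f y + dyadicKernel k c y * f y := by
    intro y hy
    -- An interval no longer than `2⁻ᵏ` meets at most two dyadic intervals of level `k`, each
    -- containing one of its end points.
    have hfl : ⌊(2 : ℝ) ^ k * a⌋ = ⌊(2 : ℝ) ^ k * y⌋ ∨ ⌊(2 : ℝ) ^ k * c⌋ = ⌊(2 : ℝ) ^ k * y⌋ := by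
      have e1 : ⌊(2 : ℝ) ^ k * a⌋ ≤ ⌊(2 : ℝ) ^ k * y⌋ :=
        Int.floor_le_floor (by gcongr; exact hy.1.le)
      have e2 : ⌊(2 : ℝ) ^ k * y⌋ ≤ ⌊(2 : ℝ) ^ k * c⌋ :=
        Int.floor_le_floor (by gcongr; exact hy.2)
      have e3 : ⌊(2 : ℝ) ^ k * c⌋ ≤ ⌊(2 : ℝ) ^ k * a⌋ + 1 := by
        rw [← Int.floor_add_one]
        exact Int.floor_le_floor (by linarith)
      omega
    rcases hfl with h | h
    · rw [dyadicKernel, if_pos h]; exact le_self_add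
    · rw [show dyadicKernel k c y = 2 ^ k from if_pos h]; exact le_add_self
  have hmκ : ∀ x, Measurable fun y => dyadicKernel k x y * f y := fun x =>
    ((measurable_dyadicKernel k).comp measurable_prodMk_left).mul hf
  have hint : (2 : ℝ≥0∞) ^ k * ∫⁻ y in Ioc a c, f y ≤ dyadicMax f a + dyadicMax f c := by
    rw [← lintegral_const_mul _ hf]
    calc ∫⁻ y in Ioc a c, 2 ^ k * f y
        ≤ ∫⁻ y in Ioc a c, (dyadicKernel k a y * f y + dyadicKernel k c y * f y) :=
          setLIntegral_mono ((hmκ a).add (hmκ c)) hpt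
      _ ≤ ∫⁻ y, (dyadicKernel k a y * f y + dyadicKernel k c y * f y) := setLIntegral_le_lintegral _ _
      _ = dyadicAvg k f a + dyadicAvg k f c := lintegral_add_left (hmκ a) _
      _ ≤ _ := add_le_add (le_iSup (fun k => dyadicAvg k f a) k) (le_iSup (fun k => dyadicAvg k f c) k)
  calc ∫⁻ y in Ioc a c, f y = ((2 : ℝ≥0∞) ^ k)⁻¹ * (2 ^ k * ∫⁻ y in Ioc a c, f y) := by
        rw [← mul_assoc, ENNReal.inv_mul_cancel (by positivity) (by finiteness), one_mul]
    _ ≤ ENNReal.ofReal (2 * (c - a)) * (dyadicMax f a + dyadicMax f c) := by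
        gcongr
        have := ENNReal.ofReal_le_ofReal hk1'
        rwa [ENNReal.ofReal_inv_of_pos hk, ENNReal.ofReal_pow (by norm_num), ENNReal.ofReal_ofNat] at this
    _ = _ := by
        rw [mul_comm 2 (c - a), ENNReal.ofReal_mul hpos.le, ENNReal.ofReal_ofNat]; ring

end dyadic

/-! ### Deviation bounds for i.i.d. uniform nodes -/

section deviations
variable {n m : ℕ}

/-- On `[0,1]` one has `exp φ ≤ 1 + 2φ`. This gives a Chernoff bound in terms of the mean alone,
with the factor `2` as the only loss. -/
lemma one_add_two_mul_exp_bound {φ : ℝ → ℝ} (hφ : Measurable φ) (h0 : ∀ x, 0 ≤ φ x)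
    (h1 : ∀ x, φ x ≤ 1) : ∫ x, Real.exp (φ x) ∂leb ≤ Real.exp (2 * ∫ x, φ x ∂leb) := by
  have i1 : Integrable φ leb := Integrable.of_bound hφ.aestronglyMeasurable 1
    (ae_of_all _ fun x => by rw [Real.norm_eq_abs, abs_of_nonneg (h0 x)]; exact h1 x)
  have i2 : Integrable (fun x => Real.exp (φ x)) leb :=
    Integrable.of_bound hφ.exp.aestronglyMeasurable (Real.exp 1) (ae_of_all _ fun x => by
      rw [Real.norm_eq_abs, abs_of_pos (Real.exp_pos _)]; exact Real.exp_le_exp.2 (h1 x))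
  have hpt : ∀ x, Real.exp (φ x) ≤ 1 + 2 * φ x := fun x => by
    have := Real.abs_exp_sub_one_le (x := φ x) (by rw [abs_of_nonneg (h0 x)]; exact h1 x)
    rw [abs_of_nonneg (h0 x)] at this
    linarith [le_abs_self (Real.exp (φ x) - 1)]
  calc ∫ x, Real.exp (φ x) ∂leb ≤ ∫ x, (1 + 2 * φ x) ∂leb :=
        integral_mono i2 ((integrable_const 1).add (i1.const_mul 2)) hpt
    _ = 1 + 2 * ∫ x, φ x ∂leb := by
        rw [integral_add (integrable_const 1) (i1.const_mul 2), integral_const_mul]; simp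
    _ ≤ _ := by linarith [Real.add_one_le_exp (2 * ∫ x, φ x ∂leb)]

lemma measure_pi_sum_gt_le {φ : ℝ → ℝ} (hφ : Measurable φ) (h0 : ∀ x, 0 ≤ φ x)
    (h1 : ∀ x, φ x ≤ 1) (m : ℕ) (s : ℝ) :
    (Measure.pi fun _ : Fin m => leb) {y | 2 * m * ∫ x, φ x ∂leb + s < ∑ j, φ (y j)} ≤
      ENNReal.ofReal (Real.exp (-s)) := by
  set ν := Measure.pi fun _ : Fin m => leb
  have hm : Measurable fun y : Fin m → ℝ => ∑ j, φ (y j) :=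
    Finset.measurable_sum _ fun j _ => hφ.comp (measurable_pi_apply j)
  have hint : Integrable (fun y : Fin m → ℝ => Real.exp (1 * ∑ j, φ (y j))) ν := by
    refine Integrable.of_bound (hm.const_mul 1).exp.aestronglyMeasurable (Real.exp m)
      (ae_of_all _ fun y => ?_)
    rw [Real.norm_eq_abs, abs_of_pos (Real.exp_pos _), one_mul]
    refine Real.exp_le_exp.2 ((Finset.sum_le_sum fun j _ => h1 (y j)).trans ?_)
    simp
  have h := measure_ge_le_exp_mul_mgf (μ := ν) (X := fun y : Fin m → ℝ => ∑ j, φ (y j)) (t := 1)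
    (2 * m * ∫ x, φ x ∂leb + s) zero_le_one hint
  have hmgf : mgf (fun y : Fin m → ℝ => ∑ j, φ (y j)) ν 1 ≤ Real.exp (2 * m * ∫ x, φ x ∂leb) := by
    unfold mgf
    simp_rw [one_mul, Real.exp_sum]
    have := integral_fintype_prod_eq_pow (ι := Fin m) (μ := leb) (fun x => Real.exp (φ x))
    rw [this, Fintype.card_fin]
    calc (∫ x, Real.exp (φ x) ∂leb) ^ m ≤ Real.exp (2 * ∫ x, φ x ∂leb) ^ m :=
          pow_le_pow_left₀ (integral_nonneg fun x => (Real.exp_pos _).le)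
            (one_add_two_mul_exp_bound hφ h0 h1) m
      _ = _ := by rw [← Real.exp_nat_mul]; congr 1; ring
  calc ν {y | 2 * m * ∫ x, φ x ∂leb + s < ∑ j, φ (y j)}
      ≤ ν {y | 2 * m * ∫ x, φ x ∂leb + s ≤ ∑ j, φ (y j)} := measure_mono fun y hy => by
          simp only [mem_ofPred_eq] at hy ⊢; exact hy.le
    _ = ENNReal.ofReal (ν.real {y | 2 * m * ∫ x, φ x ∂leb + s ≤ ∑ j, φ (y j)}) := by
        rw [Measure.real, ENNReal.ofReal_toReal (measure_ne_top _ _)]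
    _ ≤ _ := by
        refine ENNReal.ofReal_le_ofReal (h.trans ?_)
        calc _ ≤ Real.exp (-1 * (2 * m * ∫ x, φ x ∂leb + s)) * Real.exp (2 * m * ∫ x, φ x ∂leb) := by
              gcongr
          _ = _ := by rw [← Real.exp_add]; congr 1; ring

/-- Splitting off one node. -/
lemma measure_pi_le_of_sections (i : Fin (m + 1)) {B : Set (ℝ × (Fin m → ℝ))} (hB : MeasurableSet B)
    {e : ℝ≥0∞} (h : ∀ a, (Measure.pi fun _ : Fin m => leb) {y | (a, y) ∈ B} ≤ e) :
    (Measure.pi fun _ : Fin (m + 1) => leb) {x | (x i, fun j => x (i.succAbove j)) ∈ B} ≤ e := by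
  have hmp := measurePreserving_piFinSuccAbove (fun _ : Fin (m + 1) => leb) i
  have := hmp.measure_preimage hB.nullMeasurableSet
  have e1 : {x : Fin (m + 1) → ℝ | (x i, fun j => x (i.succAbove j)) ∈ B} =
      (MeasurableEquiv.piFinSuccAbove (fun _ => ℝ) i) ⁻¹' B := rfl
  rw [e1, this, Measure.prod_apply hB]
  calc _ ≤ ∫⁻ _ : ℝ, e ∂leb := lintegral_mono fun a => h a
    _ = e := by simp

/-- Given `x i`, the other nodes are still i.i.d. uniform, so the one-variable bound applies to the
section. The `+ 1` covers the diagonal term `j = i`. -/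
lemma measure_pi_pair_sum_gt_le {ψ : ℝ × ℝ → ℝ} (hψ : Measurable ψ) (h0 : ∀ z, 0 ≤ ψ z)
    (h1 : ∀ z, ψ z ≤ 1) (i : Fin n) (s : ℝ) :
    (Measure.pi fun _ : Fin n => leb)
        {x | 2 * n * (∫ y, ψ (x i, y) ∂leb) + s + 1 < ∑ j, ψ (x i, x j)} ≤
      ENNReal.ofReal (Real.exp (-s)) := by
  obtain ⟨m, rfl⟩ : ∃ m, n = m + 1 := ⟨n - 1, by have := i.pos; omega⟩
  have hH : Measurable fun a => ∫ y, ψ (a, y) ∂leb :=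
    (hψ.stronglyMeasurable.integral_prod_right' (ν := leb)).measurable
  set B : Set (ℝ × (Fin m → ℝ)) :=
    {w | 2 * m * (∫ y, ψ (w.1, y) ∂leb) + s < ∑ j, ψ (w.1, w.2 j)} with hB
  have hBm : MeasurableSet B := measurableSet_lt
    (((hH.comp measurable_fst).const_mul _).add_const s)
    (Finset.measurable_sum _ fun j _ => hψ.comp
      (measurable_fst.prodMk ((measurable_pi_apply j).comp measurable_snd)))
  refine le_trans (measure_mono fun x hx => ?_) (measure_pi_le_of_sections i hBm
    (e := ENNReal.ofReal (Real.exp (-s))) fun a =>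
      measure_pi_sum_gt_le (φ := fun y => ψ (a, y)) (hψ.comp measurable_prodMk_left)
        (fun y => h0 _) (fun y => h1 _) m s)
  have hx' : 2 * ((m + 1 : ℕ) : ℝ) * (∫ y, ψ (x i, y) ∂leb) + s + 1 < ∑ j, ψ (x i, x j) := hx
  rw [Fin.sum_univ_succAbove _ i] at hx'
  have hI : 0 ≤ ∫ y, ψ (x i, y) ∂leb := integral_nonneg fun y => h0 _
  push_cast at hx'
  change 2 * m * (∫ y, ψ (x i, y) ∂leb) + s < ∑ j, ψ (x i, x (i.succAbove j))
  linarith [h1 (x i, x i)]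

/-- The double sum over pairs of nodes. -/
theorem measure_pi_double_sum_gt_le {ψ : ℝ × ℝ → ℝ} (hψ : Measurable ψ) (h0 : ∀ z, 0 ≤ ψ z)
    (h1 : ∀ z, ψ z ≤ 1) (n : ℕ) (s : ℝ) :
    (Measure.pi fun _ : Fin n => leb)
        {x | 4 * n ^ 2 * (∫ z, ψ z ∂leb2) + 3 * n * s + n < ∑ i, ∑ j, ψ (x i, x j)} ≤
      ENNReal.ofReal ((n + 1) * Real.exp (-s)) := by
  have hH : Measurable fun a => ∫ y, ψ (a, y) ∂leb :=
    (hψ.stronglyMeasurable.integral_prod_right' (ν := leb)).measurable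
  have iψ : Integrable ψ (leb.prod leb) := Integrable.of_bound hψ.aestronglyMeasurable 1
    (ae_of_all _ fun x => by rw [Real.norm_eq_abs, abs_of_nonneg (h0 x)]; exact h1 x)
  have hI : ∫ z, ψ z ∂leb2 = ∫ a, ∫ y, ψ (a, y) ∂leb ∂leb := by
    rw [leb2_eq_prod]; exact integral_prod _ iψ
  have hH1 : ∀ a, ∫ y, ψ (a, y) ∂leb ≤ 1 := fun a => by
    calc ∫ y, ψ (a, y) ∂leb ≤ ∫ _y, (1 : ℝ) ∂leb := by
          refine integral_mono_of_nonneg (ae_of_all _ fun y => h0 _) (integrable_const 1)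
            (ae_of_all _ fun y => h1 _)
      _ = 1 := by simp
  set S0 := {x : Fin n → ℝ | 2 * n * (∫ a, ∫ y, ψ (a, y) ∂leb ∂leb) + s < ∑ i, ∫ y, ψ (x i, y) ∂leb}
  set S1 := fun i : Fin n => {x : Fin n → ℝ |
    2 * n * (∫ y, ψ (x i, y) ∂leb) + s + 1 < ∑ j, ψ (x i, x j)}
  have hsub : {x : Fin n → ℝ | 4 * n ^ 2 * (∫ z, ψ z ∂leb2) + 3 * n * s + n < ∑ i, ∑ j, ψ (x i, x j)}
      ⊆ S0 ∪ ⋃ i, S1 i := by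
    intro x hx
    by_contra hc
    simp only [mem_union, mem_iUnion, not_or, not_exists] at hc
    have c0 : ∑ i, ∫ y, ψ (x i, y) ∂leb ≤ 2 * n * (∫ a, ∫ y, ψ (a, y) ∂leb ∂leb) + s := not_lt.1 hc.1
    have c1 : ∀ i, ∑ j, ψ (x i, x j) ≤ 2 * n * (∫ y, ψ (x i, y) ∂leb) + s + 1 := fun i =>
      not_lt.1 (hc.2 i)
    have hx' : 4 * n ^ 2 * (∫ z, ψ z ∂leb2) + 3 * n * s + n < ∑ i, ∑ j, ψ (x i, x j) := hx
    -- Summing the row bounds and inserting the bound for the sum of row means gives `2n (2n I + s)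
    -- + n s + n`, with `I` the double integral.
    have c2 := Finset.sum_le_sum fun i (_ : i ∈ Finset.univ) => c1 i
    simp only [Finset.sum_add_distrib, Finset.sum_const, Finset.card_univ, Fintype.card_fin,
      nsmul_eq_mul, ← Finset.mul_sum] at c2
    have c3 := mul_le_mul_of_nonneg_left c0 (show (0 : ℝ) ≤ 2 * n by positivity)
    rw [hI] at hx'
    nlinarith
  calc _ ≤ _ := measure_mono hsub
    _ ≤ _ := measure_union_le _ _
    _ ≤ ENNReal.ofReal (Real.exp (-s)) + ∑ _i : Fin n, ENNReal.ofReal (Real.exp (-s)) := by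
        refine add_le_add (measure_pi_sum_gt_le hH (fun a => integral_nonneg fun y => h0 _) hH1 n s)
          ((measure_iUnion_fintype_le _ _).trans (Finset.sum_le_sum fun i _ =>
            measure_pi_pair_sum_gt_le hψ h0 h1 i s))
    _ = _ := by
        rw [Finset.sum_const, Finset.card_univ, Fintype.card_fin, nsmul_eq_mul, add_mul, one_mul,
          ENNReal.ofReal_add (by positivity) (by positivity), ENNReal.ofReal_mul (by positivity),
          ENNReal.ofReal_natCast, add_comm]

lemma ae_pi_mem {s : Set ℝ} (hs : ∀ᵐ x ∂leb, x ∈ s) :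
    ∀ᵐ x ∂(Measure.pi fun _ : Fin n => leb), ∀ i, x i ∈ s :=
  ae_all_iff.2 fun i =>
    (measurePreserving_eval (fun _ : Fin n => leb) i).quasiMeasurePreserving.ae hs

lemma ae_leb_mem_Ioo : ∀ᵐ x ∂leb, x ∈ Ioo (0 : ℝ) 1 := by
  rw [leb, restrict_Ioo_eq_restrict_Icc.symm]
  exact ae_restrict_mem measurableSet_Ioo

lemma ae_pi_injective : ∀ᵐ x ∂(Measure.pi fun _ : Fin n => leb), Function.Injective x := by
  have key : ∀ i j : Fin n, i ≠ j → ∀ᵐ x ∂(Measure.pi fun _ : Fin n => leb), x i ≠ x j := by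
    intro i j hij
    obtain ⟨m, rfl⟩ : ∃ m, n = m + 1 := ⟨n - 1, by have := i.pos; omega⟩
    obtain ⟨k, rfl⟩ := Fin.exists_succAbove_eq hij.symm
    have hB : MeasurableSet {w : ℝ × (Fin m → ℝ) | w.1 = w.2 k} :=
      measurableSet_eq_fun measurable_fst ((measurable_pi_apply k).comp measurable_snd)
    have := measure_pi_le_of_sections i hB (e := 0) fun a => by
      have hae : ∀ᵐ y ∂leb, y ≠ a := Measure.ae_ne _ a
      have h2 := (measurePreserving_eval (fun _ : Fin m => leb) k).quasiMeasurePreserving.ae hae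
      refine le_of_eq (measure_mono_null ?_ h2)
      intro y hy
      simp only [mem_compl_iff, mem_ofPred_eq, not_not]
      exact (show a = y k from hy).symm
    rw [ae_iff]
    refine le_antisymm (le_trans (measure_mono fun x hx => ?_) this) zero_le
    simpa using hx
  have h2 : ∀ᵐ x ∂(Measure.pi fun _ : Fin n => leb), ∀ i j, i ≠ j → x i ≠ x j :=
    ae_all_iff.2 fun i => ae_all_iff.2 fun j => by
      by_cases hij : i = j
      · simp [hij]
      · filter_upwards [key i j hij] with x hx _
        exact hx
  filter_upwards [h2] with x hx i j h
  by_contra hc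
  exact hx i j hc h

end deviations

/-! ### Concentration of order statistics -/

section orderStatDev
variable {n : ℕ}

lemma orderStat_mono (x : Fin n → ℝ) : Monotone (orderStat x) := Tuple.monotone_sort x

lemma card_le_of_lt_orderStat {x : Fin n → ℝ} {i : Fin n} {a : ℝ} (h : a < orderStat x i) :
    ∑ j, (Iic a).indicator (1 : ℝ → ℝ) (x j) ≤ i := by
  have e : ∑ j, (Iic a).indicator (1 : ℝ → ℝ) (x j) =
      ∑ k, (Iic a).indicator (1 : ℝ → ℝ) (orderStat x k) :=
    (Equiv.sum_comp (Tuple.sort x) fun j => (Iic a).indicator (1 : ℝ → ℝ) (x j)).symm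
  rw [e]
  calc ∑ k, (Iic a).indicator (1 : ℝ → ℝ) (orderStat x k) ≤ ∑ k, if k < i then (1 : ℝ) else 0 := by
        refine Finset.sum_le_sum fun k _ => ?_
        by_cases hk : k < i
        · rw [if_pos hk]; exact indicator_le_self' (fun _ _ => zero_le_one) _
        · rw [if_neg hk, indicator_of_notMem]
          rw [mem_Iic, not_le]
          exact h.trans_le (orderStat_mono x (not_lt.1 hk))
    _ = i := by
        rw [Finset.sum_boole]
        congr 1
        rw [← Fin.card_Iio i]
        congr 1
        ext k; simp

lemma le_card_of_orderStat_le {x : Fin n → ℝ} {i : Fin n} {a : ℝ} (h : orderStat x i ≤ a) :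
    (i : ℝ) + 1 ≤ ∑ j, (Iic a).indicator (1 : ℝ → ℝ) (x j) := by
  have e : ∑ j, (Iic a).indicator (1 : ℝ → ℝ) (x j) =
      ∑ k, (Iic a).indicator (1 : ℝ → ℝ) (orderStat x k) :=
    (Equiv.sum_comp (Tuple.sort x) fun j => (Iic a).indicator (1 : ℝ → ℝ) (x j)).symm
  rw [e]
  calc (i : ℝ) + 1 = ∑ k, if k ≤ i then (1 : ℝ) else 0 := by
        rw [Finset.sum_boole]
        have : (Finset.univ.filter fun k : Fin n => k ≤ i) = Finset.Iic i := by ext k; simp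
        rw [this, Fin.card_Iic]
        push_cast; rfl
    _ ≤ _ := by
        refine Finset.sum_le_sum fun k _ => ?_
        by_cases hk : k ≤ i
        · rw [if_pos hk, indicator_of_mem (show orderStat x k ∈ Iic a from (orderStat_mono x hk).trans h)]
          rfl
        · rw [if_neg hk]; exact indicator_nonneg (fun _ _ => zero_le_one) _

lemma integral_indicator_Iic {a : ℝ} (h0 : 0 ≤ a) (h1 : a ≤ 1) :
    ∫ x, (Iic a).indicator (1 : ℝ → ℝ) x ∂leb = a := by
  rw [integral_indicator_one measurableSet_Iic, measureReal_restrict_apply measurableSet_Iic]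
  have : Iic a ∩ Icc 0 1 = Icc 0 a := by
    ext x; simp only [mem_inter_iff, mem_Iic, mem_Icc]
    constructor
    · rintro ⟨h, h', _⟩; exact ⟨h', h⟩
    · rintro ⟨h, h'⟩; exact ⟨h', h, h'.trans h1⟩
  rw [this, Real.volume_real_Icc_of_le h0, sub_zero]

/-- Hoeffding's inequality for the empirical distribution function at one point; the sign `ε` treats
both tails at once. -/
lemma measure_pi_sum_indicator_ge_le {a : ℝ} (h0 : 0 ≤ a) (h1 : a ≤ 1) (ε : ℝ) (hε : ε = 1 ∨ ε = -1)
    {d : ℝ} (hd : 0 ≤ d) (hn : 0 < n) :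
    (Measure.pi fun _ : Fin n => leb)
        {x | n * d ≤ ε * ((∑ j, (Iic a).indicator (1 : ℝ → ℝ) (x j)) - n * a)} ≤
      ENNReal.ofReal (Real.exp (-(2 * n * d ^ 2))) := by
  set ν := Measure.pi fun _ : Fin n => leb
  have hn' : (0 : ℝ) < n := by exact_mod_cast hn
  have hmeas : Measurable ((Iic a).indicator (1 : ℝ → ℝ)) := measurable_one.indicator measurableSet_Iic
  have hsub : HasSubgaussianMGF (fun x : ℝ => (Iic a).indicator (1 : ℝ → ℝ) x - a)
      ((‖(1 : ℝ) - 0‖₊ / 2) ^ 2) leb := by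
    have := hasSubgaussianMGF_of_mem_Icc (μ := leb) (X := (Iic a).indicator (1 : ℝ → ℝ)) (a := 0)
      (b := 1) hmeas.aemeasurable (ae_of_all _ fun x => ⟨indicator_nonneg (fun _ _ => zero_le_one) _,
        indicator_le_self' (fun _ _ => zero_le_one) _⟩)
    rwa [integral_indicator_Iic h0 h1] at this
  have hcoord : ∀ j, HasSubgaussianMGF (fun x : Fin n → ℝ => ε * ((Iic a).indicator (1 : ℝ → ℝ) (x j) - a))
      ((‖(1 : ℝ) - 0‖₊ / 2) ^ 2) ν := by
    intro j
    have hmp := measurePreserving_eval (fun _ : Fin n => leb) j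
    have h := hsub
    rw [← hmp.map_eq] at h
    have h2 : HasSubgaussianMGF (fun x : Fin n → ℝ => (Iic a).indicator (1 : ℝ → ℝ) (x j) - a)
      ((‖(1 : ℝ) - 0‖₊ / 2) ^ 2) ν := h.of_map hmp.measurable.aemeasurable
    rcases hε with rfl | rfl
    · simpa using h2
    · have := h2.neg
      refine this.congr (ae_of_all _ fun x => ?_)
      simp
  have hind : iIndepFun (fun j (x : Fin n → ℝ) => ε * ((Iic a).indicator (1 : ℝ → ℝ) (x j) - a)) ν :=
    iIndepFun_pi (X := fun _ x => ε * ((Iic a).indicator (1 : ℝ → ℝ) x - a)) fun j =>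
      ((hmeas.sub_const a).const_mul ε).aemeasurable
  have h := HasSubgaussianMGF.measure_sum_ge_le_of_iIndepFun hind (s := Finset.univ)
    (fun j _ => hcoord j) (ε := n * d) (by positivity)
  have e1 : {x : Fin n → ℝ | n * d ≤ ε * ((∑ j, (Iic a).indicator (1 : ℝ → ℝ) (x j)) - n * a)} =
      {x | n * d ≤ ∑ j, ε * ((Iic a).indicator (1 : ℝ → ℝ) (x j) - a)} := by
    ext x
    simp only [mem_ofPred_eq]
    rw [← Finset.mul_sum, Finset.sum_sub_distrib]
    simp
  rw [e1, ← ENNReal.ofReal_toReal (measure_ne_top ν _)]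
  refine ENNReal.ofReal_le_ofReal (h.trans (Real.exp_le_exp.2 (le_of_eq ?_)))
  simp only [sub_zero, nnnorm_one, Finset.sum_const, Finset.card_univ, Fintype.card_fin, nsmul_eq_mul]
  push_cast
  field_simp

/-- All order statistics are close to their means. -/
theorem measure_pi_orderStat_dev_le (hn : 0 < n) {d : ℝ} (hd : 0 < d) :
    (Measure.pi fun _ : Fin n => leb)
        {x | ¬ ∀ i : Fin n, |orderStat x i - ((i : ℝ) + 1) / n| ≤ d} ≤
      ENNReal.ofReal (2 * n * Real.exp (-(2 * n * d ^ 2))) := by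
  set ν := Measure.pi fun _ : Fin n => leb
  have hn' : (0 : ℝ) < n := by exact_mod_cast hn
  set e := ENNReal.ofReal (Real.exp (-(2 * n * d ^ 2)))
  -- An order statistic above a threshold means too few nodes below it. Thresholds above one are
  -- never exceeded, so Hoeffding's bound is needed only inside `[0,1]`; the lower tail is
  -- symmetric.
  have hhi : ∀ i : Fin n, ν {x | (∀ k, x k ∈ Icc (0 : ℝ) 1) ∧ ((i : ℝ) + 1) / n + d < orderStat x i} ≤ e := by
    intro i
    by_cases ha : ((i : ℝ) + 1) / n + d ≤ 1
    · refine le_trans (measure_mono fun x hx => ?_) (measure_pi_sum_indicator_ge_le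
        (a := ((i : ℝ) + 1) / n + d) (by positivity) ha (-1) (Or.inr rfl) hd.le hn)
      have := card_le_of_lt_orderStat hx.2
      simp only [mem_ofPred_eq]
      have e1 : (n : ℝ) * (((i : ℝ) + 1) / n + d) = i + 1 + n * d := by field_simp
      rw [e1]
      linarith
    · refine le_trans (le_of_eq ?_) zero_le
      convert measure_empty (μ := ν)
      ext x
      simp only [mem_ofPred_eq, mem_empty_iff_false, iff_false, not_and, not_lt]
      intro hx
      exact (orderStat_mem hx i).2.trans (not_le.1 ha).le
  have hlo : ∀ i : Fin n, ν {x | (∀ k, x k ∈ Icc (0 : ℝ) 1) ∧ orderStat x i < ((i : ℝ) + 1) / n - d} ≤ e := by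
    intro i
    by_cases ha : 0 ≤ ((i : ℝ) + 1) / n - d
    · have hi1 : ((i : ℝ) + 1) / n ≤ 1 := by
        rw [div_le_one hn']; exact_mod_cast i.isLt
      refine le_trans (measure_mono fun x hx => ?_) (measure_pi_sum_indicator_ge_le
        (a := ((i : ℝ) + 1) / n - d) ha (by linarith) 1 (Or.inl rfl) hd.le hn)
      have := le_card_of_orderStat_le hx.2.le
      simp only [mem_ofPred_eq]
      have e1 : (n : ℝ) * (((i : ℝ) + 1) / n - d) = i + 1 - n * d := by field_simp
      rw [e1]
      linarith
    · refine le_trans (le_of_eq ?_) zero_le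
      convert measure_empty (μ := ν)
      ext x
      simp only [mem_ofPred_eq, mem_empty_iff_false, iff_false, not_and, not_lt]
      intro hx
      exact (not_le.1 ha).le.trans (orderStat_mem hx i).1
  have hae : ∀ᵐ x ∂ν, ∀ k, x k ∈ Icc (0 : ℝ) 1 :=
    ae_pi_mem (ae_leb_mem_Ioo.mono fun x hx => Ioo_subset_Icc_self hx)
  have hsub : ∀ᵐ x ∂ν, x ∈ {x : Fin n → ℝ | ¬ ∀ i : Fin n, |orderStat x i - ((i : ℝ) + 1) / n| ≤ d} →
      x ∈ ⋃ i : Fin n, ({x | (∀ k, x k ∈ Icc (0 : ℝ) 1) ∧ ((i : ℝ) + 1) / n + d < orderStat x i} ∪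
        {x | (∀ k, x k ∈ Icc (0 : ℝ) 1) ∧ orderStat x i < ((i : ℝ) + 1) / n - d}) := by
    filter_upwards [hae] with x hx hbad
    change ¬ _ at hbad
    push Not at hbad
    obtain ⟨i, hi⟩ := hbad
    refine mem_iUnion.2 ⟨i, ?_⟩
    rcases lt_abs.1 hi with h | h
    · exact Or.inl ⟨hx, by linarith⟩
    · exact Or.inr ⟨hx, by linarith⟩
  calc _ ≤ _ := measure_mono_ae hsub
    _ ≤ ∑ _i : Fin n, (e + e) := (measure_iUnion_fintype_le _ _).trans (Finset.sum_le_sum fun i _ =>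
        (measure_union_le _ _).trans (add_le_add (hhi i) (hlo i)))
    _ = _ := by
        rw [Finset.sum_const, Finset.card_univ, Fintype.card_fin, nsmul_eq_mul, ← two_mul,
          ENNReal.ofReal_mul (by positivity), ENNReal.ofReal_mul (by norm_num), ENNReal.ofReal_natCast,
          ENNReal.ofReal_ofNat]
        ring

end orderStatDev

/-! ### The maximal function in the plane -/

/-- The iterated dyadic maximal function. -/
noncomputable def dyadicMax2 (f : ℝ × ℝ → ℝ≥0∞) (z : ℝ × ℝ) : ℝ≥0∞ :=
  dyadicMax (fun y => dyadicMax (fun s => f (s, y)) z.1) z.2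

section plane
variable {f : ℝ × ℝ → ℝ≥0∞} {b : ℝ≥0∞}

lemma measurable_dyadicMax_fst (hf : Measurable f) :
    Measurable fun z : ℝ × ℝ => dyadicMax (fun s => f (s, z.2)) z.1 :=
  (measurable_dyadicMax_param (α := ℝ) (f := fun y s => f (s, y)) (hf.comp measurable_swap)).comp
    measurable_swap

lemma measurable_dyadicMax2 (hf : Measurable f) : Measurable (dyadicMax2 f) :=
  measurable_dyadicMax_param (α := ℝ) (f := fun s y => dyadicMax (fun s' => f (s', y)) s)
    (measurable_dyadicMax_fst hf)

lemma dyadicMax2_le (hf : ∀ z, f z ≤ b) (z : ℝ × ℝ) : dyadicMax2 f z ≤ b :=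
  dyadicMax_le (fun _ => dyadicMax_le (fun _ => hf _) _) _

lemma lintegral_ne_top_of_support {h : ℝ → ℝ≥0∞} (hb : b ≠ ∞) (hh : ∀ x, h x ≤ b)
    (hs : ∀ x, x ∉ Ico (0 : ℝ) 1 → h x = 0) : ∫⁻ x, h x ≠ ∞ := by
  refine ne_top_of_le_ne_top hb ?_
  calc ∫⁻ x, h x ≤ ∫⁻ x, (Ico (0 : ℝ) 1).indicator (fun _ => b) x := lintegral_mono fun x => by
        by_cases hx : x ∈ Ico (0 : ℝ) 1
        · rw [indicator_of_mem hx]; exact hh x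
        · rw [hs x hx]; exact zero_le
    _ = b := by rw [lintegral_indicator measurableSet_Ico, setLIntegral_const]; simp

/-- The one-dimensional maximal inequality is applied in each variable in turn, so the constant `4`
is squared. Support in the unit square supplies the integrability of every slice. -/
lemma lintegral_sq_dyadicMax2_le (hf : Measurable f) (hb : b ≠ ∞) (hfb : ∀ z, f z ≤ b)
    (hs : ∀ z, z ∉ Ico (0 : ℝ) 1 ×ˢ Ico (0 : ℝ) 1 → f z = 0) :
    ∫⁻ z, dyadicMax2 f z ^ 2 ≤ 16 * ∫⁻ z, f z ^ 2 := by
  have hm1 := measurable_dyadicMax_fst hf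
  have e0 : ∀ s y, y ∉ Ico (0 : ℝ) 1 → dyadicMax (fun s' => f (s', y)) s = 0 := by
    intro s y hy
    refine le_antisymm (dyadicMax_le (fun s' => ?_) s) zero_le
    rw [hs _ fun h => hy h.2]
  have h1 : ∀ s, ∫⁻ y, dyadicMax2 f (s, y) ^ 2 ≤ 4 * ∫⁻ y, dyadicMax (fun s' => f (s', y)) s ^ 2 :=
    fun s => lintegral_sq_dyadicMax_le (hm1.comp measurable_prodMk_left) hb
      (fun y => dyadicMax_le (fun _ => hfb _) _)
      (lintegral_ne_top_of_support hb (fun y => dyadicMax_le (fun _ => hfb _) _) (e0 s))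
  have h2 : ∀ y, ∫⁻ s, dyadicMax (fun s' => f (s', y)) s ^ 2 ≤ 4 * ∫⁻ s, f (s, y) ^ 2 :=
    fun y => lintegral_sq_dyadicMax_le (hf.comp measurable_prodMk_right) hb (fun s => hfb _)
      (lintegral_ne_top_of_support hb (fun s => hfb _) fun s hx => hs _ fun h => hx h.1)
  rw [Measure.volume_eq_prod, lintegral_prod _ ((measurable_dyadicMax2 hf).pow_const 2).aemeasurable,
    lintegral_prod_symm _ (hf.pow_const 2).aemeasurable]
  calc ∫⁻ s, ∫⁻ y, dyadicMax2 f (s, y) ^ 2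
      ≤ ∫⁻ s, 4 * ∫⁻ y, dyadicMax (fun s' => f (s', y)) s ^ 2 := lintegral_mono h1
    _ = 4 * ∫⁻ y, ∫⁻ s, dyadicMax (fun s' => f (s', y)) s ^ 2 := by
        rw [lintegral_const_mul' _ _ (by simp), lintegral_lintegral_swap]
        exact (hm1.pow_const 2).aemeasurable
    _ ≤ 4 * ∫⁻ y, 4 * ∫⁻ s, f (s, y) ^ 2 := by gcongr with y; exact h2 y
    _ = _ := by
        rw [lintegral_const_mul' _ _ (by simp), ← mul_assoc]; norm_num

/-- The one-dimensional bound is applied in the first variable, and then in the second to the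
maximal functions at its two end points. This produces the four corners, whatever the shape of the
rectangle. -/
lemma setLIntegral_prod_Ioc_le (hf : Measurable f) {a b c d : ℝ} (hab : a < b) (hab1 : b - a ≤ 1)
    (hcd : c < d) (hcd1 : d - c ≤ 1) :
    (volume (Ioc a b ×ˢ Ioc c d))⁻¹ * ∫⁻ z in Ioc a b ×ˢ Ioc c d, f z ≤
      4 * (dyadicMax2 f (a, c) + dyadicMax2 f (a, d) + dyadicMax2 f (b, c) + dyadicMax2 f (b, d)) := by
  have hm1 := measurable_dyadicMax_fst hf
  have hv : volume (Ioc a b ×ˢ Ioc c d) = ENNReal.ofReal (b - a) * ENNReal.ofReal (d - c) := by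
    rw [Measure.volume_eq_prod, Measure.prod_prod, Real.volume_Ioc, Real.volume_Ioc]
  have hma : ∀ a, Measurable fun y => dyadicMax (fun s => f (s, y)) a := fun a =>
    hm1.comp measurable_prodMk_left
  have h : ∫⁻ z in Ioc a b ×ˢ Ioc c d, f z ≤ ENNReal.ofReal (b - a) * ENNReal.ofReal (d - c) *
      (4 * (dyadicMax2 f (a, c) + dyadicMax2 f (a, d) + dyadicMax2 f (b, c) + dyadicMax2 f (b, d))) := by
    rw [Measure.volume_eq_prod, ← Measure.prod_restrict, lintegral_prod_symm _ hf.aemeasurable]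
    calc ∫⁻ y in Ioc c d, ∫⁻ s in Ioc a b, f (s, y)
        ≤ ∫⁻ y in Ioc c d, ENNReal.ofReal (b - a) * (2 * (dyadicMax (fun s => f (s, y)) a
            + dyadicMax (fun s => f (s, y)) b)) := lintegral_mono fun y =>
          setLIntegral_Ioc_le_dyadicMax (f := fun s => f (s, y)) (hf.comp measurable_prodMk_right) hab hab1
      _ = ENNReal.ofReal (b - a) * (2 * ((∫⁻ y in Ioc c d, dyadicMax (fun s => f (s, y)) a)
            + ∫⁻ y in Ioc c d, dyadicMax (fun s => f (s, y)) b)) := by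
          rw [lintegral_const_mul' _ _ ENNReal.ofReal_ne_top, lintegral_const_mul' _ _ (by simp),
            lintegral_add_left (hma a)]
      _ ≤ ENNReal.ofReal (b - a) * (2 * (ENNReal.ofReal (d - c) * (2 * (dyadicMax2 f (a, c)
            + dyadicMax2 f (a, d))) + ENNReal.ofReal (d - c) * (2 * (dyadicMax2 f (b, c)
            + dyadicMax2 f (b, d))))) := by
          gcongr
          · exact setLIntegral_Ioc_le_dyadicMax (hma a) hcd hcd1
          · exact setLIntegral_Ioc_le_dyadicMax (hma b) hcd hcd1
      _ = _ := by ring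
  rw [hv]
  have hne : ENNReal.ofReal (b - a) * ENNReal.ofReal (d - c) ≠ 0 := by
    refine mul_ne_zero ?_ ?_ <;> · rw [Ne, ENNReal.ofReal_eq_zero, not_le]; linarith
  calc _ ≤ (ENNReal.ofReal (b - a) * ENNReal.ofReal (d - c))⁻¹ * _ := mul_le_mul_right h _
    _ = _ := by
      rw [← mul_assoc, ENNReal.inv_mul_cancel hne (by finiteness), one_mul]

end plane

/-! ### Node cells of well distributed nodes -/

section nodes
variable {n : ℕ} {x : Fin n → ℝ}

lemma prevOrderStat_lt (hx : ∀ k, x k ∈ Ioo (0 : ℝ) 1) (hinj : Function.Injective x) (i : Fin n) :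
    prevOrderStat x i < orderStat x i := by
  unfold prevOrderStat
  split_ifs with h
  · exact (hx _).1
  · refine lt_of_le_of_ne (orderStat_mono x ?_) fun he => ?_
    · rw [Fin.le_def]; exact Nat.sub_le _ _
    · have := (Tuple.sort x).injective (hinj he)
      have := congrArg Fin.val this
      simp only at this
      omega

lemma nodeCell_subset_Ioo (hx : ∀ k, x k ∈ Ioo (0 : ℝ) 1) (i : Fin n) : nodeCell x i ⊆ Ioo 0 1 :=
  fun _ hy => ⟨(prevOrderStat_nonneg (fun k => Ioo_subset_Icc_self (hx k)) i).trans_lt hy.1,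
    hy.2.trans_lt (orderStat_mem hx i).2⟩

lemma orderStat_sub_prev_le (hx : ∀ k, x k ∈ Ioo (0 : ℝ) 1) (i : Fin n) :
    orderStat x i - prevOrderStat x i ≤ 1 := by
  have h1 := prevOrderStat_nonneg (fun k => Ioo_subset_Icc_self (hx k)) i
  have h2 := (orderStat_mem hx i).2
  linarith

/-- Indices start at zero, so the uniform cell ends at `(i+1)/n`, where the `i`-th order statistic
is expected, and starts where its predecessor is expected. For `i = 0` both start at `0`. -/
lemma abs_sub_le_of_mem_cells (hn : 0 < n) {d : ℝ} (hd : 0 ≤ d)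
    (hdev : ∀ i : Fin n, |orderStat x i - ((i : ℝ) + 1) / n| ≤ d) {i : Fin n} {a b : ℝ}
    (ha : a ∈ cell n i) (hb : b ∈ nodeCell x i) : |a - b| ≤ d + 1 / n := by
  have hn' : (0 : ℝ) < n := by exact_mod_cast hn
  have ha' : (i : ℝ) / n ≤ a ∧ a < ((i : ℝ) + 1) / n := ha
  have hb' : prevOrderStat x i < b ∧ b ≤ orderStat x i := hb
  have e : ((i : ℝ) + 1) / n = (i : ℝ) / n + 1 / n := by ring
  have h1 := abs_le.1 (hdev i)
  have h2 : (i : ℝ) / n - d ≤ prevOrderStat x i := by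
    unfold prevOrderStat
    split_ifs with h
    · rw [h]; simp only [Nat.cast_zero, zero_div]; linarith
    · have h3 := abs_le.1 (hdev ⟨(i : ℕ) - 1, lt_of_le_of_lt (Nat.sub_le _ _) i.isLt⟩)
      have e2 : (((i : ℕ) - 1 : ℕ) : ℝ) + 1 = i := by
        rw [Nat.cast_sub (by omega)]; push_cast; ring
      simp only [e2] at h3
      linarith
  rw [e] at ha' h1
  rw [abs_le]; constructor <;> linarith

lemma sum_orderStat (h : ℝ → ℝ≥0∞) : ∑ i, h (orderStat x i) = ∑ i, h (x i) :=
  Equiv.sum_comp (Tuple.sort x) fun j => h (x j)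

lemma sum_prevOrderStat_le (h : ℝ → ℝ≥0∞) : ∑ i, h (prevOrderStat x i) ≤ h 0 + ∑ i, h (x i) := by
  rw [← sum_orderStat (x := x) h]
  cases n with
  | zero => simp
  | succ m =>
    rw [Fin.sum_univ_succ]
    refine add_le_add ?_ ?_
    · simp [prevOrderStat]
    · rw [Fin.sum_univ_castSucc (f := fun i => h (orderStat x i))]
      refine le_trans (le_of_eq ?_) le_self_add
      refine Finset.sum_congr rfl fun i _ => ?_
      congr 1

/-- Summing a bounded function over the corners of the products of node cells. -/
lemma sum_corners_le {h : ℝ × ℝ → ℝ≥0∞} {c : ℝ≥0∞} (hc : ∀ z, h z ≤ c) :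
    ∑ i, ∑ j, (h (prevOrderStat x i, prevOrderStat x j) + h (prevOrderStat x i, orderStat x j)
      + h (orderStat x i, prevOrderStat x j) + h (orderStat x i, orderStat x j)) ≤
      4 * ∑ i, ∑ j, h (x i, x j) + 4 * n * c := by
  set S := ∑ i, ∑ j, h (x i, x j) with hS
  have e4 : ∑ i, ∑ j, h (orderStat x i, orderStat x j) = S := by
    rw [Finset.sum_congr rfl fun i _ => sum_orderStat fun y => h (orderStat x i, y)]
    exact sum_orderStat fun s => ∑ j, h (s, x j)
  have e2 : ∑ i, ∑ j, h (prevOrderStat x i, orderStat x j) ≤ n * c + S := by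
    rw [Finset.sum_congr rfl fun i _ => sum_orderStat fun y => h (prevOrderStat x i, y)]
    refine (sum_prevOrderStat_le fun s => ∑ j, h (s, x j)).trans ?_
    gcongr
    refine (Finset.sum_le_sum fun j _ => hc _).trans ?_
    simp
  have e3 : ∑ i, ∑ j, h (orderStat x i, prevOrderStat x j) ≤ n * c + S := by
    refine (Finset.sum_le_sum fun i _ => sum_prevOrderStat_le fun y => h (orderStat x i, y)).trans ?_
    rw [sum_orderStat fun s => h (s, 0) + ∑ j, h (s, x j), Finset.sum_add_distrib]
    gcongr
    refine (Finset.sum_le_sum fun j _ => hc _).trans ?_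
    simp
  -- The predecessors are the nodes without the largest one, together with the artificial point `0`.
  -- Each row or column through `0` costs at most `n` times the supremum.
  have e1 : ∑ i, ∑ j, h (prevOrderStat x i, prevOrderStat x j) ≤ 2 * (n * c) + S := by
    refine (Finset.sum_le_sum fun i _ => sum_prevOrderStat_le fun y => h (prevOrderStat x i, y)).trans ?_
    rw [Finset.sum_add_distrib, two_mul, add_assoc]
    refine add_le_add ?_ ?_
    · refine (Finset.sum_le_sum fun j _ => hc _).trans ?_
      simp
    · refine (sum_prevOrderStat_le fun s => ∑ j, h (s, x j)).trans ?_
      gcongr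
      refine (Finset.sum_le_sum fun j _ => hc _).trans ?_
      simp
  simp only [Finset.sum_add_distrib]
  rw [e4]
  calc _ ≤ (2 * (n * c) + S) + (n * c + S) + (n * c + S) + S := by gcongr
    _ = _ := by ring

end nodes

/-! ### Node averages against uniform cells -/

section displacement
variable {F : ℝ × ℝ → ℝ} {B σ L : ℝ}

/-- The distance of `F` to its averages over the blocks of side `1/m`. -/
noncomputable def blockDev (m : ℕ) (F : ℝ × ℝ → ℝ) : ℝ × ℝ → ℝ≥0∞ :=
  (Ico (0 : ℝ) 1 ×ˢ Ico (0 : ℝ) 1).indicator fun z =>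
    ENNReal.ofReal |F z - inj2 m (fun k l => ⨍ y in cell m k ×ˢ cell m l, F y) z|

lemma measurable_blockDev (m : ℕ) (hF : Measurable F) : Measurable (blockDev m F) :=
  (hF.sub (measurable_inj2 _)).abs.ennreal_ofReal.indicator (measurableSet_Ico.prod measurableSet_Ico)

lemma blockDev_eq_zero (m : ℕ) {z : ℝ × ℝ} (hz : z ∉ Ico (0 : ℝ) 1 ×ˢ Ico (0 : ℝ) 1) :
    blockDev m F z = 0 := indicator_of_notMem hz _

lemma exists_mem_block {m : ℕ} (hm : 0 < m) {z : ℝ × ℝ} (hz : z ∈ Ico (0 : ℝ) 1 ×ˢ Ico (0 : ℝ) 1) :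
    ∃ k l : Fin m, z ∈ cell m k ×ˢ cell m l := by
  obtain ⟨k, hk⟩ := exists_mem_cell hm hz.1
  obtain ⟨l, hl⟩ := exists_mem_cell hm hz.2
  exact ⟨k, l, hk, hl⟩

lemma blockDev_of_mem {m : ℕ} {k l : Fin m} {z : ℝ × ℝ} (hz : z ∈ cell m k ×ˢ cell m l) :
    blockDev m F z = ENNReal.ofReal |F z - ⨍ y in cell m k ×ˢ cell m l, F y| := by
  unfold blockDev
  rw [indicator_of_mem (show z ∈ Ico (0 : ℝ) 1 ×ˢ Ico (0 : ℝ) 1 from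
    ⟨cell_subset k hz.1, cell_subset l hz.2⟩), inj2_apply_of_mem _ hz]

lemma cell_prod_subset {m : ℕ} (k l : Fin m) :
    cell m k ×ˢ cell m l ⊆ Icc (0 : ℝ) 1 ×ˢ Icc (0 : ℝ) 1 :=
  prod_mono (cell_subset_Icc k) (cell_subset_Icc l)

lemma blockDev_le (hB : 0 ≤ B) (hFB : ∀ z, |F z| ≤ B) {m : ℕ} (hm : 0 < m) (z : ℝ × ℝ) :
    blockDev m F z ≤ ENNReal.ofReal (2 * B) := by
  by_cases hz : z ∈ Ico (0 : ℝ) 1 ×ˢ Ico (0 : ℝ) 1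
  · obtain ⟨k, l, hkl⟩ := exists_mem_block hm hz
    rw [blockDev_of_mem hkl]
    refine ENNReal.ofReal_le_ofReal ((abs_sub _ _).trans ?_)
    have := abs_setAverage_le (μ := volume) (D := univ) hB (ae_of_all _ hFB)
      (subset_univ (cell m k ×ˢ cell m l)) (by rw [volume_cell_prod]; simp)
    linarith [hFB z]
  · rw [blockDev_eq_zero m hz]; exact zero_le

lemma abs_sub_lt_of_mem_cell {m : ℕ} {k : Fin m} {a b : ℝ} (ha : a ∈ cell m k) (hb : b ∈ cell m k) :
    |a - b| < 1 / m := by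
  have ha' : (k : ℝ) / m ≤ a ∧ a < ((k : ℝ) + 1) / m := ha
  have hb' : (k : ℝ) / m ≤ b ∧ b < ((k : ℝ) + 1) / m := hb
  have e : ((k : ℝ) + 1) / m = (k : ℝ) / m + 1 / m := by ring
  rw [e] at ha' hb'
  rw [abs_lt]; constructor <;> linarith

/-- Comparing a value with the average over a nearby block. -/
lemma ofReal_sq_sub_block_le (hF : Measurable F) (hFB : ∀ z, |F z| ≤ B) {m : ℕ} (hm : 0 < m)
    {k l : Fin m} {z y : ℝ × ℝ} (hy : y ∈ cell m k ×ˢ cell m l) (h1 : |z.1 - y.1| ≤ 1 / m)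
    (h2 : |z.2 - y.2| ≤ 1 / m) :
    ENNReal.ofReal ((F z - ⨍ w in cell m k ×ˢ cell m l, F w) ^ 2) ≤
      (m : ℝ≥0∞) ^ 2 * ∫⁻ w in (Icc (0 : ℝ) 1 ×ˢ Icc (0 : ℝ) 1) ∩ Metric.ball z (2 / m),
        ENNReal.ofReal ((F w - F z) ^ 2) := by
  have hm' : (0 : ℝ) < m := by exact_mod_cast hm
  have hv : (volume (cell m k ×ˢ cell m l))⁻¹ = (m : ℝ≥0∞) ^ 2 := by
    rw [volume_cell_prod, ← ENNReal.ofReal_inv_of_pos (by positivity), one_div, inv_inv,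
      ENNReal.ofReal_pow hm'.le, ENNReal.ofReal_natCast]
  rw [← neg_sub, neg_sq]
  refine (ofReal_sq_setAverage_sub_le hF hFB (s := cell m k ×ˢ cell m l)
    (by rw [volume_cell_prod, Ne, ENNReal.ofReal_eq_zero, not_le]; positivity)
    (by rw [volume_cell_prod]; simp) (F z)).trans ?_
  rw [hv]
  gcongr
  refine fun w hw => ⟨cell_prod_subset k l hw, ?_⟩
  rw [Metric.mem_ball, Prod.dist_eq, max_lt_iff, Real.dist_eq, Real.dist_eq]
  have e : (2 : ℝ) / m = 1 / m + 1 / m := by ring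
  have a1 := abs_sub_lt_of_mem_cell hw.1 hy.1
  have a2 := abs_sub_lt_of_mem_cell hw.2 hy.2
  rw [abs_lt] at a1 a2
  rw [abs_le] at h1 h2
  rw [e, abs_lt, abs_lt]
  refine ⟨⟨?_, ?_⟩, ?_, ?_⟩ <;> linarith

lemma blockDev_sq_le (hF : Measurable F) (hFB : ∀ z, |F z| ≤ B) {m : ℕ} (hm : 0 < m) (z : ℝ × ℝ) :
    blockDev m F z ^ 2 ≤ (Ico (0 : ℝ) 1 ×ˢ Ico (0 : ℝ) 1).indicator (fun z => (m : ℝ≥0∞) ^ 2 *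
      ∫⁻ w in (Icc (0 : ℝ) 1 ×ˢ Icc (0 : ℝ) 1) ∩ Metric.ball z (2 / m),
        ENNReal.ofReal ((F w - F z) ^ 2)) z := by
  by_cases hz : z ∈ Ico (0 : ℝ) 1 ×ˢ Ico (0 : ℝ) 1
  · obtain ⟨k, l, hkl⟩ := exists_mem_block hm hz
    rw [indicator_of_mem hz, blockDev_of_mem hkl, ← ENNReal.ofReal_pow (abs_nonneg _), sq_abs]
    exact ofReal_sq_sub_block_le hF hFB hm hkl (by rw [sub_self, abs_zero]; positivity)
      (by rw [sub_self, abs_zero]; positivity)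
  · rw [blockDev_eq_zero m hz]; simp

lemma lintegral_increments_le (hF : Measurable F) (hσ : 0 ≤ σ) (hL : 0 ≤ L)
    (hH : HolderSq (Icc (0 : ℝ) 1 ×ˢ Icc (0 : ℝ) 1) σ L F) {m : ℕ} (hm : 0 < m) :
    ∫⁻ z, (m : ℝ≥0∞) ^ 2 * (∫⁻ w in (Icc (0 : ℝ) 1 ×ˢ Icc (0 : ℝ) 1) ∩ Metric.ball z (2 / m),
        ENNReal.ofReal ((F w - F z) ^ 2)) ∂leb2 ≤ ENNReal.ofReal (16 * L * (2 / m) ^ (2 * σ)) := by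
  have hm' : (0 : ℝ) < m := by exact_mod_cast hm
  have hb : volume (Metric.ball (0 : ℝ × ℝ) (2 / m)) = ENNReal.ofReal (16 / (m : ℝ) ^ 2) := by
    rw [show (0 : ℝ × ℝ) = (0, 0) from rfl, ← ball_prod_same, Measure.volume_eq_prod,
      Measure.prod_prod, Real.volume_ball, ← ENNReal.ofReal_mul (by positivity)]
    congr 1; field_simp; norm_num
  rw [lintegral_const_mul' _ _ (by simp)]
  refine (mul_le_mul_right (lintegral_lintegral_ball_le (measurableSet_Icc.prod measurableSet_Icc)
    hF hσ hL hH (ρ := 2 / m)) _).trans (le_of_eq ?_)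
  rw [hb, ← ENNReal.ofReal_natCast, ← ENNReal.ofReal_pow hm'.le, ← ENNReal.ofReal_mul (by positivity),
    ← ENNReal.ofReal_mul (by positivity)]
  congr 1; field_simp

lemma lintegral_blockDev_sq_le (hF : Measurable F) (hFB : ∀ z, |F z| ≤ B) (hσ : 0 ≤ σ) (hL : 0 ≤ L)
    (hH : HolderSq (Icc (0 : ℝ) 1 ×ˢ Icc (0 : ℝ) 1) σ L F) {m : ℕ} (hm : 0 < m) :
    ∫⁻ z, blockDev m F z ^ 2 ≤ ENNReal.ofReal (16 * L * (2 / m) ^ (2 * σ)) := by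
  refine (lintegral_mono fun z => blockDev_sq_le hF hFB hm z).trans ?_
  rw [lintegral_indicator (measurableSet_Ico.prod measurableSet_Ico)]
  refine le_trans (lintegral_mono_set' ?_) (lintegral_increments_le hF hσ hL hH hm)
  exact ae_of_all _ (prod_mono Ico_subset_Icc_self Ico_subset_Icc_self)

/-- The distance between a value and a node average. -/
lemma ofReal_sq_sub_nodeAverage_le (hF : Measurable F) (hFB : ∀ z, |F z| ≤ B)
    {m n : ℕ} (hm : 0 < m) (hn : 0 < n) {x : Fin n → ℝ} (hx : ∀ k, x k ∈ Ioo (0 : ℝ) 1)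
    (hinj : Function.Injective x) {d : ℝ} (hd : 0 ≤ d)
    (hdev : ∀ i : Fin n, |orderStat x i - ((i : ℝ) + 1) / n| ≤ d) (hdm : d + 1 / n ≤ 1 / m)
    {i j : Fin n} {z : ℝ × ℝ} (hz : z ∈ cell n i ×ˢ cell n j) :
    ENNReal.ofReal ((F z - ⨍ y in nodeCell x i ×ˢ nodeCell x j, F y) ^ 2) ≤
      2 * ((m : ℝ≥0∞) ^ 2 * ∫⁻ w in (Icc (0 : ℝ) 1 ×ˢ Icc (0 : ℝ) 1) ∩ Metric.ball z (2 / m),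
        ENNReal.ofReal ((F w - F z) ^ 2))
      + 128 * (dyadicMax2 (blockDev m F) (prevOrderStat x i, prevOrderStat x j) ^ 2
        + dyadicMax2 (blockDev m F) (prevOrderStat x i, orderStat x j) ^ 2
        + dyadicMax2 (blockDev m F) (orderStat x i, prevOrderStat x j) ^ 2
        + dyadicMax2 (blockDev m F) (orderStat x i, orderStat x j) ^ 2) := by
  set N := nodeCell x i ×ˢ nodeCell x j with hN
  set Q := (m : ℝ≥0∞) ^ 2 * ∫⁻ w in (Icc (0 : ℝ) 1 ×ˢ Icc (0 : ℝ) 1) ∩ Metric.ball z (2 / m),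
        ENNReal.ofReal ((F w - F z) ^ 2) with hQ
  have hNm : MeasurableSet N := (measurableSet_nodeCell x i).prod (measurableSet_nodeCell x j)
  have hNv : volume N = ENNReal.ofReal (orderStat x i - prevOrderStat x i) *
      ENNReal.ofReal (orderStat x j - prevOrderStat x j) := by
    rw [hN, Measure.volume_eq_prod, Measure.prod_prod, nodeCell, nodeCell, Real.volume_Ioc,
      Real.volume_Ioc]
  have hi := prevOrderStat_lt hx hinj i
  have hj := prevOrderStat_lt hx hinj j
  have hN0 : volume N ≠ 0 := by
    rw [hNv]
    refine mul_ne_zero ?_ ?_ <;> · rw [Ne, ENNReal.ofReal_eq_zero, not_le]; linarith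
  have hNt : volume N ≠ ∞ := by rw [hNv]; finiteness
  have hfin : IsFiniteMeasure (volume.restrict N) := ⟨by simpa using hNt.lt_top⟩
  have hμ : 0 < volume.real N := ENNReal.toReal_pos hN0 hNt
  have iF : Integrable F (volume.restrict N) :=
    Integrable.of_bound hF.aestronglyMeasurable B (ae_of_all _ hFB)
  have iFz : Integrable (fun y => F z - F y) (volume.restrict N) := (integrable_const _).sub iF
  -- the pointwise bound
  have hpt : ∀ y ∈ N, ENNReal.ofReal |F z - F y| ≤ Q ^ (1 / 2 : ℝ) + blockDev m F y := by
    intro y hy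
    have hyQ : y ∈ Ico (0 : ℝ) 1 ×ˢ Ico (0 : ℝ) 1 :=
      ⟨Ioo_subset_Ico_self (nodeCell_subset_Ioo hx i hy.1), Ioo_subset_Ico_self (nodeCell_subset_Ioo hx j hy.2)⟩
    obtain ⟨k, l, hkl⟩ := exists_mem_block hm hyQ
    have h1 := ofReal_sq_sub_block_le hF hFB hm (z := z) hkl
      ((abs_sub_le_of_mem_cells hn hd hdev hz.1 hy.1).trans hdm)
      ((abs_sub_le_of_mem_cells hn hd hdev hz.2 hy.2).trans hdm)
    have h2 : ENNReal.ofReal |F z - ⨍ w in cell m k ×ˢ cell m l, F w| ≤ Q ^ (1 / 2 : ℝ) := by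
      have := ENNReal.rpow_le_rpow h1 (show (0 : ℝ) ≤ 1 / 2 by norm_num)
      refine le_trans (le_of_eq ?_) this
      rw [ENNReal.ofReal_rpow_of_nonneg (sq_nonneg _) (by norm_num), ← Real.sqrt_eq_rpow,
        Real.sqrt_sq_eq_abs]
    rw [blockDev_of_mem hkl]
    refine le_trans ?_ (add_le_add h2 le_rfl)
    rw [← ENNReal.ofReal_add (abs_nonneg _) (abs_nonneg _)]
    refine ENNReal.ofReal_le_ofReal ?_
    rw [abs_sub_comm (F y)]
    exact abs_sub_le _ _ _
  have hav : ENNReal.ofReal |F z - ⨍ y in N, F y| ≤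
      (volume N)⁻¹ * ∫⁻ y in N, ENNReal.ofReal |F z - F y| := by
    have e : F z - ⨍ y in N, F y = ⨍ y in N, (F z - F y) := by
      rw [setAverage_eq, setAverage_eq, integral_sub (integrable_const _) iF, integral_const,
        measureReal_restrict_apply_univ, smul_sub, smul_smul, inv_mul_cancel₀ hμ.ne', one_smul]
    rw [e, setAverage_eq, smul_eq_mul, abs_mul, abs_of_pos (inv_pos.2 hμ),
      ENNReal.ofReal_mul (by positivity), ENNReal.ofReal_inv_of_pos hμ, Measure.real,
      ENNReal.ofReal_toReal hNt]
    gcongr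
    refine (ENNReal.ofReal_le_ofReal (abs_integral_le_integral_abs)).trans (le_of_eq ?_)
    exact ofReal_integral_eq_lintegral_ofReal iFz.abs (ae_of_all _ fun y => abs_nonneg _)
  have hbm := measurable_blockDev m hF
  have hint : (volume N)⁻¹ * ∫⁻ y in N, ENNReal.ofReal |F z - F y| ≤
      Q ^ (1 / 2 : ℝ) + 4 * (dyadicMax2 (blockDev m F) (prevOrderStat x i, prevOrderStat x j)
        + dyadicMax2 (blockDev m F) (prevOrderStat x i, orderStat x j)
        + dyadicMax2 (blockDev m F) (orderStat x i, prevOrderStat x j)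
        + dyadicMax2 (blockDev m F) (orderStat x i, orderStat x j)) := by
    -- The first term does not depend on `y`. The second is averaged over a node cell of arbitrary
    -- proportions, so its mean is bounded through the maximal function at the corners.
    calc _ ≤ (volume N)⁻¹ * ∫⁻ y in N, (Q ^ (1 / 2 : ℝ) + blockDev m F y) := by
          refine mul_le_mul_right ?_ _
          exact setLIntegral_mono (measurable_const.add hbm) hpt
      _ = Q ^ (1 / 2 : ℝ) + (volume N)⁻¹ * ∫⁻ y in N, blockDev m F y := by
          rw [lintegral_add_left measurable_const, setLIntegral_const, mul_add, mul_comm (Q ^ _),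
            ← mul_assoc, ENNReal.inv_mul_cancel hN0 hNt, one_mul]
      _ ≤ _ := by
          refine add_le_add le_rfl ?_
          exact setLIntegral_prod_Ioc_le hbm hi (orderStat_sub_prev_le hx i) hj
            (orderStat_sub_prev_le hx j)
  have h := hav.trans hint
  rw [← sq_abs, ENNReal.ofReal_pow (abs_nonneg _)]
  have hsq : ∀ a b : ℝ≥0∞, (a + b) ^ 2 ≤ 2 * (a ^ 2 + b ^ 2) := fun a b => by
    calc (a + b) ^ 2 = a ^ 2 + b ^ 2 + 2 * (a * b) := by ring
      _ ≤ a ^ 2 + b ^ 2 + (a ^ 2 + b ^ 2) := by gcongr; exact two_mul_le_sq_add_sq_ennreal a b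
      _ = _ := by ring
  refine (pow_le_pow_left' h 2).trans ((hsq _ _).trans ?_)
  set g1 := dyadicMax2 (blockDev m F) (prevOrderStat x i, prevOrderStat x j)
  set g2 := dyadicMax2 (blockDev m F) (prevOrderStat x i, orderStat x j)
  set g3 := dyadicMax2 (blockDev m F) (orderStat x i, prevOrderStat x j)
  set g4 := dyadicMax2 (blockDev m F) (orderStat x i, orderStat x j)
  have e1 : (Q ^ (1 / 2 : ℝ)) ^ 2 = Q := by
    rw [← ENNReal.rpow_natCast, ← ENNReal.rpow_mul]; norm_num
  rw [e1, mul_add]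
  refine add_le_add le_rfl ?_
  -- The constant `128` is `32` times the `4` lost in squaring a sum of four terms.
  calc 2 * (4 * (g1 + g2 + g3 + g4)) ^ 2 = 32 * ((g1 + g2) + (g3 + g4)) ^ 2 := by ring
    _ ≤ 32 * (2 * (2 * (g1 ^ 2 + g2 ^ 2) + 2 * (g3 ^ 2 + g4 ^ 2))) := by
        gcongr
        exact (hsq _ _).trans (by gcongr <;> exact hsq _ _)
    _ = _ := by ring

/-- The mean square distance between a function and its node averages, transplanted to the
uniform cells. -/
theorem lintegral_sq_sub_inj2_nodeAverage_le (hF : Measurable F) (hB : 0 ≤ B)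
    (hFB : ∀ z, |F z| ≤ B) (hσ : 0 ≤ σ) (hL : 0 ≤ L)
    (hH : HolderSq (Icc (0 : ℝ) 1 ×ˢ Icc (0 : ℝ) 1) σ L F)
    {m n : ℕ} (hm : 0 < m) (hn : 0 < n) {x : Fin n → ℝ} (hx : ∀ k, x k ∈ Ioo (0 : ℝ) 1)
    (hinj : Function.Injective x) {d : ℝ} (hd : 0 ≤ d)
    (hdev : ∀ i : Fin n, |orderStat x i - ((i : ℝ) + 1) / n| ≤ d) (hdm : d + 1 / n ≤ 1 / m) :
    ∫⁻ z, ENNReal.ofReal ((F z - inj2 n (fun i j => ⨍ y in nodeCell x i ×ˢ nodeCell x j, F y) z) ^ 2)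
        ∂leb2 ≤
      2 * ENNReal.ofReal (16 * L * (2 / m) ^ (2 * σ))
      + 128 * (4 * ∑ i, ∑ j, dyadicMax2 (blockDev m F) (x i, x j) ^ 2
        + 4 * n * ENNReal.ofReal (2 * B) ^ 2) * ENNReal.ofReal (1 / (n : ℝ) ^ 2) := by
  set q := fun z : ℝ × ℝ => (m : ℝ≥0∞) ^ 2 *
    ∫⁻ w in (Icc (0 : ℝ) 1 ×ˢ Icc (0 : ℝ) 1) ∩ Metric.ball z (2 / m),
        ENNReal.ofReal ((F w - F z) ^ 2) with hq
  set c := fun i j : Fin n => dyadicMax2 (blockDev m F) (prevOrderStat x i, prevOrderStat x j) ^ 2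
        + dyadicMax2 (blockDev m F) (prevOrderStat x i, orderStat x j) ^ 2
        + dyadicMax2 (blockDev m F) (orderStat x i, prevOrderStat x j) ^ 2
        + dyadicMax2 (blockDev m F) (orderStat x i, orderStat x j) ^ 2 with hc
  have hsplit : ∀ φ : ℝ × ℝ → ℝ≥0∞, ∫⁻ z, φ z ∂leb2 =
      ∑ e : Fin n × Fin n, ∫⁻ z in cell n e.1 ×ˢ cell n e.2, φ z := fun φ => by
    rw [leb2_eq_sum hn, lintegral_sum_measure, tsum_fintype]
  have hcell : ∀ e : Fin n × Fin n, ∫⁻ z in cell n e.1 ×ˢ cell n e.2, ENNReal.ofReal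
      ((F z - inj2 n (fun i j => ⨍ y in nodeCell x i ×ˢ nodeCell x j, F y) z) ^ 2) ≤
      (∫⁻ z in cell n e.1 ×ˢ cell n e.2, 2 * q z) + 128 * c e.1 e.2 * ENNReal.ofReal (1 / (n : ℝ) ^ 2) := by
    intro e
    rw [← volume_cell_prod e.1 e.2, ← setLIntegral_const, ← lintegral_add_right _ measurable_const]
    refine setLIntegral_mono' ((measurableSet_cell n e.1).prod (measurableSet_cell n e.2)) fun z hz => ?_
    rw [inj2_apply_of_mem _ hz]
    exact ofReal_sq_sub_nodeAverage_le hF hFB hm hn hx hinj hd hdev hdm hz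
  rw [hsplit]
  refine (Finset.sum_le_sum fun e _ => hcell e).trans ?_
  rw [Finset.sum_add_distrib, ← hsplit, lintegral_const_mul' _ _ (by simp)]
  refine add_le_add (mul_le_mul_right (lintegral_increments_le hF hσ hL hH hm) _) ?_
  rw [← Finset.sum_mul, ← Finset.mul_sum, Fintype.sum_prod_type]
  gcongr
  exact sum_corners_le (h := fun z => dyadicMax2 (blockDev m F) z ^ 2) fun z =>
    pow_le_pow_left' (dyadicMax2_le (blockDev_le hB hFB hm) z) 2

end displacement

/-! ### Node averages of random nodes: the displacement estimate in probability. -/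

section displacementProb
variable {F : ℝ × ℝ → ℝ} {B σ L : ℝ}

/-- The averages of a function over the products of node cells. -/
noncomputable def nodeAverage {n : ℕ} (F : ℝ × ℝ → ℝ) (x : Fin n → ℝ) (i j : Fin n) : ℝ :=
  ⨍ z in nodeCell x i ×ˢ nodeCell x j, F z

lemma abs_nodeAverage_le {n : ℕ} (hB : 0 ≤ B) (hFB : ∀ z, |F z| ≤ B) (x : Fin n → ℝ) (i j : Fin n) :
    |nodeAverage F x i j| ≤ B := by
  refine abs_setAverage_le (D := univ) hB (ae_of_all _ hFB) (subset_univ _) ?_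
  rw [nodeCell, nodeCell, Measure.volume_eq_prod, Measure.prod_prod, Real.volume_Ioc, Real.volume_Ioc]
  finiteness

lemma ae_sq_sub_inj2_le {n : ℕ} (hn : 0 < n) (hFB : ∀ z, |F z| ≤ B)
    {W : Fin n → Fin n → ℝ} (hW : ∀ i j, |W i j| ≤ B) :
    ∀ᵐ z ∂leb2, (F z - inj2 n W z) ^ 2 ≤ 4 * B ^ 2 :=
  ae_leb2_of_cells hn fun i j z hz => by
    rw [inj2_apply_of_mem _ hz]
    have h1 := abs_le.1 (hFB z)
    have h2 := abs_le.1 (hW i j)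
    nlinarith

lemma integrable_sq_sub_inj2 {n : ℕ} (hn : 0 < n) (hF : Measurable F) (hFB : ∀ z, |F z| ≤ B)
    {W : Fin n → Fin n → ℝ} (hW : ∀ i j, |W i j| ≤ B) :
    Integrable (fun z => (F z - inj2 n W z) ^ 2) leb2 := by
  refine Integrable.of_bound ((hF.sub (measurable_inj2 W)).pow_const 2).aestronglyMeasurable (4 * B ^ 2) ?_
  filter_upwards [ae_sq_sub_inj2_le hn hFB hW] with z hz
  rwa [Real.norm_eq_abs, abs_of_nonneg (sq_nonneg _)]

lemma integral_sq_sub_inj2_le {n : ℕ} (hn : 0 < n) (hF : Measurable F) (hFB : ∀ z, |F z| ≤ B)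
    {W : Fin n → Fin n → ℝ} (hW : ∀ i j, |W i j| ≤ B) :
    ∫ z, (F z - inj2 n W z) ^ 2 ∂leb2 ≤ 4 * B ^ 2 := by
  calc ∫ z, (F z - inj2 n W z) ^ 2 ∂leb2 ≤ ∫ _z, 4 * B ^ 2 ∂leb2 :=
        integral_mono_ae (integrable_sq_sub_inj2 hn hF hFB hW) (integrable_const _)
          (ae_sq_sub_inj2_le hn hFB hW)
    _ = 4 * B ^ 2 := by simp

/-- The displacement estimate for a fixed block size, up to small probability. -/
lemma measure_pi_integral_sq_gt_le (hF : Measurable F) (hB : 0 < B)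
    (hFB : ∀ z, |F z| ≤ B) (hσ : 0 ≤ σ) (hL : 0 ≤ L)
    (hH : HolderSq (Icc (0 : ℝ) 1 ×ˢ Icc (0 : ℝ) 1) σ L F)
    {m n : ℕ} (hm : 0 < m) (hn : 0 < n) {d : ℝ} (hd : 0 < d) (hdm : d + 1 / n ≤ 1 / m) (s : ℝ) :
    (Measure.pi fun _ : Fin n => leb) {x | ¬ ∫ z, (F z - inj2 n (nodeAverage F x) z) ^ 2 ∂leb2 ≤
        2 ^ 20 * L * (2 / m) ^ (2 * σ) + 2048 * B ^ 2 * (3 * s + 2) / n} ≤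
      ENNReal.ofReal (2 * n * Real.exp (-(2 * n * d ^ 2)) + (n + 1) * Real.exp (-s)) := by
  have hn' : (0 : ℝ) < n := by exact_mod_cast hn
  set ν := Measure.pi fun _ : Fin n => leb
  set τ : ℝ := (2 / m) ^ (2 * σ) with hτ
  have hτ0 : 0 ≤ τ := by positivity
  set G : ℝ × ℝ → ℝ≥0∞ := fun z => dyadicMax2 (blockDev m F) z ^ 2 with hG
  have hbm := measurable_blockDev m hF
  have hGm : Measurable G := (measurable_dyadicMax2 hbm).pow_const 2
  have hGb : ∀ z, G z ≤ ENNReal.ofReal (4 * B ^ 2) := fun z => by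
    refine (pow_le_pow_left' (dyadicMax2_le (blockDev_le hB.le hFB hm) z) 2).trans (le_of_eq ?_)
    rw [← ENNReal.ofReal_pow (by positivity)]; congr 1; ring
  have hGt : ∀ z, G z ≠ ∞ := fun z => ne_top_of_le_ne_top ENNReal.ofReal_ne_top (hGb z)
  have hGi : ∫⁻ z, G z ≤ ENNReal.ofReal (256 * L * τ) := by
    refine (lintegral_sq_dyadicMax2_le hbm ENNReal.ofReal_ne_top (blockDev_le hB.le hFB hm)
      fun z hz => blockDev_eq_zero m hz).trans ?_
    refine (mul_le_mul_right (lintegral_blockDev_sq_le hF hFB hσ hL hH hm) _).trans (le_of_eq ?_)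
    rw [← ENNReal.ofReal_ofNat 16, ← ENNReal.ofReal_mul (by norm_num)]
    congr 1; ring
  -- The squared maximal function is normalized to take values in `[0,1]`, as required by the
  -- deviation bound for double sums; its integral stays of order `τ`.
  set ψ : ℝ × ℝ → ℝ := fun z => (G z).toReal / (4 * B ^ 2) with hψ
  have hψm : Measurable ψ := hGm.ennreal_toReal.div_const _
  have hψ0 : ∀ z, 0 ≤ ψ z := fun z => by positivity
  have hψ1 : ∀ z, ψ z ≤ 1 := fun z => by
    rw [hψ]; simp only
    rw [div_le_one (by positivity)]
    exact ENNReal.toReal_le_of_le_ofReal (by positivity) (hGb z)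
  have hψi : ∫ z, ψ z ∂leb2 ≤ 256 * L * τ / (4 * B ^ 2) := by
    rw [hψ, integral_div]
    gcongr
    rw [integral_toReal hGm.aemeasurable (ae_of_all _ fun z => (hGt z).lt_top)]
    refine ENNReal.toReal_le_of_le_ofReal (by positivity) (le_trans ?_ hGi)
    exact setLIntegral_le_lintegral _ _
  set S1 := {x : Fin n → ℝ | ¬ ∀ i : Fin n, |orderStat x i - ((i : ℝ) + 1) / n| ≤ d}
  set S2 := {x : Fin n → ℝ | 4 * n ^ 2 * (∫ z, ψ z ∂leb2) + 3 * n * s + n < ∑ i, ∑ j, ψ (x i, x j)}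
  have hsub : ∀ᵐ x ∂ν, x ∈ {x : Fin n → ℝ | ¬ ∫ z, (F z - inj2 n (nodeAverage F x) z) ^ 2 ∂leb2 ≤
        2 ^ 20 * L * τ + 2048 * B ^ 2 * (3 * s + 2) / n} → x ∈ S1 ∪ S2 := by
    filter_upwards [ae_pi_mem ae_leb_mem_Ioo, ae_pi_injective] with x hx hinj hbad
    by_contra hc
    simp only [mem_union, not_or] at hc
    have c1 : ∀ i : Fin n, |orderStat x i - ((i : ℝ) + 1) / n| ≤ d := by
      by_contra h; exact hc.1 h
    have c2 : ∑ i, ∑ j, ψ (x i, x j) ≤ 4 * n ^ 2 * (∫ z, ψ z ∂leb2) + 3 * n * s + n := not_lt.1 hc.2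
    refine hbad ?_
    have h := lintegral_sq_sub_inj2_nodeAverage_le hF hB.le hFB hσ hL hH hm hn hx hinj hd.le c1 hdm
    have hint := integrable_sq_sub_inj2 hn hF hFB (abs_nodeAverage_le hB.le hFB x)
    change ∫⁻ z, ENNReal.ofReal ((F z - inj2 n (nodeAverage F x) z) ^ 2) ∂leb2 ≤ _ at h
    rw [← ofReal_integral_eq_lintegral_ofReal hint (ae_of_all _ fun z => sq_nonneg _)] at h
    have eG : ∀ z, dyadicMax2 (blockDev m F) z ^ 2 = ENNReal.ofReal (4 * B ^ 2 * ψ z) := fun z => by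
      rw [hψ]; simp only
      rw [mul_div_cancel₀ _ (by positivity), ENNReal.ofReal_toReal (hGt z)]
    have e0 : ∀ i j, 0 ≤ 4 * B ^ 2 * ψ (x i, x j) := fun i j => mul_nonneg (by positivity) (hψ0 _)
    have eS : ∑ i, ∑ j, dyadicMax2 (blockDev m F) (x i, x j) ^ 2 =
        ENNReal.ofReal (4 * B ^ 2 * ∑ i, ∑ j, ψ (x i, x j)) := by
      simp_rw [eG]
      rw [Finset.mul_sum, ENNReal.ofReal_sum_of_nonneg fun i _ =>
        mul_nonneg (by positivity) (Finset.sum_nonneg fun j _ => hψ0 _)]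
      refine Finset.sum_congr rfl fun i _ => ?_
      rw [Finset.mul_sum, ENNReal.ofReal_sum_of_nonneg fun j _ => e0 i j]
    set Sψ := ∑ i, ∑ j, ψ (x i, x j) with hSψ
    have hSψ0 : 0 ≤ Sψ := Finset.sum_nonneg fun i _ => Finset.sum_nonneg fun j _ => hψ0 _
    have e1 : 2 * ENNReal.ofReal (16 * L * τ) + 128 * (4 * ENNReal.ofReal (4 * B ^ 2 * Sψ)
        + 4 * n * ENNReal.ofReal (2 * B) ^ 2) * ENNReal.ofReal (1 / (n : ℝ) ^ 2) =
        ENNReal.ofReal (2 * (16 * L * τ) + 128 * (4 * (4 * B ^ 2 * Sψ) + 4 * n * (2 * B) ^ 2) * (1 / (n : ℝ) ^ 2)) := by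
      rw [ENNReal.ofReal_add (by positivity) (by positivity), ENNReal.ofReal_mul (by norm_num : (0 : ℝ) ≤ 2),
        ENNReal.ofReal_mul (by positivity : (0 : ℝ) ≤ 128 * (4 * (4 * B ^ 2 * Sψ) + 4 * n * (2 * B) ^ 2)),
        ENNReal.ofReal_mul (by norm_num : (0 : ℝ) ≤ 128), ENNReal.ofReal_add (by positivity) (by positivity),
        ENNReal.ofReal_mul (by norm_num : (0 : ℝ) ≤ 4),
        ENNReal.ofReal_mul (by positivity : (0 : ℝ) ≤ 4 * n), ENNReal.ofReal_mul (by norm_num : (0 : ℝ) ≤ 4),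
        ENNReal.ofReal_pow (by positivity)]
      simp
    rw [eS, e1, ENNReal.ofReal_le_ofReal_iff (by positivity)] at h
    refine h.trans ?_
    have hb : 4 * B ^ 2 * Sψ ≤ 1024 * n ^ 2 * L * τ + 4 * B ^ 2 * (3 * n * s + n) := by
      have h1 := c2.trans (add_le_add (add_le_add (mul_le_mul_of_nonneg_left hψi
        (by positivity : (0 : ℝ) ≤ 4 * n ^ 2)) le_rfl) le_rfl)
      have h2 := mul_le_mul_of_nonneg_left h1 (by positivity : 0 ≤ 4 * B ^ 2)
      refine h2.trans (le_of_eq ?_)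
      field_simp
      ring
    calc 2 * (16 * L * τ) + 128 * (4 * (4 * B ^ 2 * Sψ) + 4 * n * (2 * B) ^ 2) * (1 / (n : ℝ) ^ 2)
        ≤ 2 * (16 * L * τ) + 128 * (4 * (1024 * n ^ 2 * L * τ + 4 * B ^ 2 * (3 * n * s + n))
          + 4 * n * (2 * B) ^ 2) * (1 / (n : ℝ) ^ 2) := by gcongr
      _ = (2 * 16 + 128 * 4 * 1024) * (L * τ) + 2048 * B ^ 2 * (3 * s + 2) / n := by
          field_simp; ring
      _ ≤ _ := by
          have : 0 ≤ L * τ := by positivity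
          have : (2 * 16 + 128 * 4 * 1024) * (L * τ) ≤ 2 ^ 20 * (L * τ) := by
            gcongr; norm_num
          linarith
  calc _ ≤ ν (S1 ∪ S2) := measure_mono_ae hsub
    _ ≤ ν S1 + ν S2 := measure_union_le _ _
    _ ≤ _ := by
        rw [ENNReal.ofReal_add (by positivity) (by positivity)]
        exact add_le_add (measure_pi_orderStat_dev_le hn hd)
          (measure_pi_double_sum_gt_le hψm hψ0 hψ1 n s)

lemma mul_rpow_le_mul_rpow {a θ : ℝ} (ha : 1 ≤ a) (hθ : 0 ≤ θ) (hσ1 : σ ≤ 1) :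
    (a * θ) ^ σ ≤ a * θ ^ σ := by
  rw [Real.mul_rpow (by linarith) hθ]
  refine mul_le_mul_of_nonneg_right ?_ (by positivity)
  calc a ^ σ ≤ a ^ (1 : ℝ) := Real.rpow_le_rpow_of_exponent_le ha hσ1
    _ = a := Real.rpow_one _

/-- The shift from `t` to `t + 4` leaves a factor `n⁻⁴`, which beats the union bounds over `n`
events once `n ≥ 2`. The remaining `1/2` lets two such events, for `g` and for `K`, share `n^(-t)`.
-/
lemma two_mul_exp_add_le {n : ℕ} (hn2 : 2 ≤ n) {d t : ℝ}
    (hd2 : d ^ 2 = (t + 4) * (Real.log n / n) / 2) :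
    2 * (n : ℝ) * Real.exp (-(2 * n * d ^ 2)) + (n + 1) * Real.exp (-((t + 4) * Real.log n)) ≤
      1 / 2 * (n : ℝ) ^ (-t) := by
  have hn' : (0 : ℝ) < n := by exact_mod_cast (by omega : 0 < n)
  have hn2' : (2 : ℝ) ≤ n := by exact_mod_cast hn2
  have e1 : 2 * n * d ^ 2 = (t + 4) * Real.log n := by rw [hd2]; field_simp
  have e2 : Real.exp (-((t + 4) * Real.log n)) = (n : ℝ) ^ (-t) * (1 / (n : ℝ) ^ 4) := by
    rw [show -((t + 4) * Real.log n) = Real.log n * (-t) + -(Real.log n * (4 : ℕ)) by push_cast; ring,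
      Real.exp_add, ← Real.rpow_def_of_pos hn', Real.exp_neg, ← Real.rpow_def_of_pos hn',
      Real.rpow_natCast, one_div]
  rw [e1, e2]
  have h4 : (3 * (n : ℝ) + 1) * (1 / (n : ℝ) ^ 4) ≤ 1 / 2 := by
    rw [← mul_div_assoc, div_le_div_iff₀ (by positivity) (by norm_num)]
    have a2 : (4 : ℝ) ≤ n ^ 2 := by nlinarith
    have a3 : (8 : ℝ) ≤ n ^ 3 := by nlinarith
    have a4 : 8 * (n : ℝ) ≤ n ^ 4 := by
      calc 8 * (n : ℝ) ≤ n ^ 3 * n := by gcongr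
        _ = _ := by ring
    linarith
  have h5 := mul_le_mul_of_nonneg_left h4 (show 0 ≤ (n : ℝ) ^ (-t) by positivity)
  linarith

set_option maxHeartbeats 1000000 in
/-- Node averages transplanted to the uniform cells are close to the function. -/
theorem measure_pi_displacement_le (hF : Measurable F) (hB : 0 < B)
    (hFB : ∀ z, |F z| ≤ B) (hσ : 0 < σ) (hσ1 : σ ≤ 1) (hL : 0 ≤ L)
    (hH : HolderSq (Icc (0 : ℝ) 1 ×ˢ Icc (0 : ℝ) 1) σ L F) {t₀ : ℝ} (ht₀ : 0 < t₀) :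
    ∃ C > 0, ∀ n : ℕ, 2 ≤ n → ∀ t, t₀ ≤ t →
      (Measure.pi fun _ : Fin n => leb) {x | ¬ ∫ z, (F z - inj2 n (nodeAverage F x) z) ^ 2 ∂leb2 ≤
        C * (t * (Real.log n / n)) ^ σ} ≤ ENNReal.ofReal (1 / 2 * (n : ℝ) ^ (-t)) := by
  -- Chosen so that `t + 4 ≤ κ t` for all `t ≥ t₀`; this is how the constant comes to depend on
  -- `t₀`.
  set κ := 1 + 4 / t₀ with hκ
  have hκ1 : 1 ≤ κ := by rw [hκ]; have : 0 < 4 / t₀ := by positivity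
                         linarith
  refine ⟨4 * B ^ 2 * (3 * κ) + (2 ^ 20 * L * (48 * κ) + 2048 * B ^ 2 * (5 * κ)), by positivity, ?_⟩
  intro n hn2 t ht
  have hn : 0 < n := by omega
  have hn' : (0 : ℝ) < n := by exact_mod_cast hn
  have hn2' : (2 : ℝ) ≤ n := by exact_mod_cast hn2
  have ht' : 0 < t := lt_of_lt_of_le ht₀ ht
  have hlog : 1 / 2 ≤ Real.log n := by
    have h1 : Real.log 2 ≤ Real.log n := Real.log_le_log (by norm_num) hn2'
    linarith [Real.log_two_gt_d9]
  set θ := t * (Real.log n / n) with hθ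
  have hθ0 : 0 < θ := by positivity
  have hθσ : 0 < θ ^ σ := by positivity
  have hκθ : (t + 4) * (Real.log n / n) ≤ κ * θ := by
    rw [hκ, hθ, ← mul_assoc]
    gcongr
    have : 4 ≤ 4 / t₀ * t := by rw [div_mul_eq_mul_div, le_div_iff₀ ht₀]; linarith
    linarith
  have hn1 : 1 / (n : ℝ) ≤ κ * θ := by
    refine le_trans ?_ hκθ
    rw [← mul_div_assoc]
    gcongr
    nlinarith
  -- For large `θ` the target exceeds the trivial bound `4 B²`. Otherwise the displacement `D` is at
  -- most one, so that blocks of side `1/m ≥ D` fit in the unit square.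
  by_cases hbig : 1 < 3 * κ * θ
  · refine le_trans (le_of_eq ?_) zero_le
    convert measure_empty (μ := Measure.pi fun _ : Fin n => leb)
    ext x
    simp only [mem_ofPred_eq, mem_empty_iff_false, iff_false, not_not]
    refine (integral_sq_sub_inj2_le hn hF hFB (abs_nodeAverage_le hB.le hFB x)).trans ?_
    have h1 : 1 ≤ 3 * κ * θ ^ σ :=
      (Real.one_le_rpow hbig.le hσ.le).trans (mul_rpow_le_mul_rpow (by linarith) hθ0.le hσ1)
    have h2 : 4 * B ^ 2 ≤ 4 * B ^ 2 * (3 * κ * θ ^ σ) := le_mul_of_one_le_right (by positivity) h1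
    have h3 : 0 ≤ (2 ^ 20 * L * (48 * κ) + 2048 * B ^ 2 * (5 * κ)) * θ ^ σ := by positivity
    linarith
  · push Not at hbig
    have hθ1 : θ ≤ 1 := by nlinarith
    set d := Real.sqrt ((t + 4) * (Real.log n / n) / 2) with hd
    have hd0 : 0 < d := Real.sqrt_pos.2 (by positivity)
    have hd2 : d ^ 2 = (t + 4) * (Real.log n / n) / 2 := Real.sq_sqrt (by positivity)
    set D := d + 1 / n with hD
    have hD0 : 0 < D := by positivity
    have hDsq : D ^ 2 ≤ 3 * κ * θ := by
      have h1 : D ^ 2 ≤ 2 * d ^ 2 + 2 * (1 / (n : ℝ)) ^ 2 := by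
        rw [hD]; nlinarith [sq_nonneg (d - 1 / (n : ℝ))]
      have h2 : (1 / (n : ℝ)) ^ 2 ≤ 1 / n := by
        rw [sq]; refine mul_le_of_le_one_left (by positivity) ?_
        rw [div_le_one hn']; linarith
      linarith
    have hD1 : D ≤ 1 := by
      by_contra h
      push Not at h
      nlinarith
    -- The finest block size not below the displacement. Rounding loses at most a factor two, hence
    -- `2/m ≤ 4D`.
    set m := ⌊1 / D⌋₊ with hm
    have hD1' : 1 ≤ 1 / D := by rw [le_div_iff₀ hD0]; linarith
    have hm1 : 1 ≤ m := Nat.le_floor (by simpa using hD1')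
    have hm0 : (0 : ℝ) < m := by exact_mod_cast hm1
    have hmle : (m : ℝ) ≤ 1 / D := Nat.floor_le (by positivity)
    have hmgt : 1 / D < m + 1 := Nat.lt_floor_add_one _
    have hdm : d + 1 / n ≤ 1 / m := by
      rw [← hD, le_div_iff₀ hm0]
      rw [le_div_iff₀ hD0] at hmle; linarith
    have hm2 : (2 : ℝ) / m ≤ 4 * D := by
      rw [div_le_iff₀ hm0]
      rw [div_lt_iff₀ hD0] at hmgt
      have : (1 : ℝ) ≤ m := by exact_mod_cast hm1
      nlinarith
    have hτ : ((2 : ℝ) / m) ^ (2 * σ) ≤ 48 * κ * θ ^ σ := by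
      calc ((2 : ℝ) / m) ^ (2 * σ) ≤ (4 * D) ^ (2 * σ) := by gcongr
        _ = (16 * D ^ 2) ^ σ := by
            rw [Real.rpow_mul (by positivity), Real.rpow_two]; congr 1; ring
        _ ≤ (48 * κ * θ) ^ σ := by
            refine Real.rpow_le_rpow (by positivity) ?_ hσ.le
            linarith
        _ ≤ _ := mul_rpow_le_mul_rpow (by linarith) hθ0.le hσ1
    have hs : (3 * ((t + 4) * Real.log n) + 2) / n ≤ 5 * κ * θ ^ σ := by
      have h1 : θ ≤ θ ^ σ := by
        calc θ = θ ^ (1 : ℝ) := (Real.rpow_one _).symm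
          _ ≤ θ ^ σ := Real.rpow_le_rpow_of_exponent_ge hθ0 hθ1 hσ1
      have h2 : (3 * ((t + 4) * Real.log n) + 2) / n = 3 * ((t + 4) * (Real.log n / n)) + 2 * (1 / n) := by
        field_simp
      rw [h2]
      have h3 : κ * θ ≤ κ * θ ^ σ := by gcongr
      linarith
    refine (measure_mono fun x hx => ?_).trans ((measure_pi_integral_sq_gt_le hF hB hFB hσ.le hL hH hm1 hn
      hd0 hdm ((t + 4) * Real.log n)).trans (ENNReal.ofReal_le_ofReal ?_))
    · simp only [mem_ofPred_eq] at hx ⊢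
      intro hle
      refine hx (hle.trans ?_)
      have h1 : 2 ^ 20 * L * (2 / m) ^ (2 * σ) ≤ 2 ^ 20 * L * (48 * κ * θ ^ σ) := by gcongr
      have h2 : 2048 * B ^ 2 * (3 * ((t + 4) * Real.log n) + 2) / n ≤ 2048 * B ^ 2 * (5 * κ * θ ^ σ) := by
        rw [mul_div_assoc]; gcongr
      have h3 : 0 ≤ 4 * B ^ 2 * (3 * κ) * θ ^ σ := by positivity
      linarith
    · exact two_mul_exp_add_le hn2 hd2

end displacementProb

/-! ### Transfer of regularity and of node averages to representatives and to the plane. -/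

section lipCongr
variable {E : Type*} [NormedAddCommGroup E] [MeasureSpace E] [BorelSpace E]
  [SecondCountableTopology E] [(volume : Measure E).IsAddHaarMeasure]
  {D : Set E} {F F' : E → ℝ}

/-- Translations preserve null sets, so equality almost everywhere on `D` also holds at the shifted
points that stay in `D`. -/
lemma lipSeminorm_congr (hD : MeasurableSet D) (h : F =ᵐ[volume.restrict D] F') (s : ℝ) (r : ℝ≥0∞) :
    lipSeminorm D s r F = lipSeminorm D s r F' := by
  unfold lipSeminorm modulus
  congr! 7 with t _ w _
  refine eLpNorm_congr_ae ?_
  have h1 : ∀ᵐ z, z ∈ D → F z = F' z := (ae_restrict_iff' hD).1 h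
  have h2 : ∀ᵐ z, z + w ∈ D → F (z + w) = F' (z + w) :=
    (measurePreserving_add_right volume w).quasiMeasurePreserving.ae h1
  refine (ae_restrict_iff' (measurableSet_overlap hD w)).2 ?_
  filter_upwards [h1, h2] with z h1 h2 hz
  rw [h1 hz.1, h2 hz.2]

end lipCongr

/-- Lets the planar displacement estimate treat `g` as well, viewed as a function of the first
coordinate. -/
lemma HolderSq.comp_fst {g : ℝ → ℝ} (hg : Measurable g) {σ L : ℝ} (hσ : 0 ≤ σ) (hL : 0 ≤ L)
    (h : HolderSq (Icc (0 : ℝ) 1) σ L g) :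
    HolderSq (Icc (0 : ℝ) 1 ×ˢ Icc (0 : ℝ) 1) σ L fun z => g z.1 := by
  intro w
  set S : Set ℝ := {x | x ∈ Icc (0 : ℝ) 1 ∧ x + w.1 ∈ Icc (0 : ℝ) 1} with hS
  have hsub : {z : ℝ × ℝ | z ∈ Icc (0 : ℝ) 1 ×ˢ Icc (0 : ℝ) 1 ∧ z + w ∈ Icc (0 : ℝ) 1 ×ˢ Icc (0 : ℝ) 1} ⊆
      S ×ˢ Icc 0 1 := fun z hz => ⟨⟨hz.1.1, hz.2.1⟩, hz.1.2⟩
  have hprob : IsProbabilityMeasure leb := ⟨by simp⟩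
  have hm : Measurable fun x : ℝ => ENNReal.ofReal ((g (x + w.1) - g x) ^ 2) :=
    (((hg.comp (measurable_add_const w.1)).sub hg).pow_const 2).ennreal_ofReal
  have hw : ‖w.1‖ ≤ ‖w‖ := norm_fst_le w
  calc incrSq (Icc (0 : ℝ) 1 ×ˢ Icc (0 : ℝ) 1) (fun z => g z.1) w
      ≤ ∫⁻ z in S ×ˢ Icc 0 1, ENNReal.ofReal ((g (z.1 + w.1) - g z.1) ^ 2) :=
        lintegral_mono_set hsub
    _ = ∫⁻ x in S, ENNReal.ofReal ((g (x + w.1) - g x) ^ 2) := by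
        rw [Measure.volume_eq_prod, ← Measure.prod_restrict]
        exact (measurePreserving_fst (μ := volume.restrict S) (ν := leb)).lintegral_comp hm
    _ ≤ ENNReal.ofReal (L * ‖w.1‖ ^ (2 * σ)) := h w.1
    _ ≤ _ := by gcongr

section nodeAverages
variable {n : ℕ} {x : Fin n → ℝ}

/-- Under `q ‖K‖ ≤ 1` the truncation at `1/q` is inactive. -/
lemma nodeKernel_eq_nodeAverage {K : ℝ × ℝ → ℝ} {q : ℝ} (hq : 0 < q) (h : ∀ᵐ z ∂leb2, |K z| ≤ 1 / q)
    (hx : ∀ k, x k ∈ Icc (0 : ℝ) 1) : nodeKernel q K x = nodeAverage K x := by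
  ext i j
  exact min_eq_left ((le_abs_self _).trans (abs_setAverage_le (by positivity) h
    (nodeCell_prod_subset hx i j) (nodeCell_prod_volume_ne_top hx i j)))

lemma nodeAverage_comp_fst (g : ℝ → ℝ) (hx : ∀ k, x k ∈ Ioo (0 : ℝ) 1) (hinj : Function.Injective x)
    (i j : Fin n) : nodeAverage (fun z => g z.1) x i j = nodeData g x i := by
  have hj : volume.real (nodeCell x j) ≠ 0 := by
    have := prevOrderStat_lt hx hinj j
    rw [nodeCell, Real.volume_real_Ioc_of_le this.le]
    linarith
  unfold nodeAverage nodeData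
  rw [setAverage_eq, setAverage_eq, Measure.volume_eq_prod, measureReal_prod_prod,
    ← Measure.prod_restrict, integral_fun_fst]
  simp only [smul_eq_mul, measureReal_restrict_apply_univ]
  rw [mul_inv, ← mul_assoc, mul_assoc _ (volume.real (nodeCell x j))⁻¹, inv_mul_cancel₀ hj, mul_one]

lemma integral_sq_comp_fst_sub_inj2 (hn : 0 < n) {g : ℝ → ℝ} (hg : Measurable g) {γ : Fin n → ℝ}
    {W : Fin n → Fin n → ℝ} (hW : ∀ i j, W i j = γ i) :
    ∫ z, (g z.1 - inj2 n W z) ^ 2 ∂leb2 = ∫ x, (g x - inj n γ x) ^ 2 ∂leb := by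
  have h1 : ∀ᵐ z ∂leb2, (g z.1 - inj2 n W z) ^ 2 = (g z.1 - inj n γ z.1) ^ 2 :=
    ae_leb2_of_cells hn fun i j z hz => by
      rw [inj2_apply_of_mem _ hz, inj_apply_of_mem _ hz.1, hW]
  rw [integral_congr_ae h1]
  conv_rhs => rw [← measurePreserving_fst_leb2.map_eq]
  exact (integral_map (f := fun x => (g x - inj n γ x) ^ 2) measurable_fst.aemeasurable
    ((hg.sub (measurable_inj γ)).pow_const 2).aestronglyMeasurable).symm

end nodeAverages

lemma NonlocalVariational.IsRandomGraph.map_nodes {Ω : Type*} [MeasurableSpace Ω] {P : Measure Ω}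
    [IsProbabilityMeasure P] {n : ℕ} {q : ℝ} {K : ℝ × ℝ → ℝ} {X : Fin n → Ω → ℝ}
    {Υ : Fin n → Fin n → Ω → ℝ} (hG : IsRandomGraph P n q K X Υ) :
    P.map (fun ω k => X k ω) = Measure.pi fun _ => leb := by
  rw [(iIndepFun_iff_map_fun_eq_pi_map fun k => (hG.measurable_nodes k).aemeasurable).1 hG.indep_nodes]
  simp only [hG.uniform_nodes]

/-! ### The deterministic error bound in the bounded case. -/

section deterministic
variable {lam p M G : ℝ} {g u : ℝ → ℝ} {K : ℝ × ℝ → ℝ}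

lemma abs_pairDiff_le {f : ℝ → ℝ} {x y : ℝ} (hx : |f x| ≤ G) (hy : |f y| ≤ G) :
    |f y - f x| ≤ 2 * G := (abs_sub _ _).trans (by linarith)

/-- The error bound for data, kernels and minimizers that are uniformly bounded. -/
theorem integral_sq_inj_sub_le_of_bounded {n : ℕ} (hn : 0 < n) (hlam : 0 < lam)
    (hp : p ∈ Ico (1 : ℝ) 2) (hG : 0 ≤ G) (hM : 0 ≤ M) (hg : MemLp g 2 leb)
    (hK : AEMeasurable K leb2) (hK0 : ∀ᵐ z ∂leb2, 0 ≤ K z) (hKM : ∀ᵐ z ∂leb2, |K z| ≤ M)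
    (hu : IsContinuumMinimizer lam p g K u) (huG : ∀ᵐ x ∂leb, |u x| ≤ G)
    (hproj : ∀ i, |proj n u i| ≤ G) {γ : Fin n → ℝ} {W : Fin n → Fin n → ℝ}
    (hWM : ∀ i j, |W i j| ≤ M) {w : Fin n → ℝ} (hw : IsDiscreteMinimizer lam p γ W w)
    (hwG : ∀ i, |w i| ≤ G) {ρ : ℝ} (hρ : 0 < ρ) :
    ∫ x, (inj n w x - u x) ^ 2 ∂leb ≤ 32 * ∫ x, (g x - inj n γ x) ^ 2 ∂leb
      + 128 * lam ^ 2 * (4 * (1 + 2 * G)) ^ 2 * ∫ z, (K z - inj2 n W z) ^ 2 ∂leb2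
      + ∫ x, (u x - inj n (proj n u) x) ^ 2 ∂leb
      + 8 * lam * M * (4 * (1 + 2 * G)) *
        (ρ + 4 * (∫ x, (u x - inj n (proj n u) x) ^ 2 ∂leb) / ρ) := by
  set c := 4 * (1 + 2 * G) with hc
  have hc0 : 0 < c := by positivity
  set w' := proj n u with hw'
  have hprob : IsProbabilityMeasure leb2 := ⟨by simp⟩
  have hv : MemLp (inj n w) 2 leb := memLp_inj n w 2
  have hv' : MemLp (inj n w') 2 leb := memLp_inj n w' 2
  have hpc : ∀ a b : ℝ, |a| ≤ 2 * G → |b| ≤ 2 * G → |(|a| ^ p - |b| ^ p)| ≤ c * |a - b| :=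
    fun a b ha hb => (abs_rpow_sub_le_of_bounded hp hG ha hb).trans (by
      have : 0 ≤ (1 + 2 * G) * |a - b| := by positivity
      rw [hc]; nlinarith [hp.2])
  have hvb : ∀ᵐ x ∂leb, |inj n w x| ≤ G := ae_abs_inj_le hn hwG
  have hv'b : ∀ᵐ x ∂leb, |inj n w' x| ≤ G := ae_abs_inj_le hn hproj
  have hKW : Integrable (fun z => (K z - inj2 n W z) ^ 2) leb2 := by
    refine Integrable.of_bound (C := (2 * M) ^ 2)
      ((hK.sub (measurable_inj2 W).aemeasurable).pow_const 2).aestronglyMeasurable ?_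
    have h2 : ∀ᵐ z ∂leb2, |inj2 n W z| ≤ M := ae_leb2_of_cells hn fun i j z hz => by
      rw [inj2_apply_of_mem _ hz]; exact hWM i j
    filter_upwards [hKM, h2] with z h1 h2
    rw [Real.norm_eq_abs, abs_of_nonneg (sq_nonneg _), ← sq_abs]
    gcongr
    exact (abs_sub _ _).trans (by linarith)
  have hd1 : MemLp (fun x => inj n w x - inj n w' x) 2 leb := hv.sub hv'
  have hd2 : MemLp (fun x => u x - inj n w' x) 2 leb := hu.1.sub hv'
  have hΔ1 := (memLp_pairDiff hd1).integrable_sq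
  have hΔ2 := (memLp_pairDiff hd2).integrable_sq
  set X := ∫ x, (inj n w x - u x) ^ 2 ∂leb with hX
  set δ := ∫ x, (u x - inj n w' x) ^ 2 ∂leb with hδ
  set κ := ∫ z, (K z - inj2 n W z) ^ 2 ∂leb2 with hκ
  -- Young's inequality with weights such that, after multiplication by `4 lam`, exactly half of the
  -- error `X` appears on the right and can be absorbed.
  have hA : ∫ z, |K z - inj2 n W z| * |(|inj n w z.2 - inj n w z.1| ^ p
      - |inj n w' z.2 - inj n w' z.1| ^ p)| ∂leb2 ≤
      16 * lam * c ^ 2 * κ + 1 / (64 * lam) * (8 * X + 8 * δ) := by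
    calc _ ≤ ∫ z, (16 * lam * c ^ 2 * (K z - inj2 n W z) ^ 2 + 1 / (64 * lam) *
            ((inj n w z.2 - inj n w' z.2) - (inj n w z.1 - inj n w' z.1)) ^ 2) ∂leb2 := by
          refine integral_mono_of_nonneg (ae_of_all _ fun z => by positivity)
            ((hKW.const_mul _).add (hΔ1.const_mul _)) ?_
          filter_upwards [ae_leb2_pair hvb hvb, ae_leb2_pair hv'b hv'b] with z h1 h2
          have h3 := hpc _ _ (abs_pairDiff_le h1.1 h1.2) (abs_pairDiff_le h2.1 h2.2)
          rw [show inj n w z.2 - inj n w z.1 - (inj n w' z.2 - inj n w' z.1) =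
            (inj n w z.2 - inj n w' z.2) - (inj n w z.1 - inj n w' z.1) by ring] at h3
          set D := (inj n w z.2 - inj n w' z.2) - (inj n w z.1 - inj n w' z.1)
          set k := K z - inj2 n W z
          calc _ ≤ |k| * (c * |D|) := by gcongr
            _ ≤ 16 * lam * c ^ 2 * |k| ^ 2 + 1 / (64 * lam) * |D| ^ 2 := by
                have : 16 * lam * c ^ 2 * |k| ^ 2 + 1 / (64 * lam) * |D| ^ 2 - |k| * (c * |D|) =
                  1 / (64 * lam) * (32 * lam * c * |k| - |D|) ^ 2 := by field_simp; ring
                have h4 : 0 ≤ 1 / (64 * lam) * (32 * lam * c * |k| - |D|) ^ 2 := by positivity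
                linarith
            _ = _ := by rw [sq_abs, sq_abs]
      _ = 16 * lam * c ^ 2 * κ + 1 / (64 * lam) * ∫ z,
            ((inj n w z.2 - inj n w' z.2) - (inj n w z.1 - inj n w' z.1)) ^ 2 ∂leb2 := by
          rw [integral_add (by exact hKW.const_mul _) (by exact hΔ1.const_mul _),
            integral_const_mul, integral_const_mul]
      _ ≤ _ := by
          gcongr
          refine (integral_sq_pairDiff_le hd1).trans ?_
          have := integral_sq_sub_le_add hv hu.1 hv'
          linarith
  -- A first order difference is traded for a squared one by `|D| ≤ ρ + D²/ρ`; the free parameter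
  -- `ρ` is chosen later to balance the two.
  have hB : ∫ z, |(|inj n w' z.2 - inj n w' z.1| ^ p - |u z.2 - u z.1| ^ p)| ∂leb2 ≤
      c * (ρ + 4 * δ / ρ) := by
    calc _ ≤ ∫ z, c * (ρ + ((u z.2 - inj n w' z.2) - (u z.1 - inj n w' z.1)) ^ 2 / ρ) ∂leb2 := by
          refine integral_mono_of_nonneg (ae_of_all _ fun z => by positivity)
            (((integrable_const ρ).add (hΔ2.div_const ρ)).const_mul c) ?_
          filter_upwards [ae_leb2_pair huG huG, ae_leb2_pair hv'b hv'b] with z h1 h2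
          have h3 := hpc _ _ (abs_pairDiff_le h2.1 h2.2) (abs_pairDiff_le h1.1 h1.2)
          rw [← abs_neg (_ - _ - _ : ℝ), show -(inj n w' z.2 - inj n w' z.1 - (u z.2 - u z.1)) =
            (u z.2 - inj n w' z.2) - (u z.1 - inj n w' z.1) by ring] at h3
          refine h3.trans ?_
          set D := (u z.2 - inj n w' z.2) - (u z.1 - inj n w' z.1)
          gcongr
          have h5 : |D| * ρ ≤ ρ * ρ + D ^ 2 := by
            rw [← sq_abs D]; nlinarith [sq_nonneg (|D| - ρ), sq_nonneg (|D|), sq_nonneg ρ]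
          calc |D| = |D| * ρ / ρ := by field_simp
            _ ≤ (ρ * ρ + D ^ 2) / ρ := by gcongr
            _ = _ := by field_simp
      _ = c * (ρ + (∫ z, ((u z.2 - inj n w' z.2) - (u z.1 - inj n w' z.1)) ^ 2 ∂leb2) / ρ) := by
          rw [integral_const_mul, integral_add (integrable_const _) (by exact hΔ2.div_const ρ),
            integral_div]
          simp
      _ ≤ _ := by
          gcongr
          exact integral_sq_pairDiff_le hd2
  have hmain := integral_sq_inj_sub_le hn hlam hp.1 hp.2.le hg hK hK0 hKM hu hWM hw
  rw [← hX, ← hw'] at hmain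
  have hA' := mul_le_mul_of_nonneg_left hA (show 0 ≤ 4 * lam by positivity)
  have hB' := mul_le_mul_of_nonneg_left hB (show 0 ≤ 4 * lam * M by positivity)
  have e1 : 4 * lam * (16 * lam * c ^ 2 * κ + 1 / (64 * lam) * (8 * X + 8 * δ)) =
      64 * lam ^ 2 * c ^ 2 * κ + X / 2 + δ / 2 := by field_simp; ring
  rw [e1] at hA'
  linarith

end deterministic

/-- The maximum of `log x / x` is attained at `e`. Hence `t log n / n ≤ 1` for `t ≤ e`, so smaller
exponents give larger powers. -/
lemma log_div_self_le (n : ℕ) (hn : 0 < n) : Real.log n / n ≤ Real.exp (-1) := by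
  have hn' : (0 : ℝ) < n := by exact_mod_cast hn
  rw [div_le_iff₀ hn']
  have := Real.add_one_le_exp (Real.log n - 1)
  rw [sub_eq_add_neg, Real.exp_add, Real.exp_log hn'] at this
  linarith

/-! ### The sampling rate `t log n / n`. -/

section latticeRate
variable {n : ℕ} {t t₀ : ℝ}

lemma mul_log_div_pos (hn : 2 ≤ n) (ht : 0 < t) : 0 < t * (Real.log n / n) := by
  have hn' : (2 : ℝ) ≤ n := by exact_mod_cast hn
  have := Real.log_pos (by linarith : (1 : ℝ) < n)
  positivity

lemma mul_log_div_le_one (hn : 0 < n) (ht : t ≤ Real.exp 1) :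
    t * (Real.log n / n) ≤ 1 := by
  calc t * (Real.log n / n) ≤ Real.exp 1 * Real.exp (-1) :=
        mul_le_mul ht (log_div_self_le n hn) (by positivity) (by positivity)
    _ = 1 := by rw [← Real.exp_add]; simp

lemma one_div_rpow_le (hn : 2 ≤ n) (ht₀ : 0 < t₀) (ht : t₀ ≤ t) {σ : ℝ} (hσ : 0 ≤ σ) (hσ1 : σ ≤ 1) :
    (1 / (n : ℝ)) ^ σ ≤ (1 + 2 / t₀) * (t * (Real.log n / n)) ^ σ := by
  have hn' : (2 : ℝ) ≤ n := by exact_mod_cast hn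
  have hlog : 1 / 2 ≤ Real.log n := by
    have h1 : Real.log 2 ≤ Real.log n := Real.log_le_log (by norm_num) hn'
    linarith [Real.log_two_gt_d9]
  have hθ := (mul_log_div_pos hn (ht₀.trans_le ht)).le
  have ha : 0 < 2 / t₀ := by positivity
  refine (Real.rpow_le_rpow (by positivity) ?_ hσ).trans
    (mul_rpow_le_mul_rpow (by linarith) hθ hσ1)
  have h1 : 1 ≤ 2 / t₀ * (t * Real.log n) := by
    rw [div_mul_eq_mul_div, le_div_iff₀ ht₀]
    nlinarith
  calc 1 / (n : ℝ) ≤ 2 / t₀ * (t * Real.log n) / n := by gcongr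
    _ = 2 / t₀ * (t * (Real.log n / n)) := by ring
    _ ≤ _ := by linarith

end latticeRate

/-! ### Assembly of the rate under Lipschitz assumptions. -/

section rate
variable {lam p M G σ σ' L L' L'' : ℝ} {g u : ℝ → ℝ} {K : ℝ × ℝ → ℝ}

lemma rate_arithmetic {C e f E X Y κ δ b r R Cg Ck A B : ℝ} (hC : 0 ≤ C) (he : 0 ≤ e) (hf : 0 ≤ f)
    (hE : E ≤ C * (r + Y) + 2 * X) (hX : X ≤ 32 * Y + e * κ + δ + f * b) (hY : Y ≤ Cg * R)
    (hκ : κ ≤ Ck * R) (hδ : δ ≤ A * R) (hb : b ≤ B * R) (hr : 0 ≤ r)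
    (hc : 0 ≤ C * Cg + 2 * (32 * Cg + e * Ck + A + f * B)) (hR : 0 ≤ R) :
    E ≤ (C + C * Cg + 2 * (32 * Cg + e * Ck + A + f * B)) * (r + R) := by
  have h1 := mul_le_mul_of_nonneg_left hY hC
  have h2 := mul_le_mul_of_nonneg_left hκ he
  have h3 := mul_le_mul_of_nonneg_left hb hf
  have h4 := mul_nonneg hc hr
  have h5 := mul_nonneg hC hR
  linarith

/-- The rate for bounded measurable representatives. -/
theorem measure_integral_sq_gt_rate_le (hp : p ∈ Ico (1 : ℝ) 2) (hlam : 0 < lam) (hG : 0 < G)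
    (hg : Measurable g) (hgG : ∀ x, |g x| ≤ G) (hM : 0 < M) (hK : Measurable K)
    (hK0 : ∀ z, 0 ≤ K z) (hKM : ∀ z, K z ≤ M)
    (hu : IsContinuumMinimizer lam p g K u) (hum : Measurable u) (huG : ∀ x, |u x| ≤ G)
    (hσ : 0 < σ) (hσ1 : σ ≤ 1) (hσ' : 0 < σ') (hσ'1 : σ' ≤ 1)
    (hL : 0 ≤ L) (hL' : 0 ≤ L') (hL'' : 0 ≤ L'')
    (hgH : HolderSq (Icc (0 : ℝ) 1) σ L g)
    (hKH : HolderSq (Icc (0 : ℝ) 1 ×ˢ Icc (0 : ℝ) 1) σ' L' K)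
    (huH : HolderSq (Icc (0 : ℝ) 1) σ L'' u)
    {q : ℕ → ℝ} (hq_pos : ∀ n, 0 < n → 0 < q n) (hq_bdd : ∃ Q : ℝ, ∀ n, 0 < n → q n ≤ Q)
    (hqK : ∀ n, 0 < n → ∀ᵐ z ∂leb2, |K z| ≤ 1 / q n) :
    ∃ C₁ > 0, ∀ t₀ > 0, ∃ C > 0, ∀ n : ℕ, 2 ≤ n →
      ∀ (Ω : Type*) [MeasurableSpace Ω] (P : Measure Ω) [IsProbabilityMeasure P]
        (X : Fin n → Ω → ℝ) (Υ : Fin n → Fin n → Ω → ℝ), IsRandomGraph P n (q n) K X Υ →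
      ∀ un : Ω → Fin n → ℝ,
        (∀ᵐ ω ∂P, IsDiscreteMinimizer lam p (nodeData g (fun k => X k ω))
          (fun i j => Υ i j ω) (un ω)) →
      ∀ β : ℝ, 0 < β → ∀ t ∈ Ico t₀ (Real.exp 1),
        P {ω | ¬ ∫ x, (inj n (un ω) x - u x) ^ 2 ∂leb ≤ C * (noiseRate p (q n) β n
          + (t * (Real.log n / n)) ^ min σ σ')} ≤
          ENNReal.ofReal (failProb p (q n) β C₁ n + (n : ℝ) ^ (-t)) := by
  have hgL : MemLp g 2 leb := MemLp.of_bound hg.aestronglyMeasurable G (ae_of_all _ hgG)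
  have hKa : ∀ z, |K z| ≤ M := fun z => by rw [abs_of_nonneg (hK0 z)]; exact hKM z
  obtain ⟨C, hC, C₁, hC₁, hnoise⟩ := measure_error_gt_le hp hlam hgL hK.aemeasurable hM.le
    (ae_of_all _ hK0) (ae_of_all _ hKM) hq_pos hq_bdd hu.1
  refine ⟨C₁, hC₁, fun t₀ ht₀ => ?_⟩
  obtain ⟨Cg, hCg, hgbad⟩ := measure_pi_displacement_le (hg.comp measurable_fst) hG
    (fun z => hgG z.1) hσ hσ1 hL (hgH.comp_fst hg hσ.le hL) ht₀
  obtain ⟨Ck, hCk, hkbad⟩ := measure_pi_displacement_le hK hM hKa hσ' hσ'1 hL' hKH ht₀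
  set c := 4 * (1 + 2 * G) with hc
  have hc0 : 0 < c := by positivity
  set a := 1 + 2 / t₀ with ha
  have ha0 : 0 < a := by positivity
  refine ⟨C + C * Cg + 2 * (32 * Cg + 128 * lam ^ 2 * c ^ 2 * Ck + 2 * L'' * a
    + 8 * lam * M * c * ((1 + 8 * L'') * a)), by positivity, ?_⟩
  intro n hn2 Ω _ P _ X Υ hGr un hun β hβ t ht
  have hn : 0 < n := by omega
  have ht0 : 0 < t := ht₀.trans_le ht.1
  set θ := t * (Real.log n / n) with hθ
  have hθ0 : 0 < θ := mul_log_div_pos hn2 ht0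
  have hθ1 : θ ≤ 1 := mul_log_div_le_one hn ht.2.le
  have hr := noiseRate_pos (p := p) (hq_pos n hn) hβ hn
  set R := θ ^ min σ σ' with hR
  have hR0 : 0 < R := by positivity
  have hσR : θ ^ σ ≤ R := Real.rpow_le_rpow_of_exponent_ge hθ0 hθ1 (min_le_left _ _)
  have hσR' : θ ^ σ' ≤ R := Real.rpow_le_rpow_of_exponent_ge hθ0 hθ1 (min_le_right _ _)
  -- The squared projection error is of order `n^(-2σ)`, so this choice makes `ρ` and `δ/ρ` both of
  -- order `n^(-σ)`, which is below the target rate.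
  set ρ := (1 / (n : ℝ)) ^ σ with hρ
  have hn' : (0 : ℝ) < n := by exact_mod_cast hn
  have hρ0 : 0 < ρ := by positivity
  have hρ1 : ρ ≤ 1 := Real.rpow_le_one (by positivity)
    (by rw [div_le_one hn']; exact_mod_cast hn) hσ.le
  have hρR : ρ ≤ a * R := (one_div_rpow_le hn2 ht₀ ht.1 hσ.le hσ1).trans (by gcongr)
  have hδ : ∫ x, (u x - inj n (proj n u) x) ^ 2 ∂leb ≤ 2 * L'' * ρ ^ 2 := by
    have := integral_sq_sub_inj_proj_le hn hum huG hσ.le hL'' huH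
    rwa [mul_comm 2 σ, Real.rpow_mul (by positivity), Real.rpow_two] at this
  have hmap := hGr.map_nodes
  have hmeas : Measurable fun ω k => X k ω := measurable_pi_lambda _ hGr.measurable_nodes
  -- The inequality for outer measures holds for every set, so the exceptional sets of nodes need
  -- not be measurable.
  have hpull : ∀ S : Set (Fin n → ℝ), P {ω | (fun k => X k ω) ∈ S} ≤
      Measure.pi (fun _ : Fin n => leb) S := fun S => by
    rw [← hmap]; exact Measure.le_map_apply hmeas.aemeasurable S
  have hδρ : ∫ x, (u x - inj n (proj n u) x) ^ 2 ∂leb ≤ 2 * L'' * (a * R) := by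
    refine hδ.trans ?_
    have : ρ ^ 2 ≤ a * R := by nlinarith
    gcongr
  have hδdiv : ρ + 4 * (∫ x, (u x - inj n (proj n u) x) ^ 2 ∂leb) / ρ ≤ (1 + 8 * L'') * (a * R) := by
    calc _ ≤ ρ + 4 * (2 * L'' * ρ ^ 2) / ρ := by gcongr
      _ = (1 + 8 * L'') * ρ := by field_simp; ring
      _ ≤ _ := by gcongr
  have hinj : ∀ᵐ ω ∂P, Function.Injective fun k => X k ω :=
    ae_of_ae_map hmeas.aemeasurable (by rw [hmap]; exact ae_pi_injective)
  have hmem : ∀ᵐ ω ∂P, ∀ k, X k ω ∈ Ioo (0 : ℝ) 1 :=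
    ae_of_ae_map hmeas.aemeasurable (p := fun x => ∀ k, x k ∈ Ioo (0 : ℝ) 1)
      (by rw [hmap]; exact ae_pi_mem ae_leb_mem_Ioo)
  refine (measure_mono_ae ?_).trans ((measure_union_le _ _).trans ((add_le_add
    (hnoise n hn Ω P X Υ hGr un hun β hβ) ((measure_union_le _ _).trans (add_le_add
      ((hpull _).trans (hgbad n hn2 t ht.1)) ((hpull _).trans (hkbad n hn2 t ht.1))))).trans ?_))
  · filter_upwards [hinj, hmem] with ω hi hm
    change ¬ _ → ¬ _ ∨ ¬ _ ∨ ¬ _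
    contrapose!
    rintro ⟨h1, h2, h3⟩
    set x := fun k => X k ω with hx
    have hxI : ∀ k, x k ∈ Icc (0 : ℝ) 1 := fun k => Ioo_subset_Icc_self (hm k)
    rw [← nodeKernel_eq_nodeAverage (hq_pos n hn) (hqK n hn) hxI] at h3
    rw [show (g ∘ Prod.fst : ℝ × ℝ → ℝ) = fun z => g z.1 from rfl,
      integral_sq_comp_fst_sub_inj2 hn hg fun i j => nodeAverage_comp_fst g hm hi i j] at h2
    have hγ := abs_nodeData_le hG.le (ae_of_all leb hgG) hxI
    obtain ⟨u0, hu0G, hu0⟩ := exists_isDiscreteMinimizer (p := p) hlam (by linarith [hp.1])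
      (nodeData g x) (nodeKernel_nonneg (ae_of_all leb2 hK0) (hq_pos n hn) hxI) hG.le hγ
    have hW : ∀ i j, |nodeKernel (q n) K x i j| ≤ M := fun i j => by
      rw [abs_of_nonneg (nodeKernel_nonneg (ae_of_all leb2 hK0) (hq_pos n hn) hxI i j)]
      exact nodeKernel_le hM.le (ae_of_all leb2 hKa) _ hxI i j
    have hproj : ∀ i, |proj n u i| ≤ G := fun i =>
      abs_setAverage_le hG.le (ae_of_all _ huG) (cell_subset_Icc i) (by rw [volume_cell]; finiteness)
    have h4 := integral_sq_inj_sub_le_of_bounded hn hlam hp hG.le hM.le hgL hK.aemeasurable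
      (ae_of_all _ hK0) (ae_of_all _ hKa) hu (ae_of_all _ huG) hproj hW hu0 hu0G hρ0
    rw [← hc] at h4
    have h5 := h1 u0 hu0
    have h2R : ∫ y, (g y - inj n (nodeData g x) y) ^ 2 ∂leb ≤ Cg * R :=
      h2.trans (by gcongr)
    have h3R : ∫ z, (K z - inj2 n (nodeKernel (q n) K x) z) ^ 2 ∂leb2 ≤ Ck * R :=
      h3.trans (by gcongr)
    exact rate_arithmetic hC.le (by positivity) (by positivity) h5 h4 h2R h3R (by rwa [← mul_assoc] at hδρ)
      (by rwa [← mul_assoc] at hδdiv) hr.le (by positivity) hR0.le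
  · have e0 : 0 ≤ failProb p (q n) β C₁ n := by unfold failProb; positivity
    rw [← ENNReal.ofReal_add (by positivity) (by positivity),
      ← ENNReal.ofReal_add e0 (by positivity)]
    refine ENNReal.ofReal_le_ofReal ?_
    linarith

end rate

/-! ### Passage to bounded measurable representatives and the conclusion. -/

lemma ae_abs_le_of_eLpNorm_top {α : Type*} [MeasurableSpace α] {μ : Measure α} {f : α → ℝ}
    (hf : MemLp f ∞ μ) : ∃ G > 0, ∀ᵐ x ∂μ, |f x| ≤ G := by
  refine ⟨(eLpNorm f ∞ μ).toReal + 1, by positivity, ?_⟩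
  filter_upwards [ae_le_eLpNormEssSup (f := f) (μ := μ)] with x hx
  rw [← eLpNorm_exponent_top] at hx
  have := ENNReal.toReal_mono hf.eLpNorm_ne_top hx
  rw [toReal_enorm, Real.norm_eq_abs] at this
  linarith

lemma ae_abs_le_inv_of_mul_eLpNorm_top_le {α : Type*} [MeasurableSpace α] {μ : Measure α}
    {f : α → ℝ} {q : ℝ} (hq : 0 < q) (h : ENNReal.ofReal q * eLpNorm f ∞ μ ≤ 1) :
    ∀ᵐ x ∂μ, |f x| ≤ 1 / q := by
  filter_upwards [ae_le_eLpNormEssSup (f := f) (μ := μ)] with x hx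
  rw [← eLpNorm_exponent_top, Real.enorm_eq_ofReal_abs] at hx
  have h1 : ENNReal.ofReal (q * |f x|) ≤ 1 := by
    rw [ENNReal.ofReal_mul hq.le]
    exact (mul_le_mul_right hx _).trans h
  rw [le_div_iff₀ hq, mul_comm]
  exact ENNReal.ofReal_le_one.1 h1

lemma NonlocalVariational.IsContinuumMinimizer.congr_kernel {lam p : ℝ} {g u : ℝ → ℝ}
    {K K' : ℝ × ℝ → ℝ} (hu : IsContinuumMinimizer lam p g K u) (h : K =ᵐ[leb2] K') :
    IsContinuumMinimizer lam p g K' u := by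
  have key : ∀ v, energy lam p g K v = energy lam p g K' v := fun v => by
    unfold energy reg
    congr 2
    refine lintegral_congr_ae ?_
    filter_upwards [h] with z hz
    rw [hz]
  exact ⟨hu.1, fun v hv => by rw [← key, ← key]; exact hu.2 v hv⟩

/-- The rate under Lipschitz and convolution-kernel assumptions. -/
theorem withProbAtLeast_rate {p : ℝ} (hp : p ∈ Ico (1 : ℝ) 2) {lam : ℝ} (hlam : 0 < lam)
    {g : ℝ → ℝ} {K : ℝ × ℝ → ℝ} (hK : AEMeasurable K leb2) {M : ℝ} (hM : 0 < M)
    (h0 : ∀ᵐ z ∂leb2, 0 ≤ K z) (h1 : ∀ᵐ z ∂leb2, K z ≤ M)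
    {q : ℕ → ℝ} (hq_pos : ∀ n, 0 < n → 0 < q n) (hq_bdd : ∃ Q : ℝ, ∀ n, 0 < n → q n ≤ Q)
    {u : ℝ → ℝ} (hu : IsContinuumMinimizer lam p g K u) {s r : ℝ} (hs : s ∈ Ioc (0 : ℝ) 1)
    (hr : r ∈ Icc (2 / (3 - p)) 2) (hgb : MemLp g ∞ leb)
    (hgL : MemLip (Icc (0 : ℝ) 1) s (ENNReal.ofReal r) g) {J : ℝ → ℝ}
    (hKJ : ∀ x ∈ Icc (0 : ℝ) 1, ∀ y ∈ Icc (0 : ℝ) 1, K (x, y) = J |x - y|)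
    {s' : ℝ} {r' : ℝ≥0∞} (hs' : s' ∈ Ioc (0 : ℝ) 1) (hr' : ENNReal.ofReal (pExp p) ≤ r')
    (hKL : MemLip (Icc (0 : ℝ) 1 ×ˢ Icc (0 : ℝ) 1) s' r' K)
    (hqK : ∀ n, 0 < n → ENNReal.ofReal (q n) * eLpNorm K ∞ leb2 ≤ 1) :
    ∃ C₁ > 0, ∀ t₀ ∈ Ioo 0 (Real.exp 1), ∃ C > 0, ∀ n : ℕ, 0 < n →
      ∀ (Ω : Type*) [MeasurableSpace Ω] (P : Measure Ω) [IsProbabilityMeasure P]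
        (X : Fin n → Ω → ℝ) (Υ : Fin n → Fin n → Ω → ℝ), IsRandomGraph P n (q n) K X Υ →
      ∀ un : Ω → Fin n → ℝ,
        (∀ᵐ ω ∂P, IsDiscreteMinimizer lam p (nodeData g (fun k => X k ω))
          (fun i j => Υ i j ω) (un ω)) →
      ∀ β : ℝ, 0 < β → ∀ t ∈ Ico t₀ (Real.exp 1),
        WithProbAtLeast P (1 - (failProb p (q n) β C₁ n + (n : ℝ) ^ (-t)))
          {ω | norm' leb 2 (fun x => inj n (un ω) x - u x) ^ 2 ≤
            C * (noiseRate p (q n) β n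
              + (t * (Real.log n / n)) ^ min (s * r / 2) s')} := by
  have hr1 : 1 ≤ r := by
    refine le_trans ?_ hr.1
    rw [le_div_iff₀ (by linarith [hp.2])]
    linarith [hp.1]
  obtain ⟨G, hG, hgG⟩ := ae_abs_le_of_eLpNorm_top hgb
  obtain ⟨g', hg'm, hgg', hg'G⟩ := exists_measurable_bounded_rep_leb hgb.aemeasurable hG.le hgG
  obtain ⟨K', hK'm, hKK', hK'0, hK'M⟩ := exists_measurable_bounded_rep hK hM.le h0 h1
  have hKM : ∀ᵐ z ∂leb2, |K z| ≤ M := by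
    filter_upwards [h0, h1] with z h0 h1
    rwa [abs_of_nonneg h0]
  have huG := ae_abs_le_of_minimizer hlam hp.1 hp.2.le (hgb.mono_exponent le_top) hK h0 hKM hu hG.le hgG
  obtain ⟨u', hu'm, huu', hu'G⟩ := exists_measurable_bounded_rep_leb hu.1.aemeasurable hG.le huG
  have hu' : IsContinuumMinimizer lam p g' K u' := (hu.congr huu').congr_data hgg'
  have hu'K : IsContinuumMinimizer lam p g' K' u' := hu'.congr_kernel hKK'
  have hg'L := hgL.2
  rw [lipSeminorm_congr measurableSet_Icc hgg'] at hg'L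
  obtain ⟨L, hL, hg'H⟩ := exists_holderSq_of_memLip_of_bounded hG.le hg'G hr1 hr.2 hs.2 hg'L
  have hK'L := hKL.2
  rw [lipSeminorm_congr (measurableSet_Icc.prod measurableSet_Icc) hKK'] at hK'L
  -- Since `p' ≥ 2`, the regularity of the kernel can be used in mean square.
  have h2r' : 2 ≤ r' := by
    refine le_trans ?_ hr'
    rw [show (2 : ℝ≥0∞) = ENNReal.ofReal 2 by norm_num]
    exact ENNReal.ofReal_le_ofReal (two_le_pExp hp)
  obtain ⟨L', hL', hK'H⟩ := exists_holderSq_of_memLip volume_unitSquare.le h2r' hs'.2 hK'm hK'L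
  have hσ : 0 < s * r / 2 := by have := hs.1; positivity
  have hσ1 : s * r / 2 ≤ 1 := by nlinarith [hs.1, hs.2, hr.2]
  -- The original `K` is kept here: the convolution identity holds pointwise for `K` and may fail on
  -- a null set for its representative.
  have hu'H := holderSq_of_minimizer hlam hp hG.le hM.le hg'm hg'G hK h0 hKM hu' hu'm hu'G hKJ hσ1
    hL hg'H
  have hqK' : ∀ n, 0 < n → ∀ᵐ z ∂leb2, |K' z| ≤ 1 / q n := fun n hn => by
    filter_upwards [hKK', ae_abs_le_inv_of_mul_eLpNorm_top_le (hq_pos n hn) (hqK n hn)] with z h1 h2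
    rwa [← h1]
  obtain ⟨C₁, hC₁, hmain⟩ := measure_integral_sq_gt_rate_le hp hlam hG hg'm hg'G hM hK'm hK'0 hK'M
    hu'K hu'm hu'G hσ hσ1 hs'.1 hs'.2 hL hL' (by positivity) hg'H hK'H hu'H hq_pos hq_bdd hqK'
  refine ⟨C₁, hC₁, fun t₀ ht₀ => ?_⟩
  obtain ⟨C, hC, hmain⟩ := hmain t₀ ht₀.1
  refine ⟨C, hC, fun n hn Ω _ P _ X Υ hGr un hun β hβ t ht => ?_⟩
  rcases Nat.lt_or_eq_of_le (Nat.succ_le_of_lt hn) with hn2 | rfl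
  · refine withProbAtLeast_of_compl_le (le_trans ?_ (hmain n hn2 Ω P X Υ (hGr.congr hKK') un ?_ β hβ t ht))
      (by unfold failProb; positivity)
    · refine measure_mono fun ω => ?_
      have e : norm' leb 2 (fun x => inj n (un ω) x - u x) ^ 2 =
          ∫ x, (inj n (un ω) x - u' x) ^ 2 ∂leb := by
        refine (norm'_two_sq ((memLp_inj n (un ω) 2).sub hu.1)).trans (integral_congr_ae ?_)
        filter_upwards [huu'] with x hx
        simp only [Pi.sub_apply, hx]
      simp only [mem_compl_iff, mem_ofPred_eq, e]
      exact id
    · filter_upwards [hun, hGr.ae_nodes_mem] with ω h1 h2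
      rwa [show nodeData g' (fun k => X k ω) = nodeData g (fun k => X k ω) from
        funext fun i => (nodeData_congr hgg' h2 i).symm]
  -- For `n = 1` all powers of `n` equal one, so the claimed probability is `1 - 3` and nothing has
  -- to be proved; the rate itself would be degenerate since `log 1 = 0`.
  · refine ⟨∅, empty_subset _, MeasurableSet.empty, ?_⟩
    rw [ENNReal.ofReal_of_nonpos (by simp [failProb])]
    exact zero_le

theorem mainTheorem6
    (p : ℝ) (hp : p ∈ Ico (1 : ℝ) 2) (lam : ℝ) (hlam : 0 < lam)
    (g : ℝ → ℝ) (hg : MemLp g 2 leb)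
    (K : ℝ × ℝ → ℝ) (hK_meas : AEMeasurable K leb2)
    (hK_nonneg : ∀ x ∈ Icc (0 : ℝ) 1, ∀ y ∈ Icc (0 : ℝ) 1, 0 ≤ K (x, y))
    (hK_symm : ∀ x ∈ Icc (0 : ℝ) 1, ∀ y ∈ Icc (0 : ℝ) 1, K (x, y) = K (y, x))
    (hK_bdd : ∃ M : ℝ, ∀ x ∈ Icc (0 : ℝ) 1, ∀ y ∈ Icc (0 : ℝ) 1, K (x, y) ≤ M)
    (q : ℕ → ℝ) (hq_pos : ∀ n, 0 < n → 0 < q n) (hq_bdd : ∃ Q : ℝ, ∀ n, 0 < n → q n ≤ Q)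
    (u : ℝ → ℝ) (hu : IsContinuumMinimizer lam p g K u) :
    -- the general bound
    (∃ C > 0, ∃ C₁ > 0, ∀ n : ℕ, 0 < n →
      ∀ (Ω : Type*) [MeasurableSpace Ω] (P : Measure Ω) [IsProbabilityMeasure P]
        (X : Fin n → Ω → ℝ) (Υ : Fin n → Fin n → Ω → ℝ), IsRandomGraph P n (q n) K X Υ →
      ∀ un : Ω → Fin n → ℝ,
        (∀ᵐ ω ∂P, IsDiscreteMinimizer lam p (nodeData g (fun k => X k ω))
          (fun i j => Υ i j ω) (un ω)) →
      ∀ β : ℝ, 0 < β →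
        WithProbAtLeast P (1 - failProb p (q n) β C₁ n)
          {ω | norm' leb 2 (fun x => inj n (un ω) x - u x) ^ 2 ≤
            C * (noiseRate p (q n) β n
              + norm' leb 2 (fun x => g x - inj n (nodeData g (fun k => X k ω)) x) ^ 2
              + norm' leb 2 (fun x => g x - inj n (nodeData g (fun k => X k ω)) x)
              + norm' leb2 (ENNReal.ofReal (pExp p))
                  (fun z => K z - inj2 n (nodeKernel (q n) K (fun k => X k ω)) z)
              + norm' leb (ENNReal.ofReal (2 / (3 - p)))
                  (fun x => u x - inj n (proj n u) x))}) ∧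
    -- the rate under Lipschitz and convolution-kernel assumptions
    (∀ (s r : ℝ), s ∈ Ioc (0 : ℝ) 1 → r ∈ Icc (2 / (3 - p)) 2 →
      MemLp g ∞ leb → MemLip (Icc (0 : ℝ) 1) s (ENNReal.ofReal r) g →
      ∀ J : ℝ → ℝ, AEMeasurable J leb → (∀ x ∈ Icc (0 : ℝ) 1, 0 ≤ J x) →
        (∃ M : ℝ, ∀ x ∈ Icc (0 : ℝ) 1, J x ≤ M) →
        (∀ x ∈ Icc (0 : ℝ) 1, ∀ y ∈ Icc (0 : ℝ) 1, K (x, y) = J |x - y|) →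
      ∀ (s' : ℝ) (r' : ℝ≥0∞), s' ∈ Ioc (0 : ℝ) 1 → ENNReal.ofReal (pExp p) ≤ r' →
        MemLip (Icc (0 : ℝ) 1 ×ˢ Icc (0 : ℝ) 1) s' r' K →
      (∀ n, 0 < n → ENNReal.ofReal (q n) * eLpNorm K ∞ leb2 ≤ 1) →
      ∃ C₁ > 0, ∀ t₀ ∈ Ioo 0 (Real.exp 1), ∃ C > 0, ∀ n : ℕ, 0 < n →
        ∀ (Ω : Type*) [MeasurableSpace Ω] (P : Measure Ω) [IsProbabilityMeasure P]
          (X : Fin n → Ω → ℝ) (Υ : Fin n → Fin n → Ω → ℝ), IsRandomGraph P n (q n) K X Υ →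
        ∀ un : Ω → Fin n → ℝ,
          (∀ᵐ ω ∂P, IsDiscreteMinimizer lam p (nodeData g (fun k => X k ω))
            (fun i j => Υ i j ω) (un ω)) →
        ∀ β : ℝ, 0 < β → ∀ t ∈ Ico t₀ (Real.exp 1),
          WithProbAtLeast P (1 - (failProb p (q n) β C₁ n + (n : ℝ) ^ (-t)))
            {ω | norm' leb 2 (fun x => inj n (un ω) x - u x) ^ 2 ≤
              C * (noiseRate p (q n) β n
                + (t * (Real.log n / n)) ^ min (s * r / 2) s')}) := by
  obtain ⟨M, hM⟩ := hK_bdd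
  have hDm : MeasurableSet (Icc (0 : ℝ) 1 ×ˢ Icc (0 : ℝ) 1) := measurableSet_Icc.prod measurableSet_Icc
  have hM1 : 0 < max M 1 := lt_max_of_lt_right one_pos
  have h0 : ∀ᵐ z ∂leb2, 0 ≤ K z := by
    filter_upwards [ae_restrict_mem hDm] with z hz
    exact hK_nonneg z.1 hz.1 z.2 hz.2
  have h1 : ∀ᵐ z ∂leb2, K z ≤ max M 1 := by
    filter_upwards [ae_restrict_mem hDm] with z hz
    exact (hM z.1 hz.1 z.2 hz.2).trans (le_max_left _ _)
  refine ⟨withProbAtLeast_error_le hp hlam hg hK_meas hM1.le h0 h1 hq_pos hq_bdd hu, ?_⟩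
  intro s r hs hr hgb hgL J _ _ _ hKJ s' r' hs' hr' hKL hqK
  exact withProbAtLeast_rate hp hlam hK_meas hM1 h0 h1 hq_pos hq_bdd hu hs hr hgb hgL hKJ hs' hr'
    hKL hqK
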